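/- **Setting.** Let $V$ be a real valued Schwartz function on $\mathbb R^3$, $\underline c>0$, $\mathcal H=-\Delta+V+\underline c\ge 0$, $\gamma(t)=\gamma_0+\gamma_1\cos t$ with $\gamma_0,\gamma_1\in\mathbb R$, $\gamma_1\ne0$. Assume: - the eigenvalues of $\mathcal H$, repeated with multiplicity, are $0=\lambda_0<\lambda_1\le\dots\le\lambda_n<\underline c$, with real valued orthonormal eigenfunctions $\phi_0,\dots,\phi_n$; $\underline c$ is not an eigenvalue or a resonance of $\mathcal H$ (there is no nonzero solution of $\Delta u=Vu$ with $|u(x)|\lesssim\langle x\rangle^{-1}$); - $\underline c\notin\mathbb N$, and for $j=1,\dots,n$ there is $N_j\in\mathbb N$ with $N_j\lambda_j<\underline c<(N_j+1)\lambda_j$; put $N=\max\{N_1,\dots,N_n,[\underline c]\}$; - $\mu\cdot\lambda+m\ne\underline c$ for all $\mu\in\mathbb Z^{n+1}$, $m\in\mathbb Z$ with $|\mu|\le 2N+1$, $|m|\le N$, where $\lambda=(\lambda_0,\dots,\lambda_n)$; - if $0<\lambda_{j_1}<\dots<\lambda_{j_k}$, $\mu\in\mathbb Z^k$, $|\mu|\le4N+2$,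 $m\in\mathbb Z$, $|m|\le2N$, then $\mu_1\lambda_{j_1}+\dots+\mu_k\lambda_{j_k}+m=0$ if and only if $\mu=0$ and $m=0$. Write $\langle f,g\rangle=\int_{\mathbb R^3}fg\,dx$, and $u=z\cdot\phi+f$ for $u\in H^1(\mathbb R^3,\mathbb C)$, with $z_j=\langle u,\phi_j\rangle$ and $f=P_cu$. $H^{k,s}$ is the space of tempered distributions with $\langle x\rangle^s(1-\Delta)^{k/2}f\in L^2$, and $H^{k,s}_c$ is the subspace that annihilates all the $\phi_j$. On the extended phase space of the points $(\tau,t,u)\in\mathbb R\times\mathbb R\times H^1$ consider $\Omega=\langle u,\overline v\rangle-\langle\overline u,v\rangle+i\,dt\wedge d\tau$ and $$H=H_F+E_P,\quad H_F=\int\big(|\nabla u|^2+\underline c|u|^2+V|u|^2\big)dx-\tau,\quad E_P=\gamma(t)\int\frac{|u|^4}{4}dx .$$ The Hamiltonian vector field $X_F$ is defined by $\Omega(X_F,Y)=-i\,dF(Y)$. **Theorem.** There are $\mathcal T_1=\mathrm{id}$ and, for $2\le r\le N+1$, maps $\mathcal T_r=\mathcal T_{r-1}\circ\mathfrak F_r$,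 where $\mathfrak F_r$ is the time-one flow of $X_{\chi_r}$ for some $$\chi_r=\sum_{|\ell|\le m_0}e^{i\ell t}\Big[\sum_{|\mu|=|\nu|=M_0+1}a_{\ell\mu\nu}z^\mu\overline z^\nu+\sum_{|\mu|=M_0=|\nu|-1}z^\mu\overline z^\nu\langle\Phi_{\ell\mu\nu},f\rangle+\sum_{|\nu|=M_0=|\mu|-1}z^\mu\overline z^\nu\langle\Psi_{\ell\mu\nu},\overline f\rangle\Big]$$ with $m_0\ge0$, $M_0\ge1$, $\overline a_{\ell\mu\nu}=a_{-\ell\nu\mu}$ and Schwartz functions $\overline\Phi_{\ell\mu\nu}=\Psi_{-\ell\nu\mu}$ (all depending on $r$), such that for each $1\le r\le N+1$ there is an open neighborhood $\mathcal U_r$ of $0$ in $H^1$ for which $\mathcal T_r$ is a smooth canonical transformation (a smooth $\Omega$-preserving diffeomorphism onto an open set) on $\{(\tau,t,u):u\in\mathcal U_r\}$, and there $$H\circ\mathcal T_r=H_F+Z^{(r)}+\sum_{d=0}^7\mathcal R_d^{(r)},$$ where the last two terms are functions of $(t,z,f)$ and: - (i) $Z^{(r)}=Z_0+Z_1$ is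 in normal form, with monomials of degree at least $4$ and at most $2r$. That is, $Z_0=\sum a_{\mu\nu}z^\mu\overline z^\nu$ is a finite sum over $\lambda\cdot(\mu-\nu)=0$, $|\mu|=|\nu|$, with $\overline a_{\mu\nu}=a_{\nu\mu}$, and $Z_1=\sum e^{imt}z^\mu\overline z^\nu\langle\Phi_{m\mu\nu},f\rangle+\sum e^{imt}z^\mu\overline z^\nu\langle\Psi_{m\mu\nu},\overline f\rangle$ is a finite sum, with Schwartz functions $\Psi_{m\mu\nu}=\overline\Phi_{-m\nu\mu}$, where in the first sum $\lambda\cdot(\mu-\nu)-m<-\underline c$, $|\mu|=|\nu|-1$, $|m|\le|\mu|$ and in the second $\lambda\cdot(\mu-\nu)-m>\underline c$, $|\mu|=|\nu|+1$, $|m|\le|\nu|$. - (iii.0) $\mathcal R_0=\sum a_{m\mu\nu}e^{imt}z^\mu\overline z^\nu$ is a finite sum over $|\mu|=|\nu|\ge r+1$, $|m|\le|\mu|$, with $\overline a_{m\mu\nu}=a_{-m\nu\mu}$. - (iii.1) $\mathcal R_1=\sum e^{imt}z^\mu\overline z^\nu\langle\Phi_{m\mu\nu},f\rangle+\sum e^{imt}z^\mu\overline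 z^\nu\langle\Psi_{m\mu\nu},\overline f\rangle$ is a finite sum over $|\mu|=|\nu|-1\ge r$, $|m|\le|\mu|$ in the first sum and $|\nu|=|\mu|-1\ge r$, $|m|\le|\nu|$ in the second, with Schwartz functions $\Psi_{-m\nu\mu}=\overline\Phi_{m\mu\nu}$. - (iii.2–5) For $d=2,\dots,5$, $\mathcal R_d$ is real valued and $$\mathcal R_d=\sum e^{imt}z^\mu\overline z^\nu\langle\Phi,f\rangle^\alpha\langle\Psi,\overline f\rangle^\beta\langle f^a\overline f^b,\Psi_{abm\mu\nu\alpha\beta}\rangle,$$ where $\langle\Phi,f\rangle^\alpha=\prod_j\langle\Phi_j,f\rangle^{\alpha_j}$, $\langle\Psi,\overline f\rangle^\beta=\prod_j\langle\Psi_j,\overline f\rangle^{\beta_j}$ for finite families of Schwartz functions $\Phi_j,\Psi_j$, the $\Psi_{abm\mu\nu\alpha\beta}$ are Schwartz functions, $|\mu|+|\alpha|+a=|\nu|+|\beta|+b=:L+1\ge2$, $|m|\le L$, and $a+b=d$; for $d=2$ also terms with $a+b\le1$ and $|\alpha|+|\beta|+a+b\ge2$ are allowed. Only terms with $a+b\in\{2,3\}$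 may be infinitely many; the series converges absolutely for $u\in\mathcal U_r$, $t\in\mathbb R$, and there is $\rho>0$ such that $\sum\rho^{|\mu|+|\nu|+|\alpha|+|\beta|}\,p(\Psi_{abm\mu\nu\alpha\beta})<\infty$ for each Schwartz seminorm $p(g)=\sup_x|x|^j\|D^kg(x)\|$, $j,k\ge0$. - (iii.6) $\mathcal R_6=\gamma(t)\int|f|^4dx/4$. - (iii.7) For all real $K',S'$, $\mathcal R_7$ is real valued and $C^\infty$ on $\mathbb R\times\widetilde{\mathcal U}$ for a neighborhood $\widetilde{\mathcal U}=\widetilde{\mathcal U}^{-K',-S'}$ of the origin in $\mathbb C^{n+1}\times H^{-K',-S'}_c$, and there, with $C$ independent of $t$, $$|\mathcal R_7(t,z,f)|\le C\,(|z|+\|f\|_{H^{-K',-S'}})^{2N+4}.$$ -/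

import Mathlib

open MeasureTheory Set TemperedDistribution
open scoped SchwartzMap LineDeriv Laplacian ComplexConjugate ContDiff Topology

noncomputable section

namespace NLSNormalForm

/-- The physical space `ℝ³`. -/
abbrev E3 : Type := EuclideanSpace ℝ (Fin 3)

/-- `L²(ℝ³, ℂ)`. -/
abbrev L2 : Type := Lp ℂ 2 (volume : Measure E3)

/-! ### The spaces `H^{k,s}(ℝ³)` -/

/-- The inclusion of `L²` in the tempered distributions. -/
def l2Incl : L2 →ₗ[ℂ] 𝓢'(E3, ℂ) :=
  (Lp.toTemperedDistributionCLM ℂ (volume : Measure E3) 2).toLinearMap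

theorem l2Incl_injective : Function.Injective l2Incl :=
  LinearMap.ker_eq_bot.mp (Lp.ker_toTemperedDistributionCLM_eq_bot (F := ℂ)
    (μ := (volume : Measure E3)) (p := 2))

/-- Multiplication by `⟨x⟩ ^ s`, where `⟨x⟩ = (1 + |x|²)^{1/2}`. -/
def weightOp (s : ℝ) : 𝓢'(E3, ℂ) →L[ℂ] 𝓢'(E3, ℂ) :=
  smulLeftCLM ℂ (fun x : E3 => (((1 + ‖x‖ ^ 2) ^ (s / 2) : ℝ) : ℂ))

theorem weightOp_neg_weightOp (s : ℝ) (T : 𝓢'(E3, ℂ)) : weightOp (-s) (weightOp s T) = T := by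
  unfold weightOp
  rw [smulLeftCLM_smulLeftCLM_apply (by fun_prop) (by fun_prop)]
  convert smulLeftCLM_const 1 T using 2
  · congr 1
    ext x
    simp only [Pi.mul_apply]
    norm_cast
    rw [← Real.rpow_add (by positivity)]
    simp [neg_div]
  · simp

/-- The operator `T ↦ ⟨x⟩ ^ s (1 - Δ)^{k/2} T`. The Bessel potential is Mathlib's one, whose
normalization of `Δ` only changes the norms below to equivalent ones. -/
def sobolevOp (k s : ℝ) : 𝓢'(E3, ℂ) →L[ℂ] 𝓢'(E3, ℂ) :=
  (weightOp s).comp (besselPotential E3 ℂ k)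

theorem sobolevOp_injective (k s : ℝ) : Function.Injective (sobolevOp k s) := by
  intro T T' h
  have h1 : besselPotential E3 ℂ k T = besselPotential E3 ℂ k T' := by
    have h2 := congrArg (weightOp (-s)) h
    simpa [sobolevOp, weightOp_neg_weightOp] using h2
  have h3 := congrArg (besselPotential E3 ℂ (-k)) h1
  simpa using h3

/-- The tempered distributions `T` with `⟨x⟩ ^ s (1 - Δ)^{k/2} T ∈ L²`. -/
def sobolevSubmodule (k s : ℝ) : Submodule ℂ 𝓢'(E3, ℂ) :=
  (LinearMap.range l2Incl).comap (sobolevOp k s).toLinearMap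

/-- The weighted Sobolev space `H^{k,s}(ℝ³)`, for arbitrary real `k` and `s`. -/
def HSpace (k s : ℝ) : Type := sobolevSubmodule k s

namespace HSpace

variable {k s : ℝ}

instance : AddCommGroup (HSpace k s) := inferInstanceAs (AddCommGroup (sobolevSubmodule k s))

instance : Module ℂ (HSpace k s) := inferInstanceAs (Module ℂ (sobolevSubmodule k s))

/-- An element of `H^{k,s}` as a tempered distribution. -/
def toDist : HSpace k s →ₗ[ℂ] 𝓢'(E3, ℂ) := (sobolevSubmodule k s).subtype

/-- `T ↦ ⟨x⟩ ^ s (1 - Δ)^{k/2} T` as a map from `H^{k,s}` to `L²`. -/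
def toL2 : HSpace k s →ₗ[ℂ] L2 :=
  (LinearEquiv.ofInjective l2Incl l2Incl_injective).symm.toLinearMap ∘ₗ
    LinearMap.codRestrict (LinearMap.range l2Incl)
      ((sobolevOp k s).toLinearMap ∘ₗ toDist) (fun T => T.2)

theorem toL2_injective : Function.Injective (toL2 : HSpace k s →ₗ[ℂ] L2) := by
  intro T T' h
  have h1 := (LinearEquiv.ofInjective l2Incl l2Incl_injective).symm.injective h
  have h2 := congrArg Subtype.val h1
  exact Subtype.ext (sobolevOp_injective k s h2)

/-- The norm is `‖T‖ = ‖⟨x⟩ ^ s (1 - Δ)^{k/2} T‖_{L²}`. -/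
instance : NormedAddCommGroup (HSpace k s) :=
  NormedAddCommGroup.induced (HSpace k s) L2 toL2 toL2_injective

instance : NormedSpace ℂ (HSpace k s) :=
  NormedSpace.induced ℂ (HSpace k s) L2 toL2

end HSpace

/-- The Sobolev space `H¹(ℝ³, ℂ)`. -/
abbrev H1 : Type := HSpace 1 0

open Classical in
/-- The `L²` function that represents `T`, if there is one. -/
def l2rep (T : 𝓢'(E3, ℂ)) : L2 :=
  if h : T ∈ LinearMap.range l2Incl then
    (LinearEquiv.ofInjective l2Incl l2Incl_injective).symm ⟨T, h⟩
  else 0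

/-- An element of `H¹` as a function on `ℝ³`. -/
def fn (u : H1) : E3 → ℂ := l2rep u.toDist

/-! ### The operator, the energy and the hypotheses -/

/-- `𝓗 = -Δ + V + c`, acting on tempered distributions. -/
def schrodinger (V : 𝓢(E3, ℝ)) (c : ℝ) (T : 𝓢'(E3, ℂ)) : 𝓢'(E3, ℂ) :=
  -(Δ T) + smulLeftCLM ℂ (fun x : E3 => (V x : ℂ)) T + (c : ℂ) • T

/-- `T` is an `L²` solution of `𝓗 T = μ T` (an element of the eigenspace, possibly zero). -/
def IsEigenvector (V : 𝓢(E3, ℝ)) (c μ : ℝ) (T : 𝓢'(E3, ℂ)) : Prop :=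
  T ∈ LinearMap.range l2Incl ∧ schrodinger V c T = (μ : ℂ) • T

/-- `E_K(u) = ∫ |∇u|² + c ∫ |u|² + ∫ V |u|²`. -/
def kineticEnergy (V : 𝓢(E3, ℝ)) (c : ℝ) (u : H1) : ℝ :=
  (∑ j : Fin 3, ∫ x : E3, ‖l2rep (∂_{EuclideanSpace.single j (1 : ℝ)} u.toDist) x‖ ^ 2)
    + c * (∫ x : E3, ‖fn u x‖ ^ 2) + ∫ x : E3, V x * ‖fn u x‖ ^ 2

/-- `γ(t) = γ₀ + γ₁ cos t`. -/
def gam (γ₀ γ₁ t : ℝ) : ℝ := γ₀ + γ₁ * Real.cos t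

/-- The natural number `N = max {sup_j N_j, [c]}`, where `N_j = [c / l_j]` for `j = 1, …, n`
(that is `N_j l_j < c < (N_j + 1) l_j`, once `c / l_j` is not an integer). -/
def bigN {n : ℕ} (c : ℝ) (l : Fin (n + 1) → ℝ) : ℕ :=
  max ((Finset.univ.filter (fun j : Fin (n + 1) => j ≠ 0)).sup fun j => ⌊c / l j⌋₊) ⌊c⌋₊

/-- The standing hypotheses on the potential `V`, the constant `c`, the coefficients `γ₀, γ₁`, the
eigenvalues `l 0 ≤ … ≤ l n` of `𝓗` (repeated with multiplicity) and the associated eigenfunctions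
`φ 0, …, φ n`. -/
structure StandingHypotheses {n : ℕ} (V : 𝓢(E3, ℝ)) (c γ₀ γ₁ : ℝ)
    (l : Fin (n + 1) → ℝ) (φ : Fin (n + 1) → H1) : Prop where
  c_pos : 0 < c
  gamma_ne : γ₁ ≠ 0
  /-- `𝓗 ≥ 0`. -/
  nonneg : ∀ u : H1, 0 ≤ kineticEnergy V c u
  /-- `0 = l 0 < l 1 ≤ … ≤ l n < c`. -/
  l_zero : l 0 = 0
  l_pos : ∀ j, j ≠ 0 → 0 < l j
  l_mono : Monotone l
  l_lt : ∀ j, l j < c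
  /-- The `φ j` are real valued orthonormal eigenfunctions. -/
  eigen : ∀ j, IsEigenvector V c (l j) (φ j).toDist
  real : ∀ j, ∀ᵐ x : E3, (fn (φ j) x).im = 0
  orthonormal : ∀ i j, ∫ x : E3, fn (φ i) x * fn (φ j) x = if i = j then 1 else 0
  /-- There are no other eigenfunctions. -/
  complete : ∀ (μ : ℝ) (T : 𝓢'(E3, ℂ)), IsEigenvector V c μ T →
    T ∈ Submodule.span ℂ {S : 𝓢'(E3, ℂ) | ∃ j, l j = μ ∧ S = (φ j).toDist}
  /-- `c` is neither an eigenvalue nor a resonance. -/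
  no_resonance : ∀ u : E3 → ℂ, ContDiff ℝ 2 u → (∀ x, (Δ u) x = V x * u x) →
    (∃ C : ℝ, ∀ x, ‖u x‖ ≤ C / Real.sqrt (1 + ‖x‖ ^ 2)) → u = 0
  c_not_nat : ∀ k : ℕ, c ≠ k
  between : ∀ j, j ≠ 0 → ∃ k : ℕ, k * l j < c ∧ c < (k + 1) * l j
  /-- Nonresonance with the edge `c` of the continuous spectrum. -/
  nonres_edge : ∀ (μ : Fin (n + 1) → ℤ) (m : ℤ), ∑ j, |μ j| ≤ 2 * bigN c l + 1 →
    |m| ≤ bigN c l → (∑ j, μ j * l j) + m ≠ c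
  /-- Nonresonance between the distinct positive eigenvalues and the frequency `1`. -/
  nonres_eig : ∀ (k : ℕ) (j : Fin k → Fin (n + 1)), StrictMono (fun i => l (j i)) →
    (∀ i, 0 < l (j i)) → ∀ (μ : Fin k → ℤ) (m : ℤ), ∑ i, |μ i| ≤ 4 * bigN c l + 2 →
    |m| ≤ 2 * bigN c l → ((∑ i, μ i * l (j i)) + m = 0 ↔ μ = 0 ∧ m = 0)

/-- `H_c^{k,s} = P_c H^{k,s}`: the elements of `H^{k,s}` that annihilate the eigenfunctions of `𝓗`
(these are Schwartz functions, and closed under complex conjugation). -/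
def HcSpace (V : 𝓢(E3, ℝ)) (c k s : ℝ) : Submodule ℂ (HSpace k s) where
  carrier := {T | ∀ (ψ : 𝓢(E3, ℂ)) (μ : ℝ),
    IsEigenvector V c μ (SchwartzMap.toTemperedDistributionCLM E3 ℂ volume ψ) → T.toDist ψ = 0}
  add_mem' := by
    intro T T' hT hT' ψ μ h
    have h1 := hT ψ μ h
    have h2 := hT' ψ μ h
    rw [map_add]
    change T.toDist ψ + T'.toDist ψ = 0
    rw [h1, h2, add_zero]
  zero_mem' := by
    intro ψ μ h
    rw [map_zero]
    rfl
  smul_mem' := by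
    intro a T hT ψ μ h
    have h1 := hT ψ μ h
    rw [map_smul]
    change a • (T.toDist ψ) = 0
    rw [h1, smul_zero]

/-! ### Coordinates and the extended phase space -/

/-- The bilinear pairing `⟨Φ, f⟩ = ∫ Φ f`. -/
def pair (Φ : 𝓢(E3, ℂ)) (f : H1) : ℂ := ∫ x : E3, Φ x * fn f x

/-- The pairing `⟨Ψ, \bar f⟩ = ∫ Ψ \bar f`. -/
def pairConj (Ψ : 𝓢(E3, ℂ)) (f : H1) : ℂ := ∫ x : E3, Ψ x * conj (fn f x)

section coordinates

variable {n : ℕ} (φ : Fin (n + 1) → H1)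

/-- The discrete coordinates `z_j = ⟨u, φ_j⟩`. -/
def zCoord (u : H1) : Fin (n + 1) → ℂ := fun j => ∫ x : E3, fn u x * fn (φ j) x

/-- The continuous coordinate `f = P_c u = u - z · φ`. -/
def fCoord (u : H1) : H1 := u - ∑ j, zCoord φ u j • φ j

end coordinates

/-- The extended phase space: points are `(τ, t, u)`. -/
abbrev Phase : Type := ℝ × ℝ × H1

/-- The part of the extended phase space that lies over `U ⊆ H¹`. -/
def cyl (U : Set H1) : Set Phase := {p | p.2.2 ∈ U}

/-- The symplectic form `Ω = ⟨u, \bar v⟩ - ⟨\bar u, v⟩ + i dt ∧ dτ`. -/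
def symp (X Y : Phase) : ℂ :=
  (∫ x : E3, (fn X.2.2 x * conj (fn Y.2.2 x) - conj (fn X.2.2 x) * fn Y.2.2 x))
    + Complex.I * ((X.2.1 * Y.1 - X.1 * Y.2.1 : ℝ) : ℂ)

/-- `H_F = E_K - τ`. -/
def hamF (V : 𝓢(E3, ℝ)) (c : ℝ) (p : Phase) : ℝ := kineticEnergy V c p.2.2 - p.1

/-- `E_P(t, u) = γ(t) ∫ |u|⁴ / 4`. -/
def potentialEnergy (γ₀ γ₁ t : ℝ) (u : H1) : ℝ :=
  gam γ₀ γ₁ t * ∫ x : E3, ‖fn u x‖ ^ 4 / 4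

/-- `H = H_F + E_P`. -/
def ham (V : 𝓢(E3, ℝ)) (c γ₀ γ₁ : ℝ) (p : Phase) : ℝ :=
  hamF V c p + potentialEnergy γ₀ γ₁ p.2.1 p.2.2

/-- `T` is a smooth canonical transformation on `D`: a smooth diffeomorphism of the open set `D`
onto an open set that preserves the symplectic form. -/
def IsCanonicalOn (T : Phase → Phase) (D : Set Phase) : Prop :=
  IsOpen D ∧ ContDiffOn ℝ ∞ T D ∧ IsOpen (T '' D) ∧
    (∃ S : Phase → Phase, ContDiffOn ℝ ∞ S (T '' D) ∧ LeftInvOn S T D) ∧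
    ∀ p ∈ D, ∀ X Y : Phase, symp (fderiv ℝ T p X) (fderiv ℝ T p Y) = symp X Y

/-! ### Monomials and Lie transforms -/

/-- Multi-indices `μ = (μ_0, …, μ_n)`. -/
abbrev MI (n : ℕ) : Type := Fin (n + 1) → ℕ

/-- The length `|α|` of a multi-index. -/
def len {ι : Type} [Fintype ι] (α : ι → ℕ) : ℕ := ∑ j, α j

/-- `z^μ \bar z^ν`. -/
def mon {n : ℕ} (μ ν : MI n) (z : Fin (n + 1) → ℂ) : ℂ :=
  (∏ j, z j ^ μ j) * ∏ j, conj (z j) ^ ν j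

/-- `e^{imt}`. -/
def osc (m : ℤ) (t : ℝ) : ℂ := Complex.exp (Complex.I * m * t)

/-- The coefficients of a polynomial `χ`, periodic in time, with its reality conditions. -/
structure LieGenerator (n : ℕ) where
  /-- The largest frequency. -/
  m₀ : ℕ
  /-- The degree parameter. -/
  M₀ : ℕ
  M₀_pos : 1 ≤ M₀
  /-- Coefficients of `e^{iℓt} z^μ \bar z^ν`. -/
  a : ℤ → MI n → MI n → ℂ
  /-- Coefficients of the terms that are linear in `f`. -/
  Φ : ℤ → MI n → MI n → 𝓢(E3, ℂ)
  /-- Coefficients of the terms that are linear in `\bar f`. -/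
  Ψ : ℤ → MI n → MI n → 𝓢(E3, ℂ)
  symm_a : ∀ k μ ν, conj (a k μ ν) = a (-k) ν μ
  symm_Φ : ∀ k μ ν x, conj (Φ k μ ν x) = Ψ (-k) ν μ x

/-- The multi-indices of length `k`. -/
def ofLen (n k : ℕ) : Finset (MI n) := Finset.univ.piAntidiag k

namespace LieGenerator

variable {n : ℕ}

/-- The polynomial `χ(t, z, f)`. -/
def eval (g : LieGenerator n) (t : ℝ) (z : Fin (n + 1) → ℂ) (f : H1) : ℂ :=
  ∑ k ∈ Finset.Icc (-(g.m₀ : ℤ)) g.m₀, osc k t *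
    ((∑ μ ∈ ofLen n (g.M₀ + 1), ∑ ν ∈ ofLen n (g.M₀ + 1), g.a k μ ν * mon μ ν z)
    + (∑ μ ∈ ofLen n g.M₀, ∑ ν ∈ ofLen n (g.M₀ + 1), mon μ ν z * pair (g.Φ k μ ν) f)
    + ∑ μ ∈ ofLen n (g.M₀ + 1), ∑ ν ∈ ofLen n g.M₀, mon μ ν z * pairConj (g.Ψ k μ ν) f)

/-- `χ` as a function on the extended phase space. -/
def onPhase (g : LieGenerator n) (φ : Fin (n + 1) → H1) (p : Phase) : ℂ :=
  g.eval p.2.1 (zCoord φ p.2.2) (fCoord φ p.2.2)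

end LieGenerator

/-- `X` is the value at `p` of the Hamiltonian vector field of `F`: `Ω(X, Y) = -i dF(Y)`. -/
def IsHamVector (F : Phase → ℂ) (p X : Phase) : Prop :=
  ∀ Y : Phase, symp X Y = -Complex.I * fderiv ℝ F p Y

/-- On `D` the map `𝔉` is the Lie transform of the function `F`, that is the flow at time `1` of
the Hamiltonian vector field of `F`. -/
def IsLieTransformOn (F : Phase → ℂ) (𝔉 : Phase → Phase) (D : Set Phase) : Prop :=
  ∀ p ∈ D, ∃ y : ℝ → Phase, y 0 = p ∧ y 1 = 𝔉 p ∧ ∀ s ∈ Icc (0 : ℝ) 1,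
    ∃ X : Phase, HasDerivWithinAt y X (Icc 0 1) s ∧ IsHamVector F (y s) X

/-! ### Normal forms -/

/-- A finite sum `∑ e^{imt} z^μ \bar z^ν ⟨Φ_{mμν}, f⟩ + ∑ e^{imt} z^μ \bar z^ν ⟨Ψ_{mμν}, \bar f⟩`. -/
def linSum {n : ℕ} (Φ Ψ : (ℤ × MI n × MI n) →₀ 𝓢(E3, ℂ)) (t : ℝ) (z : Fin (n + 1) → ℂ)
    (f : H1) : ℂ :=
  (∑ i ∈ Φ.support, osc i.1 t * mon i.2.1 i.2.2 z * pair (Φ i) f)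
    + ∑ i ∈ Ψ.support, osc i.1 t * mon i.2.1 i.2.2 z * pairConj (Ψ i) f

/-- `Z(t, z, f)` is in normal form, with monomials of degree at least `4` and at most `2r`. -/
def IsNormalForm {n : ℕ} (c : ℝ) (l : Fin (n + 1) → ℝ) (r : ℕ)
    (Z : ℝ → (Fin (n + 1) → ℂ) → H1 → ℂ) : Prop :=
  ∃ (a : (MI n × MI n) →₀ ℂ) (Φ Ψ : (ℤ × MI n × MI n) →₀ 𝓢(E3, ℂ)),
    (∀ t z f, Z t z f = (∑ i ∈ a.support, a i * mon i.1 i.2 z) + linSum Φ Ψ t z f) ∧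
    (∀ μ ν, a (μ, ν) ≠ 0 → ∑ j, l j * ((μ j : ℝ) - ν j) = 0 ∧ len μ = len ν ∧
      4 ≤ len μ + len ν ∧ len μ + len ν ≤ 2 * r) ∧
    (∀ m μ ν, Φ (m, μ, ν) ≠ 0 → (∑ j, l j * ((μ j : ℝ) - ν j)) - m < -c ∧
      len μ + 1 = len ν ∧ |m| ≤ len μ ∧
      4 ≤ len μ + len ν + 1 ∧ len μ + len ν + 1 ≤ 2 * r) ∧
    (∀ m μ ν, Ψ (m, μ, ν) ≠ 0 → c < (∑ j, l j * ((μ j : ℝ) - ν j)) - m ∧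
      len μ = len ν + 1 ∧ |m| ≤ len ν ∧
      4 ≤ len μ + len ν + 1 ∧ len μ + len ν + 1 ≤ 2 * r) ∧
    (∀ μ ν, conj (a (μ, ν)) = a (ν, μ)) ∧
    (∀ m μ ν x, Ψ (m, μ, ν) x = conj (Φ (-m, ν, μ) x))

/-! ### The pieces of the remainder -/

/-- The part of the remainder that only depends on `t` and `z`. -/
def IsRemainderZ {n : ℕ} (r : ℕ) (R : ℝ → (Fin (n + 1) → ℂ) → H1 → ℂ) : Prop :=
  ∃ a : (ℤ × MI n × MI n) →₀ ℂ,
    (∀ t z f, R t z f = ∑ i ∈ a.support, a i * osc i.1 t * mon i.2.1 i.2.2 z) ∧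
    (∀ m μ ν, a (m, μ, ν) ≠ 0 → len μ = len ν ∧ r + 1 ≤ len μ ∧ |m| ≤ len μ) ∧
    (∀ m μ ν, conj (a (m, μ, ν)) = a (-m, ν, μ))

/-- The part of the remainder that is linear in `f`. -/
def IsRemainderLin {n : ℕ} (r : ℕ) (R : ℝ → (Fin (n + 1) → ℂ) → H1 → ℂ) : Prop :=
  ∃ Φ Ψ : (ℤ × MI n × MI n) →₀ 𝓢(E3, ℂ),
    (∀ t z f, R t z f = linSum Φ Ψ t z f) ∧
    (∀ m μ ν, Φ (m, μ, ν) ≠ 0 → len μ + 1 = len ν ∧ r ≤ len μ ∧ |m| ≤ len μ) ∧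
    (∀ m μ ν, Ψ (m, μ, ν) ≠ 0 → len ν + 1 = len μ ∧ r ≤ len ν ∧ |m| ≤ len ν) ∧
    (∀ m μ ν x, Ψ (-m, ν, μ) x = conj (Φ (m, μ, ν) x))

/-- The indices of the monomials
`e^{imt} z^μ \bar z^ν ⟨Φ, f⟩^α ⟨Ψ, \bar f⟩^β ⟨f^a \bar f^b, Θ⟩`, for families
`Φ = (Φ_1, …, Φ_p)` and `Ψ = (Ψ_1, …, Ψ_q)`. -/
structure MonIndex (n p q : ℕ) where
  /-- power of `f` -/
  a : ℕ
  /-- power of `\bar f` -/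
  b : ℕ
  /-- frequency -/
  m : ℤ
  /-- exponent of `z` -/
  μ : MI n
  /-- exponent of `\bar z` -/
  ν : MI n
  /-- exponent of `⟨Φ, f⟩` -/
  α : Fin p → ℕ
  /-- exponent of `⟨Ψ, \bar f⟩` -/
  β : Fin q → ℕ

/-- The monomial
`e^{imt} z^μ \bar z^ν ⟨Φ, f⟩^α ⟨Ψ, \bar f⟩^β ⟨f^a \bar f^b, Θ⟩`. -/
def genMon {n p q : ℕ} (Φ : Fin p → 𝓢(E3, ℂ)) (Ψ : Fin q → 𝓢(E3, ℂ)) (i : MonIndex n p q)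
    (Θ : 𝓢(E3, ℂ)) (t : ℝ) (z : Fin (n + 1) → ℂ) (f : H1) : ℂ :=
  osc i.m t * mon i.μ i.ν z * (∏ j, pair (Φ j) f ^ i.α j) * (∏ j, pairConj (Ψ j) f ^ i.β j)
    * ∫ x : E3, fn f x ^ i.a * conj (fn f x) ^ i.b * Θ x

/-- The part of the remainder of index `d = 2, …, 5`: over `U` it is the sum of an absolutely
convergent series of monomials as in `genMon`, with `a + b = d` (for `d = 2` also the monomials
with `a + b ≤ 1` that are at least quadratic in `f` are allowed), with as many factors
`z, f` as factors `\bar z, \bar f`, at least two of each, and frequency bounded by that number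
minus one. Only the monomials with `a + b = 2` or `a + b = 3` may be infinitely many, and the
coefficients `Θ` decay geometrically in each Schwartz seminorm, at a common rate. -/
def IsRemainderMid {n : ℕ} (φ : Fin (n + 1) → H1) (d : ℕ) (U : Set H1)
    (R : ℝ → (Fin (n + 1) → ℂ) → H1 → ℂ) : Prop :=
  ∃ (p q : ℕ) (Φ : Fin p → 𝓢(E3, ℂ)) (Ψ : Fin q → 𝓢(E3, ℂ))
    (Θ : MonIndex n p q → 𝓢(E3, ℂ)),
    (∀ i, Θ i ≠ 0 →
      (i.a + i.b = d ∨ (d = 2 ∧ i.a + i.b ≤ 1 ∧ 2 ≤ len i.α + len i.β + i.a + i.b)) ∧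
      len i.μ + len i.α + i.a = len i.ν + len i.β + i.b ∧
      2 ≤ len i.μ + len i.α + i.a ∧
      |i.m| + 1 ≤ (len i.μ + len i.α + i.a : ℕ)) ∧
    {i | Θ i ≠ 0 ∧ i.a + i.b ≠ 2 ∧ i.a + i.b ≠ 3}.Finite ∧
    (∃ ρ : ℝ, 0 < ρ ∧ ∀ j k : ℕ, Summable fun i =>
      ρ ^ (len i.μ + len i.ν + len i.α + len i.β) * SchwartzMap.seminorm ℂ j k (Θ i)) ∧
    ∀ (t : ℝ), ∀ u ∈ U,
      HasSum (fun i => genMon Φ Ψ i (Θ i) t (zCoord φ u) (fCoord φ u))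
        (R t (zCoord φ u) (fCoord φ u)) ∧
      (R t (zCoord φ u) (fCoord φ u)).im = 0

/-- The smooth part of the remainder: for all `K', S'` it is defined and smooth on the product of
`ℝ` and a neighbourhood of the origin in `ℂ^{n+1} × H_c^{-K',-S'}`, where it is
`O((|z| + ‖f‖_{H^{-K',-S'}})^k)` uniformly in `t`. -/
def IsRemainderSmooth {n : ℕ} (V : 𝓢(E3, ℝ)) (c : ℝ) (k : ℕ)
    (R : ℝ → (Fin (n + 1) → ℂ) → 𝓢'(E3, ℂ) → ℝ) : Prop :=
  ∀ K S : ℝ, ∃ W : Set ((Fin (n + 1) → ℂ) × HcSpace V c (-K) (-S)),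
    IsOpen W ∧ (0, 0) ∈ W ∧
    ContDiffOn ℝ ∞
      (fun p : ℝ × (Fin (n + 1) → ℂ) × HcSpace V c (-K) (-S) =>
        R p.1 p.2.1 (p.2.2 : HSpace (-K) (-S)).toDist) (univ ×ˢ W) ∧
    ∃ C : ℝ, ∀ (t : ℝ), ∀ p ∈ W,
      |R t p.1 (p.2 : HSpace (-K) (-S)).toDist| ≤ C * (‖p.1‖ + ‖p.2‖) ^ k

end NLSNormalForm

end

/-! The theorem is a Birkhoff normal form, reached by finitely many Lie transforms, each of which
removes the nonresonant part of the lowest degree of the remainder. Three points carry it: a grading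
that does all the bookkeeping, flows given by explicit series, and a homological equation that can
be solved within Schwartz functions.

Grading. Apart from integrals of `f^a \bar f^b` against Schwartz functions, everything is a
convergent series of polynomials in `e^{it}`, `e^{-it}`, the coordinates `z_j`, the pairings `⟨θ,
f⟩` and their conjugates. Such a monomial gets the weight `Var.wt`: (degree minus twice the number
of time factors, charge, degree). A variable `o` of value one counts as a time factor; it makes `γ₀
+ γ₁ cos t` homogeneous of weight `(-2, 0, 0)`, so that the quartic energy has weight `(2, 0, 4)`. A
bracket with a generator of weight `(2, 0, M + 2)` adds `(0, 0, M)`. Hence every energy term has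
weight `(2, 0, d)`: charge zero says that there are as many factors `z, f` as conjugate ones, parity
makes `d = 2(L + 1)`, and there are exactly `L` time factors, which bounds the frequency by `L`.

Flows. A generator `χ` depends on finitely many functionals and displaces `u` in finitely many
Schwartz directions, so its flow is `u` plus a combination of fixed vectors with coefficients the
time primitives of Lie series. The bound `k! A^k` for `k` brackets (`PData.wnorm_lie_iterate_le`)
makes these series converge on small balls; they are smooth (`contDiffOn_tsum_eval`), solve
Hamilton's equations (`PData.hasDerivAt_flow`) and are inverted by reversing time
(`PData.flow_neg_flow`), so that no existence theorem for differential equations is needed. The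
symplectic form is preserved because its pullback has zero derivative in time
(`symplectic_of_flow`).

Effect on the energy. The quadratic part changes by the primitive of `{H_F, χ}` (`hamF_flow`),
although `u` is only in `H¹`, because `𝓗` falls on the Schwartz directions. In `|f + Γ|⁴` with `Γ` a
combination of Schwartz functions, all terms but `|f|⁴` are integrals with at most three factors `f,
\bar f`. Those with at most one factor are again functionals and join the series (`PData.Cls`);
those with two or three are kept as they are (`ECls`). The embedding of `H¹` in `L⁴`
(`memLp_four_fn`) gives meaning to all of this.

Homological equation (`solvable`). For a polynomial of weight `(2, 0, 2r + 2)` the equation is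
solved monomial by monomial. Without `f`, one divides by `λ · (μ - ν) - m`; where this vanishes,
nonresonance forces `m = 0` and the monomial belongs to the normal form. With one factor `⟨θ, f⟩`,
one replaces `θ` by a solution of `(𝓗 + λ · (μ - ν) - m) Θ = θ` modulo eigenfunctions, which are
invisible to `f`. This is possible below the continuous spectrum (`EigenSys.exists_resolvent`:
compactness, Fredholm alternative, elliptic regularity); above it the monomial is kept, and the edge
is excluded by hypothesis. Monomials at least quadratic in `f` are never removed.

Invariant (`Reduced`). After `r - 1` steps the energy is `H_F`, plus a normal form `z`, a polynomial
`q` at least quadratic in `f`, a series `F` of degree at least `2r + 2`, a sum `E` of integrals, and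
the quartic energy of `f` alone. One step (`Reduced.step`) raises the degree of `F` by two. At each
`r` the pieces of the remainder are read off by peeling `F` degree by degree until degree `2N + 4`
(`exists_peel`); what is left depends on finitely many pairings with Schwartz functions, and
therefore is smooth on all the spaces `H^{-K,-S}` (`isRemainderSmooth_of_cls`). -/

noncomputable section

namespace NLSNormalForm

/-! ### Weighted `ℓ¹` norms of polynomials -/

section wnorm

variable {J : Type}

/-- The sum of the moduli of the coefficients of `p`, weighted by the monomials at the point `B`. -/
def wnorm (B : J → ℝ) (p : MvPolynomial J ℂ) : ℝ :=
  ∑ κ ∈ p.support, ‖p.coeff κ‖ * κ.prod fun j k => B j ^ k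

theorem wnorm_eq_sum {B : J → ℝ} {p : MvPolynomial J ℂ} {s : Finset (J →₀ ℕ)}
    (h : p.support ⊆ s) : wnorm B p = ∑ κ ∈ s, ‖p.coeff κ‖ * κ.prod fun j k => B j ^ k := by
  refine Finset.sum_subset h fun κ _ hκ => ?_
  rw [MvPolynomial.notMem_support_iff.mp hκ]
  simp

theorem prod_pow_nonneg {B : J → ℝ} (hB : ∀ j, 0 ≤ B j) (κ : J →₀ ℕ) :
    0 ≤ κ.prod fun j k => B j ^ k :=
  Finset.prod_nonneg fun j _ => pow_nonneg (hB j) _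

theorem wnorm_nonneg {B : J → ℝ} (hB : ∀ j, 0 ≤ B j) (p : MvPolynomial J ℂ) : 0 ≤ wnorm B p :=
  Finset.sum_nonneg fun κ _ => mul_nonneg (norm_nonneg _) (prod_pow_nonneg hB κ)

@[simp] theorem wnorm_zero (B : J → ℝ) : wnorm B 0 = 0 := by simp [wnorm]

theorem wnorm_add_le {B : J → ℝ} (hB : ∀ j, 0 ≤ B j) (p q : MvPolynomial J ℂ) :
    wnorm B (p + q) ≤ wnorm B p + wnorm B q := by
  classical
  rw [wnorm_eq_sum (MvPolynomial.support_add (p := p) (q := q)),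
    wnorm_eq_sum (p := p) (Finset.subset_union_left (s₂ := q.support)),
    wnorm_eq_sum (p := q) (Finset.subset_union_right (s₁ := p.support)), ← Finset.sum_add_distrib]
  refine Finset.sum_le_sum fun κ _ => ?_
  rw [← add_mul, MvPolynomial.coeff_add]
  exact mul_le_mul_of_nonneg_right (norm_add_le _ _) (prod_pow_nonneg hB κ)

theorem wnorm_sum_le {B : J → ℝ} (hB : ∀ j, 0 ≤ B j) {α : Type*} (s : Finset α)
    (f : α → MvPolynomial J ℂ) : wnorm B (∑ i ∈ s, f i) ≤ ∑ i ∈ s, wnorm B (f i) := by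
  classical
  induction s using Finset.induction_on with
  | empty => simp
  | insert a s ha ih =>
    rw [Finset.sum_insert ha, Finset.sum_insert ha]
    exact (wnorm_add_le hB _ _).trans (by gcongr)

theorem wnorm_monomial (B : J → ℝ) (κ : J →₀ ℕ) (c : ℂ) :
    wnorm B (MvPolynomial.monomial κ c) = ‖c‖ * κ.prod fun j k => B j ^ k := by
  classical
  rw [wnorm_eq_sum MvPolynomial.support_monomial_subset]
  simp

theorem wnorm_eq_sum_monomial (B : J → ℝ) (p : MvPolynomial J ℂ) :
    wnorm B p = ∑ κ ∈ p.support, wnorm B (MvPolynomial.monomial κ (p.coeff κ)) := by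
  simp only [wnorm_monomial]
  rfl

theorem wnorm_monomial_mul_le {B : J → ℝ} (hB : ∀ j, 0 ≤ B j) (κ : J →₀ ℕ) (c : ℂ)
    (q : MvPolynomial J ℂ) : wnorm B (MvPolynomial.monomial κ c * q) ≤
      (‖c‖ * κ.prod fun j k => B j ^ k) * wnorm B q := by
  classical
  conv_lhs => rw [q.as_sum, Finset.mul_sum]
  refine (wnorm_sum_le hB _ _).trans ?_
  rw [wnorm_eq_sum_monomial B q, Finset.mul_sum]
  refine Finset.sum_le_sum fun l _ => le_of_eq ?_
  rw [MvPolynomial.monomial_mul, wnorm_monomial, wnorm_monomial, norm_mul,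
    Finsupp.prod_add_index' (by simp) (by intros; rw [pow_add])]
  ring

/-- The weight of a monomial is multiplicative in the exponent, so this is the weighted `ℓ¹`
convolution inequality. It makes products of convergent series converge. -/
theorem wnorm_mul_le {B : J → ℝ} (hB : ∀ j, 0 ≤ B j) (p q : MvPolynomial J ℂ) :
    wnorm B (p * q) ≤ wnorm B p * wnorm B q := by
  classical
  conv_lhs => rw [p.as_sum, Finset.sum_mul]
  refine (wnorm_sum_le hB _ _).trans ?_
  rw [wnorm, Finset.sum_mul]
  exact Finset.sum_le_sum fun κ _ => wnorm_monomial_mul_le hB _ _ _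

theorem wnorm_smul (B : J → ℝ) (c : ℂ) (p : MvPolynomial J ℂ) :
    wnorm B (c • p) = ‖c‖ * wnorm B p := by
  rw [wnorm_eq_sum (MvPolynomial.support_smul (a := c) (f := p)), wnorm, Finset.mul_sum]
  refine Finset.sum_congr rfl fun κ _ => ?_
  rw [MvPolynomial.coeff_smul, smul_eq_mul, norm_mul, mul_assoc]

theorem wnorm_C_mul (B : J → ℝ) (c : ℂ) (p : MvPolynomial J ℂ) :
    wnorm B (MvPolynomial.C c * p) = ‖c‖ * wnorm B p := by
  rw [← MvPolynomial.smul_eq_C_mul, wnorm_smul]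

/-- The passage from coefficients to values. The bound on `x` is only asked over `S`, since `p`
involves no other variable. -/
theorem norm_eval_le {B : J → ℝ} {x : J → ℂ} {S : Set J} {p : MvPolynomial J ℂ}
    (hp : p ∈ MvPolynomial.supported ℂ S) (hx : ∀ j ∈ S, ‖x j‖ ≤ B j) :
    ‖MvPolynomial.eval x p‖ ≤ wnorm B p := by
  rw [MvPolynomial.eval_eq]
  refine (norm_sum_le _ _).trans (Finset.sum_le_sum fun κ hκ => ?_)
  rw [norm_mul, norm_prod]
  refine mul_le_mul_of_nonneg_left ?_ (norm_nonneg _)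
  refine Finset.prod_le_prod (fun j _ => norm_nonneg _) fun j hj => ?_
  rw [norm_pow]
  refine pow_le_pow_left₀ (norm_nonneg _) (hx j ?_) _
  exact MvPolynomial.mem_supported.mp hp
    (Finset.mem_coe.mpr ((MvPolynomial.mem_vars_iff_mem_support j).mpr ⟨κ, hκ, hj⟩))

theorem coeff_ne_zero_of_mem {p : MvPolynomial J ℂ} {κ : J →₀ ℕ} (h : κ ∈ p.support) :
    p.coeff κ ≠ 0 := MvPolynomial.mem_support_iff.mp h

/-- A derivation changes a weighted norm by at most the degree times a constant. -/
theorem wnorm_mkDerivation_le {B : J → ℝ} (hB : ∀ j, 0 ≤ B j) {f : J → MvPolynomial J ℂ}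
    {K : ℝ} {N : J → ℕ} (hf : ∀ j, wnorm B (f j) ≤ K * N j * B j) {d : ℕ}
    {p : MvPolynomial J ℂ} (hp : ∀ κ ∈ p.support, (κ.sum fun j k => k * N j) = d) :
    wnorm B (MvPolynomial.mkDerivation ℂ f p) ≤ K * d * wnorm B p := by
  classical
  conv_lhs => rw [p.as_sum, map_sum]
  refine (wnorm_sum_le hB _ _).trans ?_
  rw [wnorm, Finset.mul_sum]
  refine Finset.sum_le_sum fun κ hκ => ?_
  rw [MvPolynomial.mkDerivation_monomial, ← hp κ hκ]
  refine (wnorm_smul B _ _).le.trans ?_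
  rw [← mul_assoc, mul_comm (K * _), mul_assoc]
  refine mul_le_mul_of_nonneg_left ?_ (norm_nonneg _)
  refine (wnorm_sum_le hB _ _).trans ?_
  rw [Finsupp.sum, Nat.cast_sum, Finset.mul_sum, Finset.sum_mul]
  refine Finset.sum_le_sum fun j hj => ?_
  simp only [smul_eq_mul]
  refine (wnorm_monomial_mul_le hB _ _ _).trans ?_
  have hk : 1 ≤ κ j := Nat.one_le_iff_ne_zero.mpr (Finsupp.mem_support_iff.mp hj)
  have hκ' : κ = (κ - Finsupp.single j 1) + Finsupp.single j 1 := by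
    ext i
    by_cases h : i = j
    · subst h; simp; omega
    · simp [Ne.symm h]
  have hprod : (κ.prod fun j k => B j ^ k) =
      ((κ - Finsupp.single j 1).prod fun j k => B j ^ k) * B j := by
    conv_lhs => rw [hκ']
    rw [Finsupp.prod_add_index' (by simp) (by intros; rw [pow_add])]
    simp
  rw [hprod, Complex.norm_natCast]
  have h1 := prod_pow_nonneg hB (κ - Finsupp.single j 1)
  calc (κ j : ℝ) * ((κ - Finsupp.single j 1).prod fun j k => B j ^ k) * wnorm B (f j)
      ≤ (κ j : ℝ) * ((κ - Finsupp.single j 1).prod fun j k => B j ^ k) * (K * N j * B j) :=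
        mul_le_mul_of_nonneg_left (hf j) (by positivity)
    _ = _ := by push_cast; ring

/-- By Leibniz a derivation shifts the weight of every monomial by what it adds to a single
variable, so the shift `δ` need only be checked on the variables. -/
theorem isWeightedHomogeneous_mkDerivation {M : Type*} [AddCommMonoid M] {w : J → M}
    {f : J → MvPolynomial J ℂ} {δ m : M}
    (hf : ∀ j, MvPolynomial.IsWeightedHomogeneous w (f j) (w j + δ)) {p : MvPolynomial J ℂ}
    (hp : MvPolynomial.IsWeightedHomogeneous w p m) :
    MvPolynomial.IsWeightedHomogeneous w (MvPolynomial.mkDerivation ℂ f p) (m + δ) := by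
  classical
  rw [p.as_sum, map_sum]
  refine MvPolynomial.IsWeightedHomogeneous.sum _ _ _ fun κ hκ => ?_
  rw [MvPolynomial.mkDerivation_monomial, MvPolynomial.smul_eq_C_mul]
  refine MvPolynomial.IsWeightedHomogeneous.C_mul ?_ _
  refine MvPolynomial.IsWeightedHomogeneous.sum _ _ _ fun j hj => ?_
  have hk : 1 ≤ κ j := Nat.one_le_iff_ne_zero.mpr (Finsupp.mem_support_iff.mp hj)
  have hκ' : (κ - Finsupp.single j 1) + Finsupp.single j 1 = κ := by
    ext i
    by_cases h : i = j
    · subst h; simp; omega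
    · simp [Ne.symm h]
  have h1 : Finsupp.weight w (κ - Finsupp.single j 1) + w j = m := by
    rw [← hp (coeff_ne_zero_of_mem hκ)]
    conv_rhs => rw [← hκ', map_add]
    rw [Finsupp.weight_single, one_smul]
  rw [← h1, add_assoc]
  exact (MvPolynomial.isWeightedHomogeneous_monomial w _ _ rfl).mul (hf j)

theorem mkDerivation_mem_supported {f : J → MvPolynomial J ℂ} {S : Set J}
    (hf : ∀ j, f j ∈ MvPolynomial.supported ℂ S) {p : MvPolynomial J ℂ}
    (hp : p ∈ MvPolynomial.supported ℂ S) :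
    MvPolynomial.mkDerivation ℂ f p ∈ MvPolynomial.supported ℂ S := by
  rw [MvPolynomial.supported] at hp
  induction hp using Algebra.adjoin_induction with
  | mem x hx =>
    obtain ⟨j, hj, rfl⟩ := hx
    rw [MvPolynomial.mkDerivation_X]
    exact hf j
  | algebraMap c =>
    rw [Derivation.map_algebraMap]
    exact zero_mem _
  | add x y _ _ hx hy => rw [map_add]; exact add_mem hx hy
  | mul x y hx' hy' hx hy =>
    rw [Derivation.leibniz]
    exact add_mem (mul_mem hx' hy) (mul_mem hy' hx)

theorem pderiv_mem_supported (j : J) {S : Set J} {p : MvPolynomial J ℂ}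
    (hp : p ∈ MvPolynomial.supported ℂ S) :
    MvPolynomial.pderiv j p ∈ MvPolynomial.supported ℂ S := by
  classical
  rw [MvPolynomial.pderiv_def]
  refine mkDerivation_mem_supported (fun i => ?_) hp
  by_cases h : i = j
  · subst h; rw [Pi.single_eq_same]; exact one_mem _
  · rw [Pi.single_eq_of_ne h]; exact zero_mem _

/-- Cauchy's estimate for a partial derivative. -/
theorem wnorm_pderiv_le {B B' : J → ℝ} (hB : ∀ j, 0 ≤ B j) (h : ∀ j, B j ≤ B' j) (j : J)
    (hj : B j < B' j) (p : MvPolynomial J ℂ) :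
    wnorm B (MvPolynomial.pderiv j p) ≤ (B' j - B j)⁻¹ * wnorm B' p := by
  classical
  conv_lhs => rw [p.as_sum, map_sum]
  refine (wnorm_sum_le hB _ _).trans ?_
  rw [wnorm_eq_sum_monomial B' p, Finset.mul_sum]
  refine Finset.sum_le_sum fun κ _ => ?_
  rw [MvPolynomial.pderiv_monomial, wnorm_monomial, wnorm_monomial, norm_mul, Complex.norm_natCast]
  have hpos : 0 < B' j - B j := sub_pos.mpr hj
  rw [← mul_assoc, mul_comm (B' j - B j)⁻¹, mul_assoc, mul_assoc]
  refine mul_le_mul_of_nonneg_left ?_ (norm_nonneg _)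
  rw [← div_eq_inv_mul, le_div_iff₀ hpos]
  rcases Nat.eq_zero_or_pos (κ j) with h0 | h0
  · rw [h0]
    simp only [Nat.cast_zero, zero_mul]
    exact prod_pow_nonneg (fun i => (hB i).trans (h i)) κ
  have hκ' : κ = (κ.erase j) + Finsupp.single j (κ j) := (Finsupp.erase_add_single j κ).symm
  have hκ2 : κ - Finsupp.single j 1 = (κ.erase j) + Finsupp.single j (κ j - 1) := by
    ext i
    by_cases hi : i = j
    · subst hi; simp
    · simp [hi]
  have e1 : (κ.prod fun j k => B' j ^ k) = ((κ.erase j).prod fun j k => B' j ^ k) * B' j ^ κ j := by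
    conv_lhs => rw [hκ']
    rw [Finsupp.prod_add_index' (by simp) (by intros; rw [pow_add])]
    simp
  rw [hκ2, e1, Finsupp.prod_add_index' (by simp) (by intros; rw [pow_add])]
  have e2 : ((κ.erase j).prod fun j k => B j ^ k) ≤ ((κ.erase j).prod fun j k => B' j ^ k) :=
    Finset.prod_le_prod (fun j _ => pow_nonneg (hB j) _)
      fun j _ => pow_le_pow_left₀ (hB j) (h j) _
  -- From `B'^k - B^k = (B' - B) ∑ B'^i B^(k-1-i)`, where each of the `k` summands is at least
  -- `B^(k-1)`.
  have e3 : (κ j : ℝ) * B j ^ (κ j - 1) * (B' j - B j) ≤ B' j ^ κ j := by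
    obtain ⟨m, hm⟩ : ∃ m, κ j = m + 1 := ⟨κ j - 1, by omega⟩
    rw [hm, Nat.add_sub_cancel]
    have := geom_sum₂_mul (B' j) (B j) (m + 1)
    have h2 : ((m + 1 : ℕ) : ℝ) * B j ^ m ≤
        ∑ i ∈ Finset.range (m + 1), B' j ^ i * B j ^ (m + 1 - 1 - i) := by
      rw [← nsmul_eq_mul, ← Finset.card_range (m + 1), ← Finset.sum_const, Finset.card_range]
      refine Finset.sum_le_sum fun i hi => ?_
      have : m = i + (m - i) := by have := Finset.mem_range.mp hi; omega
      conv_lhs => rw [this, pow_add]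
      exact mul_le_mul_of_nonneg_right (pow_le_pow_left₀ (hB j) (h j) _) (pow_nonneg (hB j) _)
    have h3 := mul_le_mul_of_nonneg_right h2 hpos.le
    rw [this] at h3
    have := pow_nonneg (hB j) (m + 1)
    linarith
  have e4 := prod_pow_nonneg (fun i => hB i) (κ.erase j)
  calc _ = ((κ.erase j).prod fun j k => B j ^ k) * ((κ j : ℝ) * B j ^ (κ j - 1) * (B' j - B j)) := by
        rw [Finsupp.prod_single_index (by simp)]; ring
    _ ≤ _ := mul_le_mul e2 e3 (by have := hB j; positivity) (e4.trans e2)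

end wnorm

end NLSNormalForm

end


noncomputable section

namespace NLSNormalForm

/-! ### Smoothness of series of polynomials -/

section smoothSeries

variable {J P : Type} [NormedAddCommGroup P] [NormedSpace ℝ P]

theorem _root_.HasSum.smul_clm {I : Type} {f : I → ℂ} {a : ℂ} (hf : HasSum f a) (L : P →L[ℝ] ℂ) :
    HasSum (fun i => f i • L) (a • L) := by
  have := hf.map ((ContinuousLinearMap.compL ℝ P ℂ ℂ).flip L ∘L
    ContinuousLinearMap.mul ℝ ℂ).toLinearMap.toAddMonoidHom
    ((ContinuousLinearMap.compL ℝ P ℂ ℂ).flip L ∘L ContinuousLinearMap.mul ℝ ℂ).continuous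
  exact this

/-- The chain rule remains a finite sum because `p` involves only the variables in `S`, even when
`J` is infinite. -/
theorem hasFDerivAt_eval {S : Finset J} {x : P → J → ℂ} {x' : J → P →L[ℝ] ℂ} {q : P}
    (hx : ∀ j ∈ S, HasFDerivAt (fun q => x q j) (x' j) q) {p : MvPolynomial J ℂ}
    (hp : p ∈ MvPolynomial.supported ℂ (S : Set J)) :
    HasFDerivAt (fun q => MvPolynomial.eval (x q) p)
      (∑ j ∈ S, MvPolynomial.eval (x q) (MvPolynomial.pderiv j p) • x' j) q := by
  classical
  rw [MvPolynomial.supported] at hp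
  induction hp using Algebra.adjoin_induction with
  | mem y hy =>
    obtain ⟨j, hj, rfl⟩ := hy
    simp only [MvPolynomial.eval_X]
    convert! hx j hj using 1
    rw [Finset.sum_eq_single j]
    · simp
    · intro b _ hb
      rw [MvPolynomial.pderiv_X_of_ne (Ne.symm hb), map_zero]
      exact zero_smul ℂ (x' b)
    · intro h
      exact absurd hj h
  | algebraMap c =>
    simp only [MvPolynomial.algebraMap_eq, MvPolynomial.eval_C, MvPolynomial.pderiv_C, map_zero]
    rw [Finset.sum_eq_zero fun j _ => zero_smul ℂ (x' j)]
    exact hasFDerivAt_const c q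
  | add y z _ _ hy hz =>
    simp only [map_add]
    convert! hy.add hz using 1
    rw [← Finset.sum_add_distrib]
    exact Finset.sum_congr rfl fun j _ => add_smul _ _ (x' j)
  | mul y z _ _ hy hz =>
    have := hy.mul hz
    simp only [map_mul]
    convert! this using 1
    rw [Finset.smul_sum, Finset.smul_sum, ← Finset.sum_add_distrib]
    refine Finset.sum_congr rfl fun j _ => ?_
    rw [Derivation.leibniz]
    simp only [smul_eq_mul, map_add, map_mul]
    ext v
    simp
    ring

theorem contDiffOn_eval {S : Finset J} {x : P → J → ℂ} {D : Set P} {n : WithTop ℕ∞}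
    (hx : ∀ j ∈ S, ContDiffOn ℝ n (fun q => x q j) D) {p : MvPolynomial J ℂ}
    (hp : p ∈ MvPolynomial.supported ℂ (S : Set J)) :
    ContDiffOn ℝ n (fun q => MvPolynomial.eval (x q) p) D := by
  rw [MvPolynomial.supported] at hp
  induction hp using Algebra.adjoin_induction with
  | mem y hy =>
    obtain ⟨j, hj, rfl⟩ := hy
    simpa only [MvPolynomial.eval_X] using hx j hj
  | algebraMap c =>
    simp only [MvPolynomial.algebraMap_eq, MvPolynomial.eval_C]
    exact contDiffOn_const
  | add y z _ _ hy hz =>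
    simp only [map_add]
    exact hy.add hz
  | mul y z _ _ hy hz =>
    simp only [map_mul]
    exact hy.mul hz

/-- The sum of a series of polynomials that converges absolutely on a polydisc is smooth. -/
theorem contDiffOn_tsum_eval {I : Type} {S : Finset J} {x : P → J → ℂ}
    (n : ℕ) :
    ∀ {D : Set P} (_ : IsOpen D) (_ : ∀ j ∈ S, ContDiffOn ℝ ∞ (fun q => x q j) D)
    {B : J → ℝ} (_ : ∀ j, 0 ≤ B j) (_ : ∀ q ∈ D, ∀ j ∈ S, ‖x q j‖ < B j)
    {p : I → MvPolynomial J ℂ} (_ : ∀ i, p i ∈ MvPolynomial.supported ℂ (S : Set J))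
    (_ : Summable fun i => wnorm B (p i)),
    ContDiffOn ℝ n (fun q => ∑' i, MvPolynomial.eval (x q) (p i)) D := by
  classical
  -- local differentiability with an explicit derivative
  have key : ∀ {D : Set P} (_ : IsOpen D) (_ : ∀ j ∈ S, ContDiffOn ℝ ∞ (fun q => x q j) D)
      {B : J → ℝ} (_ : ∀ j, 0 ≤ B j) (_ : ∀ q ∈ D, ∀ j ∈ S, ‖x q j‖ < B j)
      {p : I → MvPolynomial J ℂ} (_ : ∀ i, p i ∈ MvPolynomial.supported ℂ (S : Set J))
      (_ : Summable fun i => wnorm B (p i)), ∀ q₀ ∈ D,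
      ∃ (D' : Set P) (B' : J → ℝ), IsOpen D' ∧ q₀ ∈ D' ∧ D' ⊆ D ∧ (∀ j, 0 ≤ B' j) ∧
        (∀ q ∈ D', ∀ j ∈ S, ‖x q j‖ < B' j) ∧
        (∀ j ∈ S, Summable fun i => wnorm B' (MvPolynomial.pderiv j (p i))) ∧
        ∀ q ∈ D', HasFDerivAt (fun q => ∑' i, MvPolynomial.eval (x q) (p i))
          (∑ j ∈ S, (∑' i, MvPolynomial.eval (x q) (MvPolynomial.pderiv j (p i))) •
            fderiv ℝ (fun q => x q j) q) q := by
    intro D hD hxD B hB0 hB p hp hs q₀ hq₀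
    set B' : J → ℝ := fun j => if j ∈ S then (‖x q₀ j‖ + B j) / 2 else B j with hB'
    have hB'S : ∀ j ∈ S, B' j < B j := fun j hj => by
      simp only [hB', if_pos hj]; linarith [hB q₀ hq₀ j hj]
    have hB'le : ∀ j, B' j ≤ B j := fun j => by
      by_cases hj : j ∈ S
      · exact (hB'S j hj).le
      · simp [hB', hj]
    have hB'0 : ∀ j, 0 ≤ B' j := fun j => by
      by_cases hj : j ∈ S
      · simp only [hB', if_pos hj]; linarith [norm_nonneg (x q₀ j), hB0 j]
      · simp [hB', hj, hB0 j]
    have hsum : ∀ j ∈ S, Summable fun i => wnorm B' (MvPolynomial.pderiv j (p i)) := fun j hj =>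
      Summable.of_nonneg_of_le (fun i => wnorm_nonneg hB'0 _)
        (fun i => wnorm_pderiv_le hB'0 hB'le j (hB'S j hj) (p i)) (hs.mul_left _)
    -- a neighbourhood where everything is bounded
    have hev1 : ∀ j ∈ S, ∀ᶠ q in 𝓝 q₀, ‖x q j‖ < B' j := fun j hj => by
      have hc : ContinuousAt (fun q => x q j) q₀ :=
        ((hxD j hj).contDiffAt (hD.mem_nhds hq₀)).continuousAt
      refine hc.norm.eventually_lt continuousAt_const ?_
      simp only [hB', if_pos hj]; linarith [hB q₀ hq₀ j hj]
    have hev2 : ∀ j ∈ S, ∀ᶠ q in 𝓝 q₀,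
        ‖fderiv ℝ (fun q => x q j) q‖ < ‖fderiv ℝ (fun q => x q j) q₀‖ + 1 := fun j hj => by
      have hc : ContinuousAt (fderiv ℝ (fun q => x q j)) q₀ :=
        (((hxD j hj).contDiffAt (hD.mem_nhds hq₀)).fderiv_right (m := 0)
          (by norm_cast)).continuousAt
      exact hc.norm.eventually_lt continuousAt_const (by linarith)
    have hev : ∀ᶠ q in 𝓝 q₀, q ∈ D ∧ ∀ j ∈ S, ‖x q j‖ < B' j ∧
        ‖fderiv ℝ (fun q => x q j) q‖ < ‖fderiv ℝ (fun q => x q j) q₀‖ + 1 := by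
      refine Filter.Eventually.and (hD.mem_nhds hq₀) ?_
      rw [Filter.eventually_all_finset]
      exact fun j hj => (hev1 j hj).and (hev2 j hj)
    obtain ⟨ε, hε, hball⟩ := Metric.eventually_nhds_iff_ball.mp hev
    refine ⟨Metric.ball q₀ ε, B', Metric.isOpen_ball, Metric.mem_ball_self hε,
      fun q hq => (hball q hq).1, hB'0, fun q hq j hj => ((hball q hq).2 j hj).1, hsum, ?_⟩
    intro q hq
    have hdiff : ∀ q ∈ Metric.ball q₀ ε, ∀ j ∈ S,
        HasFDerivAt (fun q => x q j) (fderiv ℝ (fun q => x q j) q) q := fun q hq j hj =>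
      (((hxD j hj).contDiffAt (hD.mem_nhds (hball q hq).1)).differentiableAt
        (by simp)).hasFDerivAt
    have hbd : ∀ j ∈ S, ∀ i, ∀ q ∈ Metric.ball q₀ ε,
        ‖MvPolynomial.eval (x q) (MvPolynomial.pderiv j (p i))‖ ≤
          wnorm B' (MvPolynomial.pderiv j (p i)) := fun j hj i q hq =>
      norm_eval_le (pderiv_mem_supported j (hp i))
        fun k hk => (((hball q hq).2 k hk).1).le
    have := hasFDerivAt_tsum_of_isPreconnected (𝕜 := ℝ)
      (f := fun i q => MvPolynomial.eval (x q) (p i))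
      (f' := fun i q => ∑ j ∈ S, MvPolynomial.eval (x q) (MvPolynomial.pderiv j (p i)) •
        fderiv ℝ (fun q => x q j) q)
      (u := fun i => ∑ j ∈ S, wnorm B' (MvPolynomial.pderiv j (p i)) *
        (‖fderiv ℝ (fun q => x q j) q₀‖ + 1))
      (summable_sum fun j hj => (hsum j hj).mul_right _)
      Metric.isOpen_ball (convex_ball q₀ ε).isPreconnected
      (fun i q hq => hasFDerivAt_eval (hdiff q hq) (hp i))
      (fun i q hq => (norm_sum_le _ _).trans (Finset.sum_le_sum fun j hj => by
        rw [norm_smul]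
        exact mul_le_mul (hbd j hj i q hq) ((hball q hq).2 j hj).2.le (norm_nonneg _)
          (wnorm_nonneg hB'0 _)))
      (Metric.mem_ball_self hε)
      (Summable.of_norm_bounded hs fun i => norm_eval_le (hp i)
        fun j hj => (hB q₀ hq₀ j hj).le) hq
    convert! this using 1
    rw [Summable.tsum_finsetSum]
    · refine Finset.sum_congr rfl fun j hj => ?_
      exact ((Summable.of_norm_bounded (hsum j hj) fun i => hbd j hj i q hq).hasSum.smul_clm
        (fderiv ℝ (fun q => x q j) q)).tsum_eq.symm
    · intro j hj
      exact ((Summable.of_norm_bounded (hsum j hj) fun i => hbd j hj i q hq).hasSum.smul_clm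
        (fderiv ℝ (fun q => x q j) q)).summable
  -- The derivative is a finite combination of series of the same kind, with partial derivatives of
  -- the `p i` and smaller radii. So the induction is on the order of differentiability, for all
  -- domains, radii and families at once.
  induction n with
  | zero =>
    intro D hD hxD B hB0 hB p hp hs
    rw [Nat.cast_zero, contDiffOn_zero]
    intro q hq
    obtain ⟨D', B', _, hq', _, _, _, _, h⟩ := key hD hxD hB0 hB hp hs q hq
    exact (h q hq').continuousAt.continuousWithinAt
  | succ n ih =>
    intro D hD hxD B hB0 hB p hp hs q hq
    obtain ⟨D', B', hD', hq', hsub, hB'0, hB', hs', h⟩ := key hD hxD hB0 hB hp hs q hq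
    have : ContDiffOn ℝ ((n + 1 : ℕ) : WithTop ℕ∞)
        (fun q => ∑' i, MvPolynomial.eval (x q) (p i)) D' := by
      rw [Nat.cast_add, Nat.cast_one, contDiffOn_succ_iff_fderiv_of_isOpen hD']
      refine ⟨fun q hq => (h q hq).differentiableAt.differentiableWithinAt, by simp, ?_⟩
      have hform : EqOn (fderiv ℝ (fun q => ∑' i, MvPolynomial.eval (x q) (p i)))
          (fun q => ∑ j ∈ S, (∑' i, MvPolynomial.eval (x q) (MvPolynomial.pderiv j (p i))) •
            fderiv ℝ (fun q => x q j) q) D' := fun q hq => (h q hq).fderiv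
      refine ContDiffOn.congr ?_ hform
      refine ContDiffOn.sum fun j hj => ?_
      refine ContDiffOn.fun_smul (𝕜 := ℝ) (𝕜' := ℂ) ?_ ?_
      · exact ih hD' (fun j hj => (hxD j hj).mono hsub) hB'0 hB'
          (fun i => pderiv_mem_supported j (hp i)) (hs' j hj)
      · exact ((hxD j hj).mono hsub).fderiv_of_isOpen hD' (by exact_mod_cast le_top)
    exact (this.contDiffAt (hD'.mem_nhds hq')).contDiffWithinAt

end smoothSeries

end NLSNormalForm

end


noncomputable section

namespace NLSNormalForm

/-! ### Polynomials in the time oscillations and in linear functionals -/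

/-- The variables of the polynomials: the oscillations `e^{it}`, `e^{-it}`, the constant `1`, the
linear functionals `h v` and their complex conjugates `a v`. -/
inductive Var (ι : Type) : Type
  | e : Var ι
  | e' : Var ι
  | o : Var ι
  | h (v : ι) : Var ι
  | a (v : ι) : Var ι

namespace Var

variable {ι : Type}

/-- Complex conjugation of the variables. -/
def swap : Var ι → Var ι
  | e => e'
  | e' => e
  | o => o
  | h v => a v
  | a v => h v

@[simp] theorem swap_swap (j : Var ι) : j.swap.swap = j := by cases j <;> rfl

theorem swap_injective : Function.Injective (swap : Var ι → Var ι) :=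
  Function.LeftInverse.injective swap_swap

/-- The number of factors `z, f, \bar z, \bar f` in a variable. -/
def ndeg : Var ι → ℕ
  | h _ => 1
  | a _ => 1
  | _ => 0

/-- The weight (degree minus twice the number of time oscillations, charge, degree). -/
def wt : Var ι → ℤ × ℤ × ℕ
  | h _ => (1, 1, 1)
  | a _ => (1, -1, 1)
  | _ => (-2, 0, 0)

/-- The variables that only involve time and the functionals in `S`. -/
def overS (S : Finset ι) : Set (Var ι) :=
  {e, e', o} ∪ (h '' (S : Set ι)) ∪ (a '' (S : Set ι))

theorem overS_mono {S S' : Finset ι} (hS : S ⊆ S') : overS S ⊆ overS S' := by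
  unfold overS
  gcongr

theorem overS_finite (S : Finset ι) : (overS S).Finite := by
  unfold overS
  exact ((Set.toFinite _).union (S.finite_toSet.image _)).union (S.finite_toSet.image _)

@[simp] theorem e_mem_overS (S : Finset ι) : (e : Var ι) ∈ overS S := by simp [overS]
@[simp] theorem e'_mem_overS (S : Finset ι) : (e' : Var ι) ∈ overS S := by simp [overS]
@[simp] theorem o_mem_overS (S : Finset ι) : (o : Var ι) ∈ overS S := by simp [overS]
@[simp] theorem h_mem_overS {S : Finset ι} {v : ι} : h v ∈ overS S ↔ v ∈ S := by simp [overS]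
@[simp] theorem a_mem_overS {S : Finset ι} {v : ι} : a v ∈ overS S ↔ v ∈ S := by simp [overS]

theorem swap_mem_overS {S : Finset ι} {j : Var ι} : j.swap ∈ overS S ↔ j ∈ overS S := by
  cases j <;> simp [swap]

end Var

/-- The polynomials in the variables `Var ι`. -/
abbrev VPoly (ι : Type) : Type := MvPolynomial (Var ι) ℂ

/-- `p` is homogeneous, of weight `(j, q, d)`. -/
abbrev IsHom {ι : Type} (j q : ℤ) (d : ℕ) (p : VPoly ι) : Prop :=
  MvPolynomial.IsWeightedHomogeneous Var.wt p (j, q, d)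

/-- The polynomials in the variables over `S`. -/
abbrev VSupp {ι : Type} (S : Finset ι) : Subalgebra ℂ (VPoly ι) :=
  MvPolynomial.supported ℂ (Var.overS S)

theorem VSupp_mono {ι : Type} {S S' : Finset ι} (h : S ⊆ S') : VSupp S ≤ VSupp S' :=
  MvPolynomial.supported_mono (Var.overS_mono h)

theorem exists_mem_VSupp {ι : Type} (p : VPoly ι) : ∃ S : Finset ι, p ∈ VSupp S := by
  classical
  refine ⟨p.vars.biUnion fun j => match j with | .h v => {v} | .a v => {v} | _ => ∅, ?_⟩
  rw [MvPolynomial.mem_supported]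
  intro j hj
  cases j with
  | h v => exact Var.h_mem_overS.mpr (Finset.mem_biUnion.mpr ⟨_, hj, by simp⟩)
  | a v => exact Var.a_mem_overS.mpr (Finset.mem_biUnion.mpr ⟨_, hj, by simp⟩)
  | _ => simp

section star

variable {ι : Type}

/-- Complex conjugation of polynomials. -/
def starP : VPoly ι →+* VPoly ι :=
  (MvPolynomial.rename Var.swap).toRingHom.comp (MvPolynomial.map (starRingEnd ℂ))

theorem starP_def (p : VPoly ι) :
    starP p = MvPolynomial.rename Var.swap (MvPolynomial.map (starRingEnd ℂ) p) := rfl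

@[simp] theorem starP_X (j : Var ι) : starP (MvPolynomial.X j) = MvPolynomial.X j.swap := by
  simp [starP_def]

@[simp] theorem starP_C (c : ℂ) : starP (MvPolynomial.C c : VPoly ι) = MvPolynomial.C (conj c) := by
  simp [starP_def]

theorem starP_smul (c : ℂ) (p : VPoly ι) : starP (c • p) = conj c • starP p := by
  simp [MvPolynomial.smul_eq_C_mul]

@[simp] theorem starP_starP (p : VPoly ι) : starP (starP p) = p := by
  induction p using MvPolynomial.induction_on with
  | C c => simp
  | add p q hp hq => rw [map_add, map_add, hp, hq]
  | mul_X p j hp => rw [map_mul, map_mul, hp, starP_X, starP_X, Var.swap_swap]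

theorem eval_starP {x : Var ι → ℂ} (hx : ∀ j, x j.swap = conj (x j)) (p : VPoly ι) :
    MvPolynomial.eval x (starP p) = conj (MvPolynomial.eval x p) := by
  induction p using MvPolynomial.induction_on with
  | C c => simp
  | add p q hp hq => simp only [map_add, hp, hq]
  | mul_X p j hp => simp only [map_mul, hp, starP_X, MvPolynomial.eval_X, hx]

theorem starP_pderiv (j : Var ι) (p : VPoly ι) :
    starP (MvPolynomial.pderiv j p) = MvPolynomial.pderiv j.swap (starP p) := by
  rw [starP_def, starP_def, MvPolynomial.pderiv_rename Var.swap_injective,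
    MvPolynomial.pderiv_map]

theorem starP_monomial (κ : Var ι →₀ ℕ) (c : ℂ) : starP (MvPolynomial.monomial κ c) =
    MvPolynomial.monomial (κ.mapDomain Var.swap) (conj c) := by
  rw [starP_def, MvPolynomial.map_monomial, MvPolynomial.rename_monomial]

theorem starP_mem_VSupp {S : Finset ι} {p : VPoly ι} (hp : p ∈ VSupp S) : starP p ∈ VSupp S := by
  unfold VSupp MvPolynomial.supported at hp
  induction hp using Algebra.adjoin_induction with
  | mem x hx =>
    obtain ⟨j, hj, rfl⟩ := hx
    rw [starP_X]
    exact MvPolynomial.X_mem_supported.mpr (Var.swap_mem_overS.mpr hj)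
  | algebraMap c =>
    rw [MvPolynomial.algebraMap_eq, starP_C]
    exact (VSupp S).algebraMap_mem _
  | add x y _ _ hx hy => rw [map_add]; exact add_mem hx hy
  | mul x y _ _ hx hy => rw [map_mul]; exact mul_mem hx hy

theorem isHom_starP {j q : ℤ} {d : ℕ} {p : VPoly ι} (hp : IsHom j q d p) :
    IsHom j (-q) d (starP p) := by
  classical
  rw [p.as_sum, map_sum]
  refine MvPolynomial.IsWeightedHomogeneous.sum _ _ _ fun κ hκ => ?_
  rw [starP_monomial]
  refine MvPolynomial.isWeightedHomogeneous_monomial _ _ _ ?_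
  have h1 := hp (coeff_ne_zero_of_mem hκ)
  -- The effect of conjugation on weights: only the charge changes sign.
  let T : ℤ × ℤ × ℕ →+ ℤ × ℤ × ℕ :=
    { toFun := fun m => (m.1, -m.2.1, m.2.2)
      map_zero' := by simp
      map_add' := fun m m' => by simp [add_comm] }
  have h2 : ∀ κ : Var ι →₀ ℕ, Finsupp.weight Var.wt (κ.mapDomain Var.swap) =
      T (Finsupp.weight Var.wt κ) := by
    intro κ
    induction κ using Finsupp.induction_linear with
    | zero => simp
    | add f g hf hg => simp only [Finsupp.mapDomain_add, map_add, hf, hg]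
    | single j k =>
      rw [Finsupp.mapDomain_single, Finsupp.weight_single, Finsupp.weight_single, map_nsmul]
      congr 1
      cases j <;> rfl
  rw [h2, h1]
  rfl

theorem wnorm_starP {B : Var ι → ℝ} (hB : ∀ j, B j.swap = B j) (p : VPoly ι) :
    wnorm B (starP p) = wnorm B p := by
  classical
  have key : ∀ p : VPoly ι, (∀ j, 0 ≤ |B j|) → wnorm B (starP p) = wnorm B p := by
    intro p _
    have hsupp : (starP p).support = p.support.image (Finsupp.mapDomain Var.swap) := by
      ext κ
      rw [starP_def, MvPolynomial.support_rename_of_injective Var.swap_injective,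
        MvPolynomial.support_map_of_injective _ (starRingEnd ℂ).injective]
    rw [wnorm, hsupp, Finset.sum_image
      fun _ _ _ _ h => Finsupp.mapDomain_injective Var.swap_injective h]
    refine Finset.sum_congr rfl fun κ _ => ?_
    rw [starP_def, MvPolynomial.coeff_rename_mapDomain _ Var.swap_injective,
      MvPolynomial.coeff_map, RCLike.norm_conj,
      Finsupp.prod_mapDomain_index_inj Var.swap_injective]
    simp only [hB]
  exact key p fun j => abs_nonneg _

end star

section weights

variable {ι : Type}

theorem weight_wt_snd_snd (κ : Var ι →₀ ℕ) :
    (Finsupp.weight Var.wt κ).2.2 = κ.sum fun j k => k * j.ndeg := by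
  induction κ using Finsupp.induction_linear with
  | zero => simp
  | add f g hf hg =>
    rw [map_add, Prod.snd_add, Prod.snd_add, hf, hg,
      Finsupp.sum_add_index' (by simp) (by intros; ring)]
  | single j k =>
    rw [Finsupp.weight_single, Finsupp.sum_single_index (by simp)]
    cases j <;> simp [Var.wt, Var.ndeg]

theorem IsHom.sum_ndeg {j q : ℤ} {d : ℕ} {p : VPoly ι} (hp : IsHom j q d p) {κ : Var ι →₀ ℕ}
    (hκ : κ ∈ p.support) : (κ.sum fun j k => k * j.ndeg) = d := by
  rw [← weight_wt_snd_snd, hp (coeff_ne_zero_of_mem hκ)]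

theorem IsHom.mul' {j q j' q' : ℤ} {d d' : ℕ} {p p' : VPoly ι} (hp : IsHom j q d p)
    (hp' : IsHom j' q' d' p') : IsHom (j + j') (q + q') (d + d') (p * p') :=
  MvPolynomial.IsWeightedHomogeneous.mul hp hp'

theorem IsHom.smul {j q : ℤ} {d : ℕ} {p : VPoly ι} (hp : IsHom j q d p) (c : ℂ) :
    IsHom j q d (c • p) := by
  rw [MvPolynomial.smul_eq_C_mul]
  exact MvPolynomial.IsWeightedHomogeneous.C_mul hp c

theorem IsHom.pderiv_a {j q : ℤ} {d : ℕ} {p : VPoly ι} (hp : IsHom j q (d + 1) p) (v : ι) :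
    IsHom (j - 1) (q + 1) d (MvPolynomial.pderiv (.a v) p) :=
  MvPolynomial.IsWeightedHomogeneous.pderiv hp (by simp [Var.wt])

theorem IsHom.pderiv_h {j q : ℤ} {d : ℕ} {p : VPoly ι} (hp : IsHom j q (d + 1) p) (v : ι) :
    IsHom (j - 1) (q - 1) d (MvPolynomial.pderiv (.h v) p) :=
  MvPolynomial.IsWeightedHomogeneous.pderiv hp (by simp [Var.wt])

/-- The weights of the variables, for functionals bounded by `B`. -/
def wB (B : ι → ℝ) : Var ι → ℝ
  | .h v => B v
  | .a v => B v
  -- The oscillations have modulus one; the value two leaves the strict inequality that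
  -- `contDiffOn_tsum_eval` asks for.
  | _ => 2

theorem wB_swap (B : ι → ℝ) (j : Var ι) : wB B j.swap = wB B j := by cases j <;> rfl

theorem wB_nonneg {B : ι → ℝ} (hB : ∀ v, 1 ≤ B v) (j : Var ι) : 0 ≤ wB B j := by
  cases j
  case h v => exact zero_le_one.trans (hB v)
  case a v => exact zero_le_one.trans (hB v)
  all_goals simp [wB]

/-- Only the variables that count in the degree are rescaled, so a homogeneous polynomial picks up
exactly `ρ ^ d`. Convergence of a series on a ball thus becomes convergence of a power series in the
radius. -/
theorem wnorm_wB_scale (B : ι → ℝ) (ρ : ℝ) {j q : ℤ} {d : ℕ} {p : VPoly ι} (hp : IsHom j q d p) :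
    wnorm (wB fun v => B v * ρ) p = wnorm (wB B) p * ρ ^ d := by
  rw [wnorm, wnorm, Finset.sum_mul]
  refine Finset.sum_congr rfl fun κ hκ => ?_
  rw [mul_assoc]
  congr 1
  rw [← hp.sum_ndeg hκ, Finsupp.sum, ← Finset.prod_pow_eq_pow_sum, Finsupp.prod, Finsupp.prod,
    ← Finset.prod_mul_distrib]
  refine Finset.prod_congr rfl fun j _ => ?_
  cases j <;> simp [wB, Var.ndeg, mul_pow]

end weights

end NLSNormalForm

end


/-! ### Poisson brackets with a generator, and bounds for their iterates -/

noncomputable section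

namespace NLSNormalForm

/-- A family of functionals `ℓ v` on a complex normed space, with vectors `r v` that represent them
with respect to a Hermitian form, and bounds. -/
structure PData (ι H : Type) [NormedAddCommGroup H] [NormedSpace ℂ H] where
  /-- the functionals -/
  ℓ : ι → H →L[ℂ] ℂ
  /-- the vectors -/
  r : ι → H
  /-- the bounds -/
  B : ι → ℝ
  one_le : ∀ v, 1 ≤ B v
  norm_ℓ : ∀ v u, ‖ℓ v u‖ ≤ B v * ‖u‖
  norm_ℓ_r : ∀ v b, ‖ℓ v (r b)‖ ≤ B v * B b

/-- A real homogeneous polynomial that generates a Lie transform. -/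
structure Gen (ι : Type) where
  /-- the polynomial -/
  χ : VPoly ι
  /-- the functionals that occur -/
  S : Finset ι
  /-- the degree minus two -/
  M : ℕ
  one_le : 1 ≤ M
  hom : IsHom 2 0 (M + 2) χ
  supp : χ ∈ VSupp S
  real : starP χ = χ

theorem osc_add (m k : ℤ) (t : ℝ) : osc (m + k) t = osc m t * osc k t := by
  simp only [osc, ← Complex.exp_add]
  push_cast
  ring_nf

theorem osc_zero (t : ℝ) : osc 0 t = 1 := by simp [osc]

theorem conj_osc (m : ℤ) (t : ℝ) : conj (osc m t) = osc (-m) t := by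
  simp [osc, ← Complex.exp_conj]

theorem norm_osc (m : ℤ) (t : ℝ) : ‖osc m t‖ = 1 := by
  have : osc m t = Complex.exp (((m : ℝ) * t : ℝ) * Complex.I) := by
    simp only [osc]
    push_cast
    ring_nf
  rw [this, Complex.norm_exp_ofReal_mul_I]

theorem osc_pow (m : ℤ) (k : ℕ) (t : ℝ) : osc m t ^ k = osc (k * m) t := by
  induction k with
  | zero => simp [osc_zero]
  | succ k ih => rw [pow_succ, ih, ← osc_add]; push_cast; ring_nf

theorem hasDerivAt_osc (m : ℤ) (t : ℝ) : HasDerivAt (osc m) (Complex.I * m * osc m t) t := by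
  have h1 : HasDerivAt (fun t : ℝ => Complex.I * m * (t : ℂ)) (Complex.I * m) t := by
    simpa using (Complex.ofRealCLM.hasDerivAt (x := t)).const_mul (Complex.I * m)
  have h2 := h1.cexp
  rwa [mul_comm (Complex.exp _)] at h2

theorem contDiff_osc (m : ℤ) {n : WithTop ℕ∞} : ContDiff ℝ n (osc m) := by
  unfold osc
  exact ((contDiff_const).mul Complex.ofRealCLM.contDiff).cexp

namespace PData

variable {ι H : Type} [NormedAddCommGroup H] [NormedSpace ℂ H] (D : PData ι H) (g : Gen ι)

/-- The values of the variables at time `t` and at the point `u`. -/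
def xval (t : ℝ) (u : H) : Var ι → ℂ
  | .e => osc 1 t
  | .e' => osc (-1) t
  | .o => 1
  | .h v => D.ℓ v u
  | .a v => conj (D.ℓ v u)

theorem xval_swap (t : ℝ) (u : H) (j : Var ι) : D.xval t u j.swap = conj (D.xval t u j) := by
  cases j <;> simp [xval, Var.swap, conj_osc]

theorem norm_xval_le (t : ℝ) (u : H) (j : Var ι) {ρ : ℝ} (hu : ‖u‖ ≤ ρ) :
    ‖D.xval t u j‖ ≤ wB (fun v => D.B v * ρ) j := by
  have h1 (v) : ‖D.ℓ v u‖ ≤ D.B v * ρ :=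
    (D.norm_ℓ v u).trans (mul_le_mul_of_nonneg_left hu (zero_le_one.trans (D.one_le v)))
  cases j <;> simp [xval, wB, norm_osc] <;> exact h1 _

theorem wB_nonneg' {ρ : ℝ} (hρ : 0 ≤ ρ) (j : Var ι) : 0 ≤ wB (fun v => D.B v * ρ) j := by
  have h1 (v : ι) : 0 ≤ D.B v * ρ := mul_nonneg (zero_le_one.trans (D.one_le v)) hρ
  cases j <;> simp [wB, h1]

theorem wB_pos (j : Var ι) : 0 ≤ wB D.B j := wB_nonneg D.one_le j

theorem norm_eval_hom_le {j q : ℤ} {d : ℕ} {p : VPoly ι} (hp : IsHom j q d p)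
    (t : ℝ) {u : H} {ρ : ℝ} (hu : ‖u‖ ≤ ρ) :
    ‖MvPolynomial.eval (D.xval t u) p‖ ≤ wnorm (wB D.B) p * ρ ^ d := by
  rw [← wnorm_wB_scale _ _ hp]
  exact norm_eval_le (S := Set.univ) (by simp) fun j _ => D.norm_xval_le t u j hu

/-- The Poisson bracket with `χ`. -/
def lie : Derivation ℂ (VPoly ι) (VPoly ι) :=
  MvPolynomial.mkDerivation ℂ fun j => match j with
    | .h v => ∑ b ∈ g.S,
        MvPolynomial.C (-Complex.I * D.ℓ v (D.r b)) * MvPolynomial.pderiv (.a b) g.χ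
    | .a v => ∑ b ∈ g.S,
        MvPolynomial.C (Complex.I * conj (D.ℓ v (D.r b))) * MvPolynomial.pderiv (.h b) g.χ
    | _ => 0

theorem lie_h (v : ι) : D.lie g (MvPolynomial.X (.h v)) = ∑ b ∈ g.S,
    MvPolynomial.C (-Complex.I * D.ℓ v (D.r b)) * MvPolynomial.pderiv (.a b) g.χ := by
  rw [lie, MvPolynomial.mkDerivation_X]

theorem lie_a (v : ι) : D.lie g (MvPolynomial.X (.a v)) = ∑ b ∈ g.S,
    MvPolynomial.C (Complex.I * conj (D.ℓ v (D.r b))) * MvPolynomial.pderiv (.h b) g.χ := by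
  rw [lie, MvPolynomial.mkDerivation_X]

/-- Conjugation exchanges the two kinds of partial derivatives of `χ`, because `χ` is real; the
factors `-i` and `i` in the bracket match this. -/
theorem starP_lie (p : VPoly ι) : starP (D.lie g p) = D.lie g (starP p) := by
  induction p using MvPolynomial.induction_on with
  | C c =>
    rw [starP_C, ← MvPolynomial.algebraMap_eq]
    simp
  | add p q hp hq => rw [map_add, map_add, map_add, map_add, hp, hq]
  | mul_X p j hp =>
    have hj : starP (D.lie g (MvPolynomial.X j)) = D.lie g (MvPolynomial.X j.swap) := by
      cases j
      case h v =>
        rw [Var.swap, lie_h, lie_a, map_sum]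
        refine Finset.sum_congr rfl fun b _ => ?_
        rw [map_mul, starP_C, starP_pderiv, g.real]
        simp [Var.swap]
      case a v =>
        rw [Var.swap, lie_h, lie_a, map_sum]
        refine Finset.sum_congr rfl fun b _ => ?_
        rw [map_mul, starP_C, starP_pderiv, g.real]
        simp [Var.swap]
      all_goals simp [lie, Var.swap, MvPolynomial.mkDerivation_X]
    rw [Derivation.leibniz, map_add, map_mul, starP_X, Derivation.leibniz]
    simp only [smul_eq_mul, map_mul, hp, hj, starP_X]

/-- A bracket contracts one conjugate pair, of weight `(2, 0, 2)`, with `χ`, of weight `(2, 0, M +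
2)`. So only the degree grows, and the first two weights are conserved by every Lie transform. -/
theorem isHom_lie {j q : ℤ} {d : ℕ} {p : VPoly ι} (hp : IsHom j q d p) :
    IsHom j q (d + g.M) (D.lie g p) := by
  have := isWeightedHomogeneous_mkDerivation (w := Var.wt) (δ := ((0, 0, g.M) : ℤ × ℤ × ℕ))
    (f := fun j : Var ι => match j with
    | .h v => ∑ b ∈ g.S,
        MvPolynomial.C (-Complex.I * D.ℓ v (D.r b)) * MvPolynomial.pderiv (.a b) g.χ
    | .a v => ∑ b ∈ g.S,
        MvPolynomial.C (Complex.I * conj (D.ℓ v (D.r b))) * MvPolynomial.pderiv (.h b) g.χ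
    | _ => 0) (fun j => ?_) hp
  · simpa [lie] using this
  · have hχ : IsHom 2 0 (g.M + 1 + 1) g.χ := g.hom
    cases j
    case h v =>
      refine MvPolynomial.IsWeightedHomogeneous.sum _ _ _ fun b _ => ?_
      convert MvPolynomial.IsWeightedHomogeneous.C_mul (hχ.pderiv_a b) _ using 2 <;> simp [Var.wt, add_comm]
    case a v =>
      refine MvPolynomial.IsWeightedHomogeneous.sum _ _ _ fun b _ => ?_
      convert MvPolynomial.IsWeightedHomogeneous.C_mul (hχ.pderiv_h b) _ using 2 <;> simp [Var.wt, add_comm]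
    all_goals exact MvPolynomial.isWeightedHomogeneous_zero _ _ _

theorem lie_mem_VSupp {S : Finset ι} (hS : g.S ⊆ S) {p : VPoly ι} (hp : p ∈ VSupp S) :
    D.lie g p ∈ VSupp S := by
  have hχ := VSupp_mono hS g.supp
  refine mkDerivation_mem_supported (fun j => ?_) hp
  cases j
  case h v =>
    exact sum_mem fun b _ => mul_mem ((VSupp S).algebraMap_mem _) (pderiv_mem_supported _ hχ)
  case a v =>
    exact sum_mem fun b _ => mul_mem ((VSupp S).algebraMap_mem _) (pderiv_mem_supported _ hχ)
  all_goals exact zero_mem _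

/-- The constant in the bounds for the Poisson bracket with `χ`. -/
def lieK : ℝ :=
  ∑ b ∈ g.S, D.B b * (wnorm (wB D.B) (MvPolynomial.pderiv (.a b) g.χ)
    + wnorm (wB D.B) (MvPolynomial.pderiv (.h b) g.χ))

theorem lieK_nonneg : 0 ≤ D.lieK g :=
  Finset.sum_nonneg fun b _ => mul_nonneg (zero_le_one.trans (D.one_le b))
    (add_nonneg (wnorm_nonneg D.wB_pos _) (wnorm_nonneg D.wB_pos _))

/-- A monomial of degree `d` offers `d` places to the derivation, each at a cost `lieK`; the time
variables are annihilated and cost nothing. -/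
theorem wnorm_lie_le {j q : ℤ} {d : ℕ} {p : VPoly ι} (hp : IsHom j q d p) :
    wnorm (wB D.B) (D.lie g p) ≤ D.lieK g * d * wnorm (wB D.B) p := by
  refine wnorm_mkDerivation_le D.wB_pos (N := Var.ndeg) (fun j => ?_) fun κ hκ => hp.sum_ndeg hκ
  have hB (b) : 0 ≤ D.B b := zero_le_one.trans (D.one_le b)
  have h0 := fun p => wnorm_nonneg (J := Var ι) D.wB_pos p
  cases j
  case h v =>
    simp only [Var.ndeg, Nat.cast_one, mul_one, lieK, wB, Finset.sum_mul]
    refine (wnorm_sum_le D.wB_pos _ _).trans (Finset.sum_le_sum fun b _ => ?_)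
    rw [wnorm_C_mul, norm_mul, norm_neg, Complex.norm_I, one_mul]
    calc _ ≤ (D.B v * D.B b) * (wnorm (wB D.B) (MvPolynomial.pderiv (.a b) g.χ)
          + wnorm (wB D.B) (MvPolynomial.pderiv (.h b) g.χ)) :=
          mul_le_mul (D.norm_ℓ_r v b) (le_add_of_nonneg_right (h0 _)) (h0 _)
            (mul_nonneg (hB _) (hB _))
      _ = _ := by ring
  case a v =>
    simp only [Var.ndeg, Nat.cast_one, mul_one, lieK, wB, Finset.sum_mul]
    refine (wnorm_sum_le D.wB_pos _ _).trans (Finset.sum_le_sum fun b _ => ?_)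
    rw [wnorm_C_mul, norm_mul, Complex.norm_I, one_mul, RCLike.norm_conj]
    calc _ ≤ (D.B v * D.B b) * (wnorm (wB D.B) (MvPolynomial.pderiv (.a b) g.χ)
          + wnorm (wB D.B) (MvPolynomial.pderiv (.h b) g.χ)) :=
          mul_le_mul (D.norm_ℓ_r v b) (le_add_of_nonneg_left (h0 _)) (h0 _)
            (mul_nonneg (hB _) (hB _))
      _ = _ := by ring
  all_goals simp [Var.ndeg]

theorem isHom_lie_iterate {j q : ℤ} {d : ℕ} {p : VPoly ι} (hp : IsHom j q d p) (k : ℕ) :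
    IsHom j q (d + k * g.M) ((D.lie g)^[k] p) := by
  induction k with
  | zero => simpa using hp
  | succ k ih =>
    rw [Function.iterate_succ_apply', Nat.succ_mul, ← add_assoc]
    exact D.isHom_lie g ih

theorem lie_iterate_mem_VSupp {S : Finset ι} (hS : g.S ⊆ S) {p : VPoly ι} (hp : p ∈ VSupp S)
    (k : ℕ) : (D.lie g)^[k] p ∈ VSupp S := by
  induction k with
  | zero => exact hp
  | succ k ih =>
    rw [Function.iterate_succ_apply']
    exact D.lie_mem_VSupp g hS ih

theorem starP_lie_iterate (p : VPoly ι) (k : ℕ) :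
    starP ((D.lie g)^[k] p) = (D.lie g)^[k] (starP p) := by
  induction k with
  | zero => rfl
  | succ k ih => rw [Function.iterate_succ_apply', Function.iterate_succ_apply', starP_lie, ih]

/-- The ratio in the bounds for Lie series. -/
def lieA : ℝ := 2 * (D.lieK g * g.M)

theorem lieA_nonneg : 0 ≤ D.lieA g :=
  mul_nonneg zero_le_two (mul_nonneg (D.lieK_nonneg g) (Nat.cast_nonneg _))

/-- The degree after `k` brackets is `d + kM ≤ M(d + k)`, so the successive costs multiply to at
most `(lieK M)^k` times the rising factorial `d(d+1)⋯(d+k-1)`. This is `k!` times a binomial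
coefficient, hence at most `k! 2^(d+k)`: the growth that the factorials of the Lie series absorb. -/
theorem wnorm_lie_iterate_le {j q : ℤ} {d : ℕ} {p : VPoly ι} (hp : IsHom j q d p) (k : ℕ) :
    wnorm (wB D.B) ((D.lie g)^[k] p) ≤
      k.factorial * (2 ^ d * D.lieA g ^ k * wnorm (wB D.B) p) := by
  have h0 := fun p => wnorm_nonneg (J := Var ι) D.wB_pos p
  have hK := D.lieK_nonneg g
  have h1 : wnorm (wB D.B) ((D.lie g)^[k] p) ≤
      (D.lieK g * g.M) ^ k * (d.ascFactorial k) * wnorm (wB D.B) p := by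
    induction k with
    | zero => simp
    | succ k ih =>
      rw [Function.iterate_succ_apply']
      refine (D.wnorm_lie_le g (D.isHom_lie_iterate g hp k)).trans ?_
      have h2 : ((d + k * g.M : ℕ) : ℝ) ≤ g.M * (d + k : ℕ) := by
        have := g.one_le
        norm_cast
        nlinarith
      calc _ ≤ D.lieK g * (g.M * (d + k : ℕ)) *
            ((D.lieK g * g.M) ^ k * (d.ascFactorial k) * wnorm (wB D.B) p) :=
            mul_le_mul (mul_le_mul_of_nonneg_left h2 hK) ih (h0 _) (by positivity)
        _ = _ := by rw [Nat.ascFactorial_succ]; push_cast; ring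
  have h3 : ((d.ascFactorial k : ℕ) : ℝ) ≤ k.factorial * (2 ^ d * 2 ^ k) := by
    norm_cast
    rw [Nat.ascFactorial_eq_factorial_mul_choose', ← pow_add]
    exact Nat.mul_le_mul_left _ ((Nat.choose_le_two_pow _ _).trans
      (Nat.pow_le_pow_right two_pos (Nat.sub_le _ _)))
  calc _ ≤ _ := h1
    _ ≤ (D.lieK g * g.M) ^ k * (k.factorial * (2 ^ d * 2 ^ k)) * wnorm (wB D.B) p := by
        gcongr
        exact h0 _
    _ = _ := by rw [lieA, mul_pow]; ring

/-- The radius of the balls on which Lie series converge. -/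
def lieRad : ℝ := min 1 (1 / (8 * (1 + D.lieA g)))

theorem lieRad_pos : 0 < D.lieRad g := by
  have := D.lieA_nonneg g
  unfold lieRad
  positivity

theorem lieRad_le_one : D.lieRad g ≤ 1 := min_le_left _ _

/-- The value `1/8` leaves room for one further factor `2^k`, which comes from times `|s| ≤ 2` in
`norm_lieTerm_le` and from binomial coefficients in `prim_neg_flowU`; in both cases the ratio is
then `1/4`. -/
theorem lieA_mul_le {ρ : ℝ} (hρ : 0 ≤ ρ) (h : ρ ≤ D.lieRad g) : D.lieA g * ρ ^ g.M ≤ 1 / 8 := by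
  have hA := D.lieA_nonneg g
  have h1 : ρ ^ g.M ≤ 1 / (8 * (1 + D.lieA g)) :=
    (pow_le_of_le_one hρ (h.trans (D.lieRad_le_one g)) (by have := g.one_le; omega)).trans
      (h.trans (min_le_right _ _))
  calc _ ≤ D.lieA g * (1 / (8 * (1 + D.lieA g))) := by gcongr
    _ ≤ 1 / 8 := by
      rw [mul_one_div, div_le_div_iff₀ (by positivity) (by positivity)]
      linarith

theorem wnorm_scale_lie_iterate_le {j q : ℤ} {d : ℕ} {p : VPoly ι} (hp : IsHom j q d p) (k : ℕ)
    {ρ : ℝ} (hρ : 0 ≤ ρ) (h : ρ ≤ D.lieRad g) :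
    wnorm (wB fun v => D.B v * ρ) ((D.lie g)^[k] p) ≤
      k.factorial * ((1 / 8) ^ k * (wnorm (wB D.B) p * (2 * ρ) ^ d)) := by
  rw [wnorm_wB_scale _ _ (D.isHom_lie_iterate g hp k)]
  have h0 := fun p => wnorm_nonneg (J := Var ι) D.wB_pos p
  have hA := D.lieA_nonneg g
  calc _ ≤ k.factorial * (2 ^ d * D.lieA g ^ k * wnorm (wB D.B) p) * ρ ^ (d + k * g.M) :=
        mul_le_mul_of_nonneg_right (D.wnorm_lie_iterate_le g hp k) (by positivity)
    _ = k.factorial * ((D.lieA g * ρ ^ g.M) ^ k * (wnorm (wB D.B) p * (2 * ρ) ^ d)) := by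
        rw [mul_pow, mul_pow, ← pow_mul, pow_add, mul_comm k g.M]
        ring
    _ ≤ _ := by
        have := D.lieA_mul_le g hρ h
        have := h0 p
        gcongr

theorem norm_eval_lie_iterate_le {j q : ℤ} {d : ℕ} {p : VPoly ι} (hp : IsHom j q d p) (k : ℕ)
    (t : ℝ) {u : H} {ρ : ℝ} (hu : ‖u‖ ≤ ρ) (h : ρ ≤ D.lieRad g) :
    ‖MvPolynomial.eval (D.xval t u) ((D.lie g)^[k] p)‖ ≤
      k.factorial * ((1 / 8) ^ k * (wnorm (wB D.B) p * (2 * ρ) ^ d)) :=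
  (norm_eval_le (S := Set.univ) (by simp) fun j _ => D.norm_xval_le t u j hu).trans
    (D.wnorm_scale_lie_iterate_le g hp k ((norm_nonneg u).trans hu) h)

end PData

end NLSNormalForm

end


/-! ### Lie series, and the flow that they define -/

noncomputable section

namespace NLSNormalForm

section series

theorem tsum_tsum_eq_tsum_antidiagonal {f : ℕ × ℕ → ℂ} (hf : Summable fun x => ‖f x‖) :
    ∑' k, ∑' m, f (k, m) = ∑' n, ∑ kl ∈ Finset.HasAntidiagonal.antidiagonal n, f kl := by
  have h1 : Summable f := hf.of_norm
  rw [← h1.tsum_prod]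
  conv_rhs => congr; ext; rw [← Finset.sum_finset_coe, ← tsum_fintype (L := .unconditional _)]
  rw [← Finset.HasAntidiagonal.sigmaAntidiagonalEquivProd.tsum_eq]
  exact (Finset.HasAntidiagonal.sigmaAntidiagonalEquivProd.summable_iff.mpr h1).tsum_sigma'
    (fun n => (hasSum_fintype _).summable)

theorem iterate_derivation_mul {A : Type} [CommRing A] [Algebra ℂ A] (D : Derivation ℂ A A) (n : ℕ)
    (a b : A) : D^[n] (a * b) =
      ∑ ij ∈ Finset.HasAntidiagonal.antidiagonal n, n.choose ij.1 • (D^[ij.1] a * D^[ij.2] b) := by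
  induction n with
  | zero => simp
  | succ n ih =>
    rw [Finset.sum_antidiagonal_choose_succ_nsmul (fun i j => D^[i] a * D^[j] b) n]
    simp only [Function.iterate_succ_apply', ih, map_sum, map_nsmul, Derivation.leibniz,
      smul_add, Finset.sum_add_distrib, smul_eq_mul, add_right_inj]
    refine Finset.sum_congr rfl fun ⟨i, j⟩ hij => ?_
    rw [n.choose_symm_of_eq_add (Finset.HasAntidiagonal.mem_antidiagonal.1 hij).symm, mul_comm]

theorem iterate_derivation_sum {A : Type} [CommRing A] [Algebra ℂ A] (D : Derivation ℂ A A) (n : ℕ)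
    {β : Type} (s : Finset β) (f : β → A) : D^[n] (∑ b ∈ s, f b) = ∑ b ∈ s, D^[n] (f b) := by
  induction n with
  | zero => rfl
  | succ n ih => simp only [Function.iterate_succ_apply', ih, map_sum]

theorem iterate_derivation_smul {A : Type} [CommRing A] [Algebra ℂ A] (D : Derivation ℂ A A)
    (n : ℕ) (c : ℂ) (a : A) : D^[n] (c • a) = c • D^[n] a := by
  induction n with
  | zero => rfl
  | succ n ih => simp only [Function.iterate_succ_apply', ih, Derivation.map_smul]

theorem iterate_derivation_add {A : Type} [CommRing A] [Algebra ℂ A] (D : Derivation ℂ A A)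
    (n : ℕ) (a b : A) : D^[n] (a + b) = D^[n] a + D^[n] b := by
  induction n with
  | zero => rfl
  | succ n ih => simp only [Function.iterate_succ_apply', ih, map_add]

/-- The expansion of `(-1 + 1)^(n+1) = 0` divided by `(n+1)!`, with the term of exponent zero moved
to the other side. -/
theorem sum_antidiagonal_alternating (n : ℕ) :
    ∑ kl ∈ Finset.HasAntidiagonal.antidiagonal n,
      (-1 : ℂ) ^ (kl.1 + 1) / ((kl.1 + 1).factorial * kl.2.factorial) =
      -(1 / (n + 1).factorial) := by
  have h1 : ∑ kl ∈ Finset.HasAntidiagonal.antidiagonal (n + 1),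
      (-1 : ℂ) ^ kl.1 / (kl.1.factorial * kl.2.factorial) = 0 := by
    have h2 := Commute.add_pow' (Commute.all (-1 : ℂ) 1) (n + 1)
    rw [neg_add_cancel, zero_pow (Nat.succ_ne_zero n)] at h2
    have h3 : ∀ kl ∈ Finset.HasAntidiagonal.antidiagonal (n + 1),
        (-1 : ℂ) ^ kl.1 / (kl.1.factorial * kl.2.factorial) =
        ((n + 1).choose kl.1 • ((-1 : ℂ) ^ kl.1 * 1 ^ kl.2)) / (n + 1).factorial := by
      rintro ⟨k, m⟩ hk
      rw [Finset.HasAntidiagonal.mem_antidiagonal] at hk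
      simp only at hk ⊢
      rw [← hk, nsmul_eq_mul, Nat.choose_symm_add, Nat.add_choose, Nat.cast_div (Nat.factorial_mul_factorial_dvd_factorial_add k m)
        (by exact_mod_cast (mul_pos k.factorial_pos m.factorial_pos).ne')]
      have := Nat.factorial_ne_zero (k + m)
      have := Nat.factorial_ne_zero k
      have := Nat.factorial_ne_zero m
      push_cast
      field_simp
      simp
    rw [Finset.sum_congr rfl h3, ← Finset.sum_div, ← h2, zero_div]
  rw [Finset.Nat.sum_antidiagonal_succ] at h1
  simp only [pow_zero, Nat.factorial_zero, Nat.cast_one, one_mul] at h1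
  linear_combination h1

end series

namespace PData

variable {ι H : Type} [NormedAddCommGroup H] [NormedSpace ℂ H] (D : PData ι H) (g : Gen ι)

/-- The terms of the Lie series. -/
def lieTerm (s : ℝ) (p : VPoly ι) (t : ℝ) (u : H) (k : ℕ) : ℂ :=
  (s : ℂ) ^ k / k.factorial * MvPolynomial.eval (D.xval t u) ((D.lie g)^[k] p)

/-- The terms of the primitive of the Lie series. -/
def primTerm (s : ℝ) (p : VPoly ι) (t : ℝ) (u : H) (k : ℕ) : ℂ :=
  (s : ℂ) ^ (k + 1) / (k + 1).factorial * MvPolynomial.eval (D.xval t u) ((D.lie g)^[k] p)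

/-- The primitive of the Lie series of `p`. -/
def prim (s : ℝ) (p : VPoly ι) (t : ℝ) (u : H) : ℂ := ∑' k, D.primTerm g s p t u k

/-- The polynomials `-i ∂_{\bar b} χ`. -/
def _root_.NLSNormalForm.Gen.velo (b : ι) : VPoly ι := (-Complex.I) • MvPolynomial.pderiv (.a b) g.χ

/-- The component of the flow of `χ` in the space `H`. -/
def flowU (s t : ℝ) (u : H) : H := u + ∑ b ∈ g.S, D.prim g s (g.velo b) t u • D.r b

variable {D g}

theorem isHom_velo (b : ι) : IsHom 1 1 (g.M + 1) (g.velo b) := by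
  have hχ : IsHom 2 0 (g.M + 1 + 1) g.χ := g.hom
  convert! (hχ.pderiv_a b).smul (-Complex.I) using 1

theorem velo_mem (b : ι) : g.velo b ∈ VSupp g.S :=
  (VSupp g.S).smul_mem (pderiv_mem_supported _ g.supp) _

theorem norm_lieTerm_le {j q : ℤ} {d : ℕ} {p : VPoly ι} (hp : IsHom j q d p) {s : ℝ} (hs : |s| ≤ 2)
    (t : ℝ) {u : H} {ρ : ℝ} (hu : ‖u‖ ≤ ρ) (h : ρ ≤ D.lieRad g) (k : ℕ) :
    ‖D.lieTerm g s p t u k‖ ≤ (1 / 4) ^ k * (wnorm (wB D.B) p * (2 * ρ) ^ d) := by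
  have h1 := D.norm_eval_lie_iterate_le g hp k t hu h
  have h2 : ‖(s : ℂ) ^ k / k.factorial‖ ≤ 2 ^ k / k.factorial := by
    rw [norm_div, norm_pow, Complex.norm_real, Complex.norm_natCast]
    gcongr
    exact hs
  have hk : (0 : ℝ) < k.factorial := by positivity
  rw [lieTerm, norm_mul]
  calc _ ≤ 2 ^ k / (k.factorial : ℝ) * (k.factorial * ((1 / 8) ^ k * (wnorm (wB D.B) p * (2 * ρ) ^ d))) := mul_le_mul h2 h1 (norm_nonneg _) (by positivity)
    _ = (2 ^ k * (1 / 8) ^ k) * (wnorm (wB D.B) p * (2 * ρ) ^ d) := by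
        generalize (1 / 8 : ℝ) ^ k = a
        field_simp
    _ = _ := by rw [← mul_pow]; norm_num

theorem norm_primTerm_le {j q : ℤ} {d : ℕ} {p : VPoly ι} (hp : IsHom j q d p) {s : ℝ} (hs : |s| ≤ 2)
    (t : ℝ) {u : H} {ρ : ℝ} (hu : ‖u‖ ≤ ρ) (h : ρ ≤ D.lieRad g) (k : ℕ) :
    ‖D.primTerm g s p t u k‖ ≤ (1 / 4) ^ k * (2 * (wnorm (wB D.B) p * (2 * ρ) ^ d)) := by
  have h1 := norm_lieTerm_le hp hs t hu h k
  have h2 : D.primTerm g s p t u k = s / (k + 1) * D.lieTerm g s p t u k := by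
    rw [primTerm, lieTerm, Nat.factorial_succ]
    have := Nat.factorial_ne_zero k
    have : (k + 1 : ℂ) ≠ 0 := by exact_mod_cast Nat.succ_ne_zero k
    push_cast
    field_simp
    ring
  have h3 : ‖(s : ℂ) / (k + 1)‖ ≤ 2 := by
    rw [norm_div, Complex.norm_real]
    have : ‖(k + 1 : ℂ)‖ = k + 1 := by
      rw [← Nat.cast_succ, Complex.norm_natCast, Nat.cast_succ]
    rw [this]
    exact (div_le_self (norm_nonneg _) (by simp)).trans hs
  rw [h2, norm_mul]
  calc _ ≤ 2 * _ := mul_le_mul h3 h1 (norm_nonneg _) zero_le_two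
    _ = _ := by ring

theorem summable_quarter (C : ℝ) : Summable fun k : ℕ => (1 / 4 : ℝ) ^ k * C :=
  (summable_geometric_of_lt_one (by norm_num) (by norm_num)).mul_right C

theorem summable_norm_lieTerm {j q : ℤ} {d : ℕ} {p : VPoly ι} (hp : IsHom j q d p) {s : ℝ}
    (hs : |s| ≤ 2) (t : ℝ) {u : H} (h : ‖u‖ ≤ D.lieRad g) :
    Summable fun k => ‖D.lieTerm g s p t u k‖ :=
  Summable.of_nonneg_of_le (fun _ => norm_nonneg _) (fun k => norm_lieTerm_le hp hs t le_rfl h k)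
    (summable_quarter _)

theorem summable_norm_primTerm {j q : ℤ} {d : ℕ} {p : VPoly ι} (hp : IsHom j q d p) {s : ℝ}
    (hs : |s| ≤ 2) (t : ℝ) {u : H} (h : ‖u‖ ≤ D.lieRad g) :
    Summable fun k => ‖D.primTerm g s p t u k‖ :=
  Summable.of_nonneg_of_le (fun _ => norm_nonneg _) (fun k => norm_primTerm_le hp hs t le_rfl h k)
    (summable_quarter _)

theorem norm_prim_le {j q : ℤ} {d : ℕ} {p : VPoly ι} (hp : IsHom j q d p) {s : ℝ}
    (hs : |s| ≤ 2) (t : ℝ) {u : H} (h : ‖u‖ ≤ D.lieRad g) :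
    ‖D.prim g s p t u‖ ≤ 4 * wnorm (wB D.B) p * (2 * ‖u‖) ^ d := by
  have h0 := wnorm_nonneg D.wB_pos p
  refine (norm_tsum_le_tsum_norm (summable_norm_primTerm hp hs t h)).trans ?_
  refine ((summable_norm_primTerm hp hs t h).tsum_le_tsum
    (fun k => norm_primTerm_le hp hs t le_rfl h k) (summable_quarter _)).trans ?_
  rw [tsum_mul_right, tsum_geometric_of_lt_one (by norm_num) (by norm_num)]
  have : 0 ≤ wnorm (wB D.B) p * (2 * ‖u‖) ^ d := by positivity
  norm_num
  linarith

theorem prim_zero (p : VPoly ι) (t : ℝ) (u : H) : D.prim g 0 p t u = 0 := by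
  simp [prim, primTerm]

theorem flowU_zero (t : ℝ) (u : H) : D.flowU g 0 t u = u := by simp [flowU, prim_zero]

theorem lieTerm_add (s : ℝ) (p q : VPoly ι) (t : ℝ) (u : H) (k : ℕ) :
    D.lieTerm g s (p + q) t u k = D.lieTerm g s p t u k + D.lieTerm g s q t u k := by
  simp only [lieTerm, iterate_derivation_add, map_add, mul_add]

theorem lieTerm_mul (s : ℝ) (p q : VPoly ι) (t : ℝ) (u : H) (k : ℕ) :
    D.lieTerm g s (p * q) t u k = ∑ ij ∈ Finset.HasAntidiagonal.antidiagonal k,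
      D.lieTerm g s p t u ij.1 * D.lieTerm g s q t u ij.2 := by
  rw [lieTerm, iterate_derivation_mul, map_sum, Finset.mul_sum]
  refine Finset.sum_congr rfl ?_
  rintro ⟨i, j⟩ hij
  rw [Finset.HasAntidiagonal.mem_antidiagonal] at hij
  simp only at hij ⊢
  subst hij
  rw [nsmul_eq_mul, map_mul, map_mul, map_natCast, Nat.choose_symm_add, Nat.add_choose,
    Nat.cast_div (Nat.factorial_mul_factorial_dvd_factorial_add i j)
      (by exact_mod_cast (mul_pos i.factorial_pos j.factorial_pos).ne')]
  have := Nat.factorial_ne_zero (i + j)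
  have := Nat.factorial_ne_zero i
  have := Nat.factorial_ne_zero j
  simp only [lieTerm]
  push_cast
  field_simp
  ring

theorem conj_lieTerm (s : ℝ) (p : VPoly ι) (t : ℝ) (u : H) (k : ℕ) :
    conj (D.lieTerm g s p t u k) = D.lieTerm g s (starP p) t u k := by
  rw [lieTerm, lieTerm, ← starP_lie_iterate, eval_starP (D.xval_swap t u)]
  simp

theorem lie_time (D : PData ι H) (g : Gen ι) (j : Var ι) (hj : j = .e ∨ j = .e' ∨ j = .o) :
    D.lie g (MvPolynomial.X j) = 0 := by
  rcases hj with rfl | rfl | rfl <;> simp [lie, MvPolynomial.mkDerivation_X]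

theorem lieTerm_time {j : Var ι} (hj : D.lie g (MvPolynomial.X j) = 0) (s t : ℝ) (u : H) :
    HasSum (fun k => D.lieTerm g s (MvPolynomial.X j) t u k) (D.xval t u j) := by
  have h1 : ∀ k, k ≠ 0 → D.lieTerm g s (MvPolynomial.X j) t u k = 0 := by
    rintro (_ | k) hk
    · exact absurd rfl hk
    · have : (D.lie g)^[k] 0 = 0 := by
        induction k with
        | zero => rfl
        | succ k ih => rw [Function.iterate_succ_apply, map_zero, ih (Nat.succ_ne_zero k)]
      rw [lieTerm, Function.iterate_succ_apply, hj, this, map_zero, mul_zero]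
  convert hasSum_single 0 h1
  simp [lieTerm]

/-- The bracket of `ℓ v` with `χ` is a combination of the polynomials `velo b` with constant
coefficients `ℓ v (r b)`. Shifting the index by one therefore turns its Lie series into the
primitives that enter `flowU`: the flow is defined so that this holds. -/
theorem hasSum_lieTerm_h (v : ι) {s : ℝ} (hs : |s| ≤ 2) (t : ℝ) {u : H} (h : ‖u‖ ≤ D.lieRad g) :
    HasSum (fun k => D.lieTerm g s (MvPolynomial.X (.h v)) t u k)
      (D.ℓ v (D.flowU g s t u)) := by
  rw [hasSum_nat_add_iff' 1 |>.symm]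
  have h1 : ∀ k, D.lieTerm g s (MvPolynomial.X (.h v)) t u (k + 1) =
      ∑ b ∈ g.S, D.primTerm g s (g.velo b) t u k * D.ℓ v (D.r b) := by
    intro k
    have : D.lie g (MvPolynomial.X (.h v)) = ∑ b ∈ g.S, D.ℓ v (D.r b) • g.velo b := by
      rw [lie_h]
      refine Finset.sum_congr rfl fun b _ => ?_
      rw [Gen.velo, smul_smul, MvPolynomial.smul_eq_C_mul, mul_comm (-Complex.I)]
    rw [lieTerm, Function.iterate_succ_apply, this, iterate_derivation_sum, map_sum, Finset.mul_sum]
    refine Finset.sum_congr rfl fun b _ => ?_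
    rw [iterate_derivation_smul, primTerm, MvPolynomial.smul_eval]
    ring
  simp only [h1]
  have h2 : D.ℓ v (D.flowU g s t u) - ∑ i ∈ Finset.range 1,
      D.lieTerm g s (MvPolynomial.X (.h v)) t u i =
      ∑ b ∈ g.S, D.prim g s (g.velo b) t u * D.ℓ v (D.r b) := by
    simp [flowU, lieTerm, xval]
  rw [h2]
  exact hasSum_sum fun b _ => (summable_norm_primTerm (isHom_velo b) hs t h).of_norm.hasSum.mul_right _

theorem isHom_X_h (v : ι) : IsHom 1 1 1 (MvPolynomial.X (.h v) : VPoly ι) :=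
  MvPolynomial.isWeightedHomogeneous_X _ _ _

theorem isHom_X_a (v : ι) : IsHom 1 (-1) 1 (MvPolynomial.X (.a v) : VPoly ι) :=
  MvPolynomial.isWeightedHomogeneous_X _ _ _

/-- The Lie series is the composition with the flow. -/
theorem lieTerm_summable_tsum {s : ℝ} (hs : |s| ≤ 2) (t : ℝ) {u : H} (h : ‖u‖ ≤ D.lieRad g)
    (p : VPoly ι) : (Summable fun k => ‖D.lieTerm g s p t u k‖) ∧
      ∑' k, D.lieTerm g s p t u k = MvPolynomial.eval (D.xval t (D.flowU g s t u)) p := by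
  induction p using MvPolynomial.induction_on with
  | C c =>
    have h1 : ∀ k, k ≠ 0 → D.lieTerm g s (MvPolynomial.C c) t u k = 0 := by
      rintro (_ | k) hk
      · exact absurd rfl hk
      · have : (D.lie g)^[k + 1] (MvPolynomial.C c) = 0 := by
          induction k with
          | zero => exact Derivation.map_algebraMap _ _
          | succ k ih => rw [Function.iterate_succ_apply', ih (Nat.succ_ne_zero k), map_zero]
        rw [lieTerm, this, map_zero, mul_zero]
    constructor
    · refine (hasSum_single 0 fun k hk => ?_).summable
      rw [h1 k hk, norm_zero]
    · rw [tsum_eq_single 0 h1]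
      simp [lieTerm]
  | add p q hp hq =>
    simp only [lieTerm_add, map_add]
    refine ⟨Summable.of_nonneg_of_le (fun _ => norm_nonneg _) (fun _ => norm_add_le _ _)
      (hp.1.add hq.1), ?_⟩
    rw [hp.1.of_norm.tsum_add hq.1.of_norm, hp.2, hq.2]
  -- The exponential of a derivation is multiplicative, by Leibniz and the Cauchy product of
  -- absolutely convergent series, so it is enough to treat a single variable.
  | mul_X p j hp =>
    have hj : (Summable fun k => ‖D.lieTerm g s (MvPolynomial.X j) t u k‖) ∧
        ∑' k, D.lieTerm g s (MvPolynomial.X j) t u k = D.xval t (D.flowU g s t u) j := by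
      cases j
      case h v =>
        exact ⟨summable_norm_lieTerm (isHom_X_h v) hs t h, (hasSum_lieTerm_h v hs t h).tsum_eq⟩
      case a v =>
        refine ⟨summable_norm_lieTerm (isHom_X_a v) hs t h, HasSum.tsum_eq ?_⟩
        have h1 := (hasSum_lieTerm_h (D := D) (g := g) v hs t h).map (starRingEnd ℂ)
          Complex.continuous_conj
        have h2 : (starRingEnd ℂ ∘ fun k => D.lieTerm g s (MvPolynomial.X (.h v)) t u k) =
            fun k => D.lieTerm g s (MvPolynomial.X (.a v)) t u k := by
          funext k
          simp [conj_lieTerm, Var.swap]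
        rwa [h2] at h1
      all_goals
        refine (fun h1 => ⟨h1.summable.norm, h1.tsum_eq⟩)
          (lieTerm_time (lie_time D g _ (by tauto)) s t u)
    simp only [lieTerm_mul, map_mul, MvPolynomial.eval_X]
    refine ⟨summable_norm_sum_mul_antidiagonal_of_summable_norm hp.1 hj.1, ?_⟩
    rw [← tsum_mul_tsum_eq_tsum_sum_antidiagonal_of_summable_norm hp.1 hj.1, hp.2, hj.2]

theorem hasSum_lieTerm {s : ℝ} (hs : |s| ≤ 2) (t : ℝ) {u : H} (h : ‖u‖ ≤ D.lieRad g)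
    (p : VPoly ι) : HasSum (fun k => D.lieTerm g s p t u k)
      (MvPolynomial.eval (D.xval t (D.flowU g s t u)) p) := by
  rw [← (lieTerm_summable_tsum hs t h p).2]
  exact (lieTerm_summable_tsum hs t h p).1.of_norm.hasSum

/-- The group property of the flow. -/
theorem prim_neg_flowU {j q : ℤ} {d : ℕ} {p : VPoly ι} (hp : IsHom j q d p) {s : ℝ}
    (hs : |s| ≤ 1) (t : ℝ) {u : H} (h : ‖u‖ ≤ D.lieRad g) :
    D.prim g (-s) p t (D.flowU g s t u) = -D.prim g s p t u := by
  have hs2 : |s| ≤ 2 := hs.trans one_le_two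
  set E : ℕ → ℂ := fun n => MvPolynomial.eval (D.xval t u) ((D.lie g)^[n] p) with hE
  set C : ℝ := wnorm (wB D.B) p * (2 * ‖u‖) ^ d
  have hC : 0 ≤ C := mul_nonneg (wnorm_nonneg D.wB_pos p) (by positivity)
  have hEb : ∀ n, ‖E n‖ ≤ n.factorial * ((1 / 8) ^ n * C) := fun n =>
    D.norm_eval_lie_iterate_le g hp n t le_rfl h
  -- The bracket of order `k` at the displaced point is itself a Lie series at `u`. The whole
  -- becomes a double series in which the `n`-th antidiagonal has the common factor `E n` and the
  -- coefficient of `sum_antidiagonal_alternating`.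
  set f : ℕ × ℕ → ℂ := fun km => (-s : ℂ) ^ (km.1 + 1) / (km.1 + 1).factorial *
    ((s : ℂ) ^ km.2 / km.2.factorial * E (km.2 + km.1)) with hf
  have h1 : ∀ k, D.primTerm g (-s) p t (D.flowU g s t u) k = ∑' m, f (k, m) := by
    intro k
    rw [primTerm, ← (lieTerm_summable_tsum hs2 t h _).2, ← tsum_mul_left]
    refine tsum_congr fun m => ?_
    simp only [lieTerm, hf, hE, ← Function.iterate_add_apply]
    push_cast
    rfl
  have hfs : Summable fun x => ‖f x‖ := by
    refine Summable.of_nonneg_of_le (fun _ => norm_nonneg _) (fun x => ?_)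
      (((summable_quarter C).mul_of_nonneg (summable_quarter 1) (fun k => by simp only [Pi.zero_apply]; positivity)
        (fun k => by simp only [Pi.zero_apply]; positivity)))
    obtain ⟨k, m⟩ := x
    simp only [hf, norm_mul, norm_div, norm_pow, norm_neg, Complex.norm_real, Complex.norm_natCast,
      Real.norm_eq_abs]
    have ha : |s| ^ (k + 1) / (k + 1).factorial ≤ 1 / k.factorial := by
      gcongr
      · exact pow_le_one₀ (abs_nonneg s) hs
      · omega
    have hb : |s| ^ m / m.factorial ≤ 1 / m.factorial := by
      gcongr
      exact pow_le_one₀ (abs_nonneg s) hs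
    -- The bound for `E` carries `(m + k)!`, while the two series only divide by about `k! m!`; the
    -- quotient is a binomial coefficient.
    have hc : ((m + k).factorial : ℝ) ≤ 2 ^ (m + k) * (k.factorial * m.factorial) := by
      have := Nat.choose_mul_factorial_mul_factorial (Nat.le_add_left k m)
      have h3 := Nat.choose_le_two_pow (m + k) k
      rw [← this]
      push_cast
      rw [Nat.add_sub_cancel, mul_assoc]
      gcongr
      exact_mod_cast h3
    calc _ ≤ 1 / (k.factorial : ℝ) * (1 / m.factorial *
          (2 ^ (m + k) * (k.factorial * m.factorial) * ((1 / 8) ^ (m + k) * C))) := by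
          gcongr
          exact (hEb _).trans (by gcongr)
      _ = (2 * (1 / 8)) ^ (m + k) * C := by
          have := Nat.factorial_ne_zero k
          have := Nat.factorial_ne_zero m
          rw [mul_pow]
          field_simp
      _ = _ := by rw [pow_add]; norm_num; ring
  rw [prim, prim, tsum_congr h1, tsum_tsum_eq_tsum_antidiagonal hfs, ← tsum_neg]
  refine tsum_congr fun n => ?_
  have h2 : ∀ kl ∈ Finset.HasAntidiagonal.antidiagonal n, f kl = (-1 : ℂ) ^ (kl.1 + 1) /
      ((kl.1 + 1).factorial * kl.2.factorial) * ((s : ℂ) ^ (n + 1) * E n) := by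
    rintro ⟨k, m⟩ hk
    rw [Finset.HasAntidiagonal.mem_antidiagonal] at hk
    simp only at hk
    have : m + k = n := by omega
    simp only [hf]
    rw [this, neg_pow, ← hk]
    have := Nat.factorial_ne_zero (k + 1)
    have := Nat.factorial_ne_zero m
    field_simp
    ring
  rw [Finset.sum_congr rfl h2, ← Finset.sum_mul, sum_antidiagonal_alternating, primTerm]
  ring

/-- Reversing time inverts the flow by an identity of series, without uniqueness for differential
equations. No bound is asked of the displaced point, since the series there are summed as double
series at `u`. -/
theorem flowU_neg_flowU {s : ℝ} (hs : |s| ≤ 1) (t : ℝ) {u : H} (h : ‖u‖ ≤ D.lieRad g) :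
    D.flowU g (-s) t (D.flowU g s t u) = u := by
  conv_lhs => rw [flowU]
  rw [Finset.sum_congr rfl fun b _ => by rw [prim_neg_flowU (isHom_velo b) hs t h, neg_smul],
    Finset.sum_neg_distrib, flowU]
  abel

end PData

end NLSNormalForm

end


/-! ### Smoothness of the flow and Hamilton's equations -/

noncomputable section

namespace NLSNormalForm

theorem wnorm_rename {J J' : Type} {f : J → J'} (hf : Function.Injective f) (B : J' → ℝ)
    (p : MvPolynomial J ℂ) : wnorm B (MvPolynomial.rename f p) = wnorm (B ∘ f) p := by
  classical
  rw [wnorm, MvPolynomial.support_rename_of_injective hf, Finset.sum_image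
    fun _ _ _ _ h => Finsupp.mapDomain_injective hf h]
  refine Finset.sum_congr rfl fun κ _ => ?_
  rw [MvPolynomial.coeff_rename_mapDomain _ hf, Finsupp.prod_mapDomain_index_inj hf]
  rfl

theorem mkDerivation_eq_sum {J : Type} {T : Finset J} (f : J → MvPolynomial J ℂ)
    {p : MvPolynomial J ℂ} (hp : p ∈ MvPolynomial.supported ℂ (T : Set J)) :
    MvPolynomial.mkDerivation ℂ f p = ∑ j ∈ T, MvPolynomial.pderiv j p * f j := by
  classical
  rw [MvPolynomial.supported] at hp
  induction hp using Algebra.adjoin_induction with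
  | mem x hx =>
    obtain ⟨i, hi, rfl⟩ := hx
    rw [MvPolynomial.mkDerivation_X, Finset.sum_eq_single_of_mem i hi]
    · simp
    · intro j _ hj
      rw [MvPolynomial.pderiv_X_of_ne hj.symm, zero_mul]
  | algebraMap c => simp
  | add x y _ _ hx hy => simp only [map_add, hx, hy, add_mul, Finset.sum_add_distrib]
  | mul x y _ _ hx hy =>
    simp only [Derivation.leibniz, hx, hy, smul_eq_mul, Finset.mul_sum, ← Finset.sum_add_distrib]
    exact Finset.sum_congr rfl fun _ _ => by ring

/-- The variables of `Var.overS S`, as a finite set. -/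
def Var.fin {ι : Type} (S : Finset ι) : Finset (Var ι) := (Var.overS_finite S).toFinset

theorem Var.coe_fin {ι : Type} (S : Finset ι) : (Var.fin S : Set (Var ι)) = Var.overS S := by
  simp [Var.fin]

theorem Var.sum_fin {ι M : Type} [AddCommMonoid M] (S : Finset ι) (F : Var ι → M) :
    ∑ j ∈ Var.fin S, F j =
      F .e + F .e' + F .o + ∑ v ∈ S, F (.h v) + ∑ v ∈ S, F (.a v) := by
  classical
  have h1 : Var.fin S = (({.e, .e', .o} : Finset (Var ι)) ∪ S.image .h) ∪ S.image .a := by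
    ext j
    rw [← Finset.mem_coe, Var.coe_fin]
    simp [Var.overS, or_assoc]
  rw [h1, Finset.sum_union, Finset.sum_union, Finset.sum_image (fun _ _ _ _ h => by injection h),
    Finset.sum_image (fun _ _ _ _ h => by injection h), Finset.sum_insert (by simp),
    Finset.sum_insert (by simp), Finset.sum_singleton]
  · simp only [add_assoc]
  · rw [Finset.disjoint_left]
    simp
  · rw [Finset.disjoint_left]
    simp only [Finset.mem_union, Finset.mem_insert, Finset.mem_singleton, Finset.mem_image]
    rintro _ ((rfl | rfl | rfl) | ⟨x, _, rfl⟩) ⟨y, _, hy⟩ <;> injection hy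

/-- The derivation that corresponds to `∂ / ∂t`. -/
def dT (ι : Type) : Derivation ℂ (VPoly ι) (VPoly ι) :=
  MvPolynomial.mkDerivation ℂ fun j => match j with
    | .e => MvPolynomial.C Complex.I * MvPolynomial.X .e
    | .e' => MvPolynomial.C (-Complex.I) * MvPolynomial.X .e'
    | _ => 0

theorem isHom_dT {ι : Type} {j q : ℤ} {d : ℕ} {p : VPoly ι} (hp : IsHom j q d p) :
    IsHom j q d (dT ι p) := by
  have := isWeightedHomogeneous_mkDerivation (w := Var.wt) (δ := ((0, 0, 0) : ℤ × ℤ × ℕ))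
    (f := fun j : Var ι => match j with
    | .e => MvPolynomial.C Complex.I * MvPolynomial.X .e
    | .e' => MvPolynomial.C (-Complex.I) * MvPolynomial.X .e'
    | _ => 0) (fun j => ?_) hp
  · simpa [dT] using this
  · have h0 : Var.wt j + (0, 0, 0) = Var.wt j := add_zero _
    rw [h0]
    cases j
    case e => exact MvPolynomial.IsWeightedHomogeneous.C_mul (MvPolynomial.isWeightedHomogeneous_X _ _ _) _
    case e' => exact MvPolynomial.IsWeightedHomogeneous.C_mul (MvPolynomial.isWeightedHomogeneous_X _ _ _) _
    all_goals exact MvPolynomial.isWeightedHomogeneous_zero _ _ _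

theorem dT_mem_VSupp {ι : Type} {S : Finset ι} {p : VPoly ι} (hp : p ∈ VSupp S) :
    dT ι p ∈ VSupp S := by
  refine mkDerivation_mem_supported (fun j => ?_) hp
  cases j
  case e => exact mul_mem ((VSupp S).algebraMap_mem _) (MvPolynomial.X_mem_supported.mpr (by simp))
  case e' => exact mul_mem ((VSupp S).algebraMap_mem _) (MvPolynomial.X_mem_supported.mpr (by simp))
  all_goals exact zero_mem _

theorem starP_dT {ι : Type} (p : VPoly ι) : starP (dT ι p) = dT ι (starP p) := by
  induction p using MvPolynomial.induction_on with
  | C c =>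
    rw [starP_C, ← MvPolynomial.algebraMap_eq]
    simp
  | add p q hp hq => rw [map_add, map_add, map_add, map_add, hp, hq]
  | mul_X p j hp =>
    have hj : starP (dT ι (MvPolynomial.X j)) = dT ι (MvPolynomial.X j.swap) := by
      cases j <;> simp [dT, Var.swap, MvPolynomial.mkDerivation_X]
    rw [Derivation.leibniz, map_add, map_mul, starP_X, Derivation.leibniz]
    simp only [smul_eq_mul, map_mul, hp, hj, starP_X]

namespace PData

variable {ι H : Type} [NormedAddCommGroup H] [NormedSpace ℂ H] {D : PData ι H} {g : Gen ι}

theorem contDiff_xval (j : Var ι) :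
    ContDiff ℝ ∞ fun q : ℝ × ℝ × H => D.xval q.2.1 q.2.2 j := by
  have hl (v : ι) : ContDiff ℝ ∞ fun q : ℝ × ℝ × H => D.ℓ v q.2.2 :=
    ((D.ℓ v).restrictScalars ℝ).contDiff.comp (contDiff_snd.comp contDiff_snd)
  cases j
  case e => exact (contDiff_osc 1).comp (contDiff_fst.comp contDiff_snd)
  case e' => exact (contDiff_osc (-1)).comp (contDiff_fst.comp contDiff_snd)
  case o => exact contDiff_const
  case h v => exact hl v
  case a v => exact Complex.conjCLE.contDiff.comp (hl v)

/-- The open set on which the flow is smooth. -/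
def flowDom (D : PData ι H) (g : Gen ι) : Set (ℝ × ℝ × ℝ × H) :=
  {q | |q.1| < 2 ∧ ‖q.2.2.2‖ < D.lieRad g}

theorem isOpen_flowDom : IsOpen (D.flowDom g) := by
  have h1 : Continuous fun q : ℝ × ℝ × ℝ × H => |q.1| := by fun_prop
  have h2 : Continuous fun q : ℝ × ℝ × ℝ × H => ‖q.2.2.2‖ := by fun_prop
  exact (isOpen_lt h1 continuous_const).inter (isOpen_lt h2 continuous_const)

/-- The flow time is adjoined as one more variable, `none`, so that joint smoothness in all
arguments is smoothness of a single series of polynomials. -/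
theorem contDiffOn_prim {S : Finset ι} (hS : g.S ⊆ S) {j q : ℤ} {d : ℕ} {p : VPoly ι}
    (hp : IsHom j q d p) (hpS : p ∈ VSupp S) :
    ContDiffOn ℝ ∞ (fun q : ℝ × ℝ × ℝ × H => D.prim g q.1 p q.2.2.1 q.2.2.2) (D.flowDom g) := by
  classical
  rw [contDiffOn_infty]
  intro n
  let x : ℝ × ℝ × ℝ × H → Option (Var ι) → ℂ := fun q j => match j with
    | none => q.1
    | some j => D.xval q.2.2.1 q.2.2.2 j
  let B : Option (Var ι) → ℝ := fun j => match j with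
    | none => 2
    | some j => wB (fun v => D.B v * D.lieRad g) j
  let P : ℕ → MvPolynomial (Option (Var ι)) ℂ := fun k =>
    MvPolynomial.C (1 / (k + 1).factorial : ℂ) * (MvPolynomial.monomial (Finsupp.single none (k + 1)) 1
      * MvPolynomial.rename some ((D.lie g)^[k] p))
  have hpos := D.lieRad_pos g
  have hB : ∀ j, 0 ≤ B j := by
    rintro (_ | j)
    · exact zero_le_two
    · exact D.wB_nonneg' hpos.le j
  have := contDiffOn_tsum_eval (x := x) (S := insert none ((Var.fin S).image some)) n
    (isOpen_flowDom (D := D) (g := g)) (fun j _ => ?_) (B := B) hB (fun q hq j _ => ?_) (p := P)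
    (fun k => ?_) ?_
  · refine this.congr fun q _ => tsum_congr fun k => ?_
    simp only [P, map_mul, MvPolynomial.eval_C, MvPolynomial.eval_monomial,
      MvPolynomial.eval_rename, primTerm, one_mul]
    rw [Finsupp.prod_single_index (by simp), ← mul_assoc, one_div_mul_eq_div]
    rfl
  · cases j with
    | none => exact (Complex.ofRealCLM.contDiff.comp contDiff_fst).contDiffOn
    | some j => exact ((contDiff_xval j).comp contDiff_snd).contDiffOn
  · cases j with
    | none => simpa [x, B] using hq.1
    | some j =>
      have h1 (v : ι) : ‖D.ℓ v q.2.2.2‖ < D.B v * D.lieRad g :=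
        (D.norm_ℓ v _).trans_lt (mul_lt_mul_of_pos_left hq.2
          (zero_lt_one.trans_le (D.one_le v)))
      cases j <;> simp [x, B, xval, wB, norm_osc] <;> exact h1 _
  · have h1 := D.lie_iterate_mem_VSupp g hS hpS k
    refine mul_mem (Subalgebra.algebraMap_mem _ _) (mul_mem ?_ ?_)
    · rw [← MvPolynomial.X_pow_eq_monomial]
      exact pow_mem (MvPolynomial.X_mem_supported.mpr (by simp)) _
    · rw [MvPolynomial.mem_supported]
      intro j hj
      have h2 := MvPolynomial.vars_rename _ _ hj
      obtain ⟨i, hi, rfl⟩ := Finset.mem_image.mp h2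
      have h3 := MvPolynomial.mem_supported.mp h1 hi
      rw [← Var.coe_fin] at h3
      simp [Finset.mem_coe.mp h3]
  · refine Summable.of_nonneg_of_le (fun k => wnorm_nonneg hB _) (fun k => ?_)
      (summable_quarter (2 * (wnorm (wB D.B) p * (2 * D.lieRad g) ^ d)))
    have h2 := D.wnorm_scale_lie_iterate_le g hp k hpos.le le_rfl
    have h3 : wnorm B (MvPolynomial.rename some ((D.lie g)^[k] p)) =
        wnorm (wB fun v => D.B v * D.lieRad g) ((D.lie g)^[k] p) :=
      wnorm_rename (Option.some_injective _) _ _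
    rw [wnorm_C_mul]
    refine (mul_le_mul_of_nonneg_left (wnorm_monomial_mul_le hB _ _ _) (norm_nonneg _)).trans ?_
    rw [h3, Finsupp.prod_single_index (by simp), norm_one, one_mul, norm_div, norm_one,
      Complex.norm_natCast]
    have h0 := wnorm_nonneg (J := Var ι) D.wB_pos p
    have hk : (k.factorial : ℝ) / (k + 1).factorial ≤ 1 := by
      rw [div_le_one (by positivity)]
      exact_mod_cast Nat.factorial_le (Nat.le_succ k)
    calc _ ≤ 1 / ((k + 1).factorial : ℝ) * (2 ^ (k + 1) *
          (k.factorial * ((1 / 8) ^ k * (wnorm (wB D.B) p * (2 * D.lieRad g) ^ d)))) := by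
          gcongr
      _ = (k.factorial : ℝ) / (k + 1).factorial * ((2 ^ k * (1 / 8) ^ k) *
          (2 * (wnorm (wB D.B) p * (2 * D.lieRad g) ^ d))) := by rw [pow_succ]; ring
      _ ≤ 1 * ((2 ^ k * (1 / 8) ^ k) * (2 * (wnorm (wB D.B) p * (2 * D.lieRad g) ^ d))) := by
          gcongr
      _ = _ := by rw [← mul_pow]; norm_num

/-- Differentiating the primitive term by term gives back the Lie series, whose sum is the
polynomial at the displaced point. This is the differential equation of the flow. -/
theorem hasDerivAt_prim {j q : ℤ} {d : ℕ} {p : VPoly ι} (hp : IsHom j q d p) {s : ℝ}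
    (hs : |s| < 2) (t : ℝ) {u : H} (h : ‖u‖ ≤ D.lieRad g) :
    HasDerivAt (fun s => D.prim g s p t u)
      (MvPolynomial.eval (D.xval t (D.flowU g s t u)) p) s := by
  rw [← (lieTerm_summable_tsum hs.le t h p).2]
  have hab : ∀ y ∈ Ioo (-2 : ℝ) 2, |y| ≤ 2 := fun y hy => (abs_lt.mpr hy).le
  refine hasDerivAt_tsum_of_isPreconnected (t := Ioo (-2) 2) (y₀ := s)
    (u := fun k => (1 / 4) ^ k * (wnorm (wB D.B) p * (2 * ‖u‖) ^ d)) (summable_quarter _)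
    isOpen_Ioo isPreconnected_Ioo (fun k y hy => ?_)
    (fun k y hy => norm_lieTerm_le hp (hab y hy) t le_rfl h k) (abs_lt.mp hs)
    (summable_norm_primTerm hp hs.le t h).of_norm (abs_lt.mp hs)
  have h1 : HasDerivAt (fun y : ℝ => (y : ℂ) ^ (k + 1)) ((k + 1 : ℕ) * (y : ℂ) ^ k) y := by
    simpa using (hasDerivAt_pow (k + 1) (y : ℂ)).comp_ofReal
  refine HasDerivAt.congr_deriv ((h1.div_const ((k + 1).factorial : ℂ)).mul_const
    (MvPolynomial.eval (D.xval t u) ((D.lie g)^[k] p))) ?_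
  simp only [lieTerm, Nat.factorial_succ]
  have := Nat.factorial_ne_zero k
  have : (k + 1 : ℂ) ≠ 0 := by exact_mod_cast Nat.succ_ne_zero k
  push_cast
  field_simp

/-- The flow of `χ` in the extended phase space. -/
def flow (D : PData ι H) (g : Gen ι) (s : ℝ) (p : ℝ × ℝ × H) : ℝ × ℝ × H :=
  (p.1 + (D.prim g s (dT ι g.χ) p.2.1 p.2.2).re, p.2.1, D.flowU g s p.2.1 p.2.2)

/-- The Hamiltonian vector field of `χ`. -/
def vec (D : PData ι H) (g : Gen ι) (p : ℝ × ℝ × H) : ℝ × ℝ × H :=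
  ((MvPolynomial.eval (D.xval p.2.1 p.2.2) (dT ι g.χ)).re, 0,
    ∑ b ∈ g.S, MvPolynomial.eval (D.xval p.2.1 p.2.2) (g.velo b) • D.r b)

theorem flow_zero (p : ℝ × ℝ × H) : D.flow g 0 p = p := by
  simp [flow, prim_zero, flowU_zero]

theorem flow_neg_flow {s : ℝ} (hs : |s| ≤ 1) {p : ℝ × ℝ × H} (h : ‖p.2.2‖ ≤ D.lieRad g) :
    D.flow g (-s) (D.flow g s p) = p := by
  simp only [flow]
  rw [flowU_neg_flowU hs _ h, prim_neg_flowU (isHom_dT g.hom) hs _ h]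
  simp

theorem contDiffOn_flow :
    ContDiffOn ℝ ∞ (fun q : ℝ × ℝ × ℝ × H => D.flow g q.1 q.2) (D.flowDom g) := by
  have h1 := contDiffOn_prim (D := D) (g := g) subset_rfl (isHom_dT g.hom) (dT_mem_VSupp g.supp)
  have h2 (b : ι) := contDiffOn_prim (D := D) (g := g) subset_rfl (isHom_velo b) (velo_mem b)
  refine ContDiffOn.prodMk ?_ (ContDiffOn.prodMk ?_ ?_)
  · exact (contDiff_fst.comp contDiff_snd).contDiffOn.add
      (Complex.reCLM.contDiff.comp_contDiffOn h1)
  · exact (contDiff_fst.comp (contDiff_snd.comp contDiff_snd)).contDiffOn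
  · refine ContDiffOn.add (contDiff_snd.comp (contDiff_snd.comp contDiff_snd)).contDiffOn ?_
    refine ContDiffOn.sum fun b _ => ?_
    exact ContDiffOn.fun_smul (𝕜 := ℝ) (𝕜' := ℂ) (h2 b) contDiffOn_const

theorem hasDerivAt_flow {s : ℝ} (hs : |s| < 2) {p : ℝ × ℝ × H} (h : ‖p.2.2‖ ≤ D.lieRad g) :
    HasDerivAt (fun s => D.flow g s p) (D.vec g (D.flow g s p)) s := by
  refine HasDerivAt.prodMk ?_ (HasDerivAt.prodMk (hasDerivAt_const _ _) ?_)
  · have := Complex.reCLM.hasFDerivAt.comp_hasDerivAt s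
      (hasDerivAt_prim (D := D) (g := g) (isHom_dT g.hom) hs p.2.1 h)
    exact this.const_add _
  · refine HasDerivAt.const_add _ (HasDerivAt.fun_sum fun b _ => ?_)
    exact (hasDerivAt_prim (isHom_velo b) hs p.2.1 h).smul_const _

/-- The function `χ` on the extended phase space. -/
def fnχ (D : PData ι H) (g : Gen ι) (p : ℝ × ℝ × H) : ℂ :=
  MvPolynomial.eval (D.xval p.2.1 p.2.2) g.χ

theorem contDiff_eval_xval (p : VPoly ι) :
    ContDiff ℝ ∞ fun q : ℝ × ℝ × H => MvPolynomial.eval (D.xval q.2.1 q.2.2) p := by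
  obtain ⟨S, hS⟩ := exists_mem_VSupp p
  rw [VSupp, ← Var.coe_fin] at hS
  exact contDiffOn_univ.mp (contDiffOn_eval (D := univ) (x := fun q : ℝ × ℝ × H => D.xval q.2.1 q.2.2)
    (fun j _ => (contDiff_xval j).contDiffOn) hS)

theorem contDiff_vec : ContDiff ℝ ∞ (D.vec g) := by
  refine ContDiff.prodMk (Complex.reCLM.contDiff.comp (contDiff_eval_xval _))
    (ContDiff.prodMk contDiff_const (ContDiff.sum fun b _ => ?_))
  exact ContDiff.fun_smul (𝕜 := ℝ) (𝕜' := ℂ) (contDiff_eval_xval _) contDiff_const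

theorem im_eval_dT (t : ℝ) (u : H) : (MvPolynomial.eval (D.xval t u) (dT ι g.χ)).im = 0 := by
  rw [← Complex.conj_eq_iff_im, ← eval_starP (D.xval_swap t u), starP_dT, g.real]

theorem fderiv_fnχ (p Y : ℝ × ℝ × H) : fderiv ℝ (D.fnχ g) p Y =
    ∑ b ∈ g.S, (MvPolynomial.eval (D.xval p.2.1 p.2.2) (MvPolynomial.pderiv (.h b) g.χ)
        * D.ℓ b Y.2.2
      + MvPolynomial.eval (D.xval p.2.1 p.2.2) (MvPolynomial.pderiv (.a b) g.χ)
        * conj (D.ℓ b Y.2.2))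
      + MvPolynomial.eval (D.xval p.2.1 p.2.2) (dT ι g.χ) * Y.2.1 := by
  have hS := g.supp
  rw [VSupp, ← Var.coe_fin] at hS
  let pt : (ℝ × ℝ × H) →L[ℝ] ℝ := ContinuousLinearMap.fst ℝ ℝ H ∘L ContinuousLinearMap.snd ℝ ℝ (ℝ × H)
  let pu : (ℝ × ℝ × H) →L[ℝ] H := ContinuousLinearMap.snd ℝ ℝ H ∘L ContinuousLinearMap.snd ℝ ℝ (ℝ × H)
  let x' : Var ι → (ℝ × ℝ × H) →L[ℝ] ℂ := fun j => match j with
    | .e => ContinuousLinearMap.smulRight pt (Complex.I * (1 : ℤ) * osc 1 p.2.1)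
    | .e' => ContinuousLinearMap.smulRight pt (Complex.I * (-1 : ℤ) * osc (-1) p.2.1)
    | .o => 0
    | .h v => (D.ℓ v).restrictScalars ℝ ∘L pu
    | .a v => (Complex.conjCLE : ℂ →L[ℝ] ℂ) ∘L (D.ℓ v).restrictScalars ℝ ∘L pu
  have hx : ∀ j, HasFDerivAt (fun q : ℝ × ℝ × H => D.xval q.2.1 q.2.2 j) (x' j) p := by
    intro j
    cases j
    case e => exact (hasDerivAt_osc 1 p.2.1).hasFDerivAt.comp p pt.hasFDerivAt
    case e' => exact (hasDerivAt_osc (-1) p.2.1).hasFDerivAt.comp p pt.hasFDerivAt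
    case o => exact hasFDerivAt_const _ _
    case h v => exact ((D.ℓ v).restrictScalars ℝ ∘L pu).hasFDerivAt
    case a v => exact ((Complex.conjCLE : ℂ →L[ℝ] ℂ) ∘L (D.ℓ v).restrictScalars ℝ ∘L pu).hasFDerivAt
  have h1 := hasFDerivAt_eval (fun j _ => hx j) hS
  have h2 : fderiv ℝ (D.fnχ g) p = _ := h1.fderiv
  rw [h2, dT, mkDerivation_eq_sum _ hS, Var.sum_fin, Var.sum_fin]
  simp only [add_apply, sum_apply,
    Finset.sum_add_distrib]
  have hsm : ∀ (c : ℂ) (L : (ℝ × ℝ × H) →L[ℝ] ℂ), (c • L) Y = c * L Y := fun _ _ => rfl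
  simp only [hsm]
  simp [x', pt, pu, xval]
  ring

end PData

end NLSNormalForm

end


/-! ### Invariance of a constant two-form under a Hamiltonian flow -/

noncomputable section

namespace NLSNormalForm

/-- Hamiltonian flows preserve the symplectic form. -/
theorem symplectic_of_flow {P : Type} [NormedAddCommGroup P] [NormedSpace ℝ P]
    {B : P →L[ℝ] P →L[ℝ] ℂ} (hB : ∀ x y, B x y = -B y x) {Φ : ℝ × P → P} {U : Set (ℝ × P)}
    (hU : IsOpen U) (hΦ : ContDiffOn ℝ ∞ Φ U) {X : P → P} (hX : ContDiff ℝ ∞ X) {F : P → ℂ}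
    (hF : ContDiff ℝ ∞ F)
    (hflow : ∀ q ∈ U, HasDerivAt (fun s => Φ (s, q.2)) (X (Φ q)) q.1)
    (hham : ∀ p Y, B (X p) Y = -Complex.I * fderiv ℝ F p Y) {p : P}
    (hp : ∀ s ∈ Icc (0 : ℝ) 1, (s, p) ∈ U) (h0 : ∀ᶠ p' in 𝓝 p, Φ (0, p') = p') (Y Z : P) :
    B (fderiv ℝ (fun p' => Φ (1, p')) p Y) (fderiv ℝ (fun p' => Φ (1, p')) p Z) = B Y Z := by
  have hat : ∀ q ∈ U, ContDiffAt ℝ ∞ Φ q := fun q hq => hΦ.contDiffAt (hU.mem_nhds hq)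
  have hd : ∀ q ∈ U, DifferentiableAt ℝ Φ q := fun q hq => (hat q hq).differentiableAt (by simp)
  have hd2 : ∀ q ∈ U, DifferentiableAt ℝ (fderiv ℝ Φ) q := fun q hq =>
    ((hat q hq).fderiv_right (m := 1) (by norm_cast)).differentiableAt (by simp)
  have hpart : ∀ s ∈ Icc (0 : ℝ) 1, ∀ W, fderiv ℝ (fun p' => Φ (s, p')) p W =
      fderiv ℝ Φ (s, p) (0, W) := by
    intro s hs W
    have h1 : HasFDerivAt (fun p' : P => ((s, p') : ℝ × P)) (ContinuousLinearMap.inr ℝ ℝ P) p :=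
      hasFDerivAt_prodMk_right s p
    have h2 := ((hd _ (hp s hs)).hasFDerivAt.comp p h1).fderiv
    have h3 : fderiv ℝ (fun p' => Φ (s, p')) p = _ := h2
    rw [h3]
    rfl
  have htime : ∀ q ∈ U, fderiv ℝ Φ q (1, 0) = X (Φ q) := by
    intro q hq
    have h1 : HasDerivAt (fun s : ℝ => ((s, q.2) : ℝ × P)) (1, 0) q.1 :=
      (hasDerivAt_id q.1).prodMk (hasDerivAt_const _ _)
    exact ((hd q hq).hasFDerivAt.comp_hasDerivAt q.1 h1).unique (hflow q hq)
  let v : P → ℝ → P := fun W s => fderiv ℝ Φ (s, p) (0, W)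
  -- The linearised equation: symmetry of the second derivative of `Φ` exchanges the time derivative
  -- with the derivative in the direction `W`.
  have hv : ∀ W, ∀ s ∈ Icc (0 : ℝ) 1,
      HasDerivAt (v W) (fderiv ℝ X (Φ (s, p)) (v W s)) s := by
    intro W s hs
    have hq := hp s hs
    have h1 : HasDerivAt (fun s : ℝ => ((s, p) : ℝ × P)) (1, 0) s :=
      (hasDerivAt_id s).prodMk (hasDerivAt_const _ _)
    have h2 := (hd2 _ hq).hasFDerivAt.comp_hasDerivAt s h1
    have h3 := h2.clm_apply (hasDerivAt_const s ((0 : ℝ), W))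
    simp only [map_zero, add_zero] at h3
    refine h3.congr_deriv ?_
    have hsymm : IsSymmSndFDerivAt ℝ Φ (s, p) :=
      ContDiffAt.isSymmSndFDerivAt (hat _ hq) (by
        simp only [minSmoothness_of_isRCLikeNormedField]
        norm_cast)
    rw [hsymm.eq]
    have h4 : (fun q => fderiv ℝ Φ q (1, 0)) =ᶠ[𝓝 (s, p)] fun q => X (Φ q) := by
      filter_upwards [hU.mem_nhds hq] with q hq using htime q hq
    have h5 := h4.fderiv_eq (𝕜 := ℝ)
    have h6 := ((hd2 _ hq).hasFDerivAt.clm_apply (hasFDerivAt_const ((1 : ℝ), (0 : P)) (s, p))).fderiv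
    have h7 : HasFDerivAt X (fderiv ℝ X (Φ (s, p))) (Φ (s, p)) :=
      (hX.differentiable (by simp) _).hasFDerivAt
    have h8 := (h7.comp (s, p) (hd _ hq).hasFDerivAt).fderiv
    rw [h6] at h5
    have h9 := congrArg (fun L : (ℝ × P) →L[ℝ] P => L (0, W)) (h5.trans h8)
    simpa [v] using h9
  -- Differentiating Hamilton's equation expresses the form on `DX` through the second derivative of
  -- `F`. Nondegeneracy of `B` plays no part.
  have hham2 : ∀ p' A Y, B (fderiv ℝ X p' A) Y =
      -Complex.I * fderiv ℝ (fderiv ℝ F) p' A Y := by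
    intro p' A Y
    have h1 : (fun p'' => B (X p'') Y) = fun p'' => -Complex.I * fderiv ℝ F p'' Y := by
      funext p''
      exact hham p'' Y
    have hX' : HasFDerivAt X (fderiv ℝ X p') p' := (hX.differentiable (by simp) _).hasFDerivAt
    have hF' : HasFDerivAt (fderiv ℝ F) (fderiv ℝ (fderiv ℝ F) p') p' :=
      ((hF.fderiv_right (m := 1) (by norm_cast)).differentiable (by simp) _).hasFDerivAt
    have h2 := (B.hasFDerivAt.comp p' hX').clm_apply (hasFDerivAt_const Y p')
    have h3 := (hF'.clm_apply (hasFDerivAt_const Y p')).const_mul (-Complex.I)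
    have h4 : HasFDerivAt (fun p'' => B (X p'') Y) _ p' := h2
    rw [h1] at h4
    have h5 := congrArg (fun L : P →L[ℝ] ℂ => L A) (h4.unique h3)
    simpa using h5
  have hF2 : ∀ p' A C, fderiv ℝ (fderiv ℝ F) p' A C = fderiv ℝ (fderiv ℝ F) p' C A := by
    intro p' A C
    refine (ContDiffAt.isSymmSndFDerivAt (n := ∞) hF.contDiffAt ?_).eq A C
    simp only [minSmoothness_of_isRCLikeNormedField]
    norm_cast
  -- The two terms of the product rule are values of the second derivative of `F` with the arguments
  -- exchanged and opposite signs, so they cancel.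
  have hder : ∀ s ∈ Icc (0 : ℝ) 1, HasDerivAt (fun s => B (v Y s) (v Z s)) 0 s := by
    intro s hs
    have h1 := (B.hasFDerivAt.comp_hasDerivAt s (hv Y s hs)).clm_apply (hv Z s hs)
    refine HasDerivAt.congr_deriv h1 ?_
    simp only [Function.comp]
    rw [hham2, hB (v Y s), hham2, hF2]
    ring
  have hconst := constant_of_has_deriv_right_zero (f := fun s => B (v Y s) (v Z s)) (a := 0) (b := 1)
    (fun s hs => (hder s hs).continuousAt.continuousWithinAt)
    (fun s hs => (hder s (Ico_subset_Icc_self hs)).hasDerivWithinAt) 1 (by simp)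
  have hz : ∀ W, v W 0 = W := by
    intro W
    have h1 : (fun p' => Φ (0, p')) =ᶠ[𝓝 p] id := h0
    have h2 := h1.fderiv_eq (𝕜 := ℝ)
    simp only [v]
    rw [← hpart 0 (by simp), h2, fderiv_id]
    rfl
  rw [hpart 1 (by simp), hpart 1 (by simp)]
  simp only [hz] at hconst
  exact hconst

end NLSNormalForm

end


/-! ### Classes of convergent series and their stability under flows -/

noncomputable section

namespace NLSNormalForm

theorem isHom_one {ι : Type} : IsHom (ι := ι) 0 0 0 1 :=
  MvPolynomial.isWeightedHomogeneous_one ℂ Var.wt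

theorem isHom_sum {ι α : Type} {j q : ℤ} {d : ℕ} (s : Finset α) (p : α → VPoly ι)
    (hp : ∀ a ∈ s, IsHom j q d (p a)) : IsHom j q d (∑ a ∈ s, p a) :=
  MvPolynomial.IsWeightedHomogeneous.sum _ _ _ hp

theorem hasSum_mul_of_summable_norm {f g : ℕ → ℂ} {a b : ℂ} (hf : HasSum f a) (hg : HasSum g b)
    (hf' : Summable fun d => ‖f d‖) (hg' : Summable fun d => ‖g d‖) :
    HasSum (fun x : ℕ × ℕ => f x.1 * g x.2) (a * b) := by
  have h1 : Summable fun x : ℕ × ℕ => f x.1 * g x.2 := summable_mul_of_summable_norm hf' hg'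
  exact hf.mul hg h1

/-- The degree in the time oscillations. -/
def tdeg {ι : Type} (κ : Var ι →₀ ℕ) : ℕ := κ .e + κ .e' + κ .o

theorem weight_wt_fst {ι : Type} (κ : Var ι →₀ ℕ) :
    (Finsupp.weight Var.wt κ).1 + 2 * tdeg κ = (Finsupp.weight Var.wt κ).2.2 := by
  classical
  induction κ using Finsupp.induction_linear with
  | zero => simp [tdeg]
  | add f g hf hg =>
    simp only [map_add, Prod.fst_add, Prod.snd_add, tdeg, Finsupp.add_apply] at *
    push_cast at *
    linarith
  | single j k =>
    rw [Finsupp.weight_single]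
    cases j <;> simp [Var.wt, tdeg, mul_comm]

theorem IsHom.eq_two_mul {ι : Type} {j q : ℤ} {d : ℕ} {p : VPoly ι} (hp : IsHom j q d p)
    {κ : Var ι →₀ ℕ} (hκ : κ ∈ p.support) : j + 2 * tdeg κ = d := by
  have := weight_wt_fst κ
  rw [hp (coeff_ne_zero_of_mem hκ)] at this
  exact this

/-- The difference between the degree and the first weight is twice the number of time factors. -/
theorem IsHom.eq_zero_of_odd {ι : Type} {j q : ℤ} {d : ℕ} {p : VPoly ι} (hp : IsHom j q d p)
    (h : Odd ((d : ℤ) - j)) : p = 0 := by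
  rw [← MvPolynomial.support_eq_empty, Finset.eq_empty_iff_forall_notMem]
  intro κ hκ
  have := hp.eq_two_mul hκ
  obtain ⟨k, hk⟩ := h
  omega

namespace PData

variable {ι H : Type} [NormedAddCommGroup H] [NormedSpace ℂ H] {D : PData ι H} {g : Gen ι}

/-- Functions of `(t, u)` that near `u = 0` are sums of series of polynomials in finitely many
functionals, of weights `(j, q, d)` with `d ≥ d₀`. -/
def Cls (D : PData ι H) (j q : ℤ) (d₀ : ℕ) (F : ℝ → H → ℂ) : Prop :=
  ∃ (P : ℕ → VPoly ι) (S : Finset ι) (ρ : ℝ), 0 < ρ ∧ (∀ d, IsHom j q d (P d)) ∧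
    (∀ d, P d ∈ VSupp S) ∧ (∀ d < d₀, P d = 0) ∧
    (Summable fun d => wnorm (wB D.B) (P d) * ρ ^ d) ∧
    ∀ t u, ‖u‖ < ρ → HasSum (fun d => MvPolynomial.eval (D.xval t u) (P d)) (F t u)

theorem wnorm_nonneg' (p : VPoly ι) : 0 ≤ wnorm (wB D.B) p := wnorm_nonneg D.wB_pos p

theorem summable_scale {I : Type} {deg : I → ℕ} {P : I → VPoly ι} {ρ ρ' : ℝ} (h0 : 0 ≤ ρ')
    (h : ρ' ≤ ρ) (hs : Summable fun i => wnorm (wB D.B) (P i) * ρ ^ deg i) :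
    Summable fun i => wnorm (wB D.B) (P i) * ρ' ^ deg i :=
  Summable.of_nonneg_of_le (fun _ => mul_nonneg (wnorm_nonneg' _) (pow_nonneg h0 _))
    (fun _ => mul_le_mul_of_nonneg_left (pow_le_pow_left₀ h0 h _) (wnorm_nonneg' _)) hs

/-- Regroups a series over any index type into one polynomial per degree, which is possible as soon
as each degree occurs finitely often. Products and compositions with flows arise as double series
and enter the class this way. -/
theorem Cls.of_family {j q : ℤ} {d₀ : ℕ} {F : ℝ → H → ℂ} {I : Type} (deg : I → ℕ)
    (hfin : ∀ e, {i | deg i = e}.Finite) (P : I → VPoly ι) (S : Finset ι) {ρ : ℝ} (hρ : 0 < ρ)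
    (hP : ∀ i, IsHom j q (deg i) (P i)) (hS : ∀ i, P i ∈ VSupp S)
    (hd : ∀ i, deg i < d₀ → P i = 0)
    (hs : Summable fun i => wnorm (wB D.B) (P i) * ρ ^ deg i)
    (hF : ∀ t u, ‖u‖ < ρ → HasSum (fun i => MvPolynomial.eval (D.xval t u) (P i)) (F t u)) :
    D.Cls j q d₀ F := by
  classical
  let Q : ℕ → VPoly ι := fun e => ∑ i ∈ (hfin e).toFinset, P i
  have hmem : ∀ e i, i ∈ (hfin e).toFinset ↔ deg i = e := fun e i => by simp
  have hsig : ∀ (M : Type) [NormedAddCommGroup M] [CompleteSpace M] (f : I → M) (a : M),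
      HasSum f a → HasSum (fun e => ∑ i ∈ (hfin e).toFinset, f i) a := by
    intro M _ _ f a hf
    have h1 := (Equiv.sigmaFiberEquiv deg).hasSum_iff.mpr hf
    refine h1.sigma fun e => ?_
    have : Finite {i // deg i = e} := hfin e
    have := Fintype.ofFinite {i // deg i = e}
    rw [Finset.sum_subtype _ (hmem e) f]
    exact hasSum_fintype _
  refine ⟨Q, S, ρ, hρ, fun e => ?_, fun e => sum_mem fun i _ => hS i, fun e he => ?_, ?_,
    fun t u hu => ?_⟩
  · refine isHom_sum _ _ fun i hi => ?_
    rw [← (hmem e i).mp hi]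
    exact hP i
  · refine Finset.sum_eq_zero fun i hi => hd i ?_
    rwa [(hmem e i).mp hi]
  · refine Summable.of_nonneg_of_le (fun e => mul_nonneg (wnorm_nonneg' _) (pow_nonneg hρ.le _))
      (fun e => ?_) (hsig ℝ _ _ hs.hasSum).summable
    refine (mul_le_mul_of_nonneg_right (wnorm_sum_le D.wB_pos _ _) (pow_nonneg hρ.le _)).trans ?_
    rw [Finset.sum_mul]
    refine Finset.sum_le_sum fun i hi => ?_
    rw [(hmem e i).mp hi]
  · simpa only [Q, map_sum] using hsig ℂ _ _ (hF t u hu)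

theorem norm_eval_le_scale {j q : ℤ} {d : ℕ} {p : VPoly ι} (hp : IsHom j q d p) (t : ℝ) {u : H}
    {ρ : ℝ} (hu : ‖u‖ ≤ ρ) :
    ‖MvPolynomial.eval (D.xval t u) p‖ ≤ wnorm (wB D.B) p * ρ ^ d :=
  D.norm_eval_hom_le hp t hu

theorem Cls.congr_near {j q : ℤ} {d₀ : ℕ} {F G : ℝ → H → ℂ} (hF : D.Cls j q d₀ F) {δ : ℝ}
    (hδ : 0 < δ) (h : ∀ t u, ‖u‖ < δ → F t u = G t u) : D.Cls j q d₀ G := by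
  obtain ⟨P, S, ρ, hρ, hP, hS, hd, hs, hF⟩ := hF
  refine ⟨P, S, min ρ δ, lt_min hρ hδ, hP, hS, hd,
    summable_scale (lt_min hρ hδ).le (min_le_left _ _) hs, fun t u hu => ?_⟩
  rw [← h t u (hu.trans_le (min_le_right _ _))]
  exact hF t u (hu.trans_le (min_le_left _ _))

theorem Cls.mono {j q : ℤ} {d₀ d₁ : ℕ} {F : ℝ → H → ℂ} (hF : D.Cls j q d₀ F) (h : d₁ ≤ d₀) :
    D.Cls j q d₁ F := by
  obtain ⟨P, S, ρ, hρ, hP, hS, hd, hs, hF⟩ := hF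
  exact ⟨P, S, ρ, hρ, hP, hS, fun d hd' => hd d (hd'.trans_le h), hs, hF⟩

theorem Cls.poly {j q : ℤ} {d : ℕ} {p : VPoly ι} (hp : IsHom j q d p) :
    D.Cls j q d fun t u => MvPolynomial.eval (D.xval t u) p := by
  obtain ⟨S, hS⟩ := exists_mem_VSupp p
  refine Cls.of_family (I := Unit) (fun _ => d) (fun _ => Set.toFinite _) (fun _ => p) S one_pos
    (fun _ => hp) (fun _ => hS) (fun _ h => absurd h (lt_irrefl _)) (hasSum_fintype _).summable ?_
  intro t u _
  simp

theorem Cls.zero (j q : ℤ) (d : ℕ) : D.Cls j q d fun _ _ => 0 :=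
  ⟨fun _ => 0, ∅, 1, one_pos, fun _ => MvPolynomial.isWeightedHomogeneous_zero _ _ _,
    fun _ => zero_mem _, fun _ _ => rfl, by simp [summable_zero], fun _ _ _ => by simp [hasSum_zero]⟩

theorem Cls.add {j q : ℤ} {d : ℕ} {F G : ℝ → H → ℂ} (hF : D.Cls j q d F) (hG : D.Cls j q d G) :
    D.Cls j q d fun t u => F t u + G t u := by
  classical
  obtain ⟨P, S, ρ, hρ, hP, hS, hd, hs, hF⟩ := hF
  obtain ⟨P', S', ρ', hρ', hP', hS', hd', hs', hF'⟩ := hG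
  have h0 : 0 < min ρ ρ' := lt_min hρ hρ'
  refine ⟨fun d => P d + P' d, S ∪ S', min ρ ρ', h0, fun d => (hP d).add (hP' d),
    fun d => add_mem (VSupp_mono Finset.subset_union_left (hS d))
      (VSupp_mono Finset.subset_union_right (hS' d)), fun d h => by simp only [hd d h, hd' d h, add_zero],
    ?_, fun t u hu => ?_⟩
  · refine Summable.of_nonneg_of_le (fun e => mul_nonneg (wnorm_nonneg' _) (pow_nonneg h0.le _))
      (fun e => ?_) ((summable_scale h0.le (min_le_left _ _) hs).add
        (summable_scale h0.le (min_le_right _ _) hs'))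
    rw [← add_mul]
    exact mul_le_mul_of_nonneg_right (wnorm_add_le D.wB_pos _ _) (pow_nonneg h0.le _)
  · simp only [map_add]
    exact (hF t u (hu.trans_le (min_le_left _ _))).add (hF' t u (hu.trans_le (min_le_right _ _)))

theorem Cls.const_mul {j q : ℤ} {d : ℕ} {F : ℝ → H → ℂ} (hF : D.Cls j q d F) (c : ℂ) :
    D.Cls j q d fun t u => c * F t u := by
  obtain ⟨P, S, ρ, hρ, hP, hS, hd, hs, hF⟩ := hF
  refine ⟨fun d => c • P d, S, ρ, hρ, fun d => (hP d).smul c, fun d => (VSupp S).smul_mem (hS d) c,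
    fun d h => by simp only [hd d h, smul_zero], ?_, fun t u hu => ?_⟩
  · simp only [wnorm_smul, mul_assoc]
    exact hs.mul_left _
  · simp only [MvPolynomial.smul_eval]
    exact (hF t u hu).mul_left c

theorem Cls.sum {j q : ℤ} {d : ℕ} {α : Type} (s : Finset α) {F : α → ℝ → H → ℂ}
    (hF : ∀ a ∈ s, D.Cls j q d (F a)) : D.Cls j q d fun t u => ∑ a ∈ s, F a t u := by
  classical
  induction s using Finset.induction_on with
  | empty => simpa using Cls.zero j q d
  | insert a s ha ih =>
    simp only [Finset.sum_insert ha]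
    exact (hF a (Finset.mem_insert_self _ _)).add
      (ih fun b hb => hF b (Finset.mem_insert_of_mem hb))

theorem Cls.conj {j q : ℤ} {d : ℕ} {F : ℝ → H → ℂ} (hF : D.Cls j q d F) :
    D.Cls j (-q) d fun t u => (starRingEnd ℂ) (F t u) := by
  obtain ⟨P, S, ρ, hρ, hP, hS, hd, hs, hF⟩ := hF
  refine ⟨fun d => starP (P d), S, ρ, hρ, fun d => isHom_starP (hP d),
    fun d => starP_mem_VSupp (hS d), fun d h => by simp only [hd d h, map_zero], ?_, fun t u hu => ?_⟩
  · simpa only [wnorm_starP (wB_swap D.B)] using hs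
  · simp only [eval_starP (D.xval_swap t u)]
    exact (hF t u hu).map (starRingEnd ℂ) Complex.continuous_conj

theorem Cls.mul {j q j' q' : ℤ} {d d' : ℕ} {F G : ℝ → H → ℂ} (hF : D.Cls j q d F)
    (hG : D.Cls j' q' d' G) : D.Cls (j + j') (q + q') (d + d') fun t u => F t u * G t u := by
  classical
  obtain ⟨P, S, ρ, hρ, hP, hS, hd, hs, hF⟩ := hF
  obtain ⟨P', S', ρ', hρ', hP', hS', hd', hs', hF'⟩ := hG
  have h0 : 0 < min ρ ρ' := lt_min hρ hρ'
  have hs1 := summable_scale h0.le (min_le_left _ _) hs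
  have hs2 := summable_scale h0.le (min_le_right _ _) hs'
  refine Cls.of_family (I := ℕ × ℕ) (fun x => x.1 + x.2) (fun e => ?_) (fun x => P x.1 * P' x.2)
    (S ∪ S') h0 (fun x => (hP x.1).mul' (hP' x.2)) (fun x => mul_mem
      (VSupp_mono Finset.subset_union_left (hS _)) (VSupp_mono Finset.subset_union_right (hS' _)))
    (fun x hx => ?_) ?_ (fun t u hu => ?_)
  · exact (Finset.HasAntidiagonal.antidiagonal e).finite_toSet.subset fun x hx => by simpa using hx
  · rcases Nat.lt_or_ge x.1 d with h | h
    · rw [hd _ h, zero_mul]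
    · rw [hd' x.2 (by omega), mul_zero]
  · refine Summable.of_nonneg_of_le (fun e => mul_nonneg (wnorm_nonneg' _) (pow_nonneg h0.le _))
      (fun x => ?_) (hs1.mul_of_nonneg hs2
        (fun d => mul_nonneg (wnorm_nonneg' _) (pow_nonneg h0.le _))
        (fun d => mul_nonneg (wnorm_nonneg' _) (pow_nonneg h0.le _)))
    rw [pow_add]
    calc _ ≤ (wnorm (wB D.B) (P x.1) * wnorm (wB D.B) (P' x.2)) * (min ρ ρ' ^ x.1 * min ρ ρ' ^ x.2) :=
          mul_le_mul_of_nonneg_right (wnorm_mul_le D.wB_pos _ _) (by positivity)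
      _ = _ := by ring
  · have h1 := hF t u (hu.trans_le (min_le_left _ _))
    have h2 := hF' t u (hu.trans_le (min_le_right _ _))
    simp only [map_mul]
    have h3 : Summable fun d => ‖MvPolynomial.eval (D.xval t u) (P d)‖ :=
      Summable.of_nonneg_of_le (fun _ => norm_nonneg _)
        (fun d => norm_eval_le_scale (hP d) t hu.le) hs1
    have h4 : Summable fun d => ‖MvPolynomial.eval (D.xval t u) (P' d)‖ :=
      Summable.of_nonneg_of_le (fun _ => norm_nonneg _)
        (fun d => norm_eval_le_scale (hP' d) t hu.le) hs2
    have h5 := hasSum_mul_of_summable_norm (f := fun d => MvPolynomial.eval (D.xval t u) (P d))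
      (g := fun d => MvPolynomial.eval (D.xval t u) (P' d)) h1 h2
    have h6 := h5 h3
    have h7 := h6 h4
    exact h7

theorem Cls.one : D.Cls 0 0 0 fun _ _ => 1 := by
  simpa using Cls.poly (D := D) (isHom_one (ι := ι))

/-- The coefficient `γ₀ + γ₁ cos t`. -/
theorem Cls.gam (γ₀ γ₁ : ℝ) : D.Cls (-2) 0 0 fun t _ => (gam γ₀ γ₁ t : ℂ) := by
  -- The constant `γ₀` is multiplied by the variable `o`, of value one, so as to have the same
  -- weight as the oscillations.
  have h1 : IsHom (ι := ι) (-2) 0 0 ((γ₀ : ℂ) • MvPolynomial.X .o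
      + ((γ₁ / 2 : ℂ) • MvPolynomial.X .e + (γ₁ / 2 : ℂ) • MvPolynomial.X .e')) := by
    refine MvPolynomial.IsWeightedHomogeneous.add ?_ (MvPolynomial.IsWeightedHomogeneous.add ?_ ?_)
      <;> exact IsHom.smul (MvPolynomial.isWeightedHomogeneous_X _ _ _) _
  refine (Cls.poly (D := D) h1).congr_near one_pos fun t u _ => ?_
  simp only [map_add, MvPolynomial.smul_eval, MvPolynomial.eval_X, xval, NLSNormalForm.gam, osc]
  push_cast
  rw [Complex.cos]
  rw [show Complex.I * 1 * (t : ℂ) = t * Complex.I by ring,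
    show Complex.I * -1 * (t : ℂ) = -t * Complex.I by ring]
  ring

theorem Cls.split {j q : ℤ} {d : ℕ} {F : ℝ → H → ℂ} (hF : D.Cls j q d F) :
    ∃ p : VPoly ι, IsHom j q d p ∧
      D.Cls j q (d + 1) fun t u => F t u - MvPolynomial.eval (D.xval t u) p := by
  obtain ⟨P, S, ρ, hρ, hP, hS, hd, hs, hF⟩ := hF
  refine ⟨P d, hP d, Function.update P d 0, S, ρ, hρ, fun e => ?_, fun e => ?_, fun e he => ?_, ?_,
    fun t u hu => ?_⟩
  · by_cases h : e = d
    · subst h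
      simpa using MvPolynomial.isWeightedHomogeneous_zero _ _ _
    · simpa [h] using hP e
  · by_cases h : e = d
    · subst h
      simp
    · simpa [h] using hS e
  · by_cases h : e = d
    · subst h
      simp
    · simpa [h] using hd e (by omega)
  · refine Summable.of_nonneg_of_le (fun e => mul_nonneg (wnorm_nonneg' _) (pow_nonneg hρ.le _))
      (fun e => ?_) hs
    refine mul_le_mul_of_nonneg_right ?_ (pow_nonneg hρ.le _)
    by_cases h : e = d
    · subst h
      simpa using wnorm_nonneg' _
    · simp [h]
  · have h1 := (hF t u hu).update d 0
    have h2 : Function.update (fun e => MvPolynomial.eval (D.xval t u) (P e)) d 0 =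
        fun e => MvPolynomial.eval (D.xval t u) (Function.update P d 0 e) := by
      funext e
      by_cases h : e = d
      · subst h
        simp
      · simp [h]
    rw [h2] at h1
    have h3 : 0 - MvPolynomial.eval (D.xval t u) (P d) + F t u =
        F t u - MvPolynomial.eval (D.xval t u) (P d) := by ring
    rwa [h3] at h1

/-- By parity the polynomial of the next degree vanishes, so that removing the lowest one gains two
degrees. -/
theorem Cls.split_two {j q : ℤ} {d : ℕ} {F : ℝ → H → ℂ} (hF : D.Cls j q d F)
    (hpar : Even ((d : ℤ) - j)) : ∃ p : VPoly ι, IsHom j q d p ∧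
      D.Cls j q (d + 2) fun t u => F t u - MvPolynomial.eval (D.xval t u) p := by
  obtain ⟨p, hp, hF⟩ := hF.split
  obtain ⟨p', hp', hF'⟩ := hF.split
  have : p' = 0 := by
    refine hp'.eq_zero_of_odd ?_
    obtain ⟨k, hk⟩ := hpar
    exact ⟨k, by push_cast; omega⟩
  subst this
  exact ⟨p, hp, by simpa using hF'⟩

/-- The size of the displacement by the flow. -/
theorem norm_flowU_sub_le {s : ℝ} (hs : |s| ≤ 2) (t : ℝ) {u : H} (h : ‖u‖ ≤ D.lieRad g) :
    ‖D.flowU g s t u - u‖ ≤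
      (∑ b ∈ g.S, 4 * wnorm (wB D.B) (g.velo b) * 2 ^ (g.M + 1) * ‖D.r b‖) * ‖u‖ ^ (g.M + 1) := by
  rw [flowU, add_sub_cancel_left, Finset.sum_mul]
  refine (norm_sum_le _ _).trans (Finset.sum_le_sum fun b _ => ?_)
  rw [norm_smul]
  calc _ ≤ (4 * wnorm (wB D.B) (g.velo b) * (2 * ‖u‖) ^ (g.M + 1)) * ‖D.r b‖ :=
        mul_le_mul_of_nonneg_right (norm_prim_le (isHom_velo b) hs t h) (norm_nonneg _)
    _ = _ := by rw [mul_pow]; ring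

theorem exists_norm_flowU_le (D : PData ι H) (g : Gen ι) : ∃ ρ : ℝ, 0 < ρ ∧ ρ ≤ D.lieRad g ∧
    ∀ s t : ℝ, |s| ≤ 2 → ∀ u : H, ‖u‖ ≤ ρ → ‖D.flowU g s t u‖ ≤ 2 * ‖u‖ := by
  set C := ∑ b ∈ g.S, 4 * wnorm (wB D.B) (g.velo b) * 2 ^ (g.M + 1) * ‖D.r b‖ with hC
  have hC0 : 0 ≤ C := Finset.sum_nonneg fun b _ => by
    have := wnorm_nonneg' (D := D) (g.velo b)
    positivity
  have hpos := D.lieRad_pos g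
  refine ⟨min (D.lieRad g) (1 / (1 + C)), lt_min hpos (by positivity), min_le_left _ _,
    fun s t hs u hu => ?_⟩
  have h1 := hu.trans (min_le_left _ _)
  have h2 := hu.trans (min_le_right _ _)
  have h3 := norm_flowU_sub_le hs t h1
  rw [← hC] at h3
  have h4 : C * ‖u‖ ^ (g.M + 1) ≤ ‖u‖ := by
    have h5 : ‖u‖ ^ g.M ≤ 1 / (1 + C) :=
      (pow_le_of_le_one (norm_nonneg _) (h1.trans (D.lieRad_le_one g))
        (by have := g.one_le; omega)).trans h2
    calc C * ‖u‖ ^ (g.M + 1) = C * ‖u‖ ^ g.M * ‖u‖ := by ring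
      _ ≤ C * (1 / (1 + C)) * ‖u‖ := by gcongr
      _ ≤ 1 * ‖u‖ := by
        gcongr
        rw [mul_one_div, div_le_one (by positivity)]
        linarith
      _ = ‖u‖ := one_mul _
  calc ‖D.flowU g s t u‖ = ‖D.flowU g s t u - u + u‖ := by rw [sub_add_cancel]
    _ ≤ _ := norm_add_le _ _
    _ ≤ 2 * ‖u‖ := by linarith

theorem finite_fibre (M : ℕ) (hM : 1 ≤ M) (a e : ℕ) :
    {x : ℕ × ℕ | x.1 + (x.2 + a) * M = e}.Finite := by
  refine ((Finset.range (e + 1)) ×ˢ (Finset.range (e + 1))).finite_toSet.subset fun x hx => ?_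
  simp only [mem_ofPred_eq] at hx
  have : x.2 + a ≤ (x.2 + a) * M := Nat.le_mul_of_pos_right _ hM
  simp only [Finset.coe_product, Finset.coe_range, mem_prod, mem_Iio]
  omega

/-- The difference is the Lie series without its zeroth term, applied to each polynomial of the
series of `F`. Every remaining term has undergone at least one bracket, which accounts for the gain
`M` in degree. -/
theorem Cls.comp_flow_sub {j q : ℤ} {d : ℕ} {F : ℝ → H → ℂ} (hF : D.Cls j q d F) (g : Gen ι) :
    D.Cls j q (d + g.M) fun t u => F t (D.flowU g 1 t u) - F t u := by
  classical
  obtain ⟨P, S, ρ, hρ, hP, hS, hd, hs, hF⟩ := hF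
  obtain ⟨ρ₁, hρ₁, hρ₁', hfl⟩ := exists_norm_flowU_le D g
  -- Half the radius serves twice: the bounds for Lie series carry `(2ρ')^d`, and the flow may
  -- double the norm of `u`.
  set ρ' := min ρ₁ (ρ / 2)
  have h0 : 0 < ρ' := lt_min hρ₁ (by positivity)
  have hle1 : ρ' ≤ D.lieRad g := (min_le_left _ _).trans hρ₁'
  have hle2 : 2 * ρ' ≤ ρ := by linarith [min_le_right ρ₁ (ρ / 2)]
  have hsum : Summable fun x : ℕ × ℕ => (1 / 8 : ℝ) ^ (x.2 + 1) *
      (wnorm (wB D.B) (P x.1) * (2 * ρ') ^ x.1) := by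
    have h1 := (summable_scale (D := D) (by positivity) hle2 hs).mul_of_nonneg
      ((summable_nat_add_iff 1).mpr (summable_geometric_of_lt_one (r := (1 / 8 : ℝ)) (by norm_num) (by norm_num)))
      (fun d => mul_nonneg (wnorm_nonneg' _) (by positivity)) (fun d => by positivity)
    refine h1.congr fun x => ?_
    ring
  have hterm : ∀ x : ℕ × ℕ, wnorm (wB D.B)
      ((1 / (x.2 + 1).factorial : ℂ) • (D.lie g)^[x.2 + 1] (P x.1)) * ρ' ^ (x.1 + (x.2 + 1) * g.M) ≤
      (1 / 8 : ℝ) ^ (x.2 + 1) * (wnorm (wB D.B) (P x.1) * (2 * ρ') ^ x.1) := by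
    intro x
    have h1 := D.wnorm_scale_lie_iterate_le g (hP x.1) (x.2 + 1) h0.le hle1
    rw [wnorm_wB_scale _ _ (D.isHom_lie_iterate g (hP x.1) (x.2 + 1))] at h1
    rw [wnorm_smul, norm_div, norm_one, Complex.norm_natCast, mul_assoc, one_div_mul_eq_div,
      div_le_iff₀ (by positivity)]
    linarith
  refine Cls.of_family (I := ℕ × ℕ) (fun x => x.1 + (x.2 + 1) * g.M)
    (finite_fibre _ g.one_le 1) (fun x => (1 / (x.2 + 1).factorial : ℂ) • (D.lie g)^[x.2 + 1] (P x.1))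
    (g.S ∪ S) h0 (fun x => (D.isHom_lie_iterate g (hP x.1) _).smul _) (fun x => ?_)
    (fun x hx => ?_) (Summable.of_nonneg_of_le (fun x => mul_nonneg (wnorm_nonneg' _) (by positivity))
      hterm hsum) (fun t u hu => ?_)
  · exact (VSupp _).smul_mem (D.lie_iterate_mem_VSupp g Finset.subset_union_left
      (VSupp_mono Finset.subset_union_right (hS _)) _) _
  · rw [hd x.1]
    · rw [Function.iterate_succ_apply, map_zero]
      have : (D.lie g)^[x.2] 0 = 0 := by simp
      rw [this, smul_zero]
    · have : g.M ≤ (x.2 + 1) * g.M := Nat.le_mul_of_pos_left _ (Nat.succ_pos _)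
      omega
  · have hu1 : ‖u‖ ≤ D.lieRad g := hu.le.trans hle1
    have hu2 : ‖D.flowU g 1 t u‖ < ρ := by
      have := hfl 1 t (by norm_num) u (hu.le.trans (min_le_left _ _))
      linarith
    have hu3 : ‖u‖ < ρ := by linarith [norm_nonneg u]
    have h2 : ∀ x : ℕ × ℕ, MvPolynomial.eval (D.xval t u)
        ((1 / (x.2 + 1).factorial : ℂ) • (D.lie g)^[x.2 + 1] (P x.1)) =
        D.lieTerm g 1 (P x.1) t u (x.2 + 1) := by
      intro x
      simp [lieTerm, MvPolynomial.smul_eval]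
    have hsm : Summable fun x : ℕ × ℕ => MvPolynomial.eval (D.xval t u)
        ((1 / (x.2 + 1).factorial : ℂ) • (D.lie g)^[x.2 + 1] (P x.1)) := by
      refine Summable.of_norm (Summable.of_nonneg_of_le (fun _ => norm_nonneg _) (fun x => ?_) hsum)
      exact (norm_eval_le_scale ((D.isHom_lie_iterate g (hP x.1) _).smul _) t hu.le).trans (hterm x)
    have h3 : ∀ d, HasSum (fun k => MvPolynomial.eval (D.xval t u)
        ((1 / (k + 1).factorial : ℂ) • (D.lie g)^[k + 1] (P d)))
        (MvPolynomial.eval (D.xval t (D.flowU g 1 t u)) (P d) - MvPolynomial.eval (D.xval t u) (P d)) := by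
      intro d
      simp only [fun k => h2 (d, k)]
      rw [hasSum_nat_add_iff]
      have h6 : MvPolynomial.eval (D.xval t (D.flowU g 1 t u)) (P d)
          - MvPolynomial.eval (D.xval t u) (P d)
          + ∑ i ∈ Finset.range 1, D.lieTerm g 1 (P d) t u i =
          MvPolynomial.eval (D.xval t (D.flowU g 1 t u)) (P d) := by simp [lieTerm]
      rw [h6]
      exact hasSum_lieTerm (by norm_num) t hu1 (P d)
    have h4 := hsm.hasSum.prod_fiberwise h3
    have h5 := (hF t _ hu2).sub (hF t u hu3)
    rw [← h4.unique h5]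
    exact hsm.hasSum

theorem Cls.comp_flow {j q : ℤ} {d : ℕ} {F : ℝ → H → ℂ} (hF : D.Cls j q d F) (g : Gen ι) :
    D.Cls j q d fun t u => F t (D.flowU g 1 t u) := by
  have h1 := hF.add ((hF.comp_flow_sub g).mono (Nat.le_add_right d g.M))
  simpa using h1

/-- At time one the zeroth term of the primitive is `p` itself. With `p` the bracket of `H_F` and
`χ`, this isolates the term that enters the homological equation from those of higher degree. -/
theorem Cls.prim_sub {j q : ℤ} {d : ℕ} {p : VPoly ι} (hp : IsHom j q d p) (g : Gen ι) :
    D.Cls j q (d + g.M) fun t u => D.prim g 1 p t u - MvPolynomial.eval (D.xval t u) p := by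
  classical
  obtain ⟨S, hS⟩ := exists_mem_VSupp p
  have h0 := D.lieRad_pos g
  have hterm : ∀ k : ℕ, wnorm (wB D.B)
      ((1 / (k + 1 + 1).factorial : ℂ) • (D.lie g)^[k + 1] p) * D.lieRad g ^ (d + (k + 1) * g.M) ≤
      (1 / 4 : ℝ) ^ k * (wnorm (wB D.B) p * (2 * D.lieRad g) ^ d) := by
    intro k
    have h1 := D.wnorm_scale_lie_iterate_le g hp (k + 1) h0.le le_rfl
    rw [wnorm_wB_scale _ _ (D.isHom_lie_iterate g hp (k + 1))] at h1
    rw [wnorm_smul, norm_div, norm_one, Complex.norm_natCast, mul_assoc, one_div_mul_eq_div,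
      div_le_iff₀ (by positivity)]
    refine h1.trans ?_
    have h2 : ((k + 1).factorial : ℝ) ≤ (k + 1 + 1).factorial := by
      exact_mod_cast Nat.factorial_le (Nat.le_succ _)
    have h3 : (1 / 8 : ℝ) ^ (k + 1) ≤ (1 / 4) ^ k := by
      rw [pow_succ]
      calc (1 / 8 : ℝ) ^ k * (1 / 8) ≤ (1 / 4) ^ k * 1 := by gcongr <;> norm_num
        _ = _ := mul_one _
    have h4 := wnorm_nonneg' (D := D) p
    calc _ ≤ ((k + 1 + 1).factorial : ℝ) * ((1 / 4) ^ k * (wnorm (wB D.B) p * (2 * D.lieRad g) ^ d)) := by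
          gcongr
      _ = _ := by ring
  have hfin : ∀ e, {k : ℕ | d + (k + 1) * g.M = e}.Finite := fun e =>
    (Set.finite_Iio e).subset fun k hk => by
      simp only [mem_ofPred_eq] at hk
      have : k + 1 ≤ (k + 1) * g.M := Nat.le_mul_of_pos_right _ g.one_le
      simp only [mem_Iio]
      omega
  refine Cls.of_family (I := ℕ) (fun k => d + (k + 1) * g.M) hfin
    (fun k => (1 / (k + 1 + 1).factorial : ℂ) • (D.lie g)^[k + 1] p)
    (g.S ∪ S) h0 (fun x => (D.isHom_lie_iterate g hp _).smul _) (fun x => ?_)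
    (fun k hk => ?_) (Summable.of_nonneg_of_le (fun x => mul_nonneg (wnorm_nonneg' _) (by positivity))
      hterm (summable_quarter _)) (fun t u hu => ?_)
  · exact (VSupp _).smul_mem (D.lie_iterate_mem_VSupp g Finset.subset_union_left
      (VSupp_mono Finset.subset_union_right hS) _) _
  · have : g.M ≤ (k + 1) * g.M := Nat.le_mul_of_pos_left _ (Nat.succ_pos _)
    omega
  · have h1 := (summable_norm_primTerm (D := D) (g := g) hp (s := 1) (by norm_num) t hu.le).of_norm.hasSum
    have h2 : ∀ k, MvPolynomial.eval (D.xval t u)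
        ((1 / (k + 1 + 1).factorial : ℂ) • (D.lie g)^[k + 1] p) = D.primTerm g 1 p t u (k + 1) := by
      intro k
      simp [primTerm, MvPolynomial.smul_eval]
    simp only [h2]
    rw [hasSum_nat_add_iff]
    have h6 : D.prim g 1 p t u - MvPolynomial.eval (D.xval t u) p
        + ∑ i ∈ Finset.range 1, D.primTerm g 1 p t u i = D.prim g 1 p t u := by simp [primTerm]
    rw [h6]
    exact h1

theorem Cls.prim {j q : ℤ} {d : ℕ} {p : VPoly ι} (hp : IsHom j q d p) (g : Gen ι) :
    D.Cls j q d (D.prim g 1 p) := by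
  have h1 := (Cls.poly (D := D) hp).add ((Cls.prim_sub (D := D) hp g).mono (Nat.le_add_right d g.M))
  simpa using h1

end PData

end NLSNormalForm

end


noncomputable section

namespace NLSNormalForm

open scoped BoundedContinuousFunction FourierTransform ENNReal

/-! ### Multiplication operators and Fourier multipliers on `L²` -/

/-- A bounded continuous function as an element of `L^∞`. -/
def bddLp (a : E3 →ᵇ ℂ) : Lp ℂ ∞ (volume : Measure E3) := a.memLp_top.toLp _

/-- Multiplication by a bounded continuous function on `L²`. -/
def mulL2 (a : E3 →ᵇ ℂ) : L2 →L[ℂ] L2 :=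
  LinearMap.mkContinuous
    { toFun := fun f => (bddLp a • f : L2)
      map_add' := fun f g => Lp.add_smul _ f g
      map_smul' := fun c _ => (Lp.smul_comm c (bddLp a) _).symm }
    ‖bddLp a‖ fun _ => Lp.norm_smul_le _ _

theorem mulL2_apply (a : E3 →ᵇ ℂ) (f : L2) : mulL2 a f = (bddLp a • f : L2) := rfl

theorem coeFn_mulL2 (a : E3 →ᵇ ℂ) (f : L2) : ∀ᵐ x, mulL2 a f x = a x * f x := by
  have h1 : ((bddLp a • f : L2) : E3 → ℂ) =ᵐ[volume] (bddLp a : E3 → ℂ) • (f : E3 → ℂ) :=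
    Lp.coeFn_lpSMul _ _
  filter_upwards [h1, (a.memLp_top (μ := (volume : Measure E3))).coeFn_toLp] with x h1 h2
  rw [mulL2_apply, h1, Pi.smul_apply', bddLp, h2, smul_eq_mul]

theorem l2Incl_mulL2 {a : E3 →ᵇ ℂ} (ha : (a : E3 → ℂ).HasTemperateGrowth) (f : L2) :
    l2Incl (mulL2 a f) = smulLeftCLM ℂ (a : E3 → ℂ) (l2Incl f) :=
  Lp.toTemperedDistribution_smul_eq ha a.memLp_top f

/-- The Fourier transform on `L²`. -/
def fourierL2 : L2 ≃ₗᵢ[ℂ] L2 := Lp.fourierTransformₗᵢ E3 ℂ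

theorem l2Incl_fourierL2 (f : L2) : l2Incl (fourierL2 f) = 𝓕 (l2Incl f) :=
  (Lp.fourier_toTemperedDistribution_eq f).symm

theorem l2Incl_fourierL2_symm (f : L2) : l2Incl (fourierL2.symm f) = 𝓕⁻ (l2Incl f) :=
  (Lp.fourierInv_toTemperedDistribution_eq f).symm

/-- The Fourier multiplier on `L²` with a bounded continuous symbol. -/
def multL2 (a : E3 →ᵇ ℂ) : L2 →L[ℂ] L2 :=
  fourierL2.symm.toLinearIsometry.toContinuousLinearMap ∘L mulL2 a ∘L
    fourierL2.toLinearIsometry.toContinuousLinearMap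

theorem multL2_apply (a : E3 →ᵇ ℂ) (f : L2) :
    multL2 a f = fourierL2.symm (mulL2 a (fourierL2 f)) := rfl

theorem l2Incl_multL2 {a : E3 →ᵇ ℂ} (ha : (a : E3 → ℂ).HasTemperateGrowth) (f : L2) :
    l2Incl (multL2 a f) = fourierMultiplierCLM ℂ (a : E3 → ℂ) (l2Incl f) := by
  rw [multL2_apply, l2Incl_fourierL2_symm, l2Incl_mulL2 ha, l2Incl_fourierL2,
    fourierMultiplierCLM_apply]

/-- The symbol `⟨ξ⟩ ^ (-s)`, for `s ≥ 0`. -/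
def besselSymbol (s : ℝ) (hs : 0 ≤ s) : E3 →ᵇ ℂ :=
  BoundedContinuousFunction.ofNormedAddCommGroup
    (fun x : E3 => (((1 + ‖x‖ ^ 2) ^ (-s / 2) : ℝ) : ℂ))
    (by
      have : (fun x : E3 => (((1 + ‖x‖ ^ 2) ^ (-s / 2) : ℝ) : ℂ)).HasTemperateGrowth := by fun_prop
      exact this.1.continuous) 1
    (fun x => by
      rw [Complex.norm_real, Real.norm_eq_abs, abs_eq_self.mpr (by positivity)]
      exact Real.rpow_le_one_of_one_le_of_nonpos (by simp) (by linarith))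

theorem besselSymbol_temperate (s : ℝ) (hs : 0 ≤ s) :
    (besselSymbol s hs : E3 → ℂ).HasTemperateGrowth := by
  have : (fun x : E3 => (((1 + ‖x‖ ^ 2) ^ (-s / 2) : ℝ) : ℂ)).HasTemperateGrowth := by fun_prop
  exact this

/-! ### Elements of `H¹` as functions -/

theorem l2rep_l2Incl (f : L2) : l2rep (l2Incl f) = f := by
  have h : l2Incl f ∈ LinearMap.range l2Incl := ⟨f, rfl⟩
  rw [l2rep, dif_pos h]
  exact (LinearEquiv.ofInjective l2Incl l2Incl_injective).symm_apply_apply f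

theorem l2Incl_l2rep {T : 𝓢'(E3, ℂ)} (hT : T ∈ LinearMap.range l2Incl) : l2Incl (l2rep T) = T := by
  obtain ⟨f, rfl⟩ := hT
  rw [l2rep_l2Incl]

theorem l2Incl_apply (f : L2) (ψ : 𝓢(E3, ℂ)) : l2Incl f ψ = ∫ x, ψ x * f x := by
  rw [show l2Incl f ψ = ∫ x, ψ x • f x from Lp.toTemperedDistribution_apply f ψ]
  rfl

theorem HSpace.l2Incl_toL2 {k s : ℝ} (u : HSpace k s) : l2Incl u.toL2 = sobolevOp k s u.toDist :=
  congrArg Subtype.val ((LinearEquiv.ofInjective l2Incl l2Incl_injective).apply_symm_apply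
    ((LinearMap.codRestrict (LinearMap.range l2Incl)
      ((sobolevOp k s).toLinearMap ∘ₗ HSpace.toDist) (fun T => T.2)) u))

theorem HSpace.norm_def {k s : ℝ} (u : HSpace k s) : ‖u‖ = ‖u.toL2‖ := rfl

theorem HSpace.ext {k s : ℝ} {u v : HSpace k s} (h : u.toDist = v.toDist) : u = v := Subtype.ext h

theorem weightOp_zero (T : 𝓢'(E3, ℂ)) : weightOp 0 T = T := by
  have := smulLeftCLM_const (E := E3) 1 T
  rw [one_smul] at this
  rw [weightOp]
  convert this using 4
  simp

theorem sobolevOp_zero_right (k : ℝ) (T : 𝓢'(E3, ℂ)) : sobolevOp k 0 T = besselPotential E3 ℂ k T :=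
  weightOp_zero _

/-- The element of `H^{k,s}` given by a tempered distribution. -/
def HSpace.mk {k s : ℝ} (T : 𝓢'(E3, ℂ)) (hT : sobolevOp k s T ∈ LinearMap.range l2Incl) :
    HSpace k s := ⟨T, hT⟩

theorem memSobolev_zero_iff' {T : 𝓢'(E3, ℂ)} : MemSobolev 0 2 T ↔ T ∈ LinearMap.range l2Incl := by
  rw [memSobolev_zero_iff]
  exact ⟨fun ⟨f, hf⟩ => ⟨f, hf.symm⟩, fun ⟨f, hf⟩ => ⟨f, hf.symm⟩⟩

theorem H1.memSobolev (u : H1) : MemSobolev 1 2 u.toDist :=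
  ⟨u.toL2, by rw [← sobolevOp_zero_right, ← HSpace.l2Incl_toL2]; rfl⟩

theorem MemSobolev.mem_sobolev {T : 𝓢'(E3, ℂ)} {k : ℝ} (h : MemSobolev k 2 T) :
    sobolevOp k 0 T ∈ LinearMap.range l2Incl := by
  obtain ⟨f, hf⟩ := h
  exact ⟨f, by rw [sobolevOp_zero_right, hf]; rfl⟩

/-- The inclusion of `H¹` in `L²`. -/
def emb : H1 →L[ℂ] L2 :=
  (multL2 (besselSymbol 1 zero_le_one)).comp
    (LinearMap.mkContinuous (HSpace.toL2 : H1 →ₗ[ℂ] L2) 1 fun u => by rw [one_mul]; exact le_rfl)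

theorem l2Incl_emb (u : H1) : l2Incl (emb u) = u.toDist := by
  have h1 : l2Incl (emb u) = besselPotential E3 ℂ (-1) (l2Incl u.toL2) :=
    l2Incl_multL2 (besselSymbol_temperate 1 zero_le_one) _
  rw [h1, HSpace.l2Incl_toL2, sobolevOp_zero_right]
  simp

theorem fn_eq_emb (u : H1) : fn u = emb u := by
  rw [fn, ← l2Incl_emb, l2rep_l2Incl]

theorem memLp_fn (u : H1) : MemLp (fn u) 2 := by
  rw [fn_eq_emb]
  exact Lp.memLp _

theorem fn_add (u v : H1) : ∀ᵐ x, fn (u + v) x = fn u x + fn v x := by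
  simp only [fn_eq_emb, map_add]
  exact Lp.coeFn_add _ _

/-- Schwartz functions as elements of `H¹`. -/
def ofSchwartz : 𝓢(E3, ℂ) →ₗ[ℂ] H1 where
  toFun ψ := HSpace.mk (ψ : 𝓢'(E3, ℂ)) (MemSobolev.mem_sobolev ψ.memSobolev)
  map_add' ψ ψ' := HSpace.ext
    (map_add (SchwartzMap.toTemperedDistributionCLM E3 ℂ volume) ψ ψ')
  map_smul' c ψ := HSpace.ext
    (map_smul (SchwartzMap.toTemperedDistributionCLM E3 ℂ volume) c ψ)

theorem toDist_ofSchwartz (ψ : 𝓢(E3, ℂ)) : (ofSchwartz ψ).toDist = (ψ : 𝓢'(E3, ℂ)) := rfl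

theorem l2Incl_toLp (ψ : 𝓢(E3, ℂ)) : l2Incl (ψ.toLp 2) = (ψ : 𝓢'(E3, ℂ)) :=
  Lp.toTemperedDistribution_toLp_eq ψ

theorem emb_ofSchwartz (ψ : 𝓢(E3, ℂ)) : emb (ofSchwartz ψ) = ψ.toLp 2 :=
  l2Incl_injective (by rw [l2Incl_emb, toDist_ofSchwartz, l2Incl_toLp])

theorem fn_ofSchwartz (ψ : 𝓢(E3, ℂ)) : ∀ᵐ x, fn (ofSchwartz ψ) x = ψ x := by
  rw [fn_eq_emb, emb_ofSchwartz]
  exact SchwartzMap.coeFn_toLp ψ 2 volume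

theorem pair_eq (Φ : 𝓢(E3, ℂ)) (u : H1) : pair Φ u = u.toDist Φ := by
  rw [pair, ← l2Incl_emb, l2Incl_apply, fn_eq_emb]

/-- Complex conjugation of Schwartz functions. -/
def conjS (ψ : 𝓢(E3, ℂ)) : 𝓢(E3, ℂ) :=
  SchwartzMap.postcompCLM (𝕜 := ℝ) (Complex.conjCLE : ℂ →L[ℝ] ℂ) ψ

@[simp] theorem conjS_apply (ψ : 𝓢(E3, ℂ)) (x : E3) : conjS ψ x = conj (ψ x) := rfl

theorem conjS_conjS (ψ : 𝓢(E3, ℂ)) : conjS (conjS ψ) = ψ := by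
  ext x
  simp

theorem integrable_schwartz_mul_fn (Φ : 𝓢(E3, ℂ)) (u : H1) : Integrable fun x => Φ x * fn u x :=
  (Φ.memLp 2 volume).integrable_mul (memLp_fn u)

theorem pairConj_eq (Ψ : 𝓢(E3, ℂ)) (u : H1) : pairConj Ψ u = conj (pair (conjS Ψ) u) := by
  rw [pairConj, pair, ← integral_conj]
  simp

theorem pairConj_conjS (Ψ : 𝓢(E3, ℂ)) (u : H1) : pairConj (conjS Ψ) u = conj (pair Ψ u) := by
  rw [pairConj_eq, conjS_conjS]

end NLSNormalForm

end


noncomputable section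

namespace NLSNormalForm

open scoped BoundedContinuousFunction FourierTransform ENNReal

/-! ### Multiplication by Schwartz functions in Sobolev spaces -/

theorem lineDerivOp_smulLeft (m : E3) (V : 𝓢(E3, ℂ)) (ψ : 𝓢(E3, ℂ)) :
    ∂_{m} (SchwartzMap.smulLeftCLM ℂ V ψ) =
      SchwartzMap.smulLeftCLM ℂ (∂_{m} V : 𝓢(E3, ℂ)) ψ + SchwartzMap.smulLeftCLM ℂ V (∂_{m} ψ) := by
  ext x
  have hV := V.hasTemperateGrowth
  have hV' := (∂_{m} V : 𝓢(E3, ℂ)).hasTemperateGrowth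
  rw [add_apply, SchwartzMap.smulLeftCLM_apply_apply hV,
    SchwartzMap.smulLeftCLM_apply_apply hV', SchwartzMap.lineDerivOp_apply_eq_fderiv,
    SchwartzMap.lineDerivOp_apply_eq_fderiv, SchwartzMap.lineDerivOp_apply_eq_fderiv,
    SchwartzMap.smulLeftCLM_apply hV, fderiv_fun_smul V.differentiableAt ψ.differentiableAt]
  simp
  ring

theorem lineDerivOp_smulLeftCLM (m : E3) (V : 𝓢(E3, ℂ)) (T : 𝓢'(E3, ℂ)) :
    ∂_{m} (smulLeftCLM ℂ V T) = smulLeftCLM ℂ (∂_{m} V : 𝓢(E3, ℂ)) T + smulLeftCLM ℂ V (∂_{m} T) := by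
  ext ψ
  have h := lineDerivOp_smulLeft m V ψ
  rw [lineDerivOp_apply_apply, smulLeftCLM_apply_apply, add_apply,
    smulLeftCLM_apply_apply, smulLeftCLM_apply_apply, lineDerivOp_apply_apply, h]
  simp only [map_neg, map_add]
  ring

/-- The Fourier transform has `2π` in the exponent, so `⟨ξ⟩²` corresponds to `1 - (2π)⁻² Δ`. -/
theorem laplacian_eq_besselPotential (T : 𝓢'(E3, ℂ)) :
    besselPotential E3 ℂ 2 T = T - ((2 * Real.pi) ^ 2 : ℝ)⁻¹ • Δ T := by
  rw [TemperedDistribution.laplacian_eq_fourierMultiplierCLM, besselPotential]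
  have h1 : (fun x : E3 => (((1 + ‖x‖ ^ 2) ^ ((2 : ℝ) / 2) : ℝ) : ℂ)) =
      fun x => ∑ i ∈ (Finset.univ : Finset (Fin 2)), ![fun _ => 1, fun x => Complex.ofReal (‖x‖ ^ 2)] i x := by
    ext x
    simp
  rw [h1, fourierMultiplierCLM_sum]
  · have h2 : fourierMultiplierCLM ℂ (fun _ : E3 => (1 : ℂ)) T = T := by simp
    rw [sum_apply, Fin.sum_univ_two]
    simp only [Matrix.cons_val_zero, Matrix.cons_val_one]
    rw [h2, smul_smul, sub_eq_add_neg, ← neg_smul]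
    congr 1
    have : -(((2 * Real.pi) ^ 2 : ℝ)⁻¹ * -(2 * Real.pi) ^ 2) = 1 := by
      have := Real.pi_pos
      field_simp
    rw [this, one_smul]
  · intro i _
    fin_cases i
    · simp only [Matrix.cons_val_zero, Fin.zero_eta]; fun_prop
    · simp only [Matrix.cons_val_one, Matrix.cons_val_fin_one, Fin.mk_one]; fun_prop

theorem MemSobolev.real_smul {s : ℝ} (c : ℝ) {T : 𝓢'(E3, ℂ)} (h : MemSobolev s 2 T) :
    MemSobolev s 2 (c • T) := by
  have := h.smul (c : ℂ)
  rwa [Complex.coe_smul] at this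

theorem MemSobolev.sum' {α : Type} {s : ℝ} (I : Finset α) {T : α → 𝓢'(E3, ℂ)}
    (h : ∀ i ∈ I, MemSobolev s 2 (T i)) : MemSobolev s 2 (∑ i ∈ I, T i) := by
  classical
  induction I using Finset.induction_on with
  | empty => simp
  | insert a I ha ih =>
    rw [Finset.sum_insert ha]
    exact (h a (by simp)).add (ih fun i hi => h i (by simp [hi]))

theorem memSobolev_of_laplacian {s : ℝ} {T : 𝓢'(E3, ℂ)} (h : MemSobolev s 2 T)
    (h' : MemSobolev s 2 (Δ T)) : MemSobolev (s + 2) 2 T := by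
  rw [add_comm, ← memSobolev_besselPotential_iff, laplacian_eq_besselPotential]
  exact h.sub (MemSobolev.real_smul _ h')

/-- Both `T` and its Laplacian, a sum of derivatives of the `∂ T`, have order `s - 1`; ellipticity
then gives order `s + 1`. -/
theorem memSobolev_of_lineDerivOp {s : ℝ} {T : 𝓢'(E3, ℂ)} (h : MemSobolev s 2 T)
    (h' : ∀ m : E3, MemSobolev s 2 (∂_{m} T)) : MemSobolev (s + 1) 2 T := by
  have h1 : s + 1 = (s - 1) + 2 := by ring
  rw [h1]
  refine memSobolev_of_laplacian (h.mono (by linarith)) ?_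
  rw [TemperedDistribution.laplacian_eq_sum (EuclideanSpace.basisFun (Fin 3) ℝ)]
  exact MemSobolev.sum' _ fun i _ => (h' _).lineDerivOp

/-- Induction on the order, by the product rule. Natural orders are all that the bootstrap for
elliptic regularity uses. -/
theorem memSobolev_smulLeftCLM (k : ℕ) : ∀ (V : 𝓢(E3, ℂ)) {T : 𝓢'(E3, ℂ)}, MemSobolev k 2 T →
    MemSobolev k 2 (smulLeftCLM ℂ V T) := by
  induction k with
  | zero =>
    intro V T hT
    rw [Nat.cast_zero, memSobolev_zero_iff'] at *
    obtain ⟨f, rfl⟩ := hT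
    exact ⟨mulL2 (SchwartzMap.toBoundedContinuousFunction V) f,
      l2Incl_mulL2 (a := SchwartzMap.toBoundedContinuousFunction V) V.hasTemperateGrowth f⟩
  | succ k ih =>
    intro V T hT
    rw [Nat.cast_succ] at *
    have hT' : MemSobolev k 2 T := hT.mono (by simp)
    refine memSobolev_of_lineDerivOp (ih V hT') fun m => ?_
    rw [lineDerivOp_smulLeftCLM]
    refine (ih _ hT').add (ih _ ?_)
    have := hT.lineDerivOp (m := m)
    rwa [add_sub_cancel_right] at this

/-! ### Distributions in all Sobolev spaces -/

theorem besselSymbol_apply (s : ℝ) (hs : 0 ≤ s) (x : E3) :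
    besselSymbol s hs x = (((1 + ‖x‖ ^ 2) ^ (-s / 2) : ℝ) : ℂ) := rfl

/-- Since `T` has order `n + 2` and `2 > 3/2`, the Fourier transform of `T` times `⟨ξ⟩^n` is
integrable in dimension three. -/
theorem exists_fourier_integrable {T : 𝓢'(E3, ℂ)} (h : ∀ k : ℕ, MemSobolev k 2 T) :
    ∃ v : E3 → ℂ, (∀ n : ℕ, Integrable fun ξ => ‖ξ‖ ^ n * ‖v ξ‖) ∧ AEStronglyMeasurable v ∧
      ∀ ψ : 𝓢(E3, ℂ), T ψ = ∫ ξ, 𝓕⁻ ψ ξ * v ξ := by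
  have key : ∀ n : ℕ, ∃ w : Lp ℂ 1 (volume : Measure E3),
      𝓕 (besselPotential E3 ℂ n T) = (w : 𝓢'(E3, ℂ)) := by
    intro n
    refine MemSobolev.fourier_memL1 (s := 2) ?_ ?_
    · simp; norm_num
    · rw [memSobolev_besselPotential_iff]
      exact_mod_cast h (n + 2)
  choose w hw using key
  have h0 : 𝓕 T = (w 0 : 𝓢'(E3, ℂ)) := by
    rw [← hw 0]; simp
  have hinj : Function.Injective (Lp.toTemperedDistributionCLM ℂ (volume : Measure E3) 1) :=
    LinearMap.ker_eq_bot.mp (Lp.ker_toTemperedDistributionCLM_eq_bot (F := ℂ)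
      (μ := (volume : Measure E3)) (p := 1))
  -- The functions obtained for the various `n` differ only by the weight: `w n` is `⟨ξ⟩^n` times `w
  -- 0`, so that a single function has all its moments integrable.
  have h1 : ∀ n : ℕ, (bddLp (besselSymbol n n.cast_nonneg) • w n : Lp ℂ 1 (volume : Measure E3)) = w 0 := by
    intro n
    apply hinj
    have e1 : Lp.toTemperedDistributionCLM ℂ (volume : Measure E3) 1
        (bddLp (besselSymbol n n.cast_nonneg) • w n) =
        smulLeftCLM ℂ (besselSymbol n n.cast_nonneg : E3 → ℂ) (w n : 𝓢'(E3, ℂ)) :=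
      Lp.toTemperedDistribution_smul_eq (besselSymbol_temperate n n.cast_nonneg)
        (besselSymbol n n.cast_nonneg).memLp_top (w n)
    rw [e1, ← hw, Lp.toTemperedDistributionCLM_apply, ← h0,
      fourier_besselPotential_eq_smulLeftCLM_fourier_apply]
    have := fourier_besselPotential_eq_smulLeftCLM_fourier_apply (-n : ℝ) (besselPotential E3 ℂ n T)
    rw [besselPotential_besselPotential_apply, add_neg_cancel, besselPotential_zero,
      fourier_besselPotential_eq_smulLeftCLM_fourier_apply] at this
    exact this.symm
  refine ⟨w 0, fun n => ?_, Lp.aestronglyMeasurable _, fun ψ => ?_⟩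
  · have i1 : Integrable (w n : E3 → ℂ) := L1.integrable_coeFn (w n)
    refine i1.norm.mono' ((by fun_prop : Continuous fun ξ : E3 => ‖ξ‖ ^ n).aestronglyMeasurable.mul
      (Lp.aestronglyMeasurable (w 0)).norm) ?_
    have h2 : ((bddLp (besselSymbol n n.cast_nonneg) • w n : Lp ℂ 1 (volume : Measure E3)) : E3 → ℂ)
        =ᵐ[volume] (bddLp (besselSymbol n n.cast_nonneg) : E3 → ℂ) • (w n : E3 → ℂ) :=
      Lp.coeFn_lpSMul _ _
    rw [h1] at h2
    filter_upwards [h2, ((besselSymbol n n.cast_nonneg).memLp_top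
      (μ := (volume : Measure E3))).coeFn_toLp] with ξ h2 h3
    rw [h2, Pi.smul_apply', bddLp, h3, smul_eq_mul, norm_mul, besselSymbol_apply, norm_mul, norm_pow,
      norm_norm, norm_mul, norm_norm, norm_norm]
    have h4 : ‖ξ‖ ^ n * ‖(((1 + ‖ξ‖ ^ 2) ^ (-(n : ℝ) / 2) : ℝ) : ℂ)‖ ≤ 1 := by
      rw [Complex.norm_real, Real.norm_of_nonneg (by positivity), neg_div,
        Real.rpow_neg (by positivity), ← div_eq_mul_inv, div_le_one (by positivity),
        div_eq_inv_mul, Real.rpow_mul (by positivity), Real.rpow_natCast]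
      gcongr
      rw [← Real.sqrt_sq (norm_nonneg ξ)]
      rw [← one_div, ← Real.sqrt_eq_rpow]
      apply Real.sqrt_le_sqrt
      rw [Real.sqrt_sq (norm_nonneg ξ)]
      simp
    calc _ = (‖ξ‖ ^ n * ‖(((1 + ‖ξ‖ ^ 2) ^ (-(n : ℝ) / 2) : ℝ) : ℂ)‖) * ‖w n ξ‖ := by ring
      _ ≤ 1 * ‖w n ξ‖ := by gcongr
      _ = _ := one_mul _
  · have : T = 𝓕⁻ (w 0 : 𝓢'(E3, ℂ)) := by
      rw [← h0, FourierTransform.fourierInv_fourier_eq]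
    rw [this, TemperedDistribution.fourierInv_apply, Lp.toTemperedDistribution_apply]
    rfl

/-- A distribution in all Sobolev spaces is a smooth function with bounded derivatives. -/
theorem exists_temperate {T : 𝓢'(E3, ℂ)} (h : ∀ k : ℕ, MemSobolev k 2 T) :
    ∃ g : E3 → ℂ, g.HasTemperateGrowth ∧ ∀ ψ : 𝓢(E3, ℂ), T ψ = ∫ x, ψ x * g x := by
  obtain ⟨v, hv, hvm, hT⟩ := exists_fourier_integrable h
  -- The reflection turns the inverse Fourier transform into the direct one, whose differentiability
  -- under integrable moments is then used.
  set u : E3 → ℂ := fun ξ => v (-ξ) with hu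
  have hui : ∀ n : ℕ, Integrable fun ξ => ‖ξ‖ ^ n * ‖u ξ‖ := by
    intro n
    have := (hv n).comp_neg
    simpa using this
  have hum : AEStronglyMeasurable u := hvm.comp_measurePreserving
    (Measure.measurePreserving_neg (volume : Measure E3))
  have hu1 : Integrable u := by
    have := hui 0
    simp only [pow_zero, one_mul] at this
    exact (integrable_norm_iff hum).mp this
  refine ⟨𝓕 u, ⟨?_, fun n => ⟨0, ∫ ξ, ‖VectorFourier.fourierPowSMulRight (innerSL ℝ) u ξ n‖,
    fun x => ?_⟩⟩, fun ψ => ?_⟩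
  · exact contDiff_infty.2 fun N => Real.contDiff_fourier (N := N) fun n _ => hui n
  · rw [Real.iteratedFDeriv_fourier (N := n) (fun k _ => hui k) hum le_rfl, pow_zero, mul_one]
    exact VectorFourier.norm_fourierIntegral_le_integral_norm _ _ _ _ _
  · have e1 : T ψ = ∫ ξ, 𝓕 (ψ : E3 → ℂ) ξ * u ξ := by
      rw [hT, ← integral_neg_eq_self]
      congr 1
      ext ξ
      rw [SchwartzMap.fourierInv_coe, Real.fourierInv_eq_fourier_neg, neg_neg]
    rw [e1]
    have := VectorFourier.integral_fourierIntegral_smul_eq_flip (𝕜 := ℝ) (μ := (volume : Measure E3))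
      (ν := (volume : Measure E3)) (L := innerₗ E3) (f := (ψ : E3 → ℂ)) (g := u)
      Real.continuous_fourierChar continuous_inner ψ.integrable hu1
    simpa [flip_innerₗ] using! this

/-- The product of a Schwartz function with a distribution in all Sobolev spaces is Schwartz. -/
theorem exists_schwartz_smulLeftCLM {T : 𝓢'(E3, ℂ)} (h : ∀ k : ℕ, MemSobolev k 2 T)
    (V : 𝓢(E3, ℂ)) : ∃ σ : 𝓢(E3, ℂ), smulLeftCLM ℂ V T = (σ : 𝓢'(E3, ℂ)) := by
  obtain ⟨g, hg, hT⟩ := exists_temperate h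
  refine ⟨SchwartzMap.smulLeftCLM ℂ g V, ?_⟩
  ext ψ
  rw [smulLeftCLM_apply_apply, hT, SchwartzMap.coe_apply]
  congr 1
  ext x
  rw [SchwartzMap.smulLeftCLM_apply_apply V.hasTemperateGrowth, SchwartzMap.smulLeftCLM_apply_apply hg]
  simp only [smul_eq_mul]
  ring

/-! ### The free resolvent -/

/-- The symbol `(κ + 4π²|ξ|²)⁻¹` of `(-Δ + κ)⁻¹`. -/
def resSymbol (κ : ℝ) (ξ : E3) : ℂ := ((κ + (2 * Real.pi) ^ 2 * ‖ξ‖ ^ 2)⁻¹ : ℝ)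

theorem resSymbol_temperate {κ : ℝ} (hκ : 0 < κ) : (resSymbol κ).HasTemperateGrowth := by
  have h1 := (Function.hasTemperateGrowth_one_add_norm_sq_rpow E3 (-1)).comp
    (ContinuousLinearMap.hasTemperateGrowth ((2 * Real.pi / Real.sqrt κ) • ContinuousLinearMap.id ℝ E3))
  have h2 : resSymbol κ = fun ξ => ((κ⁻¹ : ℝ) : ℂ) * Complex.ofReal
      (((fun x : E3 => (1 + ‖x‖ ^ 2) ^ (-1 : ℝ)) ∘
      ((2 * Real.pi / Real.sqrt κ) • ContinuousLinearMap.id ℝ E3)) ξ) := by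
    ext ξ
    rw [resSymbol, ← Complex.ofReal_mul]
    congr 1
    simp only [Function.comp_apply, smul_apply, ContinuousLinearMap.id_apply,
      norm_smul, mul_pow, Real.norm_eq_abs, sq_abs, div_pow, Real.sq_sqrt hκ.le]
    rw [Real.rpow_neg_one, ← mul_inv]
    congr 1
    field_simp
  rw [h2]
  fun_prop

theorem norm_resSymbol_le {κ : ℝ} (hκ : 0 < κ) (ξ : E3) : ‖resSymbol κ ξ‖ ≤ κ⁻¹ := by
  rw [resSymbol, Complex.norm_real, Real.norm_of_nonneg (by positivity)]
  gcongr
  have : 0 ≤ (2 * Real.pi) ^ 2 * ‖ξ‖ ^ 2 := by positivity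
  linarith

theorem resolvent_left {κ : ℝ} (hκ : 0 < κ) (T : 𝓢'(E3, ℂ)) :
    fourierMultiplierCLM ℂ (resSymbol κ) (-(Δ T) + (κ : ℂ) • T) = T ∧
      -(Δ (fourierMultiplierCLM ℂ (resSymbol κ) T)) +
        (κ : ℂ) • fourierMultiplierCLM ℂ (resSymbol κ) T = T := by
  have ht := resSymbol_temperate hκ
  have hq : (fun x : E3 => Complex.ofReal (‖x‖ ^ 2)).HasTemperateGrowth := by fun_prop
  have hs : ∀ S : 𝓢'(E3, ℂ), (2 * Real.pi) ^ 2 • fourierMultiplierCLM ℂ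
      (resSymbol κ * fun x : E3 => Complex.ofReal (‖x‖ ^ 2)) S +
      (κ : ℂ) • fourierMultiplierCLM ℂ (resSymbol κ) S = S := by
    intro S
    have e1 : ∑ i ∈ (Finset.univ : Finset (Fin 2)), fourierMultiplierCLM ℂ
      (![(((2 * Real.pi) ^ 2 : ℝ) : ℂ) • (resSymbol κ * fun x : E3 => Complex.ofReal (‖x‖ ^ 2)),
        (κ : ℂ) • resSymbol κ] i) = ContinuousLinearMap.id ℂ _ := by
      rw [← fourierMultiplierCLM_sum]
      · have : (fun x : E3 => ∑ i ∈ (Finset.univ : Finset (Fin 2)),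
          (![(((2 * Real.pi) ^ 2 : ℝ) : ℂ) • (resSymbol κ * fun x : E3 => Complex.ofReal (‖x‖ ^ 2)),
          (κ : ℂ) • resSymbol κ] i) x) = fun _ => 1 := by
          ext x
          simp only [Fin.sum_univ_two, Matrix.cons_val_zero, Matrix.cons_val_one, Pi.smul_apply,
            Pi.mul_apply, smul_eq_mul, resSymbol]
          norm_cast
          have : κ + (2 * Real.pi) ^ 2 * ‖x‖ ^ 2 ≠ 0 := by positivity
          field_simp
          ring
        rw [this]
        simp
      · intro i _
        fin_cases i
        · simp only [Matrix.cons_val_zero, Fin.zero_eta]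
          exact (Function.HasTemperateGrowth.const _).mul (ht.mul hq)
        · simp only [Matrix.cons_val_one, Fin.mk_one]
          exact (Function.HasTemperateGrowth.const _).mul ht
    have e2 := DFunLike.congr_fun e1 S
    rw [Fin.sum_univ_two] at e2
    simp only [Matrix.cons_val_zero, Matrix.cons_val_one] at e2
    rw [fourierMultiplierCLM_smul (ht.mul hq), fourierMultiplierCLM_smul ht] at e2
    rw [← Complex.coe_smul]
    exact e2
  constructor
  · rw [map_add, map_neg, map_smul, TemperedDistribution.laplacian_eq_fourierMultiplierCLM,
      ContinuousLinearMap.map_smul_of_tower,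
      fourierMultiplierCLM_fourierMultiplierCLM_apply hq ht, neg_smul, neg_neg,
      mul_comm _ (resSymbol κ)]
    exact hs T
  · rw [TemperedDistribution.laplacian_eq_fourierMultiplierCLM,
      fourierMultiplierCLM_fourierMultiplierCLM_apply ht hq, neg_smul, neg_neg]
    exact hs T

/-- Elliptic regularity: an `L²` solution of `(-Δ + κ) T = -V T + η`, with `κ > 0` and Schwartz
functions `V, η`, is a Schwartz function. -/
theorem exists_schwartz_of_elliptic {κ : ℝ} (hκ : 0 < κ) (V η : 𝓢(E3, ℂ)) {T : 𝓢'(E3, ℂ)}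
    (hT : T ∈ LinearMap.range l2Incl)
    (h : -(Δ T) + (κ : ℂ) • T = -(smulLeftCLM ℂ V T) + (η : 𝓢'(E3, ℂ))) :
    ∃ σ : 𝓢(E3, ℂ), T = (σ : 𝓢'(E3, ℂ)) := by
  have hlap : Δ T = (κ : ℂ) • T + smulLeftCLM ℂ V T - (η : 𝓢'(E3, ℂ)) := by
    have : Δ T = (κ : ℂ) • T - (-(Δ T) + (κ : ℂ) • T) := by abel
    rw [this, h]
    abel
  -- Bootstrap: by the equation `Δ T` has the regularity of `T`, and each round gains two
  -- derivatives.
  have hk : ∀ k : ℕ, MemSobolev (2 * k : ℕ) 2 T := by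
    intro k
    induction k with
    | zero => simpa using memSobolev_zero_iff'.mpr hT
    | succ k ih =>
      have : ((2 * (k + 1) : ℕ) : ℝ) = (2 * k : ℕ) + 2 := by push_cast; ring
      rw [this]
      refine memSobolev_of_laplacian ih ?_
      rw [hlap]
      exact ((ih.smul _).add (memSobolev_smulLeftCLM _ V ih)).sub η.memSobolev
  have hk' : ∀ k : ℕ, MemSobolev k 2 T := fun k => (hk k).mono (by push_cast; linarith [k.cast_nonneg (α := ℝ)])
  -- The bootstrap gives no decay for `T`. But `V T` decays with `V`, so it is Schwartz, and `T` is
  -- the free resolvent of the Schwartz function `η - V T`.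
  obtain ⟨σ, hσ⟩ := exists_schwartz_smulLeftCLM hk' V
  refine ⟨SchwartzMap.fourierMultiplierCLM ℂ (resSymbol κ) (η - σ), ?_⟩
  have h2 : -(Δ T) + (κ : ℂ) • T = ((η - σ : 𝓢(E3, ℂ)) : 𝓢'(E3, ℂ)) := by
    rw [h, hσ, map_sub]
    abel
  rw [← fourierMultiplierCLM_toTemperedDistributionCLM_eq (resSymbol_temperate hκ), ← h2,
    (resolvent_left hκ T).1]

end NLSNormalForm

end


noncomputable section

namespace NLSNormalForm

open scoped BoundedContinuousFunction FourierTransform ENNReal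

/-! ### Compactness of `(-Δ + κ)⁻¹ V` -/

/-- The operator on `L²` with kernel `v ∈ L²(ℝ³, (L²)*)`. -/
def kernelOp : Lp (L2 →L[ℂ] ℂ) 2 (volume : Measure E3) →L[ℂ] (L2 →L[ℂ] L2) :=
  ((ContinuousLinearMap.apply ℂ ℂ : L2 →L[ℂ] (L2 →L[ℂ] ℂ) →L[ℂ] ℂ).compLpL₂ 2
    (volume : Measure E3)).flip

theorem coeFn_kernelOp (v : Lp (L2 →L[ℂ] ℂ) 2 (volume : Measure E3)) (g : L2) :
    ∀ᵐ ξ, kernelOp v g ξ = v ξ g :=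
  ContinuousLinearMap.coeFn_compLp _ v

/-- A Hilbert–Schmidt argument: an indicator times a fixed functional gives an operator of rank one,
and compactness passes to sums and to limits in norm. -/
theorem isCompactOperator_kernelOp (v : Lp (L2 →L[ℂ] ℂ) 2 (volume : Measure E3)) :
    IsCompactOperator (kernelOp v) := by
  refine Lp.induction (p := 2) (by simp) (fun v => IsCompactOperator (kernelOp v)) ?_ ?_ ?_ v
  · intro L s hs hμ
    have h1 : (kernelOp (Lp.simpleFunc.indicatorConst 2 hs hμ.ne L) : L2 → L2) =
        (ContinuousLinearMap.smulRight (1 : ℂ →L[ℂ] ℂ) (indicatorConstLp 2 hs hμ.ne (1 : ℂ))) ∘ L := by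
      ext1 g
      refine Lp.ext ?_
      filter_upwards [coeFn_kernelOp (Lp.simpleFunc.indicatorConst 2 hs hμ.ne L) g,
        indicatorConstLp_coeFn (p := 2) (hs := hs) (hμs := hμ.ne) (c := L),
        indicatorConstLp_coeFn (p := 2) (hs := hs) (hμs := hμ.ne) (c := (1 : ℂ)),
        Lp.coeFn_smul (L g) (indicatorConstLp 2 hs hμ.ne (1 : ℂ))] with ξ h1 h2 h3 h4
      rw [h1, Lp.simpleFunc.coe_indicatorConst, h2]
      have : (ContinuousLinearMap.smulRight (1 : ℂ →L[ℂ] ℂ)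
        (indicatorConstLp 2 hs hμ.ne (1 : ℂ)) ∘ L) g = L g • indicatorConstLp 2 hs hμ.ne (1 : ℂ) := rfl
      rw [this, h4, Pi.smul_apply, h3]
      by_cases hξ : ξ ∈ s <;> simp [hξ]
    rw [h1]
    exact (isCompactOperator_of_locallyCompactSpace_dom L).clm_comp _
  · intro f g hf hg _ h1 h2
    rw [map_add]
    exact h1.add h2
  · exact isClosed_setOfPred_isCompactOperator.preimage kernelOp.continuous

/-- The character `x ↦ e^{2πi x·ξ}`. -/
def charB (ξ : E3) : E3 →ᵇ ℂ :=
  BoundedContinuousFunction.ofNormedAddCommGroup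
    (fun x : E3 => Complex.exp (Complex.I * ((2 * Real.pi * inner ℝ x ξ : ℝ) : ℂ)))
    (by fun_prop) 1
    (fun x => by rw [Complex.norm_exp]; simp)

theorem charB_apply (ξ x : E3) :
    charB ξ x = Complex.exp (Complex.I * ((2 * Real.pi * inner ℝ x ξ : ℝ) : ℂ)) := rfl

theorem norm_charB_apply (ξ x : E3) : ‖charB ξ x‖ = 1 := by
  rw [charB_apply, Complex.norm_exp]; simp

theorem norm_charB_sub_le (ξ η x : E3) :
    ‖charB ξ x - charB η x‖ ≤ 2 * Real.pi * ‖ξ - η‖ * (1 + ‖x‖ ^ 2) := by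
  have h1 : charB ξ x - charB η x = charB η x *
      (Complex.exp (Complex.I * ((2 * Real.pi * inner ℝ x (ξ - η) : ℝ) : ℂ)) - 1) := by
    rw [charB_apply, charB_apply, mul_sub, mul_one, ← Complex.exp_add, inner_sub_right]
    congr 2
    push_cast
    ring
  rw [h1, norm_mul, norm_charB_apply, one_mul]
  refine Real.norm_exp_I_mul_ofReal_sub_one_le.trans ?_
  have h2 := abs_real_inner_le_norm x (ξ - η)
  rw [norm_mul, Real.norm_of_nonneg (by positivity), Real.norm_eq_abs, mul_assoc]
  have h3 : ‖x‖ ≤ 1 + ‖x‖ ^ 2 := by nlinarith [sq_nonneg (‖x‖ - 1)]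
  have : |inner ℝ x (ξ - η)| ≤ ‖ξ - η‖ * (1 + ‖x‖ ^ 2) := by
    refine h2.trans ?_
    rw [mul_comm]
    gcongr
  have hp := Real.pi_pos
  nlinarith [mul_le_mul_of_nonneg_left this hp.le]

/-- Continuity in `ξ` makes the operator-valued kernel measurable. The Lipschitz constant of the
characters grows with `x`; the weight `1 + |x|²` is put on the Schwartz function. -/
theorem continuous_charB_mul (V : 𝓢(E3, ℂ)) : Continuous fun ξ => mulL2 (charB ξ) (V.toLp 2) := by
  set W : 𝓢(E3, ℂ) := SchwartzMap.smulLeftCLM ℂ (fun x : E3 => ((1 + ‖x‖ ^ 2 : ℝ) : ℂ)) V with hW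
  have hW' : ∀ x, ‖W x‖ = (1 + ‖x‖ ^ 2) * ‖V x‖ := by
    intro x
    rw [hW, SchwartzMap.smulLeftCLM_apply_apply (by fun_prop), norm_smul, Complex.norm_real,
      Real.norm_of_nonneg (by positivity)]
  refine LipschitzWith.continuous (K := Real.toNNReal (2 * Real.pi * ‖W.toLp 2‖))
    (LipschitzWith.of_dist_le_mul fun ξ η => ?_)
  rw [dist_eq_norm, dist_eq_norm, Real.coe_toNNReal _ (by positivity)]
  have : ‖mulL2 (charB ξ) (V.toLp 2) - mulL2 (charB η) (V.toLp 2)‖ ≤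
      (2 * Real.pi * ‖ξ - η‖) * ‖W.toLp 2‖ := by
    refine Lp.norm_le_mul_norm_of_ae_le_mul ?_
    filter_upwards [Lp.coeFn_sub (mulL2 (charB ξ) (V.toLp 2)) (mulL2 (charB η) (V.toLp 2)),
      coeFn_mulL2 (charB ξ) (V.toLp 2), coeFn_mulL2 (charB η) (V.toLp 2),
      SchwartzMap.coeFn_toLp V 2 volume, SchwartzMap.coeFn_toLp W 2 volume] with x h1 h2 h3 h4 h5
    rw [h1, Pi.sub_apply, h2, h3, h4, h5, hW', ← sub_mul, norm_mul, ← mul_assoc]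
    gcongr
    exact norm_charB_sub_le ξ η x
  linarith

/-- The bounded symbol of `(-Δ + κ)⁻¹`. -/
def resB (κ : ℝ) (hκ : 0 < κ) : E3 →ᵇ ℂ :=
  BoundedContinuousFunction.ofNormedAddCommGroup (resSymbol κ)
    (resSymbol_temperate hκ).1.continuous κ⁻¹ (norm_resSymbol_le hκ)

/-- The square is dominated by a multiple of `⟨ξ⟩⁻⁴`, which is integrable in dimension three. -/
theorem memLp_resSymbol {κ : ℝ} (hκ : 0 < κ) : MemLp (resSymbol κ) 2 := by
  have hc : Continuous (resSymbol κ) := (resSymbol_temperate hκ).1.continuous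
  rw [memLp_two_iff_integrable_sq_norm hc.aestronglyMeasurable]
  have h1 : Integrable fun x : E3 => (min κ 1)⁻¹ ^ 2 * (1 + ‖x‖ ^ 2) ^ (-(4 : ℝ) / 2) :=
    (integrable_rpow_neg_one_add_norm_sq (by simp; norm_num)).const_mul _
  refine h1.mono' (hc.norm.pow 2).aestronglyMeasurable (Filter.Eventually.of_forall fun x => ?_)
  have hm : 0 < min κ 1 := lt_min hκ one_pos
  have h2 : (1 + ‖x‖ ^ 2) ^ (-(4 : ℝ) / 2) = ((1 + ‖x‖ ^ 2)⁻¹) ^ 2 := by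
    rw [show -(4 : ℝ) / 2 = -((2 : ℕ) : ℝ) by norm_num, Real.rpow_neg (by positivity),
      Real.rpow_natCast, inv_pow]
  rw [h2, ← mul_pow, ← mul_inv, norm_pow, norm_norm]
  gcongr
  rw [resSymbol, Complex.norm_real, Real.norm_of_nonneg (by positivity)]
  have hp : 1 ≤ (2 * Real.pi) ^ 2 := by nlinarith [Real.pi_gt_three]
  have hx : 0 ≤ ‖x‖ ^ 2 := by positivity
  gcongr
  nlinarith [min_le_left κ 1, min_le_right κ 1]

/-- The kernel of `(-Δ + κ)⁻¹ V` on the Fourier side. -/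
def resKernel (κ : ℝ) (V : 𝓢(E3, ℂ)) (ξ : E3) : L2 →L[ℂ] ℂ :=
  resSymbol κ ξ • innerSL ℂ (mulL2 (charB ξ) ((conjS V).toLp 2))

theorem norm_mulL2_charB_le (ξ : E3) (g : L2) : ‖mulL2 (charB ξ) g‖ ≤ ‖g‖ := by
  refine Lp.norm_le_norm_of_ae_le ?_
  filter_upwards [coeFn_mulL2 (charB ξ) g] with x h
  rw [h, norm_mul, norm_charB_apply, one_mul]

theorem memLp_resKernel {κ : ℝ} (hκ : 0 < κ) (V : 𝓢(E3, ℂ)) : MemLp (resKernel κ V) 2 := by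
  have hc : Continuous (resKernel κ V) :=
    (resSymbol_temperate hκ).1.continuous.smul
      ((innerSL ℂ (E := L2)).continuous.comp (continuous_charB_mul (conjS V)))
  refine ((memLp_resSymbol hκ).const_mul (‖(conjS V).toLp 2‖ : ℂ)).mono hc.aestronglyMeasurable
    (Filter.Eventually.of_forall fun ξ => ?_)
  rw [resKernel, norm_smul, innerSL_apply_norm, norm_mul, mul_comm, Complex.norm_real, norm_norm]
  gcongr
  exact norm_mulL2_charB_le _ _

theorem resKernel_apply (κ : ℝ) (V : 𝓢(E3, ℂ)) (ξ : E3) (g : L2) :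
    resKernel κ V ξ g = resSymbol κ ξ * 𝓕 (fun x => V x * g x) ξ := by
  rw [resKernel, smul_apply, innerSL_apply_apply, smul_eq_mul, L2.inner_def,
    Real.fourier_eq']
  congr 1
  refine integral_congr_ae ?_
  filter_upwards [coeFn_mulL2 (charB ξ) ((conjS V).toLp 2),
    SchwartzMap.coeFn_toLp (conjS V) 2 volume] with x h1 h2
  rw [h1, h2, RCLike.inner_apply, map_mul, conjS_apply, Complex.conj_conj, charB_apply,
    ← Complex.exp_conj, smul_eq_mul]
  simp only [map_mul, Complex.conj_I, Complex.conj_ofReal]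
  rw [show ((-2 * Real.pi * inner ℝ x ξ : ℝ) : ℂ) * Complex.I =
    -Complex.I * ((2 * Real.pi * inner ℝ x ξ : ℝ) : ℂ) by push_cast; ring]
  ring

/-- The product `V g` of two square integrable functions is integrable, so its Fourier transform is
given by the pointwise integral, which is an inner product of `g` with a function depending on `ξ`.
The identity is checked against Schwartz functions. -/
theorem multL2_comp_mulL2 {κ : ℝ} (hκ : 0 < κ) (V : 𝓢(E3, ℂ)) (g : L2) :
    multL2 (resB κ hκ) (mulL2 (SchwartzMap.toBoundedContinuousFunction V) g) =
      fourierL2.symm (kernelOp ((memLp_resKernel hκ V).toLp _) g) := by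
  rw [multL2_apply]
  congr 1
  apply l2Incl_injective
  set h : L2 := mulL2 (SchwartzMap.toBoundedContinuousFunction V) g with hh
  have hVh : ∀ᵐ x, h x = V x * g x := coeFn_mulL2 _ g
  have hi : Integrable h :=
    (((V.memLp 2 volume).integrable_mul (Lp.memLp g)).congr (by
      filter_upwards [hVh] with x hx; rw [hx]; rfl))
  have ht : (resB κ hκ : E3 → ℂ).HasTemperateGrowth := resSymbol_temperate hκ
  ext ψ
  rw [l2Incl_mulL2 ht, smulLeftCLM_apply_apply, l2Incl_fourierL2, TemperedDistribution.fourier_apply,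
    l2Incl_apply, l2Incl_apply]
  set ψ' : 𝓢(E3, ℂ) := SchwartzMap.smulLeftCLM ℂ (resB κ hκ) ψ with hψ'
  have e1 : ∫ x, 𝓕 ψ' x * h x = ∫ ξ, ψ' ξ * 𝓕 (h : E3 → ℂ) ξ := by
    have := VectorFourier.integral_fourierIntegral_smul_eq_flip (𝕜 := ℝ) (μ := (volume : Measure E3))
      (ν := (volume : Measure E3)) (L := innerₗ E3) (f := (ψ' : E3 → ℂ)) (g := (h : E3 → ℂ))
      Real.continuous_fourierChar continuous_inner ψ'.integrable hi
    simpa [flip_innerₗ] using! this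
  rw [e1]
  refine integral_congr_ae ?_
  filter_upwards [coeFn_kernelOp ((memLp_resKernel hκ V).toLp _) g,
    (memLp_resKernel hκ V).coeFn_toLp] with ξ h1 h2
  have e2 : 𝓕 (h : E3 → ℂ) ξ = 𝓕 (fun x => V x * g x) ξ := by
    rw [Real.fourier_eq', Real.fourier_eq']
    refine integral_congr_ae ?_
    filter_upwards [hVh] with x hx
    rw [hx]
  rw [h1, h2, resKernel_apply, e2, hψ', SchwartzMap.smulLeftCLM_apply_apply ht, smul_eq_mul]
  change resSymbol κ ξ * ψ ξ * _ = _
  ring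

theorem isCompactOperator_resolvent {κ : ℝ} (hκ : 0 < κ) (V : 𝓢(E3, ℂ)) :
    IsCompactOperator ((multL2 (resB κ hκ)).comp
      (mulL2 (SchwartzMap.toBoundedContinuousFunction V))) := by
  have h := (isCompactOperator_kernelOp ((memLp_resKernel hκ V).toLp _)).clm_comp
    (fourierL2.symm.toLinearIsometry.toContinuousLinearMap)
  have e : ((multL2 (resB κ hκ)).comp (mulL2 (SchwartzMap.toBoundedContinuousFunction V)) :
      L2 → L2) = fourierL2.symm.toLinearIsometry.toContinuousLinearMap ∘
        kernelOp ((memLp_resKernel hκ V).toLp _) := funext (multL2_comp_mulL2 hκ V)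
  rw [e]
  exact h

end NLSNormalForm

end


noncomputable section

namespace NLSNormalForm

open scoped BoundedContinuousFunction FourierTransform ENNReal

/-! ### The operator `𝓗` on Schwartz functions -/

/-- A real Schwartz function as a complex one. -/
def toC (V : 𝓢(E3, ℝ)) : 𝓢(E3, ℂ) := SchwartzMap.postcompCLM (𝕜 := ℝ) Complex.ofRealCLM V

@[simp] theorem toC_apply (V : 𝓢(E3, ℝ)) (x : E3) : toC V x = (V x : ℂ) := rfl

/-- `𝓗` on Schwartz functions. -/
def schS (V : 𝓢(E3, ℝ)) (c : ℝ) : 𝓢(E3, ℂ) →L[ℂ] 𝓢(E3, ℂ) :=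
  -(LineDeriv.laplacianCLM ℂ E3 𝓢(E3, ℂ)) + SchwartzMap.smulLeftCLM ℂ (toC V) +
    (c : ℂ) • ContinuousLinearMap.id ℂ _

theorem schS_eq (V : 𝓢(E3, ℝ)) (c : ℝ) (ψ : 𝓢(E3, ℂ)) :
    schS V c ψ = -(Δ ψ) + SchwartzMap.smulLeftCLM ℂ (toC V) ψ + (c : ℂ) • ψ := by
  rw [← SchwartzMap.laplacianCLM_eq (𝕜 := ℂ)]
  rfl

theorem schrodinger_eq (V : 𝓢(E3, ℝ)) (c : ℝ) (T : 𝓢'(E3, ℂ)) :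
    schrodinger V c T = -(Δ T) + smulLeftCLM ℂ (toC V) T + (c : ℂ) • T := rfl

theorem schrodinger_apply (V : 𝓢(E3, ℝ)) (c : ℝ) (T : 𝓢'(E3, ℂ)) (ψ : 𝓢(E3, ℂ)) :
    schrodinger V c T ψ = T (schS V c ψ) := by
  rw [schrodinger_eq, schS_eq, map_add, map_add, map_neg, map_smul]
  simp only [add_apply, neg_apply, smul_apply, smulLeftCLM_apply_apply,
    TemperedDistribution.laplacian_apply_apply]

theorem coe_eq_l2Incl (ψ : 𝓢(E3, ℂ)) : (ψ : 𝓢'(E3, ℂ)) = l2Incl (ψ.toLp 2) := (l2Incl_toLp ψ).symm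

theorem coe_injective : Function.Injective (SchwartzMap.toTemperedDistributionCLM E3 ℂ volume) := by
  intro ψ ψ' h
  have h1 : (ψ : 𝓢'(E3, ℂ)) = (ψ' : 𝓢'(E3, ℂ)) := h
  rw [coe_eq_l2Incl, coe_eq_l2Incl] at h1
  have h2 := l2Incl_injective h1
  have h3 : (ψ : E3 → ℂ) =ᵐ[volume] ψ' := by
    filter_upwards [SchwartzMap.coeFn_toLp ψ 2 volume, SchwartzMap.coeFn_toLp ψ' 2 volume] with x e1 e2
    rw [← e1, ← e2, h2]
  exact DFunLike.coe_injective (Continuous.ae_eq_iff_eq volume ψ.continuous ψ'.continuous |>.mp h3)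

theorem coe_smulLeft (V ψ : 𝓢(E3, ℂ)) : smulLeftCLM ℂ V (ψ : 𝓢'(E3, ℂ)) =
    ((SchwartzMap.smulLeftCLM ℂ V ψ : 𝓢(E3, ℂ)) : 𝓢'(E3, ℂ)) := by
  ext η
  rw [smulLeftCLM_apply_apply, SchwartzMap.coe_apply, SchwartzMap.coe_apply]
  congr 1
  ext x
  rw [SchwartzMap.smulLeftCLM_apply_apply V.hasTemperateGrowth,
    SchwartzMap.smulLeftCLM_apply_apply V.hasTemperateGrowth]
  simp only [smul_eq_mul]
  ring

theorem schrodinger_coe (V : 𝓢(E3, ℝ)) (c : ℝ) (ψ : 𝓢(E3, ℂ)) :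
    schrodinger V c (ψ : 𝓢'(E3, ℂ)) = ((schS V c ψ : 𝓢(E3, ℂ)) : 𝓢'(E3, ℂ)) := by
  rw [schrodinger_eq, schS_eq, coe_smulLeft, TemperedDistribution.laplacian_toTemperedDistributionCLM_eq,
    map_add, map_add, map_neg, map_smul]

theorem schS_apply_apply (V : 𝓢(E3, ℝ)) (c : ℝ) (ψ : 𝓢(E3, ℂ)) (x : E3) :
    schS V c ψ x = -(Δ ψ : 𝓢(E3, ℂ)) x + V x * ψ x + c * ψ x := by
  rw [schS_eq, add_apply, add_apply, SchwartzMap.smulLeftCLM_apply_apply (toC V).hasTemperateGrowth]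
  rfl

theorem laplacian_conjS (ψ : 𝓢(E3, ℂ)) : (Δ (conjS ψ) : 𝓢(E3, ℂ)) = conjS (Δ ψ) := by
  have h1 : ∀ (m : E3) (ψ : 𝓢(E3, ℂ)), (∂_{m} (conjS ψ) : 𝓢(E3, ℂ)) = conjS (∂_{m} ψ) := by
    intro m ψ
    ext x
    rw [conjS_apply, SchwartzMap.lineDerivOp_apply_eq_fderiv, SchwartzMap.lineDerivOp_apply_eq_fderiv]
    have : (conjS ψ : E3 → ℂ) = (Complex.conjCLE : ℂ →L[ℝ] ℂ) ∘ ψ := rfl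
    rw [this, fderiv_comp _ (ContinuousLinearMap.differentiableAt _) ψ.differentiableAt,
      ContinuousLinearMap.fderiv]
    rfl
  have h2 : ∀ I : Finset (Fin 3), ∀ g : Fin 3 → 𝓢(E3, ℂ), conjS (∑ i ∈ I, g i) = ∑ i ∈ I, conjS (g i) := by
    intro I g
    exact map_sum (SchwartzMap.postcompCLM (𝕜 := ℝ) (Complex.conjCLE : ℂ →L[ℝ] ℂ)) g I
  rw [SchwartzMap.laplacian_eq_sum (EuclideanSpace.basisFun (Fin 3) ℝ),
    SchwartzMap.laplacian_eq_sum (EuclideanSpace.basisFun (Fin 3) ℝ), h2]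
  exact Finset.sum_congr rfl fun i _ => by rw [h1, h1]

theorem schS_conjS (V : 𝓢(E3, ℝ)) (c : ℝ) (ψ : 𝓢(E3, ℂ)) :
    schS V c (conjS ψ) = conjS (schS V c ψ) := by
  ext x
  rw [conjS_apply, schS_apply_apply, schS_apply_apply, laplacian_conjS]
  simp

/-- A complete system of real Schwartz eigenfunctions of `𝓗` below `c`. -/
structure EigenSys {n : ℕ} (V : 𝓢(E3, ℝ)) (c : ℝ) (l : Fin (n + 1) → ℝ)
    (φ : Fin (n + 1) → 𝓢(E3, ℂ)) : Prop where
  eig : ∀ j, schS V c (φ j) = (l j : ℂ) • φ j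
  real : ∀ j, conjS (φ j) = φ j
  orth : ∀ i j, ∫ x, φ i x * φ j x = if i = j then 1 else 0
  complete : ∀ (μ : ℝ) (T : 𝓢'(E3, ℂ)), IsEigenvector V c μ T →
    T ∈ Submodule.span ℂ {S : 𝓢'(E3, ℂ) | ∃ j, l j = μ ∧ S = (φ j : 𝓢'(E3, ℂ))}

/-- Each eigenvalue lies strictly below `c`, so elliptic regularity with `κ = c - λ_j` makes the
eigenfunctions Schwartz, and identities almost everywhere become identities of Schwartz functions.
-/
theorem StandingHypotheses.exists_eigenSys {n : ℕ} {V : 𝓢(E3, ℝ)} {c γ₀ γ₁ : ℝ}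
    {l : Fin (n + 1) → ℝ} {φ : Fin (n + 1) → H1} (hyp : StandingHypotheses V c γ₀ γ₁ l φ) :
    ∃ φS : Fin (n + 1) → 𝓢(E3, ℂ), (∀ j, φ j = ofSchwartz (φS j)) ∧ EigenSys V c l φS := by
  have h1 : ∀ j, ∃ σ : 𝓢(E3, ℂ), (φ j).toDist = (σ : 𝓢'(E3, ℂ)) := by
    intro j
    obtain ⟨hr, he⟩ := hyp.eigen j
    refine exists_schwartz_of_elliptic (sub_pos.mpr (hyp.l_lt j)) (toC V) 0 hr ?_
    rw [schrodinger_eq] at he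
    have h2 : ((c : ℂ) - (l j : ℂ)) • (φ j).toDist =
      (c : ℂ) • (φ j).toDist - (l j : ℂ) • (φ j).toDist :=
      sub_smul (R := ℂ) (M := 𝓢'(E3, ℂ)) _ _ _
    rw [map_zero, add_zero, Complex.ofReal_sub, h2, ← he]
    abel
  choose φS hφ using h1
  have hφ' : ∀ j, φ j = ofSchwartz (φS j) := fun j => HSpace.ext (hφ j)
  have hfn : ∀ j, ∀ᵐ x, fn (φ j) x = φS j x := fun j => by rw [hφ']; exact fn_ofSchwartz _
  refine ⟨φS, hφ', fun j => ?_, fun j => ?_, fun i j => ?_, fun μ T hT => ?_⟩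
  · apply coe_injective
    have := (hyp.eigen j).2
    rw [hφ, schrodinger_coe] at this
    rw [map_smul]
    exact this
  · apply DFunLike.coe_injective
    refine (Continuous.ae_eq_iff_eq volume (conjS (φS j)).continuous (φS j).continuous).mp ?_
    filter_upwards [hfn j, hyp.real j] with x h1 h2
    rw [conjS_apply, ← h1]
    exact Complex.conj_eq_iff_im.mpr h2
  · rw [← hyp.orthonormal i j]
    refine integral_congr_ae ?_
    filter_upwards [hfn i, hfn j] with x h1 h2
    rw [h1, h2]
  · have := hyp.complete μ T hT
    simpa only [hφ] using this

/-- The projection onto the eigenspace of `μ`. -/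
def eigProj {n : ℕ} (l : Fin (n + 1) → ℝ) (φ : Fin (n + 1) → 𝓢(E3, ℂ)) (μ : ℝ) (θ : 𝓢(E3, ℂ)) :
    𝓢(E3, ℂ) :=
  ∑ j ∈ Finset.univ.filter (fun j => l j = μ), (∫ x, φ j x * θ x) • φ j

/-- The operator `g ↦ ∑ ⟨φ_j, g⟩ φ_j` on `L²`. -/
def finRank {n : ℕ} (φ : Fin (n + 1) → 𝓢(E3, ℂ)) (J : Finset (Fin (n + 1))) : L2 →L[ℂ] L2 :=
  ∑ j ∈ J, (innerSL ℂ ((φ j).toLp 2 : L2)).smulRight ((φ j).toLp 2 : L2)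

theorem l2Incl_finRank {n : ℕ} {φ : Fin (n + 1) → 𝓢(E3, ℂ)} (hφ : ∀ j, conjS (φ j) = φ j)
    (J : Finset (Fin (n + 1))) (g : L2) :
    l2Incl (finRank φ J g) = ∑ j ∈ J, (l2Incl g (φ j)) • (φ j : 𝓢'(E3, ℂ)) := by
  rw [finRank, sum_apply, map_sum]
  refine Finset.sum_congr rfl fun j _ => ?_
  rw [ContinuousLinearMap.smulRight_apply, map_smul, l2Incl_toLp, innerSL_apply_apply,
    L2.inner_def, l2Incl_apply]
  congr 1
  refine integral_congr_ae ?_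
  filter_upwards [SchwartzMap.coeFn_toLp (φ j) 2 volume] with x hx
  rw [hx, RCLike.inner_apply, ← conjS_apply, hφ j, mul_comm]

theorem isCompactOperator_finRank {n : ℕ} (φ : Fin (n + 1) → 𝓢(E3, ℂ))
    (J : Finset (Fin (n + 1))) : IsCompactOperator (finRank φ J) := by
  have h : ∀ j, IsCompactOperator
      ((innerSL ℂ ((φ j).toLp 2 : L2)).smulRight ((φ j).toLp 2 : L2)) := by
    intro j
    have e : ((innerSL ℂ ((φ j).toLp 2 : L2)).smulRight ((φ j).toLp 2 : L2) : L2 → L2) =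
        (ContinuousLinearMap.smulRight (1 : ℂ →L[ℂ] ℂ) ((φ j).toLp 2 : L2)) ∘
          (innerSL ℂ ((φ j).toLp 2 : L2)) := by
      ext1 g
      rw [ContinuousLinearMap.smulRight_apply, Function.comp_apply,
        ContinuousLinearMap.smulRight_apply, one_apply_eq_self]
    rw [e]
    exact (isCompactOperator_of_locallyCompactSpace_dom _).clm_comp _
  unfold finRank
  induction J using Finset.induction_on with
  | empty => exact isCompactOperator_zero
  | insert a J ha ih =>
    rw [Finset.sum_insert ha, FunLike.coe_add]
    exact IsCompactOperator.add (h a) ih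

/-- The Fredholm alternative at `-1`, which is either an eigenvalue of `K` or in its resolvent set.
-/
theorem exists_add_eq_of_isCompactOperator {X : Type} [NormedAddCommGroup X] [NormedSpace ℂ X]
    [CompleteSpace X] {K : X →L[ℂ] X} (hK : IsCompactOperator K)
    (hinj : ∀ g, g + K g = 0 → g = 0) (y : X) : ∃ g, g + K g = y := by
  have hres : (-1 : ℂ) ∈ resolventSet ℂ K := by
    refine (hK.hasEigenvalue_or_mem_resolventSet (by norm_num)).resolve_left fun hev => ?_
    obtain ⟨g, hg, hg0⟩ := hev.exists_hasEigenvector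
    refine hg0 (hinj g ?_)
    have : K g = (-1 : ℂ) • g := Module.End.mem_eigenspace_iff.mp hg
    rw [this]
    simp
  rw [spectrum.mem_resolventSet_iff, ContinuousLinearMap.isUnit_iff_bijective] at hres
  obtain ⟨g, hg⟩ := hres.2 (-y)
  refine ⟨g, ?_⟩
  have h : (-1 : ℂ) • g - K g = -y := hg
  rw [neg_smul, one_smul] at h
  rw [← neg_inj, ← h]
  abel

set_option maxHeartbeats 1000000 in
/-- The resolvent of `𝓗` below the continuous spectrum preserves Schwartz functions. -/
theorem EigenSys.exists_resolvent {n : ℕ} {V : 𝓢(E3, ℝ)} {c : ℝ} {l : Fin (n + 1) → ℝ}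
    {φ : Fin (n + 1) → 𝓢(E3, ℂ)} (h : EigenSys V c l φ) {μ : ℝ} (hμ : μ < c) (θ : 𝓢(E3, ℂ)) :
    ∃ Θ : 𝓢(E3, ℂ), schS V c Θ = (μ : ℂ) • Θ + θ - eigProj l φ μ θ := by
  have hκ : 0 < c - μ := sub_pos.mpr hμ
  set J := Finset.univ.filter (fun j : Fin (n + 1) => l j = μ) with hJ
  set G := multL2 (resB (c - μ) hκ) with hG
  set M := mulL2 (SchwartzMap.toBoundedContinuousFunction (toC V)) with hM
  -- Adding the projection onto the eigenspace makes `𝓗 - μ + P` injective even when `μ` is an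
  -- eigenvalue. If it is not one, `J` is empty and `P` vanishes.
  set P : L2 →L[ℂ] L2 := finRank φ J with hP
  have hPg : ∀ g : L2, l2Incl (P g) = ∑ j ∈ J, (l2Incl g (φ j)) • (φ j : 𝓢'(E3, ℂ)) :=
    l2Incl_finRank h.real J
  -- The integral equation is `(𝓗 - μ + P) g = η` multiplied by the free resolvent `G` of `-Δ + c -
  -- μ`.
  have hsol : ∀ (g : L2) (η : 𝓢(E3, ℂ)), g + G ((M + P) g) = G (η.toLp 2) →
      schrodinger V c (l2Incl g) = (μ : ℂ) • l2Incl g + (η : 𝓢'(E3, ℂ)) -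
        ∑ j ∈ J, (l2Incl g (φ j)) • (φ j : 𝓢'(E3, ℂ)) := by
    intro g η hg
    have hg' : g = G ((η.toLp 2 : L2) - (M + P) g) := by rw [map_sub, ← hg]; abel
    have h1 : l2Incl g = fourierMultiplierCLM ℂ (resSymbol (c - μ)) ((η : 𝓢'(E3, ℂ)) -
        (smulLeftCLM ℂ (toC V) (l2Incl g) + ∑ j ∈ J, (l2Incl g (φ j)) • (φ j : 𝓢'(E3, ℂ)))) := by
      conv_lhs => rw [hg']
      rw [hG, l2Incl_multL2 (resSymbol_temperate hκ), map_sub, l2Incl_toLp, add_apply, map_add,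
        hPg, hM, l2Incl_mulL2 (a := SchwartzMap.toBoundedContinuousFunction (toC V))
          (toC V).hasTemperateGrowth]
      rfl
    have h2 := (resolvent_left hκ ((η : 𝓢'(E3, ℂ)) -
        (smulLeftCLM ℂ (toC V) (l2Incl g) + ∑ j ∈ J, (l2Incl g (φ j)) • (φ j : 𝓢'(E3, ℂ))))).2
    have h4 : ((c : ℂ) - (μ : ℂ)) • l2Incl g = (c : ℂ) • l2Incl g - (μ : ℂ) • l2Incl g :=
      sub_smul (R := ℂ) (M := 𝓢'(E3, ℂ)) _ _ _
    rw [← h1, Complex.ofReal_sub, h4] at h2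
    rw [schrodinger_eq]
    have h3 : -(Δ (l2Incl g)) = (η : 𝓢'(E3, ℂ)) -
        (smulLeftCLM ℂ (toC V) (l2Incl g) + ∑ j ∈ J, (l2Incl g (φ j)) • (φ j : 𝓢'(E3, ℂ))) -
        ((c : ℂ) • l2Incl g - (μ : ℂ) • l2Incl g) := by rw [← h2]; abel
    rw [h3]
    abel
  -- Pairing with an eigenfunction kills `(𝓗 - μ) g`, by symmetry of `𝓗`, so the coefficients of `P
  -- g` are those of the right-hand side.
  have hpair : ∀ (g : L2) (η : 𝓢(E3, ℂ)), g + G ((M + P) g) = G (η.toLp 2) → ∀ i ∈ J,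
      l2Incl g (φ i) = ∫ x, φ i x * η x := by
    intro g η hg i hi
    have h1 := DFunLike.congr_fun (hsol g η hg) (φ i)
    rw [schrodinger_apply, h.eig, map_smul, (Finset.mem_filter.mp hi).2, sub_apply, add_apply,
      smul_apply, sum_apply] at h1
    have h2 : ∑ j ∈ J, ((l2Incl g (φ j)) • (φ j : 𝓢'(E3, ℂ))) (φ i) = l2Incl g (φ i) := by
      rw [Finset.sum_eq_single_of_mem i hi]
      · rw [smul_apply, SchwartzMap.coe_apply]
        simp only [smul_eq_mul]
        rw [h.orth, if_pos rfl, mul_one]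
      · intro j _ hj
        rw [smul_apply, SchwartzMap.coe_apply]
        simp only [smul_eq_mul]
        rw [h.orth, if_neg hj.symm, mul_zero]
    rw [h2, SchwartzMap.coe_apply] at h1
    simp only [smul_eq_mul] at h1
    linear_combination h1
  -- A solution of the homogeneous equation has zero coefficients, hence satisfies `𝓗 g = μ g`; by
  -- completeness it is in the span of the `φ j` with `l j = μ`, and zero coefficients leave only
  -- zero.
  have hinj : ∀ g : L2, g + G ((M + P) g) = 0 → g = 0 := by
    intro g hg
    have hg0 : g + G ((M + P) g) = G ((0 : 𝓢(E3, ℂ)).toLp 2) := by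
      rw [hg, ← map_zero G]
      congr 1
    have hz : ∀ i ∈ J, l2Incl g (φ i) = 0 := by
      intro i hi
      rw [hpair g 0 hg0 i hi]
      simp
    have h1 := hsol g 0 hg0
    rw [map_zero, add_zero, Finset.sum_eq_zero (fun j hj => by rw [hz j hj, zero_smul]), sub_zero] at h1
    have h2 := h.complete μ (l2Incl g) ⟨⟨g, rfl⟩, h1⟩
    have h3 : {S : 𝓢'(E3, ℂ) | ∃ j, l j = μ ∧ S = (φ j : 𝓢'(E3, ℂ))} =
        (fun j => (φ j : 𝓢'(E3, ℂ))) '' (J : Set (Fin (n + 1))) := by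
      ext S
      simp only [mem_ofPred_eq, mem_image, hJ, Finset.coe_filter, Finset.mem_univ, true_and]
      exact ⟨fun ⟨j, h1, h2⟩ => ⟨j, h1, h2.symm⟩, fun ⟨j, h1, h2⟩ => ⟨j, h1, h2.symm⟩⟩
    rw [h3, Submodule.mem_span_image_finset_iff_exists_fun] at h2
    obtain ⟨a, ha⟩ := h2
    have h4 : ∀ i : J, a i = 0 := by
      intro i
      rw [← hz i i.2, ← ha, sum_apply, Finset.sum_eq_single_of_mem i (Finset.mem_univ _)]
      · rw [smul_apply, SchwartzMap.coe_apply]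
        simp only [smul_eq_mul]
        rw [h.orth, if_pos rfl, mul_one]
      · intro j _ hj
        rw [smul_apply, SchwartzMap.coe_apply]
        simp only [smul_eq_mul]
        rw [h.orth, if_neg (fun e => hj (Subtype.ext e.symm)), mul_zero]
    apply l2Incl_injective
    rw [← ha, map_zero]
    exact Finset.sum_eq_zero fun j _ => by rw [h4 j, zero_smul]
  have hcomp : IsCompactOperator (G ∘L (M + P)) := by
    have h1 : IsCompactOperator (G ∘L P) := (isCompactOperator_finRank φ J).clm_comp G
    rw [ContinuousLinearMap.comp_add]
    exact (isCompactOperator_resolvent hκ (toC V)).add h1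
  obtain ⟨g, hg1⟩ := exists_add_eq_of_isCompactOperator hcomp hinj (G (θ.toLp 2))
  have hp := hpair g θ hg1
  have hs := hsol g θ hg1
  have hs' : schrodinger V c (l2Incl g) = (μ : ℂ) • l2Incl g +
      ((θ - eigProj l φ μ θ : 𝓢(E3, ℂ)) : 𝓢'(E3, ℂ)) := by
    rw [hs, eigProj, map_sub, map_sum, add_sub_assoc]
    congr 2
    exact Finset.sum_congr rfl fun j hj => by rw [hp j hj, map_smul]
  -- The right-hand side is now known to be Schwartz, so elliptic regularity upgrades the `L²`
  -- solution.
  obtain ⟨Θ, hΘ⟩ := exists_schwartz_of_elliptic hκ (toC V) (θ - eigProj l φ μ θ) ⟨g, rfl⟩ (by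
    rw [schrodinger_eq] at hs'
    have h2 : ((c : ℂ) - (μ : ℂ)) • l2Incl g = (c : ℂ) • l2Incl g - (μ : ℂ) • l2Incl g :=
      sub_smul (R := ℂ) (M := 𝓢'(E3, ℂ)) _ _ _
    rw [Complex.ofReal_sub, h2]
    have h3 : ((θ - eigProj l φ μ θ : 𝓢(E3, ℂ)) : 𝓢'(E3, ℂ)) =
      (-(Δ (l2Incl g)) + smulLeftCLM ℂ (toC V) (l2Incl g) + (c : ℂ) • l2Incl g) -
        (μ : ℂ) • l2Incl g := by rw [hs']; abel
    rw [h3]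
    abel)
  refine ⟨Θ, coe_injective ?_⟩
  rw [add_sub_assoc, map_add, map_smul, ← hΘ, ← hs', hΘ, schrodinger_coe]

end NLSNormalForm

end


noncomputable section

namespace NLSNormalForm

open scoped BoundedContinuousFunction FourierTransform ENNReal

/-! ### The embedding `H¹ ⊆ L⁴` -/

theorem lintegral_mul_sq_le {α : Type*} [MeasurableSpace α] (μ : Measure α) {f g : α → ℝ≥0∞}
    (hf : AEMeasurable f μ) (hg : AEMeasurable g μ) :
    (∫⁻ a, f a * g a ∂μ) ^ 2 ≤ (∫⁻ a, f a ^ 2 ∂μ) * ∫⁻ a, g a ^ 2 ∂μ := by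
  have h := ENNReal.lintegral_mul_le_Lp_mul_Lq μ (Real.HolderConjugate.two_two) hf hg
  calc (∫⁻ a, f a * g a ∂μ) ^ 2 ≤ ((∫⁻ a, f a ^ (2 : ℝ) ∂μ) ^ (1 / (2 : ℝ)) *
        (∫⁻ a, g a ^ (2 : ℝ) ∂μ) ^ (1 / (2 : ℝ))) ^ 2 := by gcongr; exact h
    _ = _ := by
      rw [mul_pow, ← ENNReal.rpow_natCast, ← ENNReal.rpow_natCast, ← ENNReal.rpow_mul,
        ← ENNReal.rpow_mul]
      norm_num

/-- `⟨ξ⟩⁻¹` with values in `[0, ∞]`. -/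
def japInv (ξ : E3) : ℝ≥0∞ := ‖besselSymbol 1 zero_le_one ξ‖ₑ

theorem measurable_japInv : Measurable japInv :=
  (besselSymbol 1 zero_le_one).continuous.enorm.measurable

theorem lintegral_japInv_pow_four_lt_top : ∫⁻ ξ, japInv ξ ^ 4 < ⊤ := by
  have h1 : Integrable fun x : E3 => (1 + ‖x‖ ^ 2) ^ (-(4 : ℝ) / 2) :=
    integrable_rpow_neg_one_add_norm_sq (by simp; norm_num)
  refine lt_of_le_of_lt (lintegral_mono fun ξ => ?_) h1.2
  rw [japInv, besselSymbol_apply, ← enorm_pow]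
  apply le_of_eq
  rw [← ofReal_norm, ← ofReal_norm, norm_pow, Complex.norm_real, ← norm_pow, ← Real.rpow_natCast,
    ← Real.rpow_mul (by positivity)]
  norm_num

/-- From `(ab)² ≤ a⁴ + b⁴` and translation invariance; what matters is that the bound does not
depend on `ξ`. -/
theorem lintegral_japInv_conv_le (ξ : E3) :
    ∫⁻ η, (japInv η * japInv (ξ - η)) ^ 2 ≤ 2 * ∫⁻ η, japInv η ^ 4 := by
  have hm : Measurable fun η => japInv (ξ - η) := measurable_japInv.comp (by fun_prop)
  calc ∫⁻ η, (japInv η * japInv (ξ - η)) ^ 2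
      ≤ ∫⁻ η, (japInv η ^ 4 + japInv (ξ - η) ^ 4) := by
        refine lintegral_mono fun η => ?_
        have : ∀ a b : ℝ≥0∞, (a * b) ^ 2 ≤ a ^ 4 + b ^ 4 := by
          intro a b
          rcases le_total a b with h | h
          · calc (a * b) ^ 2 ≤ (b * b) ^ 2 := by gcongr
              _ = b ^ 4 := by ring
              _ ≤ _ := le_add_self
          · calc (a * b) ^ 2 ≤ (a * a) ^ 2 := by gcongr
              _ = a ^ 4 := by ring
              _ ≤ _ := le_self_add
        exact this _ _
    _ = _ := by
      rw [lintegral_add_left (measurable_japInv.pow_const 4),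
        lintegral_sub_left_eq_self (fun η => japInv η ^ 4) ξ, two_mul]

theorem lintegral_enorm_sq_fourier (g : 𝓢(E3, ℂ)) : ∫⁻ ξ, ‖𝓕 g ξ‖ₑ ^ 2 = ∫⁻ x, ‖g x‖ₑ ^ 2 := by
  have h : ∀ g : 𝓢(E3, ℂ), ∫⁻ x, ‖g x‖ₑ ^ 2 = ENNReal.ofReal (∫ x, ‖g x‖ ^ 2) := by
    intro g
    rw [ofReal_integral_eq_lintegral_ofReal]
    · refine lintegral_congr fun x => ?_
      rw [← ofReal_norm, ENNReal.ofReal_pow (norm_nonneg _)]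
    · exact (memLp_two_iff_integrable_sq_norm g.continuous.aestronglyMeasurable).mp (g.memLp 2)
    · exact Filter.Eventually.of_forall fun x => by positivity
  rw [h, h, SchwartzMap.integral_norm_sq_fourier]

/-- `⟨ξ⟩⁻¹ g` as a Schwartz function. -/
def japMul (g : 𝓢(E3, ℂ)) : 𝓢(E3, ℂ) := SchwartzMap.smulLeftCLM ℂ (besselSymbol 1 zero_le_one) g

theorem enorm_japMul (g : 𝓢(E3, ℂ)) (ξ : E3) : ‖japMul g ξ‖ₑ = japInv ξ * ‖g ξ‖ₑ := by
  rw [japMul, SchwartzMap.smulLeftCLM_apply_apply (besselSymbol_temperate 1 zero_le_one), smul_eq_mul,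
    enorm_mul, japInv]

/-- The fourth power of the `L⁴` norm is the square of the `L²` norm of the square, so Plancherel
turns it into that of a convolution. Cauchy–Schwarz separates the two factors `⟨·⟩⁻¹` from `g`, and
`⟨η⟩⁻⁴` is integrable in dimension three. -/
theorem lintegral_fourier_pow_four_le (g : 𝓢(E3, ℂ)) :
    ∫⁻ x, ‖𝓕 (japMul g) x‖ₑ ^ 4 ≤ 2 * (∫⁻ η, japInv η ^ 4) * (∫⁻ ξ, ‖g ξ‖ₑ ^ 2) ^ 2 := by
  set w := japMul g with hw
  set B := ContinuousLinearMap.mul ℂ ℂ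
  have hgm : Measurable fun η => ‖g η‖ₑ := g.continuous.enorm.measurable
  have h1 : ∫⁻ x, ‖𝓕 w x‖ₑ ^ 4 = ∫⁻ ξ, ‖SchwartzMap.convolution B w w ξ‖ₑ ^ 2 := by
    rw [← lintegral_enorm_sq_fourier]
    refine lintegral_congr fun x => ?_
    rw [SchwartzMap.fourier_convolution]
    have : SchwartzMap.pairing B (𝓕 w) (𝓕 w) x = 𝓕 w x * 𝓕 w x := rfl
    rw [this, enorm_mul]
    ring
  have h2 : ∀ ξ, ‖SchwartzMap.convolution B w w ξ‖ₑ ^ 2 ≤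
      (2 * ∫⁻ η, japInv η ^ 4) * ∫⁻ η, ‖g η‖ₑ ^ 2 * ‖g (ξ - η)‖ₑ ^ 2 := by
    intro ξ
    have hgm' : Measurable fun η => ‖g (ξ - η)‖ₑ := hgm.comp (by fun_prop)
    have hjm' : Measurable fun η => japInv (ξ - η) := measurable_japInv.comp (by fun_prop)
    have e1 : ‖SchwartzMap.convolution B w w ξ‖ₑ ≤
        ∫⁻ η, (japInv η * japInv (ξ - η)) * (‖g η‖ₑ * ‖g (ξ - η)‖ₑ) := by
      rw [SchwartzMap.convolution_apply, MeasureTheory.convolution_def]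
      refine (enorm_integral_le_lintegral_enorm _).trans (le_of_eq ?_)
      refine lintegral_congr fun η => ?_
      have : B (w η) (w (ξ - η)) = w η * w (ξ - η) := rfl
      rw [this, enorm_mul, hw, enorm_japMul, enorm_japMul]
      ring
    calc _ ≤ (∫⁻ η, (japInv η * japInv (ξ - η)) * (‖g η‖ₑ * ‖g (ξ - η)‖ₑ)) ^ 2 := by gcongr
      _ ≤ (∫⁻ η, (japInv η * japInv (ξ - η)) ^ 2) * ∫⁻ η, (‖g η‖ₑ * ‖g (ξ - η)‖ₑ) ^ 2 :=
        lintegral_mul_sq_le _ (measurable_japInv.mul hjm').aemeasurable (hgm.mul hgm').aemeasurable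
      _ ≤ _ := by
        simp only [mul_pow]
        gcongr
        simp only [← mul_pow]
        exact lintegral_japInv_conv_le ξ
  rw [h1]
  calc _ ≤ ∫⁻ ξ, (2 * ∫⁻ η, japInv η ^ 4) * ∫⁻ η, ‖g η‖ₑ ^ 2 * ‖g (ξ - η)‖ₑ ^ 2 :=
        lintegral_mono h2
    _ = (2 * ∫⁻ η, japInv η ^ 4) * ∫⁻ ξ, ∫⁻ η, ‖g η‖ₑ ^ 2 * ‖g (ξ - η)‖ₑ ^ 2 := by
      rw [lintegral_const_mul']
      exact ENNReal.mul_ne_top (by simp) lintegral_japInv_pow_four_lt_top.ne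
    _ = _ := by
      congr 1
      rw [lintegral_lintegral_swap]
      · have : ∀ η, ∫⁻ ξ, ‖g η‖ₑ ^ 2 * ‖g (ξ - η)‖ₑ ^ 2 = ‖g η‖ₑ ^ 2 * ∫⁻ ξ, ‖g ξ‖ₑ ^ 2 := by
          intro η
          rw [lintegral_const_mul' _ _ (by finiteness),
            lintegral_sub_right_eq_self (fun ξ => ‖g ξ‖ₑ ^ 2) η]
        simp only [this]
        rw [lintegral_mul_const _ (hgm.pow_const 2), sq]
      · refine Measurable.aemeasurable ?_
        exact ((hgm.comp measurable_snd).pow_const 2).mul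
          ((hgm.comp (measurable_fst.sub measurable_snd)).pow_const 2)

theorem multL2_besselSymbol_toLp (ψ : 𝓢(E3, ℂ)) :
    multL2 (besselSymbol 1 zero_le_one) (ψ.toLp 2) = (𝓕⁻ (japMul (𝓕 ψ))).toLp 2 := by
  apply l2Incl_injective
  rw [l2Incl_multL2 (besselSymbol_temperate 1 zero_le_one), l2Incl_toLp, l2Incl_toLp,
    fourierMultiplierCLM_toTemperedDistributionCLM_eq (besselSymbol_temperate 1 zero_le_one)]
  rfl

theorem exists_eLpNorm_four_le : ∃ C : ℝ≥0∞, C ≠ ⊤ ∧ ∀ ψ : 𝓢(E3, ℂ),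
    eLpNorm (multL2 (besselSymbol 1 zero_le_one) (ψ.toLp 2)) 4 ≤ C * ‖ψ.toLp 2‖ₑ := by
  refine ⟨(2 * ∫⁻ η, japInv η ^ 4) ^ (1 / 4 : ℝ), ?_, fun ψ => ?_⟩
  · exact ENNReal.rpow_ne_top_of_nonneg (by norm_num : (0 : ℝ) ≤ 1 / 4)
      (ENNReal.mul_ne_top (by norm_num : (2 : ℝ≥0∞) ≠ ⊤) lintegral_japInv_pow_four_lt_top.ne)
  · rw [multL2_besselSymbol_toLp, eLpNorm_congr_ae (SchwartzMap.coeFn_toLp _ 2 volume),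
      eLpNorm_eq_lintegral_rpow_enorm_toReal (by norm_num) (by norm_num)]
    have h1 : ∫⁻ x, ‖(𝓕⁻ (japMul (𝓕 ψ)) : 𝓢(E3, ℂ)) x‖ₑ ^ 4 =
        ∫⁻ x, ‖𝓕 (japMul (𝓕 ψ)) x‖ₑ ^ 4 := by
      rw [← lintegral_neg_eq_self]
      refine lintegral_congr fun x => ?_
      rw [SchwartzMap.fourierInv_coe, Real.fourierInv_eq_fourier_neg, neg_neg, SchwartzMap.fourier_coe]
    have h2 := lintegral_fourier_pow_four_le (𝓕 ψ)
    rw [← h1, lintegral_enorm_sq_fourier] at h2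
    have h3 : ‖ψ.toLp 2‖ₑ ^ 4 = (∫⁻ x, ‖ψ x‖ₑ ^ 2) ^ 2 := by
      rw [Lp.enorm_def, eLpNorm_congr_ae (SchwartzMap.coeFn_toLp _ 2 volume),
        eLpNorm_eq_lintegral_rpow_enorm_toReal (by norm_num) (by norm_num), ← ENNReal.rpow_natCast,
        ← ENNReal.rpow_mul]
      norm_num
    rw [← h3] at h2
    calc _ = (∫⁻ x, ‖(𝓕⁻ (japMul (𝓕 ψ)) : 𝓢(E3, ℂ)) x‖ₑ ^ 4) ^ (1 / 4 : ℝ) := by norm_num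
      _ ≤ ((2 * ∫⁻ η, japInv η ^ 4) * ‖ψ.toLp 2‖ₑ ^ 4) ^ (1 / 4 : ℝ) := by gcongr
      _ = _ := by
        rw [ENNReal.mul_rpow_of_nonneg _ _ (by norm_num), ← ENNReal.rpow_natCast,
          ← ENNReal.rpow_mul]
        norm_num

theorem exists_seq_schwartz (h : L2) :
    ∃ ψ : ℕ → 𝓢(E3, ℂ), Filter.Tendsto (fun k => ((ψ k).toLp 2 : L2)) Filter.atTop (𝓝 h) := by
  have hd : DenseRange (SchwartzMap.toLpCLM ℝ ℂ 2 (volume : Measure E3)) :=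
    SchwartzMap.denseRange_toLpCLM (by simp)
  obtain ⟨x, hx, hxt⟩ := mem_closure_iff_seq_limit.mp (hd h)
  refine ⟨fun k => (hx k).choose, ?_⟩
  have : (fun k => ((hx k).choose.toLp 2 : L2)) = x := funext fun k => (hx k).choose_spec
  rw [this]
  exact hxt

/-- Schwartz approximations converge almost everywhere along a subsequence, and Fatou's lemma
carries the uniform `L⁴` bound to the limit. -/
theorem memLp_four_of_bound {B : L2 →L[ℂ] L2} {C : ℝ≥0∞} (hC : C ≠ ⊤)
    (hb : ∀ ψ : 𝓢(E3, ℂ), eLpNorm (B (ψ.toLp 2)) 4 ≤ C * ‖ψ.toLp 2‖ₑ) (h : L2) :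
    MemLp (B h) 4 := by
  obtain ⟨ψ, ht⟩ := exists_seq_schwartz h
  have ht' : Filter.Tendsto (fun k => B ((ψ k).toLp 2)) Filter.atTop (𝓝 (B h)) :=
    (B.continuous.tendsto h).comp ht
  obtain ⟨ns, hns, hae⟩ := (tendstoInMeasure_of_tendsto_Lp ht').exists_seq_tendsto_ae
  have hle : ∀ᶠ k in Filter.atTop, ‖((ψ (ns k)).toLp 2 : L2)‖ₑ < ‖h‖ₑ + 1 := by
    have h1 : Filter.Tendsto (fun k => ‖((ψ (ns k)).toLp 2 : L2)‖ₑ) Filter.atTop (𝓝 ‖h‖ₑ) :=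
      (continuous_enorm.tendsto h).comp (ht.comp hns.tendsto_atTop)
    exact h1.eventually_lt_const (ENNReal.lt_add_right enorm_ne_top one_ne_zero)
  have hfin : C * (‖h‖ₑ + 1) < ⊤ :=
    ENNReal.mul_lt_top hC.lt_top (ENNReal.add_lt_top.mpr ⟨enorm_lt_top, ENNReal.one_lt_top⟩)
  have hbd : ∀ᶠ k in Filter.atTop, eLpNorm (B ((ψ (ns k)).toLp 2)) 4 volume ≤ C * (‖h‖ₑ + 1) := by
    filter_upwards [hle] with k hk
    exact (hb _).trans (mul_le_mul_right hk.le C)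
  have hms : ∀ k, AEStronglyMeasurable (B ((ψ (ns k)).toLp 2)) volume :=
    fun k => Lp.aestronglyMeasurable _
  exact ⟨Lp.aestronglyMeasurable _, (Lp.eLpNorm_le_of_ae_tendsto hbd hms hae).trans_lt hfin⟩

theorem memLp_four_multL2 (h : L2) : MemLp (multL2 (besselSymbol 1 zero_le_one) h) 4 := by
  obtain ⟨C, hC, hb⟩ := exists_eLpNorm_four_le
  exact memLp_four_of_bound hC hb h

theorem memLp_four_fn (u : H1) : MemLp (fn u) 4 := by
  rw [fn_eq_emb]
  exact memLp_four_multL2 _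

end NLSNormalForm

end


noncomputable section

namespace NLSNormalForm

/-! ### The coordinates as functionals on `H¹` -/

theorem pair_add_left (Φ Φ' : 𝓢(E3, ℂ)) (u : H1) : pair (Φ + Φ') u = pair Φ u + pair Φ' u := by
  simp only [pair_eq, map_add]

theorem pair_sub_left (Φ Φ' : 𝓢(E3, ℂ)) (u : H1) : pair (Φ - Φ') u = pair Φ u - pair Φ' u := by
  simp only [pair_eq, map_sub]

theorem pair_smul_left (c : ℂ) (Φ : 𝓢(E3, ℂ)) (u : H1) : pair (c • Φ) u = c * pair Φ u := by
  simp only [pair_eq, map_smul, smul_eq_mul]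

theorem pair_sum_left {α : Type} (s : Finset α) (Φ : α → 𝓢(E3, ℂ)) (u : H1) :
    pair (∑ i ∈ s, Φ i) u = ∑ i ∈ s, pair (Φ i) u := by
  simp only [pair_eq, map_sum]

theorem pair_zero_left (u : H1) : pair 0 u = 0 := by
  simp only [pair_eq, map_zero]

/-- The functional `⟨Φ, ·⟩` on `H¹`. -/
def pairL (Φ : 𝓢(E3, ℂ)) : H1 →L[ℂ] ℂ := (innerSL ℂ ((conjS Φ).toLp 2 : L2)).comp emb

theorem pairL_apply (Φ : 𝓢(E3, ℂ)) (u : H1) : pairL Φ u = pair Φ u := by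
  rw [pairL, ContinuousLinearMap.comp_apply, innerSL_apply_apply, L2.inner_def, pair, fn_eq_emb]
  refine integral_congr_ae ?_
  filter_upwards [SchwartzMap.coeFn_toLp (conjS Φ) 2 volume] with x hx
  rw [hx, RCLike.inner_apply, ← conjS_apply, conjS_conjS, mul_comm]

theorem norm_toLp_conjS (Φ : 𝓢(E3, ℂ)) : ‖((conjS Φ).toLp 2 : L2)‖ = ‖(Φ.toLp 2 : L2)‖ := by
  rw [Lp.norm_def, Lp.norm_def, eLpNorm_congr_ae (SchwartzMap.coeFn_toLp (conjS Φ) 2 volume),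
    eLpNorm_congr_ae (SchwartzMap.coeFn_toLp Φ 2 volume)]
  congr 1
  refine eLpNorm_congr_norm_ae (Filter.Eventually.of_forall fun x => ?_)
  rw [conjS_apply, RCLike.norm_conj]

theorem norm_pairL_le (Φ : 𝓢(E3, ℂ)) (u : H1) : ‖pairL Φ u‖ ≤ ‖(Φ.toLp 2 : L2)‖ * ‖emb u‖ := by
  rw [pairL, ContinuousLinearMap.comp_apply, innerSL_apply_apply, ← norm_toLp_conjS]
  exact norm_inner_le_norm _ _

theorem pair_ofSchwartz (Φ ψ : 𝓢(E3, ℂ)) : pair Φ (ofSchwartz ψ) = ∫ x, Φ x * ψ x := by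
  refine integral_congr_ae ?_
  filter_upwards [fn_ofSchwartz ψ] with x hx
  rw [hx]

theorem pair_comm (Φ ψ : 𝓢(E3, ℂ)) : pair Φ (ofSchwartz ψ) = pair ψ (ofSchwartz Φ) := by
  rw [pair_ofSchwartz, pair_ofSchwartz]
  simp only [mul_comm]

theorem pair_conj_conj (Φ ψ : 𝓢(E3, ℂ)) :
    pair (conjS Φ) (ofSchwartz (conjS ψ)) = conj (pair Φ (ofSchwartz ψ)) := by
  rw [pair_ofSchwartz, pair_ofSchwartz, ← integral_conj]
  simp

section data

variable {n : ℕ} (φ : Fin (n + 1) → 𝓢(E3, ℂ))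

/-- The labels of the functionals: the discrete modes and the Schwartz functions. -/
abbrev Lab (n : ℕ) : Type := Fin (n + 1) ⊕ 𝓢(E3, ℂ)

/-- The projection `P_c` on Schwartz functions. -/
def projS (θ : 𝓢(E3, ℂ)) : 𝓢(E3, ℂ) := θ - ∑ j, (pair θ (ofSchwartz (φ j))) • φ j

/-- The Schwartz function that represents a functional. -/
def rep : Lab n → 𝓢(E3, ℂ)
  | .inl j => φ j
  | .inr θ => projS φ θ

/-- The functionals `z_j` and `⟨θ, f⟩` on `H¹`. -/
def dat : PData (Lab n) H1 where
  ℓ v := pairL (rep φ v)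
  r v := ofSchwartz (conjS (rep φ v))
  -- The factor `1 + ‖emb‖` lets one constant serve for both kinds of bounds: `‖u‖` is the norm of
  -- `H¹`, whereas the vectors `r b` are measured in `L²`.
  B v := 1 + ‖((rep φ v).toLp 2 : L2)‖ * (1 + ‖emb‖)
  one_le v := by
    have : 0 ≤ ‖((rep φ v).toLp 2 : L2)‖ * (1 + ‖emb‖) := by positivity
    linarith
  norm_ℓ v u := by
    refine (norm_pairL_le _ _).trans ?_
    have h1 := emb.le_opNorm u
    have h2 := norm_nonneg ((rep φ v).toLp 2 : L2)
    have h3 := norm_nonneg u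
    calc _ ≤ ‖((rep φ v).toLp 2 : L2)‖ * (‖emb‖ * ‖u‖) := by gcongr
      _ ≤ _ := by nlinarith [mul_nonneg h2 h3]
  norm_ℓ_r v b := by
    refine (norm_pairL_le _ _).trans ?_
    rw [emb_ofSchwartz, norm_toLp_conjS]
    have h2 := norm_nonneg ((rep φ v).toLp 2 : L2)
    have h4 := norm_nonneg ((rep φ b).toLp 2 : L2)
    have h3 := norm_nonneg emb
    gcongr <;> nlinarith [mul_nonneg h2 h3, mul_nonneg h4 h3]

theorem dat_ℓ (v : Lab n) (u : H1) : (dat φ).ℓ v u = pair (rep φ v) u := pairL_apply _ _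

theorem dat_r (v : Lab n) : (dat φ).r v = ofSchwartz (conjS (rep φ v)) := rfl

/-- The eigenfunctions as elements of `H¹`. -/
abbrev eigH (j : Fin (n + 1)) : H1 := ofSchwartz (φ j)

theorem zCoord_eq (u : H1) (j : Fin (n + 1)) : zCoord (eigH φ) u j = (dat φ).ℓ (.inl j) u := by
  rw [dat_ℓ, zCoord, pair]
  refine integral_congr_ae ?_
  filter_upwards [fn_ofSchwartz (φ j)] with x hx
  rw [hx, rep, mul_comm]

theorem zCoord_eq_pair (u : H1) (j : Fin (n + 1)) : zCoord (eigH φ) u j = pair (φ j) u := by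
  rw [zCoord_eq, dat_ℓ, rep]

/-- The projection `P_c` is symmetric for the bilinear pairing, so it can be moved to the test
function; every pairing with `f` becomes a functional of `u`. -/
theorem pair_fCoord (θ : 𝓢(E3, ℂ)) (u : H1) :
    pair θ (fCoord (eigH φ) u) = pair (projS φ θ) u := by
  rw [← pairL_apply, fCoord, map_sub, map_sum, projS, pair_sub_left, pair_sum_left, pairL_apply]
  congr 1
  refine Finset.sum_congr rfl fun j _ => ?_
  rw [map_smul, pair_smul_left, zCoord_eq_pair, pairL_apply, smul_eq_mul, mul_comm]

theorem pair_fCoord_eq (θ : 𝓢(E3, ℂ)) (u : H1) :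
    pair θ (fCoord (eigH φ) u) = (dat φ).ℓ (.inr θ) u := by
  rw [pair_fCoord, dat_ℓ, rep]

/-- `u = z · φ + f`. -/
def recon (z : Fin (n + 1) → ℂ) (f : H1) : H1 := f + ∑ j, z j • eigH φ j

theorem recon_coord (u : H1) : recon φ (zCoord (eigH φ) u) (fCoord (eigH φ) u) = u := by
  rw [recon, fCoord, sub_add_cancel]

theorem fCoord_add_sum (u : H1) {α : Type} (s : Finset α) (c : α → ℂ) (v : α → H1) :
    fCoord (eigH φ) (u + ∑ a ∈ s, c a • v a) =
      fCoord (eigH φ) u + ∑ a ∈ s, c a • fCoord (eigH φ) (v a) := by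
  have hz : ∀ w : H1, fCoord (eigH φ) w = w - ∑ j, (pairL (φ j) w) • eigH φ j := by
    intro w
    rw [fCoord]
    congr 1
    exact Finset.sum_congr rfl fun j _ => by rw [zCoord_eq_pair, pairL_apply]
  have hlin : fCoord (eigH φ) = ⇑((LinearMap.id : H1 →ₗ[ℂ] H1) -
      ∑ j, (pairL (φ j)).toLinearMap.smulRight (eigH φ j)) := by
    ext1 w
    rw [hz, LinearMap.sub_apply, LinearMap.sum_apply]
    rfl
  rw [hlin, map_add, map_sum]
  simp only [map_smul]

theorem fCoord_ofSchwartz (θ : 𝓢(E3, ℂ)) : fCoord (eigH φ) (ofSchwartz θ) = ofSchwartz (projS φ θ) := by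
  rw [fCoord, projS, map_sub, map_sum]
  congr 1
  refine Finset.sum_congr rfl fun j _ => ?_
  rw [zCoord_eq_pair, map_smul, pair_comm]

end data

/-! ### The symplectic form -/

theorem symp_eq (X Y : Phase) : symp X Y =
    inner ℂ (emb Y.2.2) (emb X.2.2) - inner ℂ (emb X.2.2) (emb Y.2.2)
      + Complex.I * ((X.2.1 * Y.1 - X.1 * Y.2.1 : ℝ) : ℂ) := by
  have h : ∀ u v : H1, ∫ x, fn u x * conj (fn v x) = inner ℂ (emb v) (emb u) := by
    intro u v
    rw [L2.inner_def, fn_eq_emb, fn_eq_emb]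
    rfl
  have hi : ∀ u v : H1, Integrable fun x => fn u x * conj (fn v x) := fun u v =>
    (memLp_fn u).integrable_mul (memLp_fn v).star
  rw [symp, integral_sub (hi _ _) ((hi Y.2.2 X.2.2).congr
    (Filter.Eventually.of_forall fun x => mul_comm _ _)), h, ← h Y.2.2 X.2.2]
  simp only [mul_comm]

/-- The symplectic form as a continuous bilinear form. -/
def sympB : Phase →L[ℝ] Phase →L[ℝ] ℂ :=
  LinearMap.mkContinuous₂ (LinearMap.mk₂ ℝ symp
    (by
      intro X X' Y
      simp only [symp_eq, Prod.fst_add, Prod.snd_add, map_add, inner_add_left, inner_add_right]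
      push_cast
      ring)
    (by
      intro c X Y
      have h : emb (c • X.2.2) = (c : ℂ) • emb X.2.2 := by rw [← map_smul]; rfl
      simp only [symp_eq, Prod.smul_fst, Prod.smul_snd, h, inner_smul_left, inner_smul_right,
        smul_eq_mul, Complex.conj_ofReal, Complex.real_smul]
      push_cast
      ring)
    (by
      intro X Y Y'
      simp only [symp_eq, Prod.fst_add, Prod.snd_add, map_add, inner_add_left, inner_add_right]
      push_cast
      ring)
    (by
      intro c X Y
      have h : emb (c • Y.2.2) = (c : ℂ) • emb Y.2.2 := by rw [← map_smul]; rfl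
      simp only [symp_eq, Prod.smul_fst, Prod.smul_snd, h, inner_smul_left, inner_smul_right,
        smul_eq_mul, Complex.conj_ofReal, Complex.real_smul]
      push_cast
      ring))
    (2 * ‖emb‖ ^ 2 + 2) (by
      intro X Y
      rw [LinearMap.mk₂_apply, symp_eq]
      have h1 : ‖X.2.2‖ ≤ ‖X‖ := (norm_snd_le X.2).trans (norm_snd_le X)
      have h2 : ‖Y.2.2‖ ≤ ‖Y‖ := (norm_snd_le Y.2).trans (norm_snd_le Y)
      have h3 : ‖X.2.1‖ ≤ ‖X‖ := (norm_fst_le X.2).trans (norm_snd_le X)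
      have h4 : ‖Y.2.1‖ ≤ ‖Y‖ := (norm_fst_le Y.2).trans (norm_snd_le Y)
      have h5 : ‖X.1‖ ≤ ‖X‖ := norm_fst_le X
      have h6 : ‖Y.1‖ ≤ ‖Y‖ := norm_fst_le Y
      have e1 : ‖emb X.2.2‖ ≤ ‖emb‖ * ‖X‖ := (emb.le_opNorm _).trans (by gcongr)
      have e2 : ‖emb Y.2.2‖ ≤ ‖emb‖ * ‖Y‖ := (emb.le_opNorm _).trans (by gcongr)
      have i1 := norm_inner_le_norm (𝕜 := ℂ) (emb Y.2.2) (emb X.2.2)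
      have i2 := norm_inner_le_norm (𝕜 := ℂ) (emb X.2.2) (emb Y.2.2)
      have i3 : ‖Complex.I * ((X.2.1 * Y.1 - X.1 * Y.2.1 : ℝ) : ℂ)‖ ≤ 2 * (‖X‖ * ‖Y‖) := by
        rw [norm_mul, Complex.norm_I, one_mul, Complex.norm_real]
        refine (norm_sub_le _ _).trans ?_
        rw [norm_mul, norm_mul]
        have a1 : ‖X.2.1‖ * ‖Y.1‖ ≤ ‖X‖ * ‖Y‖ := by gcongr
        have a2 : ‖X.1‖ * ‖Y.2.1‖ ≤ ‖X‖ * ‖Y‖ := by gcongr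
        linarith
      have i4 : ‖emb Y.2.2‖ * ‖emb X.2.2‖ ≤ (‖emb‖ * ‖Y‖) * (‖emb‖ * ‖X‖) := by gcongr
      calc _ ≤ ‖inner ℂ (emb Y.2.2) (emb X.2.2)‖ + ‖inner ℂ (emb X.2.2) (emb Y.2.2)‖ +
            ‖Complex.I * ((X.2.1 * Y.1 - X.1 * Y.2.1 : ℝ) : ℂ)‖ :=
            (norm_add_le _ _).trans (by gcongr; exact norm_sub_le _ _)
        _ ≤ _ := by nlinarith)

theorem symp_antisymm (X Y : Phase) : symp X Y = -symp Y X := by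
  rw [symp_eq, symp_eq]
  push_cast
  ring

/-! ### Lie transforms as canonical transformations -/

section flow

variable {n : ℕ} (φ : Fin (n + 1) → 𝓢(E3, ℂ)) (g : Gen (Lab n))

theorem eval_pderiv_h (t : ℝ) (u : H1) (b : Lab n) :
    MvPolynomial.eval ((dat φ).xval t u) (MvPolynomial.pderiv (.h b) g.χ) =
      conj (MvPolynomial.eval ((dat φ).xval t u) (MvPolynomial.pderiv (.a b) g.χ)) := by
  rw [← eval_starP ((dat φ).xval_swap t u), starP_pderiv, g.real]
  rfl

/-- The vector `r b` represents the functional `ℓ b` in the `L²` inner product, and the derivative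
of `χ` in time goes to the component along `τ`, which `i dt ∧ dτ` pairs with the `t`-component of
`Y`. -/
theorem symp_vec (p Y : Phase) :
    symp ((dat φ).vec g p) Y = -Complex.I * fderiv ℝ ((dat φ).fnχ g) p Y := by
  have hr : ∀ b, inner ℂ (emb ((dat φ).r b)) (emb Y.2.2) = (dat φ).ℓ b Y.2.2 := by
    intro b
    rw [dat_r, emb_ofSchwartz]
    rfl
  have hr' : ∀ b, inner ℂ (emb Y.2.2) (emb ((dat φ).r b)) = conj ((dat φ).ℓ b Y.2.2) := by
    intro b
    rw [← hr, inner_conj_symm]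
  have hd : ((MvPolynomial.eval ((dat φ).xval p.2.1 p.2.2) (dT (Lab n) g.χ)).re : ℂ) =
      MvPolynomial.eval ((dat φ).xval p.2.1 p.2.2) (dT (Lab n) g.χ) :=
    Complex.ext rfl (by simpa using (PData.im_eval_dT (D := dat φ) (g := g) p.2.1 p.2.2).symm)
  rw [symp_eq, PData.fderiv_fnχ (D := dat φ) (g := g)]
  simp only [PData.vec, map_sum, map_smul, sum_inner, inner_sum, inner_smul_left, inner_smul_right,
    hr, hr', zero_mul, zero_sub]
  push_cast
  rw [hd, ← Finset.sum_sub_distrib, mul_add, Finset.mul_sum]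
  congr 1
  · refine Finset.sum_congr rfl fun b _ => ?_
    have e : MvPolynomial.eval ((dat φ).xval p.2.1 p.2.2) (g.velo b) = -Complex.I *
        MvPolynomial.eval ((dat φ).xval p.2.1 p.2.2) (MvPolynomial.pderiv (.a b) g.χ) := by
      rw [Gen.velo, MvPolynomial.smul_eval]
    rw [e, eval_pderiv_h]
    simp only [map_mul, map_neg, Complex.conj_I]
    ring
  · ring

theorem isOpen_cyl {U : Set H1} (hU : IsOpen U) : IsOpen (cyl U) :=
  hU.preimage (continuous_snd.comp continuous_snd)

theorem contDiffOn_flow_fixed {s : ℝ} (hs : |s| < 2) :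
    ContDiffOn ℝ ∞ ((dat φ).flow g s) (cyl (Metric.ball 0 ((dat φ).lieRad g))) := by
  have h := PData.contDiffOn_flow (D := dat φ) (g := g)
  refine h.comp (f := fun p : Phase => (s, p)) (contDiff_prodMk_right s).contDiffOn ?_
  intro p hp
  have : ‖p.2.2‖ < (dat φ).lieRad g := by simpa [cyl] using hp
  exact ⟨hs, this⟩

theorem isCanonicalOn_flow {δ : ℝ} (hδ : δ ≤ (dat φ).lieRad g)
    (hmaps : MapsTo ((dat φ).flow g 1) (cyl (Metric.ball 0 δ))
      (cyl (Metric.ball 0 ((dat φ).lieRad g)))) :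
    IsCanonicalOn ((dat φ).flow g 1) (cyl (Metric.ball 0 δ)) := by
  have hnorm : ∀ {p : Phase} {ρ : ℝ}, p ∈ cyl (Metric.ball 0 ρ) → ‖p.2.2‖ < ρ := by
    intro p ρ hp
    simpa [cyl] using hp
  have hsub : cyl (Metric.ball (0 : H1) δ) ⊆ cyl (Metric.ball 0 ((dat φ).lieRad g)) :=
    fun p hp => Metric.ball_subset_ball hδ hp
  have hD : IsOpen (cyl (Metric.ball (0 : H1) δ)) := isOpen_cyl Metric.isOpen_ball
  have hL : IsOpen (cyl (Metric.ball (0 : H1) ((dat φ).lieRad g))) := isOpen_cyl Metric.isOpen_ball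
  have hm := contDiffOn_flow_fixed φ g (s := -1) (by norm_num)
  -- The image is described through the inverse flow as a preimage of an open set, which gives its
  -- openness without an inverse function theorem.
  have him : (dat φ).flow g 1 '' cyl (Metric.ball 0 δ) =
      cyl (Metric.ball 0 ((dat φ).lieRad g)) ∩ (dat φ).flow g (-1) ⁻¹' cyl (Metric.ball 0 δ) := by
    ext q
    constructor
    · rintro ⟨p, hp, rfl⟩
      refine ⟨hmaps hp, ?_⟩
      rw [mem_preimage, PData.flow_neg_flow (D := dat φ) (g := g) (by norm_num) (hnorm (hsub hp)).le]
      exact hp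
    · rintro ⟨hq, hq'⟩
      refine ⟨_, hq', ?_⟩
      have := PData.flow_neg_flow (D := dat φ) (g := g) (s := -1) (by norm_num) (hnorm hq).le
      rwa [neg_neg] at this
  refine ⟨hD, (contDiffOn_flow_fixed φ g (by norm_num)).mono hsub, ?_,
    ⟨(dat φ).flow g (-1), ?_, ?_⟩, ?_⟩
  · rw [him]
    exact hm.continuousOn.isOpen_inter_preimage hL hD
  · rw [him]
    exact hm.mono inter_subset_left
  · intro p hp
    exact PData.flow_neg_flow (D := dat φ) (g := g) (by norm_num) (hnorm (hsub hp)).le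
  · intro p hp X Y
    have h := symplectic_of_flow (B := sympB) (fun x y => symp_antisymm x y)
      (PData.isOpen_flowDom (D := dat φ) (g := g)) (PData.contDiffOn_flow (D := dat φ) (g := g)) (PData.contDiff_vec (D := dat φ) (g := g))
      (PData.contDiff_eval_xval (D := dat φ) g.χ) (p := p)
      (fun q hq => PData.hasDerivAt_flow (D := dat φ) (g := g) hq.1 hq.2.le)
      (fun p Y => symp_vec φ g p Y)
      (fun s hs => ⟨by rw [abs_of_nonneg hs.1]; exact hs.2.trans_lt (by norm_num), hnorm (hsub hp)⟩)
      (Filter.Eventually.of_forall fun p' => PData.flow_zero (D := dat φ) (g := g) p') X Y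
    exact h

theorem isLieTransformOn_flow {F : Phase → ℂ} (hF : F = (dat φ).fnχ g) {δ : ℝ}
    (hδ : δ ≤ (dat φ).lieRad g) :
    IsLieTransformOn F ((dat φ).flow g 1) (cyl (Metric.ball 0 δ)) := by
  subst hF
  intro p hp
  have hp' : ‖p.2.2‖ ≤ (dat φ).lieRad g := (by simpa [cyl] using hp : ‖p.2.2‖ < δ).le.trans hδ
  refine ⟨fun s => (dat φ).flow g s p, PData.flow_zero (D := dat φ) (g := g) p, rfl, fun s hs =>
    ⟨(dat φ).vec g ((dat φ).flow g s p), ?_, fun Y => symp_vec φ g _ Y⟩⟩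
  refine (PData.hasDerivAt_flow (D := dat φ) (g := g) ?_ hp').hasDerivWithinAt
  rw [abs_of_nonneg hs.1]
  exact hs.2.trans_lt (by norm_num)

end flow

theorem isCanonicalOn_id {D : Set Phase} (hD : IsOpen D) : IsCanonicalOn id D := by
  refine ⟨hD, contDiffOn_id, by rwa [image_id], ⟨id, contDiffOn_id, fun _ _ => rfl⟩, ?_⟩
  intro p _ X Y
  rw [fderiv_id]
  rfl

theorem IsCanonicalOn.comp {T F : Phase → Phase} {D D' : Set Phase} (hT : IsCanonicalOn T D')
    (hF : IsCanonicalOn F D) (hm : MapsTo F D D') : IsCanonicalOn (T ∘ F) D := by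
  obtain ⟨hD', hTd, hTo, ⟨S, hSd, hSl⟩, hTs⟩ := hT
  obtain ⟨hD, hFd, hFo, ⟨R, hRd, hRl⟩, hFs⟩ := hF
  have hsub : F '' D ⊆ D' := hm.image_subset
  have him : (T ∘ F) '' D = T '' D' ∩ S ⁻¹' (F '' D) := by
    rw [image_comp]
    ext q
    constructor
    · rintro ⟨y, hy, rfl⟩
      refine ⟨⟨y, hsub hy, rfl⟩, ?_⟩
      rw [mem_preimage, hSl (hsub hy)]
      exact hy
    · rintro ⟨⟨y, hy, rfl⟩, hq⟩
      rw [mem_preimage, hSl hy] at hq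
      exact ⟨y, hq, rfl⟩
  refine ⟨hD, hTd.comp hFd hm, ?_, ⟨R ∘ S, ?_, ?_⟩, ?_⟩
  · rw [him]
    exact hSd.continuousOn.isOpen_inter_preimage hTo hFo
  · rw [him]
    exact hRd.comp (hSd.mono inter_subset_left) fun q hq => hq.2
  · intro p hp
    rw [Function.comp_apply, Function.comp_apply, hSl (hm hp), hRl hp]
  · intro p hp X Y
    have h1 : DifferentiableAt ℝ F p :=
      ((hFd.contDiffAt (hD.mem_nhds hp)).differentiableAt (by simp))
    have h2 : DifferentiableAt ℝ T (F p) :=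
      ((hTd.contDiffAt (hD'.mem_nhds (hm hp))).differentiableAt (by simp))
    rw [fderiv_comp _ h2 h1, ContinuousLinearMap.comp_apply, ContinuousLinearMap.comp_apply,
      hTs _ (hm hp), hFs _ hp]

end NLSNormalForm

end


noncomputable section

namespace NLSNormalForm

/-! ### The quadratic energy -/

theorem lineDerivOp_conjS (m : E3) (ψ : 𝓢(E3, ℂ)) :
    (∂_{m} (conjS ψ) : 𝓢(E3, ℂ)) = conjS (∂_{m} ψ) := by
  ext x
  rw [conjS_apply, SchwartzMap.lineDerivOp_apply_eq_fderiv, SchwartzMap.lineDerivOp_apply_eq_fderiv]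
  have : (conjS ψ : E3 → ℂ) = (Complex.conjCLE : ℂ →L[ℝ] ℂ) ∘ ψ := rfl
  rw [this, fderiv_comp _ (ContinuousLinearMap.differentiableAt _) ψ.differentiableAt,
    ContinuousLinearMap.fderiv]
  rfl

/-- The distributional partial derivative of an element of `H¹`. -/
def gradC (j : Fin 3) (u : H1) : L2 := l2rep (∂_{EuclideanSpace.single j (1 : ℝ)} u.toDist)

theorem l2Incl_gradC (j : Fin 3) (u : H1) :
    l2Incl (gradC j u) = ∂_{EuclideanSpace.single j (1 : ℝ)} u.toDist := by
  refine l2Incl_l2rep (memSobolev_zero_iff'.mp ?_)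
  have := (H1.memSobolev u).lineDerivOp (m := EuclideanSpace.single j (1 : ℝ))
  simpa using this

theorem gradC_add (j : Fin 3) (u v : H1) : gradC j (u + v) = gradC j u + gradC j v := by
  apply l2Incl_injective
  rw [map_add, l2Incl_gradC, l2Incl_gradC, l2Incl_gradC, map_add, LineDeriv.lineDerivOp_add]

theorem gradC_ofSchwartz (j : Fin 3) (ψ : 𝓢(E3, ℂ)) : gradC j (ofSchwartz ψ) =
    ((∂_{EuclideanSpace.single j (1 : ℝ)} ψ : 𝓢(E3, ℂ)).toLp 2 : L2) := by
  apply l2Incl_injective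
  rw [l2Incl_gradC, l2Incl_toLp, toDist_ofSchwartz, lineDerivOp_toTemperedDistributionCLM_eq]

theorem inner_toLp (ψ : 𝓢(E3, ℂ)) (f : L2) : inner ℂ (ψ.toLp 2 : L2) f = l2Incl f (conjS ψ) := by
  rw [L2.inner_def, l2Incl_apply]
  refine integral_congr_ae ?_
  filter_upwards [SchwartzMap.coeFn_toLp ψ 2 volume] with x hx
  rw [hx, RCLike.inner_apply, conjS_apply, mul_comm]

theorem inner_gradC (j : Fin 3) (ψ : 𝓢(E3, ℂ)) (u : H1) :
    inner ℂ (gradC j (ofSchwartz ψ)) (gradC j u) =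
      -pair (∂_{EuclideanSpace.single j (1 : ℝ)} (∂_{EuclideanSpace.single j (1 : ℝ)}
        (conjS ψ) : 𝓢(E3, ℂ)) : 𝓢(E3, ℂ)) u := by
  rw [gradC_ofSchwartz, inner_toLp, l2Incl_gradC, pair_eq, ← lineDerivOp_conjS,
    TemperedDistribution.lineDerivOp_apply_apply, map_neg]

theorem integral_norm_sq_eq (f : L2) : ∫ x, ‖f x‖ ^ 2 = ‖f‖ ^ 2 := by
  have h : (inner ℂ f f : ℂ).re = ‖f‖ ^ 2 := by
    rw [inner_self_eq_norm_sq_to_K]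
    norm_cast
  rw [← h, L2.inner_def]
  have h2 : ∀ x, inner ℂ (f x) (f x) = ((‖f x‖ ^ 2 : ℝ) : ℂ) := fun x => by
    rw [inner_self_eq_norm_sq_to_K]
    norm_cast
  simp only [h2]
  have h3 : (∫ x, ((‖f x‖ ^ 2 : ℝ) : ℂ)) = ((∫ x, ‖f x‖ ^ 2 : ℝ) : ℂ) := integral_ofReal
  rw [h3, Complex.ofReal_re]

theorem kineticEnergy_eq (V : 𝓢(E3, ℝ)) (c : ℝ) (u : H1) : kineticEnergy V c u =
    (∑ j, ‖gradC j u‖ ^ 2) + c * ‖emb u‖ ^ 2 + ∫ x, V x * ‖fn u x‖ ^ 2 := by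
  have h : ∀ j, ∫ x : E3, ‖l2rep (∂_{EuclideanSpace.single j (1 : ℝ)} u.toDist) x‖ ^ 2 =
      ‖gradC j u‖ ^ 2 := fun j => integral_norm_sq_eq _
  have h' : ∫ x : E3, ‖fn u x‖ ^ 2 = ‖emb u‖ ^ 2 := by
    rw [fn_eq_emb]
    exact integral_norm_sq_eq _
  rw [kineticEnergy, h']
  simp only [h]

theorem norm_add_sq_complex (a b : L2) :
    ‖a + b‖ ^ 2 = ‖a‖ ^ 2 + 2 * (inner ℂ b a : ℂ).re + (inner ℂ b b : ℂ).re := by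
  rw [norm_add_sq (𝕜 := ℂ), inner_re_symm]
  congr 1
  rw [inner_self_eq_norm_sq_to_K]
  norm_cast

theorem integrable_mul_norm_sq (V : 𝓢(E3, ℝ)) (u : H1) : Integrable fun x => V x * ‖fn u x‖ ^ 2 := by
  have h1 : Integrable fun x => ‖fn u x‖ ^ 2 := (memLp_fn u).integrable_norm_pow (by norm_num)
  obtain ⟨C, hC⟩ := V.decay 0 0
  refine h1.bdd_mul (c := C) V.continuous.aestronglyMeasurable
    (Filter.Eventually.of_forall fun x => ?_)
  simpa using hC.2 x

theorem integral_potential_add (V : 𝓢(E3, ℝ)) (ψ : 𝓢(E3, ℂ)) (u : H1) :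
    ∫ x, V x * ‖fn (u + ofSchwartz ψ) x‖ ^ 2 = (∫ x, V x * ‖fn u x‖ ^ 2)
      + 2 * (pair (SchwartzMap.smulLeftCLM ℂ (toC V) (conjS ψ)) u).re
      + (pair (SchwartzMap.smulLeftCLM ℂ (toC V) (conjS ψ)) (ofSchwartz ψ)).re := by
  have hi := fun u => integrable_schwartz_mul_fn (SchwartzMap.smulLeftCLM ℂ (toC V) (conjS ψ)) u
  have hre : ∀ w, (pair (SchwartzMap.smulLeftCLM ℂ (toC V) (conjS ψ)) w).re =
      ∫ x, ((SchwartzMap.smulLeftCLM ℂ (toC V) (conjS ψ)) x * fn w x).re := fun w => by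
    have := integral_re (hi w)
    exact this.symm
  have hr : ∀ w, Integrable fun x =>
      ((SchwartzMap.smulLeftCLM ℂ (toC V) (conjS ψ)) x * fn w x).re := fun w => (hi w).re
  have hs : Integrable fun x => V x * ‖fn u x‖ ^ 2 +
      2 * ((SchwartzMap.smulLeftCLM ℂ (toC V) (conjS ψ)) x * fn u x).re :=
    (integrable_mul_norm_sq V u).add ((hr u).const_mul 2)
  rw [hre, hre, ← integral_const_mul, ← integral_add (integrable_mul_norm_sq V u)
    ((hr u).const_mul 2), ← integral_add hs (hr _)]
  refine integral_congr_ae ?_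
  filter_upwards [fn_add u (ofSchwartz ψ), fn_ofSchwartz ψ] with x h1 h2
  simp only [h1, h2, SchwartzMap.smulLeftCLM_apply_apply (toC V).hasTemperateGrowth]
  rw [← Complex.normSq_eq_norm_sq, ← Complex.normSq_eq_norm_sq, Complex.normSq_add]
  simp [Complex.normSq_apply]
  ring

theorem pair_schS (V : 𝓢(E3, ℝ)) (c : ℝ) (θ : 𝓢(E3, ℂ)) (u : H1) : pair (schS V c θ) u =
    (∑ j : Fin 3, -pair (∂_{EuclideanSpace.single j (1 : ℝ)} (∂_{EuclideanSpace.single j (1 : ℝ)}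
      θ : 𝓢(E3, ℂ)) : 𝓢(E3, ℂ)) u) + c * pair θ u
      + pair (SchwartzMap.smulLeftCLM ℂ (toC V) θ) u := by
  have : -(Δ θ : 𝓢(E3, ℂ)) = (-1 : ℂ) • (Δ θ : 𝓢(E3, ℂ)) := by rw [neg_one_smul]
  rw [schS_eq, pair_add_left, pair_add_left, pair_smul_left, this, pair_smul_left,
    SchwartzMap.laplacian_eq_sum (EuclideanSpace.basisFun (Fin 3) ℝ), pair_sum_left,
    Finset.sum_neg_distrib]
  simp only [EuclideanSpace.basisFun_apply]
  ring

/-- The energy is a quadratic form, with polar form given by `𝓗`. -/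
theorem kineticEnergy_add (V : 𝓢(E3, ℝ)) (c : ℝ) (u : H1) (ψ : 𝓢(E3, ℂ)) :
    kineticEnergy V c (u + ofSchwartz ψ) = kineticEnergy V c u
      + 2 * (pair (schS V c (conjS ψ)) u).re
      + (pair (schS V c (conjS ψ)) (ofSchwartz ψ)).re := by
  rw [kineticEnergy_eq, kineticEnergy_eq, integral_potential_add, pair_schS, pair_schS]
  have h0 : ∀ w, inner ℂ (emb (ofSchwartz ψ)) (emb w) = pair (conjS ψ) w := fun w => by
    rw [emb_ofSchwartz, inner_toLp, l2Incl_emb, pair_eq]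
  simp only [gradC_add, map_add, norm_add_sq_complex, inner_gradC, h0, Finset.sum_add_distrib,
    ← Finset.mul_sum, Complex.add_re, Complex.re_sum, Complex.re_ofReal_mul]
  ring

theorem pair_schS_comm (V : 𝓢(E3, ℝ)) (c : ℝ) (θ ψ : 𝓢(E3, ℂ)) :
    pair (schS V c θ) (ofSchwartz ψ) = pair (schS V c ψ) (ofSchwartz θ) := by
  have h : ∀ θ ψ, pair (schS V c θ) (ofSchwartz ψ) = pair θ (ofSchwartz (schS V c ψ)) := by
    intro θ ψ
    rw [pair_eq, pair_eq, toDist_ofSchwartz, toDist_ofSchwartz, ← schrodinger_apply,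
      schrodinger_coe]
  rw [h, pair_comm]

section energy

variable {n : ℕ} {V : 𝓢(E3, ℝ)} {c : ℝ} {l : Fin (n + 1) → ℝ} {φ : Fin (n + 1) → 𝓢(E3, ℂ)}

theorem schS_projS (h : EigenSys V c l φ) (θ : 𝓢(E3, ℂ)) :
    schS V c (projS φ θ) = projS φ (schS V c θ) := by
  rw [projS, projS, map_sub, map_sum]
  congr 1
  refine Finset.sum_congr rfl fun j _ => ?_
  rw [map_smul, h.eig, pair_schS_comm, h.eig, pair_smul_left, pair_comm, smul_smul, mul_comm]

/-- The Poisson bracket with the quadratic energy `H_F`. -/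
def energyD (V : 𝓢(E3, ℝ)) (c : ℝ) (l : Fin (n + 1) → ℝ) :
    Derivation ℂ (VPoly (Lab n)) (VPoly (Lab n)) :=
  MvPolynomial.mkDerivation ℂ fun j => match j with
    | .e => MvPolynomial.C (-Complex.I) * MvPolynomial.X .e
    | .e' => MvPolynomial.C Complex.I * MvPolynomial.X .e'
    | .o => 0
    | .h (.inl j) => MvPolynomial.C (Complex.I * l j) * MvPolynomial.X (.h (.inl j))
    | .h (.inr θ) => MvPolynomial.C Complex.I * MvPolynomial.X (.h (.inr (schS V c θ)))
    | .a (.inl j) => MvPolynomial.C (-(Complex.I * l j)) * MvPolynomial.X (.a (.inl j))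
    | .a (.inr θ) => MvPolynomial.C (-Complex.I) * MvPolynomial.X (.a (.inr (schS V c θ)))

theorem isHom_energyD {j q : ℤ} {d : ℕ} {p : VPoly (Lab n)} (hp : IsHom j q d p) :
    IsHom j q d (energyD V c l p) := by
  have := isWeightedHomogeneous_mkDerivation (w := Var.wt) (δ := ((0, 0, 0) : ℤ × ℤ × ℕ))
    (f := fun j : Var (Lab n) => energyD V c l (MvPolynomial.X j)) (fun j => ?_) hp
  · have h2 : MvPolynomial.mkDerivation ℂ (fun j : Var (Lab n) => energyD V c l (MvPolynomial.X j)) =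
        energyD V c l := by
      refine MvPolynomial.derivation_ext fun j => ?_
      rw [MvPolynomial.mkDerivation_X]
    rw [h2] at this
    simpa using this
  · have h0 : Var.wt j + (0, 0, 0) = Var.wt j := add_zero _
    rw [h0, energyD, MvPolynomial.mkDerivation_X]
    have key : ∀ (a : ℂ) (k : Var (Lab n)), MvPolynomial.IsWeightedHomogeneous Var.wt
        (MvPolynomial.C a * MvPolynomial.X k) (Var.wt k) := fun a k =>
      MvPolynomial.IsWeightedHomogeneous.C_mul (MvPolynomial.isWeightedHomogeneous_X _ _ _) _
    rcases j with _ | _ | _ | (j | θ) | (j | θ)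
    case o => exact MvPolynomial.isWeightedHomogeneous_zero _ _ _
    all_goals exact key _ _

theorem starP_energyD (p : VPoly (Lab n)) :
    starP (energyD V c l p) = energyD V c l (starP p) := by
  induction p using MvPolynomial.induction_on with
  | C c =>
    rw [starP_C, ← MvPolynomial.algebraMap_eq]
    simp
  | add p q hp hq => rw [map_add, map_add, map_add, map_add, hp, hq]
  | mul_X p j hp =>
    have hj : starP (energyD V c l (MvPolynomial.X j)) = energyD V c l (MvPolynomial.X j.swap) := by
      rcases j with _ | _ | _ | (j | θ) | (j | θ) <;>
        simp [energyD, Var.swap, MvPolynomial.mkDerivation_X]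
    rw [Derivation.leibniz, map_add, map_mul, starP_X, Derivation.leibniz]
    simp only [smul_eq_mul, map_mul, hp, hj, starP_X]

theorem eval_derivation {ι : Type} (E : Derivation ℂ (VPoly ι) (VPoly ι)) {S : Finset ι}
    {p : VPoly ι} (hp : p ∈ VSupp S) (x : Var ι → ℂ) :
    MvPolynomial.eval x (E p) = ∑ j ∈ Var.fin S,
      MvPolynomial.eval x (MvPolynomial.pderiv j p) * MvPolynomial.eval x (E (MvPolynomial.X j)) := by
  rw [VSupp, ← Var.coe_fin] at hp
  have h2 : MvPolynomial.mkDerivation ℂ (fun j : Var ι => E (MvPolynomial.X j)) = E := by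
    refine MvPolynomial.derivation_ext fun j => ?_
    rw [MvPolynomial.mkDerivation_X]
  conv_lhs => rw [← h2, mkDerivation_eq_sum _ hp]
  simp only [map_sum, map_mul]

/-- The formal derivation is the Poisson bracket with `H_F`: the `h` and `a` derivatives are paired
with `𝓗`, and the derivative in time enters with a minus sign because `H_F` contains `-τ`. -/
theorem eval_energyD (h : EigenSys V c l φ) {S : Finset (Lab n)} {p : VPoly (Lab n)}
    (hp : p ∈ VSupp S) (t : ℝ) (u : H1) :
    MvPolynomial.eval ((dat φ).xval t u) (energyD V c l p) =
      (∑ b ∈ S, (Complex.I * pair (schS V c (rep φ b)) u *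
          MvPolynomial.eval ((dat φ).xval t u) (MvPolynomial.pderiv (.h b) p)
        - Complex.I * conj (pair (schS V c (rep φ b)) u) *
          MvPolynomial.eval ((dat φ).xval t u) (MvPolynomial.pderiv (.a b) p)))
        - MvPolynomial.eval ((dat φ).xval t u) (dT (Lab n) p) := by
  have hh : ∀ b, MvPolynomial.eval ((dat φ).xval t u) (energyD V c l (MvPolynomial.X (.h b))) =
      Complex.I * pair (schS V c (rep φ b)) u := by
    rintro (j | θ)
    · simp only [energyD, MvPolynomial.mkDerivation_X, map_mul, MvPolynomial.eval_C,
        MvPolynomial.eval_X, PData.xval, rep, dat_ℓ, h.eig, pair_smul_left]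
      ring
    · simp only [energyD, MvPolynomial.mkDerivation_X, map_mul, MvPolynomial.eval_C,
        MvPolynomial.eval_X, PData.xval, rep, dat_ℓ, schS_projS h]
  have ha : ∀ b, MvPolynomial.eval ((dat φ).xval t u) (energyD V c l (MvPolynomial.X (.a b))) =
      -(Complex.I * conj (pair (schS V c (rep φ b)) u)) := by
    intro b
    have := eval_starP ((dat φ).xval_swap t u) (energyD V c l (MvPolynomial.X (.h b)))
    rw [starP_energyD, starP_X, hh, map_mul, Complex.conj_I] at this
    rw [← neg_mul, ← this]
    rfl
  rw [eval_derivation _ hp, eval_derivation _ hp, Var.sum_fin, Var.sum_fin]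
  simp only [hh, ha]
  simp only [energyD, dT, MvPolynomial.mkDerivation_X, map_mul, MvPolynomial.eval_C,
        MvPolynomial.eval_X, map_zero, mul_zero, Finset.sum_const_zero]
  have e1 : ∀ X Y : Lab n → ℂ, ∑ b ∈ S, (X b - Y b) = ∑ b ∈ S, X b - ∑ b ∈ S, Y b :=
    fun X Y => Finset.sum_sub_distrib X Y
  rw [e1]
  simp only [mul_neg, Finset.sum_neg_distrib]
  simp only [mul_comm (MvPolynomial.eval ((dat φ).xval t u) (MvPolynomial.pderiv _ p))]
  ring

theorem hasDerivAt_conj {x : ℝ → ℂ} {v : ℂ} {s : ℝ} (h : HasDerivAt x v s) :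
    HasDerivAt (fun s => conj (x s)) (conj v) s :=
  (Complex.conjCLE : ℂ →L[ℝ] ℂ).hasFDerivAt.comp_hasDerivAt s h

theorem hasDerivAt_re {x : ℝ → ℂ} {v : ℂ} {s : ℝ} (h : HasDerivAt x v s) :
    HasDerivAt (fun s => (x s).re) v.re s :=
  Complex.reCLM.hasFDerivAt.comp_hasDerivAt s h

theorem conjS_sum_smul {α : Type} (s : Finset α) (x : α → ℂ) (ψ : α → 𝓢(E3, ℂ)) :
    conjS (∑ b ∈ s, x b • ψ b) = ∑ b ∈ s, conj (x b) • conjS (ψ b) := by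
  ext y
  rw [conjS_apply, sum_apply, sum_apply, map_sum]
  simp

theorem conj_pair_schS (V : 𝓢(E3, ℝ)) (c : ℝ) (θ ψ : 𝓢(E3, ℂ)) :
    conj (pair (schS V c θ) (ofSchwartz (conjS ψ))) =
      pair (schS V c ψ) (ofSchwartz (conjS θ)) := by
  rw [← pair_conj_conj, conjS_conjS, ← schS_conjS, pair_schS_comm]

/-- Only Schwartz directions are varied, so `𝓗` can be applied to them, while the base point `u` is
merely in `H¹`. The quadratic terms combine because `𝓗` is symmetric and real. -/
theorem hasDerivAt_kineticEnergy (V : 𝓢(E3, ℝ)) (c : ℝ) (S : Finset (Lab n)) {x v : Lab n → ℝ → ℂ}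
    {s : ℝ} (hx : ∀ b, HasDerivAt (x b) (v b s) s) (u : H1) :
    HasDerivAt (fun s => kineticEnergy V c (u + ∑ b ∈ S, x b s • (dat φ).r b))
      (∑ b ∈ S, 2 * (conj (v b s) *
        pair (schS V c (rep φ b)) (u + ∑ b ∈ S, x b s • (dat φ).r b)).re) s := by
  have h1 : ∀ s, u + ∑ b ∈ S, x b s • (dat φ).r b =
      u + ofSchwartz (∑ b ∈ S, x b s • conjS (rep φ b)) := fun s => by
    simp only [map_sum, map_smul, dat_r]
  have h2 : ∀ s w, pair (schS V c (conjS (∑ b ∈ S, x b s • conjS (rep φ b)))) w =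
      ∑ b ∈ S, conj (x b s) * pair (schS V c (rep φ b)) w := fun s w => by
    simp only [conjS_sum_smul, conjS_conjS, map_sum, map_smul, pair_sum_left, pair_smul_left]
  have h3 : ∀ s b, pair (schS V c (rep φ b)) (ofSchwartz (∑ b ∈ S, x b s • conjS (rep φ b))) =
      ∑ b' ∈ S, x b' s * pair (schS V c (rep φ b)) (ofSchwartz (conjS (rep φ b'))) := fun s b => by
    simp only [← pairL_apply, map_sum, map_smul, smul_eq_mul]
  have h4 : ∀ s b, pair (schS V c (rep φ b)) (u + ∑ b ∈ S, x b s • (dat φ).r b) =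
      pair (schS V c (rep φ b)) u +
      ∑ b' ∈ S, x b' s * pair (schS V c (rep φ b)) (ofSchwartz (conjS (rep φ b'))) := fun s b => by
    rw [← h3, h1]
    simp only [← pairL_apply, map_add]
  have h5 : (fun s => kineticEnergy V c (u + ∑ b ∈ S, x b s • (dat φ).r b)) = fun s =>
      kineticEnergy V c u + 2 * (∑ b ∈ S, conj (x b s) * pair (schS V c (rep φ b)) u).re
      + (∑ b ∈ S, conj (x b s) * ∑ b' ∈ S,
        x b' s * pair (schS V c (rep φ b)) (ofSchwartz (conjS (rep φ b')))).re := by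
    funext s
    rw [h1, kineticEnergy_add, h2, h2]
    simp only [h3]
  rw [h5]
  simp only [h4]
  have hc : ∀ b, HasDerivAt (fun s => conj (x b s)) (conj (v b s)) s := fun b => hasDerivAt_conj (hx b)
  have d1 := (hasDerivAt_re (HasDerivAt.fun_sum fun b (_ : b ∈ S) =>
    (hc b).mul_const (pair (schS V c (rep φ b)) u))).const_mul 2
  have d2 := hasDerivAt_re (HasDerivAt.fun_sum fun b (_ : b ∈ S) =>
    (hc b).fun_mul (HasDerivAt.fun_sum fun b' (_ : b' ∈ S) =>
      (hx b').mul_const (pair (schS V c (rep φ b)) (ofSchwartz (conjS (rep φ b'))))))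
  refine ((d1.const_add (kineticEnergy V c u)).add d2).congr_deriv ?_
  simp only [Finset.sum_add_distrib, Complex.add_re, mul_add, ← Finset.mul_sum]
  have h6 : (∑ b ∈ S, conj (x b s) * ∑ b' ∈ S,
      v b' s * pair (schS V c (rep φ b)) (ofSchwartz (conjS (rep φ b')))).re =
      (∑ b ∈ S, conj (v b s) * ∑ b' ∈ S,
        x b' s * pair (schS V c (rep φ b)) (ofSchwartz (conjS (rep φ b')))).re := by
    rw [← Complex.conj_re]
    simp only [map_sum, map_mul, Complex.conj_conj, conj_pair_schS, Finset.mul_sum]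
    rw [Finset.sum_comm]
    congr 1
    refine Finset.sum_congr rfl fun b _ => Finset.sum_congr rfl fun b' _ => ?_
    ring
  rw [h6, Complex.re_sum, Complex.re_sum]
  ring

/-- The quadratic energy along the flow. -/
theorem hamF_flow (h : EigenSys V c l φ) (g : Gen (Lab n)) {p : Phase}
    (hp : ‖p.2.2‖ ≤ (dat φ).lieRad g) :
    hamF V c ((dat φ).flow g 1 p) =
      hamF V c p + ((dat φ).prim g 1 (energyD V c l g.χ) p.2.1 p.2.2).re := by
  -- Both the energy along the flow and the primitive of the bracket have the bracket at the
  -- displaced point as derivative, so their difference is constant in `s`.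
  have hd : ∀ s ∈ Icc (0 : ℝ) 1, HasDerivAt (fun s => hamF V c ((dat φ).flow g s p) -
      ((dat φ).prim g s (energyD V c l g.χ) p.2.1 p.2.2).re) 0 s := by
    intro s hs
    have hs2 : |s| < 2 := by rw [abs_of_nonneg hs.1]; exact hs.2.trans_lt (by norm_num)
    have d1 := hasDerivAt_kineticEnergy (φ := φ) V c g.S
      (x := fun b s => (dat φ).prim g s (g.velo b) p.2.1 p.2.2)
      (v := fun b s => MvPolynomial.eval ((dat φ).xval p.2.1 ((dat φ).flowU g s p.2.1 p.2.2))
        (g.velo b)) (fun b => PData.hasDerivAt_prim (PData.isHom_velo b) hs2 p.2.1 hp) p.2.2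
    have d2 := (hasDerivAt_re (PData.hasDerivAt_prim (D := dat φ) (g := g) (isHom_dT g.hom) hs2
      p.2.1 hp)).const_add p.1
    have d3 := hasDerivAt_re (PData.hasDerivAt_prim (D := dat φ) (g := g)
      (isHom_energyD (V := V) (c := c) (l := l) g.hom) hs2 p.2.1 hp)
    refine ((d1.sub d2).sub d3).congr_deriv ?_
    rw [eval_energyD h g.supp]
    simp only [Complex.sub_re, Complex.re_sum]
    rw [sub_sub, sub_eq_zero]
    have this : (dat φ).flowU g s p.2.1 p.2.2 = p.2.2 +
      ∑ b ∈ g.S, (dat φ).prim g s (g.velo b) p.2.1 p.2.2 • (dat φ).r b := rfl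
    rw [add_sub_cancel]
    refine Finset.sum_congr rfl fun b _ => ?_
    rw [← this, eval_pderiv_h, Gen.velo, MvPolynomial.smul_eval]
    simp
    ring
  have hc := constant_of_has_deriv_right_zero (a := 0) (b := 1)
    (fun s hs => (hd s hs).continuousAt.continuousWithinAt)
    (fun s hs => (hd s ⟨hs.1, hs.2.le⟩).hasDerivWithinAt) 1 (by simp)
  simp only [PData.flow_zero, PData.prim_zero, Complex.zero_re, sub_zero] at hc
  rw [← hc, sub_add_cancel]

end energy

end NLSNormalForm

end


noncomputable section

namespace NLSNormalForm

/-! ### Expansion of the quartic energy -/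

/-- The product of Schwartz functions. -/
def mulS (ψ η : 𝓢(E3, ℂ)) : 𝓢(E3, ℂ) := SchwartzMap.smulLeftCLM ℂ ψ η

@[simp] theorem mulS_apply (ψ η : 𝓢(E3, ℂ)) (x : E3) : mulS ψ η x = ψ x * η x :=
  SchwartzMap.smulLeftCLM_apply_apply ψ.hasTemperateGrowth _ _

/-- `∫ f^a \bar f^b ψ`. -/
def nlInt (a b : ℕ) (ψ : 𝓢(E3, ℂ)) (f : H1) : ℂ := ∫ x, fn f x ^ a * conj (fn f x) ^ b * ψ x

theorem sq_mul_conj_sq (z : ℂ) : z ^ 2 * conj z ^ 2 = ((‖z‖ ^ 4 : ℝ) : ℂ) := by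
  rw [← mul_pow, Complex.mul_conj', ← pow_mul]
  norm_cast

theorem integrable_norm_pow_four (f : H1) : Integrable fun x => ‖fn f x‖ ^ 4 :=
  (memLp_four_fn f).integrable_norm_pow (by norm_num)

theorem integrable_nl {a b : ℕ} (h : a + b ≤ 4) (ψ : 𝓢(E3, ℂ)) (f : H1) :
    Integrable fun x => fn f x ^ a * conj (fn f x) ^ b * ψ x := by
  have hm : AEStronglyMeasurable (fn f) := (memLp_fn f).1
  have hψ : Integrable fun x => ψ x := ψ.integrable
  obtain ⟨C, hC⟩ := ψ.decay 0 0
  have h1 : Integrable fun x => ‖fn f x‖ ^ 4 * ‖ψ x‖ := by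
    refine (integrable_norm_pow_four f).mul_bdd (c := C) ψ.continuous.norm.aestronglyMeasurable
      (Filter.Eventually.of_forall fun x => ?_)
    simpa using hC.2 x
  refine (hψ.norm.add h1).mono' ?_ (Filter.Eventually.of_forall fun x => ?_)
  · exact ((hm.pow a).mul ((Complex.continuous_conj.comp_aestronglyMeasurable hm).pow b)).mul
      ψ.continuous.aestronglyMeasurable
  · rw [norm_mul, norm_mul, norm_pow, norm_pow, RCLike.norm_conj, ← pow_add]
    have h2 : ‖fn f x‖ ^ (a + b) ≤ 1 + ‖fn f x‖ ^ 4 := by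
      rcases le_total ‖fn f x‖ 1 with h3 | h3
      · exact (pow_le_one₀ (norm_nonneg _) h3).trans (by have := norm_nonneg (fn f x); nlinarith [pow_nonneg this 4])
      · exact (pow_le_pow_right₀ h3 h).trans (by linarith)
    calc _ ≤ (1 + ‖fn f x‖ ^ 4) * ‖ψ x‖ := by gcongr
      _ = _ := by simp only [Pi.add_apply]; ring

section expansion

variable {n : ℕ} (φ : Fin (n + 1) → 𝓢(E3, ℂ))

/-- The continuous coordinate as a function. -/
def fc (u : H1) (x : E3) : ℂ := fn (fCoord (eigH φ) u) x

/-- Polynomials in `f(x), \bar f(x)`, of degree at most `k`, whose coefficients are Schwartz functions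
times functions of class `PData.Cls`, with total weights `(j, q, ≥ d)`. -/
inductive Sym (j q : ℤ) (d k : ℕ) : (ℝ → H1 → E3 → ℂ) → Prop
  | term (a b e : ℕ) (Q : ℝ → H1 → ℂ) (ψ : 𝓢(E3, ℂ))
      (hQ : (dat φ).Cls (j - (a + b)) (q - (a - b)) e Q) (hd : d ≤ e + (a + b)) (hk : a + b ≤ k) :
      Sym j q d k fun t u x => Q t u * (fc φ u x ^ a * conj (fc φ u x) ^ b * ψ x)
  | add {W W' : ℝ → H1 → E3 → ℂ} (h : Sym j q d k W) (h' : Sym j q d k W') :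
      Sym j q d k fun t u x => W t u x + W' t u x

variable {φ}

theorem Sym.congr {j q : ℤ} {d k : ℕ} {W W' : ℝ → H1 → E3 → ℂ} (h : Sym φ j q d k W)
    (e : ∀ t u x, W t u x = W' t u x) : Sym φ j q d k W' := by
  have : W = W' := funext fun t => funext fun u => funext fun x => e t u x
  rwa [← this]

theorem Sym.zero (j q : ℤ) (d k : ℕ) : Sym φ j q d k fun _ _ _ => 0 := by
  have h := Sym.term (φ := φ) (j := j) (q := q) (d := d) (k := k) 0 0 d (fun _ _ => 0) 0
    (PData.Cls.zero _ _ _) (by simp) (by simp)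
  exact h.congr fun t u x => zero_mul _

theorem Sym.sum {α : Type} {j q : ℤ} {d k : ℕ} (s : Finset α) {W : α → ℝ → H1 → E3 → ℂ}
    (h : ∀ b ∈ s, Sym φ j q d k (W b)) : Sym φ j q d k fun t u x => ∑ b ∈ s, W b t u x := by
  classical
  induction s using Finset.induction_on with
  | empty => exact (Sym.zero j q d k).congr fun t u x => (Finset.sum_empty).symm
  | insert a s ha ih =>
    simp only [Finset.sum_insert ha]
    exact (h a (Finset.mem_insert_self _ _)).add
      (ih fun b hb => h b (Finset.mem_insert_of_mem hb))

theorem Sym.mono {j q : ℤ} {d k d' k' : ℕ} {W : ℝ → H1 → E3 → ℂ} (h : Sym φ j q d k W)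
    (hd : d' ≤ d) (hk : k ≤ k') : Sym φ j q d' k' W := by
  induction h with
  | term a b e Q ψ hQ hd' hk' => exact .term a b e Q ψ hQ (hd.trans hd') (hk'.trans hk)
  | add _ _ ih ih' => exact ih.add ih'

theorem Sym.mul_cls {j q j' q' : ℤ} {d d' k : ℕ} {W : ℝ → H1 → E3 → ℂ} (h : Sym φ j q d k W)
    {P : ℝ → H1 → ℂ} (hP : (dat φ).Cls j' q' d' P) :
    Sym φ (j + j') (q + q') (d + d') k fun t u x => P t u * W t u x := by
  induction h with
  | term a b e Q ψ hQ hd hk =>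
    have h1 := hP.mul hQ
    have h2 := Sym.term (φ := φ) (j := j + j') (q := q + q') (d := d + d') (k := k) a b (d' + e)
      _ ψ (by convert h1 using 1 <;> ring) (by omega) hk
    exact h2.congr fun t u x => mul_assoc _ _ _
  | add _ _ ih ih' => exact (ih.add ih').congr fun t u x => (mul_add _ _ _).symm

theorem Sym.mul_schwartz {j q : ℤ} {d k : ℕ} {W : ℝ → H1 → E3 → ℂ} (h : Sym φ j q d k W)
    (η : 𝓢(E3, ℂ)) : Sym φ j q d k fun t u x => η x * W t u x := by
  induction h with
  | term a b e Q ψ hQ hd hk =>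
    refine (Sym.term a b e Q (mulS ψ η) hQ hd hk).congr fun t u x => ?_
    rw [mulS_apply]
    ring
  | add _ _ ih ih' => exact (ih.add ih').congr fun t u x => (mul_add _ _ _).symm

theorem Sym.mul_fc {j q : ℤ} {d k : ℕ} {W : ℝ → H1 → E3 → ℂ} (h : Sym φ j q d k W) :
    Sym φ (j + 1) (q + 1) (d + 1) (k + 1) fun t u x => fc φ u x * W t u x := by
  induction h with
  | term a b e Q ψ hQ hd hk =>
    refine (Sym.term (a + 1) b e Q ψ ?_ (by omega) (by omega)).congr fun t u x => ?_
    · convert hQ using 1 <;> push_cast <;> ring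
    · ring
  | add _ _ ih ih' => exact (ih.add ih').congr fun t u x => (mul_add _ _ _).symm

theorem Sym.mul_conj_fc {j q : ℤ} {d k : ℕ} {W : ℝ → H1 → E3 → ℂ} (h : Sym φ j q d k W) :
    Sym φ (j + 1) (q - 1) (d + 1) (k + 1) fun t u x => conj (fc φ u x) * W t u x := by
  induction h with
  | term a b e Q ψ hQ hd hk =>
    refine (Sym.term a (b + 1) e Q ψ ?_ (by omega) (by omega)).congr fun t u x => ?_
    · convert hQ using 1 <;> push_cast <;> ring
    · ring
  | add _ _ ih ih' => exact (ih.add ih').congr fun t u x => (mul_add _ _ _).symm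

/-- `∑ g_b s_b`, for functions `g_b` of the point and Schwartz functions `s_b`. -/
def shiftS {α : Type} (S : Finset α) (g : α → ℝ → H1 → ℂ) (s : α → 𝓢(E3, ℂ)) (t : ℝ) (u : H1)
    (x : E3) : ℂ := ∑ b ∈ S, g b t u * s b x

section shift

variable {α : Type} {S : Finset α} {g : α → ℝ → H1 → ℂ} {s : α → 𝓢(E3, ℂ)} {e : ℕ}

theorem Sym.mul_shift (hg : ∀ b ∈ S, (dat φ).Cls 1 1 e (g b)) {j q : ℤ} {d k : ℕ}
    {W : ℝ → H1 → E3 → ℂ} (h : Sym φ j q d k W) :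
    Sym φ (j + 1) (q + 1) (d + e) k fun t u x => shiftS S g s t u x * W t u x := by
  refine (Sym.sum S fun b hb => (h.mul_schwartz (s b)).mul_cls (hg b hb)).congr fun t u x => ?_
  rw [shiftS, Finset.sum_mul]
  exact Finset.sum_congr rfl fun b _ => by ring

theorem Sym.mul_conj_shift (hg : ∀ b ∈ S, (dat φ).Cls 1 1 e (g b)) {j q : ℤ} {d k : ℕ}
    {W : ℝ → H1 → E3 → ℂ} (h : Sym φ j q d k W) :
    Sym φ (j + 1) (q - 1) (d + e) k fun t u x => conj (shiftS S g s t u x) * W t u x := by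
  refine (Sym.sum S fun b hb =>
    (h.mul_schwartz (conjS (s b))).mul_cls (hg b hb).conj).congr fun t u x => ?_
  rw [shiftS, map_sum, Finset.sum_mul]
  refine Finset.sum_congr rfl fun b _ => ?_
  rw [map_mul, conjS_apply]
  ring

theorem Sym.shift (hg : ∀ b ∈ S, (dat φ).Cls 1 1 e (g b)) :
    Sym φ 1 1 e 0 (shiftS S g s) := by
  refine (Sym.sum S fun b hb => Sym.term 0 0 e (g b) (s b)
    (by simpa using hg b hb) (by simp) (by simp)).congr fun t u x => ?_
  simp [shiftS]

theorem Sym.conj_shift (hg : ∀ b ∈ S, (dat φ).Cls 1 1 e (g b)) :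
    Sym φ 1 (-1) e 0 fun t u x => conj (shiftS S g s t u x) := by
  refine (Sym.sum S fun b hb => Sym.term 0 0 e _ (conjS (s b))
    (by simpa using (hg b hb).conj) (by simp) (by simp)).congr fun t u x => ?_
  simp [shiftS]

theorem Sym.mul_fc_pow {j q : ℤ} {d k : ℕ} {W : ℝ → H1 → E3 → ℂ} (h : Sym φ j q d k W) (a b : ℕ) :
    Sym φ (j + (a + b)) (q + (a - b)) (d + (a + b)) (k + (a + b))
      fun t u x => fc φ u x ^ a * conj (fc φ u x) ^ b * W t u x := by
  induction a with
  | zero =>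
    induction b with
    | zero => simpa using h
    | succ b ih =>
      refine Sym.congr (W := fun t u x => conj (fc φ u x) * (fc φ u x ^ 0 * conj (fc φ u x) ^ b * W t u x))
        ?_ fun t u x => by ring
      convert ih.mul_conj_fc using 1 <;> push_cast <;> ring
  | succ a ih =>
    refine Sym.congr (W := fun t u x => fc φ u x * (fc φ u x ^ a * conj (fc φ u x) ^ b * W t u x))
      ?_ fun t u x => by ring
    convert ih.mul_fc using 1 <;> push_cast <;> ring

/-- `(f + Γ)^a (\bar f + \bar Γ)^b - f^a \bar f^b`. -/
def powDiff (S : Finset α) (g : α → ℝ → H1 → ℂ) (s : α → 𝓢(E3, ℂ)) (a b : ℕ) (t : ℝ) (u : H1)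
    (x : E3) : ℂ :=
  (fc φ u x + shiftS S g s t u x) ^ a * conj (fc φ u x + shiftS S g s t u x) ^ b -
    fc φ u x ^ a * conj (fc φ u x) ^ b

theorem powDiff_zero (t : ℝ) (u : H1) (x : E3) : powDiff (φ := φ) S g s 0 0 t u x = 0 := by
  simp [powDiff]

/-- Each term of the difference contains at least one factor of the shift, which replaces a factor
`f` of degree one by a coefficient of degree `e`: hence at most `a + b - 1` factors `f, \bar f`, and
total degree at least `a + b - 1 + e`. -/
theorem Sym.powDiff (he : 1 ≤ e) (hg : ∀ b ∈ S, (dat φ).Cls 1 1 e (g b)) (a b : ℕ) :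
    Sym φ (a + b) (a - b) (a + b + e - 1) (a + b - 1) (powDiff (φ := φ) S g s a b) := by
  induction a with
  | zero =>
    induction b with
    | zero => exact (Sym.zero _ _ _ _).congr fun t u x => (powDiff_zero t u x).symm
    | succ b ih =>
      have h1 : Sym φ ((0 : ℕ) + (b + 1 : ℕ)) ((0 : ℕ) - (b + 1 : ℕ)) (0 + (b + 1) + e - 1) b
          fun t u x => fc φ u x ^ 0 * conj (fc φ u x) ^ b * conj (shiftS S g s t u x) := by
        have := ((Sym.conj_shift (φ := φ) (s := s) hg).mul_fc_pow 0 b).mono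
          (d' := 0 + (b + 1) + e - 1) (k' := b) (by omega) (by omega)
        convert this using 1 <;> push_cast <;> ring
      have h2 : Sym φ ((0 : ℕ) + (b + 1 : ℕ)) ((0 : ℕ) - (b + 1 : ℕ)) (0 + (b + 1) + e - 1) b
          fun t u x => conj (fc φ u x) * NLSNormalForm.powDiff (φ := φ) S g s 0 b t u x +
            conj (shiftS S g s t u x) * NLSNormalForm.powDiff (φ := φ) S g s 0 b t u x := by
        -- The exponent `0 + b - 1` is truncated at `b = 0`, where the difference vanishes anyway.
        rcases b.eq_zero_or_pos with rfl | hb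
        · exact (Sym.zero _ _ _ _).congr fun t u x => by rw [powDiff_zero]; simp
        · have h3 := (ih.mul_conj_fc).mono (d' := 0 + (b + 1) + e - 1) (k' := b) (by omega) (by omega)
          have h4 := (ih.mul_conj_shift (s := s) hg).mono (d' := 0 + (b + 1) + e - 1) (k' := b)
            (by omega) (by omega)
          convert h3.add h4 using 1 <;> push_cast <;> ring
      refine (h2.add h1).mono le_rfl (by omega) |>.congr fun t u x => ?_
      simp only [NLSNormalForm.powDiff, map_add, pow_zero]
      ring
  | succ a ih =>
    have h1 : Sym φ ((a + 1 : ℕ) + b) ((a + 1 : ℕ) - b) (a + 1 + b + e - 1) (a + b)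
        fun t u x => fc φ u x ^ a * conj (fc φ u x) ^ b * shiftS S g s t u x := by
      have := ((Sym.shift (φ := φ) (s := s) hg).mul_fc_pow a b).mono
        (d' := a + 1 + b + e - 1) (k' := a + b) (by omega) (by omega)
      convert this using 1 <;> push_cast <;> ring
    have h2 : Sym φ ((a + 1 : ℕ) + b) ((a + 1 : ℕ) - b) (a + 1 + b + e - 1) (a + b)
        fun t u x => fc φ u x * NLSNormalForm.powDiff (φ := φ) S g s a b t u x +
          shiftS S g s t u x * NLSNormalForm.powDiff (φ := φ) S g s a b t u x := by
      rcases (a + b).eq_zero_or_pos with h0 | hb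
      · obtain ⟨rfl, rfl⟩ : a = 0 ∧ b = 0 := by omega
        exact (Sym.zero _ _ _ _).congr fun t u x => by rw [powDiff_zero]; simp
      · have h3 := (ih.mul_fc).mono (d' := a + 1 + b + e - 1) (k' := a + b) (by omega) (by omega)
        have h4 := (ih.mul_shift (s := s) hg).mono (d' := a + 1 + b + e - 1) (k' := a + b)
          (by omega) (by omega)
        convert h3.add h4 using 1 <;> push_cast <;> ring
    refine (h2.add h1).mono le_rfl (by omega) |>.congr fun t u x => ?_
    simp only [NLSNormalForm.powDiff]
    ring

end shift

/-! ### Integration of the expansion -/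

variable (φ) in
/-- A term `Q ∫ f^a \bar f^b ψ` with `a + b = 2` or `a + b = 3`. -/
structure ETerm where
  /-- power of `f` -/
  a : ℕ
  /-- power of `\bar f` -/
  b : ℕ
  /-- the degree of the coefficient -/
  e : ℕ
  /-- the Schwartz function -/
  ψ : 𝓢(E3, ℂ)
  /-- the coefficient -/
  Q : ℝ → H1 → ℂ
  hab : a + b = 2 ∨ a + b = 3
  hQ : (dat φ).Cls (2 - (a + b)) (b - a) e Q
  he : 4 ≤ e + (a + b)

/-- The value of a term. -/
def ETerm.val (τ : ETerm φ) (t : ℝ) (u : H1) : ℂ :=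
  τ.Q t u * nlInt τ.a τ.b τ.ψ (fCoord (eigH φ) u)

variable (φ) in
/-- Finite sums of terms `Q ∫ f^a \bar f^b ψ` with `a + b = 2` or `a + b = 3`. -/
def ECls (G : ℝ → H1 → ℂ) : Prop :=
  ∃ L : List (ETerm φ), ∀ t u, G t u = (L.map fun τ => τ.val t u).sum

theorem ECls.zero : ECls φ fun _ _ => 0 := ⟨[], fun _ _ => rfl⟩

theorem ECls.add {G G' : ℝ → H1 → ℂ} (h : ECls φ G) (h' : ECls φ G') :
    ECls φ fun t u => G t u + G' t u := by
  obtain ⟨L, hL⟩ := h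
  obtain ⟨L', hL'⟩ := h'
  exact ⟨L ++ L', fun t u => by simp only [hL, hL', List.map_append, List.sum_append]⟩

theorem ETerm.eCls (τ : ETerm φ) : ECls φ τ.val := ⟨[τ], fun t u => by simp⟩

theorem conj_nlInt (a b : ℕ) (ψ : 𝓢(E3, ℂ)) (f : H1) :
    conj (nlInt a b ψ f) = nlInt b a (conjS ψ) f := by
  rw [nlInt, nlInt, ← integral_conj]
  refine integral_congr_ae (Filter.Eventually.of_forall fun x => ?_)
  simp only [map_mul, map_pow, Complex.conj_conj, conjS_apply]
  ring

theorem nlInt_one_zero (ψ : 𝓢(E3, ℂ)) (f : H1) : nlInt 1 0 ψ f = pair ψ f := by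
  rw [nlInt, pair]
  exact integral_congr_ae (Filter.Eventually.of_forall fun x => by simp; ring)

/-- With at most one factor the integral is a constant, a pairing or a conjugate pairing, hence one
of the functionals. -/
theorem Cls_nlInt {a b : ℕ} (h : a + b ≤ 1) (ψ : 𝓢(E3, ℂ)) :
    (dat φ).Cls (a + b) (a - b) (a + b) fun _ u => nlInt a b ψ (fCoord (eigH φ) u) := by
  have h1 : (dat φ).Cls 1 1 1 fun _ u => nlInt 1 0 ψ (fCoord (eigH φ) u) := by
    have := PData.Cls.poly (D := dat φ) (PData.isHom_X_h (.inr ψ))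
    simpa only [MvPolynomial.eval_X, PData.xval, nlInt_one_zero, pair_fCoord_eq] using this
  have h2 : (dat φ).Cls 1 (-1) 1 fun _ u => nlInt 0 1 ψ (fCoord (eigH φ) u) := by
    have := (PData.Cls.poly (D := dat φ) (PData.isHom_X_h (.inr (conjS ψ)))).conj
    simpa only [MvPolynomial.eval_X, PData.xval, ← pair_fCoord_eq, ← nlInt_one_zero, conj_nlInt,
      conjS_conjS] using this
  obtain ⟨rfl, rfl⟩ | ⟨rfl, rfl⟩ | ⟨rfl, rfl⟩ : a = 0 ∧ b = 0 ∨ a = 1 ∧ b = 0 ∨ a = 0 ∧ b = 1 := by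
    omega
  · have := (PData.Cls.one (D := dat φ)).const_mul (∫ x, ψ x)
    simpa [nlInt] using this
  · simpa using h1
  · simpa using h2

theorem Sym.integrable {j q : ℤ} {d k : ℕ} {W : ℝ → H1 → E3 → ℂ} (h : Sym φ j q d k W) (hk : k ≤ 4)
    (t : ℝ) (u : H1) : Integrable (W t u) := by
  induction h with
  | term a b e Q ψ hQ hd hk' => exact (integrable_nl (hk'.trans hk) ψ _).const_mul _
  | add _ _ ih ih' => exact ih.add ih'

/-- After integration, terms with at most one factor `f, \bar f` become series in the functionals.
Those with two or three factors are genuinely nonlinear in `f` and are kept apart. -/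
theorem Sym.integral {d : ℕ} {W : ℝ → H1 → E3 → ℂ} (h : Sym φ 2 0 d 3 W) (hd : 4 ≤ d) :
    ∃ E C : ℝ → H1 → ℂ, ECls φ E ∧ (dat φ).Cls 2 0 d C ∧
      ∀ t u, ∫ x, W t u x = E t u + C t u := by
  induction h with
  | term a b e Q ψ hQ hd' hk =>
    have hv : ∀ t u, ∫ x, Q t u * (fc φ u x ^ a * (starRingEnd ℂ) (fc φ u x) ^ b * ψ x) =
        Q t u * nlInt a b ψ (fCoord (eigH φ) u) := fun t u => integral_const_mul _ _
    by_cases hab : a + b ≤ 1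
    · refine ⟨_, _, ECls.zero, ?_, fun t u => (hv t u).trans (zero_add _).symm⟩
      have := hQ.mul (Cls_nlInt hab ψ)
      refine PData.Cls.mono ?_ hd'
      convert this using 1 <;> ring
    · refine ⟨_, _, ETerm.eCls ⟨a, b, e, ψ, Q, by omega, ?_, by omega⟩, PData.Cls.zero _ _ _,
        fun t u => (hv t u).trans (add_zero _).symm⟩
      convert hQ using 1
      ring
  | add h1 h2 ih ih' =>
    obtain ⟨E, C, hE, hC, h⟩ := ih
    obtain ⟨E', C', hE', hC', h'⟩ := ih'
    refine ⟨_, _, hE.add hE', hC.add hC', fun t u => ?_⟩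
    rw [integral_add (h1.integrable (by norm_num) t u) (h2.integrable (by norm_num) t u), h, h']
    ring

section shift

variable {α : Type} {S : Finset α} {g : α → ℝ → H1 → ℂ} {s : α → 𝓢(E3, ℂ)} {e : ℕ}
  {w : ℝ → H1 → H1}

theorem nlInt_shift (he : 1 ≤ e) (hg : ∀ b ∈ S, (dat φ).Cls 1 1 e (g b))
    (hw : ∀ t u, ∀ᵐ x, fn (w t u) x = fc φ u x + shiftS S g s t u x) {a b : ℕ} (hab : a + b ≤ 4)
    (ψ : 𝓢(E3, ℂ)) (t : ℝ) (u : H1) : nlInt a b ψ (w t u) =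
      nlInt a b ψ (fCoord (eigH φ) u) + ∫ x, ψ x * powDiff (φ := φ) S g s a b t u x := by
  rw [nlInt, nlInt, ← integral_add (integrable_nl hab _ _)
    (((Sym.powDiff he hg a b).mul_schwartz ψ).integrable (by omega) t u)]
  refine integral_congr_ae ?_
  filter_upwards [hw t u] with x hx
  rw [hx, powDiff, fc]
  ring

/-- The total degree is at least four, and trading one factor `f` for the shift leaves at least `3 +
e`. -/
theorem nlInt_expand (he : 1 ≤ e) (hg : ∀ b ∈ S, (dat φ).Cls 1 1 e (g b))
    (hw : ∀ t u, ∀ᵐ x, fn (w t u) x = fc φ u x + shiftS S g s t u x) {a b d : ℕ}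
    (hab : a + b = 2 ∨ a + b = 3) (ψ : 𝓢(E3, ℂ)) {Q : ℝ → H1 → ℂ}
    (hQ : (dat φ).Cls (2 - (a + b)) (b - a) d Q) (hd : 4 ≤ d + (a + b)) :
    ∃ E C : ℝ → H1 → ℂ, ECls φ E ∧ (dat φ).Cls 2 0 (3 + e) C ∧
      ∀ t u, Q t u * nlInt a b ψ (w t u) = E t u + C t u := by
  have h1 := (((Sym.powDiff (s := s) he hg a b).mul_schwartz ψ).mul_cls hQ).mono
    (d' := 3 + e) (k' := 3) (by omega) (by omega)
  have h2 : Sym φ 2 0 (3 + e) 3 fun t u x =>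
      Q t u * (ψ x * powDiff (φ := φ) S g s a b t u x) := by
    convert h1 using 1 <;> ring
  obtain ⟨E, C, hE, hC, h⟩ := h2.integral (by omega)
  refine ⟨_, C, (ETerm.eCls ⟨a, b, d, ψ, Q, hab, hQ, hd⟩).add hE, hC, fun t u => ?_⟩
  rw [nlInt_shift he hg hw (by omega), mul_add, ← integral_const_mul, h, ETerm.val]
  ring

/-- Used with `Γ = z · φ` and `e = 1` to expand the energy at the start, and with the displacement
by a Lie transform and `e = M + 1` at each step. Apart from `|f|⁴`, at most three factors `f, \bar
f` survive. -/
theorem quartic_shift (he : 1 ≤ e) (hg : ∀ b ∈ S, (dat φ).Cls 1 1 e (g b))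
    (hw : ∀ t u, ∀ᵐ x, fn (w t u) x = fc φ u x + shiftS S g s t u x) (γ₀ γ₁ : ℝ) :
    ∃ E C : ℝ → H1 → ℂ, ECls φ E ∧ (dat φ).Cls 2 0 (3 + e) C ∧
      ∀ t u, (potentialEnergy γ₀ γ₁ t (w t u) : ℂ) =
        (potentialEnergy γ₀ γ₁ t (fCoord (eigH φ) u) : ℂ) + E t u + C t u := by
  have h1 := ((Sym.powDiff (s := s) he hg 2 2).mul_cls
    ((PData.Cls.gam (D := dat φ) γ₀ γ₁).const_mul (1 / 4))).mono (d' := 3 + e) (k' := 3)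
    (by omega) (by omega)
  have h2 : Sym φ 2 0 (3 + e) 3 fun t u x =>
      (1 / 4 * (gam γ₀ γ₁ t : ℂ)) * powDiff (φ := φ) S g s 2 2 t u x := by
    convert h1 using 1 <;> norm_num
  obtain ⟨E, C, hE, hC, h⟩ := h2.integral (by omega)
  refine ⟨E, C, hE, hC, fun t u => ?_⟩
  have h3 : ∀ f : H1, ∀ t, (potentialEnergy γ₀ γ₁ t f : ℂ) =
      ∫ x, (1 / 4 * (gam γ₀ γ₁ t : ℂ)) * (fn f x ^ 2 * (starRingEnd ℂ) (fn f x) ^ 2) := by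
    intro f t
    simp only [sq_mul_conj_sq]
    have h4 : ∫ x, ‖fn f x‖ ^ 4 / 4 = 1 / 4 * ∫ x, ‖fn f x‖ ^ 4 := by
      rw [← integral_const_mul]
      exact integral_congr_ae (Filter.Eventually.of_forall fun x => by ring)
    have h5 : ∫ x, ((‖fn f x‖ ^ 4 : ℝ) : ℂ) = ((∫ x, ‖fn f x‖ ^ 4 : ℝ) : ℂ) := integral_ofReal
    rw [integral_const_mul, h5, potentialEnergy, h4]
    push_cast
    ring
  have hi : Integrable fun x => (1 / 4 * (gam γ₀ γ₁ t : ℂ)) *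
      (fn (fCoord (eigH φ) u) x ^ 2 * (starRingEnd ℂ) (fn (fCoord (eigH φ) u) x) ^ 2) := by
    refine Integrable.const_mul ?_ _
    simp only [sq_mul_conj_sq]
    exact (integrable_norm_pow_four (fCoord (eigH φ) u)).ofReal
  rw [h3, h3, add_assoc, ← h, ← integral_add hi (h2.integrable (by norm_num) t u)]
  refine integral_congr_ae ?_
  filter_upwards [hw t u] with x hx
  rw [hx, powDiff, fc]
  ring

end shift

theorem fn_fCoord_flowU (g : Gen (Lab n)) (t : ℝ) (u : H1) :
    ∀ᵐ x, fn (fCoord (eigH φ) ((dat φ).flowU g 1 t u)) x = fc φ u x +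
      shiftS g.S (fun b => (dat φ).prim g 1 (g.velo b)) (fun b => projS φ (conjS (rep φ b))) t u x := by
  have h : fCoord (eigH φ) ((dat φ).flowU g 1 t u) = fCoord (eigH φ) u +
      ofSchwartz (∑ b ∈ g.S, (dat φ).prim g 1 (g.velo b) t u • projS φ (conjS (rep φ b))) := by
    rw [PData.flowU, fCoord_add_sum, map_sum]
    simp only [dat_r, fCoord_ofSchwartz, map_smul]
  rw [h]
  filter_upwards [fn_add (fCoord (eigH φ) u) (ofSchwartz (∑ b ∈ g.S,
    (dat φ).prim g 1 (g.velo b) t u • projS φ (conjS (rep φ b)))), fn_ofSchwartz (∑ b ∈ g.S,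
    (dat φ).prim g 1 (g.velo b) t u • projS φ (conjS (rep φ b)))] with x h1 h2
  rw [h1, h2, fc, shiftS, sum_apply]
  rfl

theorem ECls.comp_flow {G : ℝ → H1 → ℂ} (h : ECls φ G) (g : Gen (Lab n)) :
    ∃ E C : ℝ → H1 → ℂ, ECls φ E ∧ (dat φ).Cls 2 0 (4 + g.M) C ∧
      ∀ t u, G t ((dat φ).flowU g 1 t u) = E t u + C t u := by
  obtain ⟨L, hL⟩ := h
  simp only [hL]
  clear hL
  induction L with
  | nil => exact ⟨_, _, ECls.zero, PData.Cls.zero _ _ _, fun t u => by simp⟩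
  | cons τ L ih =>
    obtain ⟨E, C, hE, hC, h⟩ := ih
    obtain ⟨E', C', hE', hC', h'⟩ := nlInt_expand (e := g.M + 1) (by omega)
      (fun b _ => PData.Cls.prim (PData.isHom_velo b) g)
      (fn_fCoord_flowU g) τ.hab τ.ψ (τ.hQ.comp_flow g) τ.he
    have e1 : 3 + (g.M + 1) = 4 + g.M := by ring
    rw [e1] at hC'
    refine ⟨_, _, hE'.add hE, hC'.add hC, fun t u => ?_⟩
    rw [List.map_cons, List.sum_cons, h, ETerm.val, h']
    ring

theorem quartic_comp_flow (γ₀ γ₁ : ℝ) (g : Gen (Lab n)) :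
    ∃ E C : ℝ → H1 → ℂ, ECls φ E ∧ (dat φ).Cls 2 0 (4 + g.M) C ∧
      ∀ t u, (potentialEnergy γ₀ γ₁ t (fCoord (eigH φ) ((dat φ).flowU g 1 t u)) : ℂ) =
        (potentialEnergy γ₀ γ₁ t (fCoord (eigH φ) u) : ℂ) + E t u + C t u := by
  have := quartic_shift (e := g.M + 1) (by omega)
      (fun b _ => PData.Cls.prim (PData.isHom_velo b) g)
      (fn_fCoord_flowU (φ := φ) g) γ₀ γ₁
  have e1 : 3 + (g.M + 1) = 4 + g.M := by ring
  rwa [e1] at this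

theorem quartic_expand (γ₀ γ₁ : ℝ) :
    ∃ E C : ℝ → H1 → ℂ, ECls φ E ∧ (dat φ).Cls 2 0 4 C ∧
      ∀ t u, (potentialEnergy γ₀ γ₁ t u : ℂ) =
        (potentialEnergy γ₀ γ₁ t (fCoord (eigH φ) u) : ℂ) + E t u + C t u := by
  refine quartic_shift (e := 1) (S := Finset.univ) (s := φ)
    (g := fun j _ u => (dat φ).ℓ (.inl j) u) (w := fun _ u => u) le_rfl (fun j _ => ?_)
    (fun t u => ?_) γ₀ γ₁
  · have := PData.Cls.poly (D := dat φ) (PData.isHom_X_h (.inl j))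
    simpa only [MvPolynomial.eval_X, PData.xval] using this
  · have h : u = fCoord (eigH φ) u + ofSchwartz (∑ j, (dat φ).ℓ (.inl j) u • φ j) := by
      conv_lhs => rw [← recon_coord φ u, recon]
      simp only [map_sum, map_smul, zCoord_eq]
    have h1 := fn_add (fCoord (eigH φ) u) (ofSchwartz (∑ j, (dat φ).ℓ (.inl j) u • φ j))
    rw [← h] at h1
    filter_upwards [h1, fn_ofSchwartz (∑ j, (dat φ).ℓ (.inl j) u • φ j)] with x h1 h2
    rw [h1, h2, fc, shiftS, sum_apply]
    rfl

end expansion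

end NLSNormalForm

end


noncomputable section

namespace NLSNormalForm

/-! ### Monomials in the coordinates -/

section monomials

variable {n : ℕ}

/-- The labels of the discrete modes and of the Schwartz functions in `T`. -/
def labs (n : ℕ) (T : Finset 𝓢(E3, ℂ)) : Finset (Lab n) := Finset.univ.disjSum T

/-- The frequency of a monomial. -/
def mfreq (κ : Var (Lab n) →₀ ℕ) : ℤ := (κ .e : ℤ) - κ .e'

/-- The exponent of `z`. -/
def mμ (κ : Var (Lab n) →₀ ℕ) : MI n := fun j => κ (.h (.inl j))

/-- The exponent of `\bar z`. -/
def mν (κ : Var (Lab n) →₀ ℕ) : MI n := fun j => κ (.a (.inl j))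

/-- The degree in `f` and `\bar f`. -/
def wdeg (κ : Var (Lab n) →₀ ℕ) : ℕ :=
  Finsupp.weight (fun j : Var (Lab n) => match j with
    | .h (.inr _) => 1
    | .a (.inr _) => 1
    | _ => 0) κ

theorem wdeg_add (κ κ' : Var (Lab n) →₀ ℕ) : wdeg (κ + κ') = wdeg κ + wdeg κ' := map_add _ _ _

theorem wdeg_single_h (θ : 𝓢(E3, ℂ)) : wdeg (Finsupp.single (.h (.inr θ) : Var (Lab n)) 1) = 1 := by
  simp [wdeg, Finsupp.weight_single]

theorem wdeg_single_a (θ : 𝓢(E3, ℂ)) : wdeg (Finsupp.single (.a (.inr θ) : Var (Lab n)) 1) = 1 := by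
  simp [wdeg, Finsupp.weight_single]

theorem wdeg_mapDomain_swap (κ : Var (Lab n) →₀ ℕ) : wdeg (κ.mapDomain Var.swap) = wdeg κ := by
  classical
  induction κ using Finsupp.induction_linear with
  | zero => rw [Finsupp.mapDomain_zero]
  | add f g hf hg => rw [Finsupp.mapDomain_add, wdeg_add, wdeg_add, hf, hg]
  | single j k =>
    rw [Finsupp.mapDomain_single, wdeg, wdeg, Finsupp.weight_single, Finsupp.weight_single]
    rcases j with _ | _ | _ | (j | θ) | (j | θ) <;> rfl

theorem sum_fin_labs {M : Type} [AddCommMonoid M] (T : Finset 𝓢(E3, ℂ)) (F : Var (Lab n) → M) :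
    ∑ j ∈ Var.fin (labs n T), F j = F .e + F .e' + F .o
      + (∑ j, F (.h (.inl j)) + ∑ θ ∈ T, F (.h (.inr θ)))
      + (∑ j, F (.a (.inl j)) + ∑ θ ∈ T, F (.a (.inr θ))) := by
  rw [Var.sum_fin, labs, Finset.sum_disjSum, Finset.sum_disjSum]

theorem prod_fin_labs {M : Type} [CommMonoid M] (T : Finset 𝓢(E3, ℂ)) (F : Var (Lab n) → M) :
    ∏ j ∈ Var.fin (labs n T), F j = F .e * F .e' * F .o
      * ((∏ j, F (.h (.inl j))) * ∏ θ ∈ T, F (.h (.inr θ)))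
      * ((∏ j, F (.a (.inl j))) * ∏ θ ∈ T, F (.a (.inr θ))) :=
  sum_fin_labs (M := Additive M) T F

variable {T : Finset 𝓢(E3, ℂ)} {κ : Var (Lab n) →₀ ℕ}

theorem support_subset_of_mem_VSupp {S : Finset (Lab n)} {p : VPoly (Lab n)} (hp : p ∈ VSupp S)
    (hκ : κ ∈ p.support) : κ.support ⊆ Var.fin S := by
  intro j hj
  rw [VSupp, MvPolynomial.mem_supported, ← Var.coe_fin] at hp
  exact Finset.mem_coe.mp (hp (Finset.mem_coe.mpr ((MvPolynomial.mem_vars_iff_mem_support j).mpr ⟨κ, hκ, hj⟩)))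

theorem support_subset_of_wdeg (h : wdeg κ = 0) : κ.support ⊆ Var.fin (labs n ∅) := by
  intro j hj
  have h1 : ∀ k : Var (Lab n), (match k with
    | .h (.inr _) => 1
    | .a (.inr _) => 1
    | _ => 0) ≠ 0 → κ k = 0 := fun k hk => by
    have := Finsupp.le_weight (fun j : Var (Lab n) => match j with
    | .h (.inr _) => 1
    | .a (.inr _) => 1
    | _ => 0) hk κ
    rw [wdeg] at h
    omega
  rw [← Finset.mem_coe, Var.coe_fin]
  rcases j with _ | _ | _ | (j | θ) | (j | θ)
  any_goals simp [Var.overS, labs]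
  · exact Finsupp.mem_support_iff.mp hj (h1 _ (by simp))
  · exact Finsupp.mem_support_iff.mp hj (h1 _ (by simp))

theorem exists_of_wdeg_pos (h : wdeg κ ≠ 0) : ∃ (κ' : Var (Lab n) →₀ ℕ) (θ : 𝓢(E3, ℂ)),
    κ = κ' + Finsupp.single (.h (.inr θ)) 1 ∨ κ = κ' + Finsupp.single (.a (.inr θ)) 1 := by
  by_contra! hc
  apply h
  have hz : ∀ j : Var (Lab n), κ j ≠ 0 → κ = (κ - Finsupp.single j 1) + Finsupp.single j 1 := by
    intro j hj
    rw [tsub_add_cancel_of_le]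
    exact Finsupp.single_le_iff.mpr (Nat.one_le_iff_ne_zero.mpr hj)
  rw [wdeg, Finsupp.weight_apply]
  refine Finset.sum_eq_zero fun j hj => ?_
  have hj' := Finsupp.mem_support_iff.mp hj
  rcases j with _ | _ | _ | (j | θ) | (j | θ)
  any_goals simp
  · exact absurd (hz _ hj') (hc _ θ).1
  · exact absurd (hz _ hj') (hc _ θ).2

theorem sum_eq_of_support {M : Type} [AddCommMonoid M] (h : κ.support ⊆ Var.fin (labs n T))
    (F : Var (Lab n) → ℕ → M) (hF : ∀ j, F j 0 = 0) :
    κ.sum F = F .e (κ .e) + F .e' (κ .e') + F .o (κ .o)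
      + (∑ j, F (.h (.inl j)) (mμ κ j) + ∑ θ ∈ T, F (.h (.inr θ)) (κ (.h (.inr θ))))
      + (∑ j, F (.a (.inl j)) (mν κ j) + ∑ θ ∈ T, F (.a (.inr θ)) (κ (.a (.inr θ)))) := by
  rw [Finsupp.sum_of_support_subset _ h _ fun j _ => hF j, sum_fin_labs]
  rfl

theorem weight_of_support (h : κ.support ⊆ Var.fin (labs n T)) :
    (Finsupp.weight Var.wt κ).2.1 =
      ((len (mμ κ) + ∑ θ ∈ T, κ (.h (.inr θ)) : ℕ) : ℤ) -
        ((len (mν κ) + ∑ θ ∈ T, κ (.a (.inr θ)) : ℕ) : ℤ) ∧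
    (Finsupp.weight Var.wt κ).2.2 =
      len (mμ κ) + ∑ θ ∈ T, κ (.h (.inr θ)) + (len (mν κ) + ∑ θ ∈ T, κ (.a (.inr θ))) := by
  rw [Finsupp.weight_apply, sum_eq_of_support h (fun j k => k • Var.wt j) fun j => zero_smul _ _]
  simp only [Var.wt, Prod.snd_add, Prod.fst_add, Prod.fst_sum, Prod.snd_sum, len]
  constructor
  · simp
    ring
  · simp

theorem wdeg_of_support (h : κ.support ⊆ Var.fin (labs n T)) :
    wdeg κ = ∑ θ ∈ T, κ (.h (.inr θ)) + ∑ θ ∈ T, κ (.a (.inr θ)) := by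
  rw [wdeg, Finsupp.weight_apply, sum_eq_of_support h (fun j k => k • _) fun j => zero_smul _ _]
  simp

/-- The source of all frequency bounds: the number of time factors is fixed by the weight. -/
theorem abs_mfreq_le (κ : Var (Lab n) →₀ ℕ) : |mfreq κ| ≤ tdeg κ := by
  rw [mfreq, tdeg, abs_le]
  constructor <;> push_cast <;> linarith [Int.natCast_nonneg (κ .e), Int.natCast_nonneg (κ .e'),
    Int.natCast_nonneg (κ .o)]

theorem eval_monomial_xval (φ : Fin (n + 1) → 𝓢(E3, ℂ)) (h : κ.support ⊆ Var.fin (labs n T)) (c : ℂ)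
    (t : ℝ) (u : H1) : MvPolynomial.eval ((dat φ).xval t u) (MvPolynomial.monomial κ c) =
      c * (osc (mfreq κ) t * mon (mμ κ) (mν κ) (zCoord (eigH φ) u) *
        (∏ θ ∈ T, pair θ (fCoord (eigH φ) u) ^ κ (.h (.inr θ))) *
        ∏ θ ∈ T, conj (pair θ (fCoord (eigH φ) u)) ^ κ (.a (.inr θ))) := by
  rw [MvPolynomial.eval_monomial, Finsupp.prod_of_support_subset _ h _ fun j _ => pow_zero _,
    prod_fin_labs]
  simp only [PData.xval, one_pow, osc_pow, mon, zCoord_eq, pair_fCoord_eq, mul_neg, mul_one]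
  have : mfreq κ = (κ .e : ℤ) + -(κ .e' : ℤ) := rfl
  rw [this, osc_add]
  simp only [mμ, mν]
  ring

end monomials

/-! ### Real functions that are at most linear in `f` -/

section reps

variable {n : ℕ}

/-- `∑ a e^{imt} z^μ \bar z^ν`. -/
def zSum (a : (ℤ × MI n × MI n) →₀ ℂ) (t : ℝ) (z : Fin (n + 1) → ℂ) : ℂ :=
  ∑ i ∈ a.support, a i * osc i.1 t * mon i.2.1 i.2.2 z

theorem zSum_eq (a : (ℤ × MI n × MI n) →₀ ℂ) (t : ℝ) (z : Fin (n + 1) → ℂ) :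
    zSum a t z = a.sum fun i c => c * osc i.1 t * mon i.2.1 i.2.2 z := rfl

theorem zSum_add (a b : (ℤ × MI n × MI n) →₀ ℂ) (t : ℝ) (z : Fin (n + 1) → ℂ) :
    zSum (a + b) t z = zSum a t z + zSum b t z := by
  rw [zSum_eq, zSum_eq, zSum_eq]
  exact Finsupp.sum_add_index' (fun _ => by ring) fun _ _ _ => by ring

theorem zSum_single (i : ℤ × MI n × MI n) (c : ℂ) (t : ℝ) (z : Fin (n + 1) → ℂ) :
    zSum (Finsupp.single i c) t z = c * osc i.1 t * mon i.2.1 i.2.2 z := by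
  rw [zSum_eq]
  exact Finsupp.sum_single_index (by ring)

theorem linSum_eq (Φ Ψ : (ℤ × MI n × MI n) →₀ 𝓢(E3, ℂ)) (t : ℝ) (z : Fin (n + 1) → ℂ) (f : H1) :
    linSum Φ Ψ t z f = (Φ.sum fun i θ => osc i.1 t * mon i.2.1 i.2.2 z * pair θ f) +
      Ψ.sum fun i θ => osc i.1 t * mon i.2.1 i.2.2 z * pairConj θ f := rfl

theorem pairConj_add_left (Ψ Ψ' : 𝓢(E3, ℂ)) (u : H1) :
    pairConj (Ψ + Ψ') u = pairConj Ψ u + pairConj Ψ' u := by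
  have : conjS (Ψ + Ψ') = conjS Ψ + conjS Ψ' := by ext x; simp
  rw [pairConj_eq, pairConj_eq, pairConj_eq, this, pair_add_left, map_add]

theorem pairConj_zero_left (u : H1) : pairConj 0 u = 0 := by
  simp [pairConj]

theorem linSum_add (Φ Ψ Φ' Ψ' : (ℤ × MI n × MI n) →₀ 𝓢(E3, ℂ)) (t : ℝ) (z : Fin (n + 1) → ℂ)
    (f : H1) : linSum (Φ + Φ') (Ψ + Ψ') t z f = linSum Φ Ψ t z f + linSum Φ' Ψ' t z f := by
  rw [linSum_eq, linSum_eq, linSum_eq,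
    Finsupp.sum_add_index' (fun _ => by rw [pair_zero_left, mul_zero])
      fun _ _ _ => by rw [pair_add_left, mul_add],
    Finsupp.sum_add_index' (fun _ => by rw [pairConj_zero_left, mul_zero])
      fun _ _ _ => by rw [pairConj_add_left, mul_add]]
  ring

theorem linSum_single (i j : ℤ × MI n × MI n) (Φ Ψ : 𝓢(E3, ℂ)) (t : ℝ) (z : Fin (n + 1) → ℂ)
    (f : H1) : linSum (Finsupp.single i Φ) (Finsupp.single j Ψ) t z f =
      osc i.1 t * mon i.2.1 i.2.2 z * pair Φ f + osc j.1 t * mon j.2.1 j.2.2 z * pairConj Ψ f := by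
  rw [linSum_eq, Finsupp.sum_single_index (by rw [pair_zero_left, mul_zero]),
    Finsupp.sum_single_index (by rw [pairConj_zero_left, mul_zero])]

theorem conj_mon (μ ν : MI n) (z : Fin (n + 1) → ℂ) : conj (mon μ ν z) = mon ν μ z := by
  simp only [mon, map_mul, map_prod, map_pow, Complex.conj_conj]
  ring

variable (φ : Fin (n + 1) → 𝓢(E3, ℂ))

/-- The real function `G` of `(t, u)` is a finite sum of monomials `e^{imt} z^μ \bar z^ν` with
indices in `P` and of monomials `e^{imt} z^μ \bar z^ν ⟨Φ, f⟩` with indices in `Q`, and of the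
complex conjugates of the latter. -/
def LinRep (P Q : ℤ → MI n → MI n → Prop) (G : ℝ → H1 → ℂ) : Prop :=
  ∃ (a : (ℤ × MI n × MI n) →₀ ℂ) (Φ Ψ : (ℤ × MI n × MI n) →₀ 𝓢(E3, ℂ)),
    (∀ t u, G t u = zSum a t (zCoord (eigH φ) u) +
      linSum Φ Ψ t (zCoord (eigH φ) u) (fCoord (eigH φ) u)) ∧
    (∀ m μ ν, a (m, μ, ν) ≠ 0 → P m μ ν) ∧
    (∀ m μ ν, Φ (m, μ, ν) ≠ 0 → Q m μ ν) ∧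
    (∀ m μ ν, conj (a (m, μ, ν)) = a (-m, ν, μ)) ∧
    (∀ m μ ν, Ψ (-m, ν, μ) = conjS (Φ (m, μ, ν)))

variable {φ} {P Q : ℤ → MI n → MI n → Prop}

theorem LinRep.congr {G G' : ℝ → H1 → ℂ} (h : LinRep φ P Q G) (e : ∀ t u, G t u = G' t u) :
    LinRep φ P Q G' := by
  have : G = G' := funext fun t => funext fun u => e t u
  rwa [← this]

theorem conjS_zero : conjS 0 = 0 := by ext x; simp

theorem conjS_add (ψ η : 𝓢(E3, ℂ)) : conjS (ψ + η) = conjS ψ + conjS η := by ext x; simp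

theorem LinRep.zero : LinRep φ P Q fun _ _ => 0 :=
  ⟨0, 0, 0, fun t u => by simp [zSum, linSum], by simp, by simp, by simp, by simp [conjS_zero]⟩

theorem LinRep.add {G G' : ℝ → H1 → ℂ} (h : LinRep φ P Q G) (h' : LinRep φ P Q G') :
    LinRep φ P Q fun t u => G t u + G' t u := by
  obtain ⟨a, Φ, Ψ, h, hP, hQ, ha, hΨ⟩ := h
  obtain ⟨a', Φ', Ψ', h', hP', hQ', ha', hΨ'⟩ := h'
  refine ⟨a + a', Φ + Φ', Ψ + Ψ', fun t u => ?_, fun m μ ν h0 => ?_, fun m μ ν h0 => ?_,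
    fun m μ ν => ?_, fun m μ ν => ?_⟩
  · beta_reduce
    rw [zSum_add, linSum_add, h, h']
    ring
  · by_cases h1 : a (m, μ, ν) = 0
    · exact hP' _ _ _ fun h2 => h0 (by rw [Finsupp.add_apply, h1, h2, add_zero])
    · exact hP _ _ _ h1
  · by_cases h1 : Φ (m, μ, ν) = 0
    · exact hQ' _ _ _ fun h2 => h0 (by rw [Finsupp.add_apply, h1, h2, add_zero])
    · exact hQ _ _ _ h1
  · rw [Finsupp.add_apply, Finsupp.add_apply, map_add, ha, ha']
  · rw [Finsupp.add_apply, Finsupp.add_apply, conjS_add, hΨ, hΨ']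

theorem LinRep.mono {P' Q' : ℤ → MI n → MI n → Prop} {G : ℝ → H1 → ℂ} (h : LinRep φ P Q G)
    (hP : ∀ m μ ν, P m μ ν → P' m μ ν) (hQ : ∀ m μ ν, Q m μ ν → Q' m μ ν) : LinRep φ P' Q' G := by
  obtain ⟨a, Φ, Ψ, h, hP', hQ', ha, hΨ⟩ := h
  exact ⟨a, Φ, Ψ, h, fun m μ ν h0 => hP _ _ _ (hP' _ _ _ h0), fun m μ ν h0 => hQ _ _ _ (hQ' _ _ _ h0),
    ha, hΨ⟩

theorem single_flip_apply {M : Type} [Zero M] (m m' : ℤ) (μ ν μ' ν' : MI n) (c : M) :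
    Finsupp.single (m, μ, ν) c (-m', ν', μ') = Finsupp.single (-m, ν, μ) c (m', μ', ν') := by
  classical
  rw [Finsupp.single_apply, Finsupp.single_apply]
  refine if_congr ?_ rfl rfl
  simp only [Prod.mk.injEq]
  constructor <;> rintro ⟨h1, h2, h3⟩ <;> exact ⟨by omega, h3, h2⟩

/-- The real part is half the monomial plus half its conjugate. The two indices may coincide, and
then the coefficients add up; this is why both must be admissible. -/
theorem LinRep.of_z {m : ℤ} {μ ν : MI n} (hP : P m μ ν) (hP' : P (-m) ν μ) (c : ℂ) :
    LinRep φ P Q fun t u => (((c * (osc m t * mon μ ν (zCoord (eigH φ) u))).re : ℝ) : ℂ) := by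
  classical
  refine ⟨Finsupp.single (m, μ, ν) (c / 2) + Finsupp.single (-m, ν, μ) (conj (c / 2)), 0, 0,
    fun t u => ?_, fun m' μ' ν' h0 => ?_, by simp, fun m' μ' ν' => ?_, by simp [conjS_zero]⟩
  · beta_reduce
    rw [zSum_add, zSum_single, zSum_single, Complex.re_eq_add_conj]
    simp only [map_mul, conj_osc, conj_mon, linSum, Finsupp.support_zero, Finset.sum_empty, map_div₀,
      Complex.conj_ofNat]
    ring
  · rw [Finsupp.add_apply] at h0
    by_cases h1 : (m, μ, ν) = (m', μ', ν')
    · simp only [Prod.mk.injEq] at h1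
      obtain ⟨rfl, rfl, rfl⟩ := h1
      exact hP
    · by_cases h2 : (-m, ν, μ) = (m', μ', ν')
      · simp only [Prod.mk.injEq] at h2
        obtain ⟨rfl, rfl, rfl⟩ := h2
        exact hP'
      · rw [Finsupp.single_eq_of_ne (Ne.symm h1), Finsupp.single_eq_of_ne (Ne.symm h2), add_zero] at h0
        exact absurd rfl h0
  · have hc : ∀ (i j : ℤ × MI n × MI n) (d : ℂ), conj (Finsupp.single i d j) = Finsupp.single i (conj d) j := by
      intro i j d
      rw [Finsupp.single_apply, Finsupp.single_apply]
      split_ifs <;> simp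
    rw [Finsupp.add_apply, Finsupp.add_apply, map_add, hc, hc, Complex.conj_conj, single_flip_apply,
      single_flip_apply, neg_neg, add_comm]

theorem LinRep.of_f {m : ℤ} {μ ν : MI n} (hQ : Q m μ ν) (c : ℂ) (θ : 𝓢(E3, ℂ)) :
    LinRep φ P Q fun t u => (((c * (osc m t * mon μ ν (zCoord (eigH φ) u) *
      pair θ (fCoord (eigH φ) u))).re : ℝ) : ℂ) := by
  classical
  refine ⟨0, Finsupp.single (m, μ, ν) ((c / 2) • θ), Finsupp.single (-m, ν, μ) (conjS ((c / 2) • θ)),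
    fun t u => ?_, by simp, fun m' μ' ν' h0 => ?_, by simp, fun m' μ' ν' => ?_⟩
  · beta_reduce
    rw [linSum_single, Complex.re_eq_add_conj, pairConj_conjS, pair_smul_left]
    simp only [map_mul, conj_osc, conj_mon, zSum, Finsupp.support_zero, Finset.sum_empty, map_div₀,
      Complex.conj_ofNat]
    ring
  · by_cases h1 : (m, μ, ν) = (m', μ', ν')
    · simp only [Prod.mk.injEq] at h1
      obtain ⟨rfl, rfl, rfl⟩ := h1
      exact hQ
    · rw [Finsupp.single_eq_of_ne (Ne.symm h1)] at h0
      exact absurd rfl h0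
  · rw [single_flip_apply, neg_neg, Finsupp.single_apply, Finsupp.single_apply]
    split_ifs <;> simp [conjS_zero]

end reps

end NLSNormalForm

end


noncomputable section

namespace NLSNormalForm

/-! ### The homological equation -/

theorem derivation_monomial_of_eigen {J : Type}
    (E : Derivation ℂ (MvPolynomial J ℂ) (MvPolynomial J ℂ)) {α : J → ℂ} {κ : J →₀ ℕ}
    (h : ∀ j ∈ κ.support, E (MvPolynomial.X j) = MvPolynomial.C (α j) * MvPolynomial.X j) (c : ℂ) :
    E (MvPolynomial.monomial κ c) = MvPolynomial.monomial κ ((κ.sum fun j k => k * α j) * c) := by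
  have h2 : MvPolynomial.mkDerivation ℂ (fun j : J => E (MvPolynomial.X j)) = E := by
    refine MvPolynomial.derivation_ext fun j => ?_
    rw [MvPolynomial.mkDerivation_X]
  conv_lhs => rw [← h2]
  rw [MvPolynomial.mkDerivation_monomial, Finsupp.sum, Finsupp.sum, Finset.sum_mul, map_sum,
    Finset.smul_sum]
  refine Finset.sum_congr rfl fun j hj => ?_
  rw [h j hj, smul_eq_mul, ← mul_assoc, mul_comm _ (MvPolynomial.C _), MvPolynomial.C_mul_monomial,
    MvPolynomial.X, MvPolynomial.monomial_mul, tsub_add_cancel_of_le, MvPolynomial.smul_monomial]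
  · congr 1
    rw [smul_eq_mul]
    ring
  · exact Finsupp.single_le_iff.mpr (Nat.one_le_iff_ne_zero.mpr (Finsupp.mem_support_iff.mp hj))

section homological

variable {n : ℕ} {V : 𝓢(E3, ℝ)} {c γ₀ γ₁ : ℝ} {l : Fin (n + 1) → ℝ} {φ : Fin (n + 1) → 𝓢(E3, ℂ)}

/-- `λ · (μ - ν) - m`. -/
def freqGap (l : Fin (n + 1) → ℝ) (m : ℤ) (μ ν : MI n) : ℝ := (∑ j, l j * ((μ j : ℝ) - ν j)) - m

theorem energyD_monomial {κ : Var (Lab n) →₀ ℕ} (h : wdeg κ = 0) (a : ℂ) :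
    energyD V c l (MvPolynomial.monomial κ a) =
      MvPolynomial.monomial κ (Complex.I * freqGap l (mfreq κ) (mμ κ) (mν κ) * a) := by
  have hs := support_subset_of_wdeg h
  let α : Var (Lab n) → ℂ := fun j => match j with
    | .e => -Complex.I
    | .e' => Complex.I
    | .o => 0
    | .h (.inl j) => Complex.I * l j
    | .a (.inl j) => -(Complex.I * l j)
    | _ => 0
  rw [derivation_monomial_of_eigen (α := α)]
  · congr 2
    rw [sum_eq_of_support hs (fun j k => k * α j) fun j => by simp]
    simp only [α, freqGap, mfreq, mul_zero, Finset.sum_empty, add_zero]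
    push_cast
    have : ∀ j, (mμ κ j : ℂ) * (Complex.I * l j) + (mν κ j : ℂ) * -(Complex.I * l j) =
      Complex.I * (l j * ((mμ κ j : ℂ) - mν κ j)) := fun j => by ring
    rw [add_assoc, ← Finset.sum_add_distrib, Finset.sum_congr rfl fun j _ => this j,
      ← Finset.mul_sum]
    ring
  · intro j hj
    have h2 := hs hj
    rw [← Finset.mem_coe, Var.coe_fin] at h2
    rw [energyD, MvPolynomial.mkDerivation_X]
    rcases j with _ | _ | _ | (j | θ) | (j | θ)
    any_goals rfl
    · simp [α]
    · simp [Var.overS, labs] at h2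
    · simp [Var.overS, labs] at h2

theorem zdata {κ : Var (Lab n) →₀ ℕ} (h : wdeg κ = 0) :
    (Finsupp.weight Var.wt κ).2.1 = (len (mμ κ) : ℤ) - len (mν κ) ∧
    (Finsupp.weight Var.wt κ).2.2 = len (mμ κ) + len (mν κ) ∧
    (Finsupp.weight Var.wt κ).1 + 2 * |mfreq κ| ≤ (Finsupp.weight Var.wt κ).2.2 := by
  obtain ⟨h1, h2⟩ := weight_of_support (support_subset_of_wdeg h)
  have h3 := weight_wt_fst κ
  have h4 := abs_mfreq_le κ
  simp only [Finset.sum_empty, add_zero] at h1 h2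
  exact ⟨h1, h2, by omega⟩

theorem eval_zmonomial {κ : Var (Lab n) →₀ ℕ} (h : wdeg κ = 0) (a : ℂ) (t : ℝ) (u : H1) :
    MvPolynomial.eval ((dat φ).xval t u) (MvPolynomial.monomial κ a) =
      a * (osc (mfreq κ) t * mon (mμ κ) (mν κ) (zCoord (eigH φ) u)) := by
  rw [eval_monomial_xval φ (support_subset_of_wdeg h)]
  simp

theorem eval_monomial_add_single {ι : Type} (x : Var ι → ℂ) (κ : Var ι →₀ ℕ) (j : Var ι) (a : ℂ) :
    MvPolynomial.eval x (MvPolynomial.monomial (κ + Finsupp.single j 1) a) =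
      MvPolynomial.eval x (MvPolynomial.monomial κ a) * x j := by
  rw [MvPolynomial.monomial_add_single, pow_one, map_mul, MvPolynomial.eval_X]

theorem LinRep.sum {P Q : ℤ → MI n → MI n → Prop} {α : Type} (s : Finset α) {G : α → ℝ → H1 → ℂ}
    (h : ∀ b ∈ s, LinRep φ P Q (G b)) : LinRep φ P Q fun t u => ∑ b ∈ s, G b t u := by
  classical
  induction s using Finset.induction_on with
  | empty => exact LinRep.zero.congr fun t u => (Finset.sum_empty).symm
  | insert a s ha ih =>
    simp only [Finset.sum_insert ha]
    exact (h a (Finset.mem_insert_self _ _)).add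
      (ih fun b hb => h b (Finset.mem_insert_of_mem hb))

theorem re_conj_factor (a X Y : ℂ) : ((a * X * conj Y).re : ℂ) = ((conj a * (conj X * Y)).re : ℂ) := by
  rw [← Complex.conj_re]
  simp [mul_assoc]

theorem wdeg_one_cases {κ : Var (Lab n) →₀ ℕ} (h : wdeg κ = 1) :
    ∃ (κ' : Var (Lab n) →₀ ℕ) (θ : 𝓢(E3, ℂ)), wdeg κ' = 0 ∧
      (κ = κ' + Finsupp.single (.h (.inr θ)) 1 ∨ κ = κ' + Finsupp.single (.a (.inr θ)) 1) := by
  obtain ⟨κ', θ, h'⟩ := exists_of_wdeg_pos (κ := κ) (by omega)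
  refine ⟨κ', θ, ?_, h'⟩
  rcases h' with rfl | rfl
  · rw [wdeg_add, wdeg_single_h] at h
    omega
  · rw [wdeg_add, wdeg_single_a] at h
    omega

/-- Weight `(2, 0, d)` means `d/2` factors of each kind and `d/2 - 1` time factors. A monomial in
`\bar f` is replaced by its conjugate, which has the same real part. -/
theorem LinRep.of_monomial {d : ℕ} {κ : Var (Lab n) →₀ ℕ}
    (hw : Finsupp.weight Var.wt κ = (2, 0, d)) (h : wdeg κ ≤ 1) (a : ℂ) :
    LinRep φ (fun m μ ν => len μ = len ν ∧ 2 * len μ = d ∧ |m| + 1 ≤ len μ)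
      (fun m μ ν => len μ + 1 = len ν ∧ 2 * len ν = d ∧ |m| ≤ len μ)
      fun t u => ((MvPolynomial.eval ((dat φ).xval t u) (MvPolynomial.monomial κ a)).re : ℂ) := by
  rcases Nat.le_one_iff_eq_zero_or_eq_one.mp h with h0 | h1
  · obtain ⟨h2, h3, h4⟩ := zdata h0
    rw [hw] at h2 h3 h4
    simp only at h2 h3 h4
    refine (LinRep.of_z (m := mfreq κ) (μ := mμ κ) (ν := mν κ) ⟨by omega, by omega, by omega⟩
      ⟨by omega, by omega, by rw [abs_neg]; omega⟩ a).congr fun t u => ?_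
    rw [eval_zmonomial h0]
  · obtain ⟨κ', θ, h0, rfl | rfl⟩ := wdeg_one_cases h1
    all_goals
      obtain ⟨h2, h3, h4⟩ := zdata h0
      rw [map_add, Finsupp.weight_single, one_smul] at hw
      have e1 := congrArg Prod.fst hw
      have e2 := congrArg (fun x => x.2.1) hw
      have e3 := congrArg (fun x => x.2.2) hw
      simp only [Prod.fst_add, Prod.snd_add, Var.wt] at e1 e2 e3
    · refine (LinRep.of_f (m := mfreq κ') (μ := mμ κ') (ν := mν κ')
        ⟨by omega, by omega, by omega⟩ a θ).congr fun t u => ?_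
      rw [eval_monomial_add_single, eval_zmonomial h0, PData.xval, ← pair_fCoord_eq]
      ring_nf
    · refine (LinRep.of_f (m := -mfreq κ') (μ := mν κ') (ν := mμ κ')
        ⟨by omega, by omega, by rw [abs_neg]; omega⟩ (conj a) θ).congr fun t u => ?_
      rw [eval_monomial_add_single, eval_zmonomial h0, PData.xval, ← pair_fCoord_eq,
        re_conj_factor, map_mul, conj_osc, conj_mon]

theorem eval_eq_sum {ι : Type} (x : Var ι → ℂ) (p : VPoly ι) : MvPolynomial.eval x p =
    ∑ κ ∈ p.support, MvPolynomial.eval x (MvPolynomial.monomial κ (p.coeff κ)) := by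
  conv_lhs => rw [p.as_sum]
  rw [map_sum]

/-- A polynomial that is at most linear in `f, \bar f`, as a function. -/
theorem LinRep.of_poly {d : ℕ} {p : VPoly (Lab n)} (hp : IsHom 2 0 d p)
    (h : ∀ κ ∈ p.support, wdeg κ ≤ 1) :
    LinRep φ (fun m μ ν => len μ = len ν ∧ 2 * len μ = d ∧ |m| + 1 ≤ len μ)
      (fun m μ ν => len μ + 1 = len ν ∧ 2 * len ν = d ∧ |m| ≤ len μ)
      fun t u => ((MvPolynomial.eval ((dat φ).xval t u) p).re : ℂ) := by
  refine (LinRep.sum p.support fun κ hκ => LinRep.of_monomial (φ := φ)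
    (hp (coeff_ne_zero_of_mem hκ)) (h κ hκ) (p.coeff κ)).congr fun t u => ?_
  rw [eval_eq_sum _ p, Complex.re_sum]
  push_cast
  rfl

/-- No resonances between the distinct positive eigenvalues and the frequency `1`. -/
theorem StandingHypotheses.freq_eq_zero {φ : Fin (n + 1) → H1}
    (hyp : StandingHypotheses V c γ₀ γ₁ l φ)
    {k : Fin (n + 1) → ℤ} {m : ℤ} (hk : ∑ j, |k j| ≤ 4 * bigN c l + 2) (hm : |m| ≤ 2 * bigN c l)
    (h : ∑ j, l j * k j = m) : m = 0 := by
  classical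
  -- The distinct positive eigenvalues in increasing order. Coefficients of equal eigenvalues are
  -- added up, and the zero eigenvalue contributes nothing, so the relation becomes one that the
  -- hypothesis covers.
  let A : Finset ℝ := (Finset.univ.image l).filter (0 < ·)
  let e := A.orderIsoOfFin rfl
  have hA : ∀ i, ∃ j, l j = e i := fun i => by
    have h1 := (e i).2
    simp only [A, Finset.mem_filter, Finset.mem_image, Finset.mem_univ, true_and] at h1
    exact h1.1
  have hpos : ∀ i, (0 : ℝ) < e i := fun i => (Finset.mem_filter.mp (e i).2).2
  choose ρ hρ using hA
  have key := hyp.nonres_eig A.card ρ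
    (fun i i' hi => by beta_reduce; rw [hρ, hρ]; exact_mod_cast e.strictMono hi) (fun i => by rw [hρ]; exact hpos i)
    (fun i => ∑ j ∈ Finset.univ.filter (fun j => l j = e i), k j) (-m) ?_ (by rwa [abs_neg])
  · have h2 : (∑ i, ((∑ j ∈ Finset.univ.filter (fun j => l j = e i), k j : ℤ) : ℝ) * l (ρ i)) + (-m : ℤ) = 0 := by
      have h3 : ∀ i, ((∑ j ∈ Finset.univ.filter (fun j => l j = e i), k j : ℤ) : ℝ) * l (ρ i) =
          ∑ j ∈ Finset.univ.filter (fun j => l j = e i), l j * k j := fun i => by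
        rw [Int.cast_sum, Finset.sum_mul]
        refine Finset.sum_congr rfl fun j hj => ?_
        rw [hρ, (Finset.mem_filter.mp hj).2, mul_comm]
      have h4 : ∑ i, ∑ j ∈ Finset.univ.filter (fun j => l j = e i), l j * (k j : ℝ) =
          ∑ j, l j * k j := by
        rw [← Finset.sum_subset (Finset.subset_univ (Finset.univ.filter fun j => 0 < l j))]
        · rw [← Finset.sum_fiberwise_of_maps_to (s := Finset.univ.filter fun j => 0 < l j)
            (t := A) (g := l) (f := fun j => l j * (k j : ℝ)), ← Finset.sum_coe_sort A,
            ← e.toEquiv.sum_comp]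
          · refine Finset.sum_congr rfl fun i _ => Finset.sum_congr ?_ fun _ _ => rfl
            ext j
            simp only [Finset.mem_filter, Finset.mem_univ, true_and]
            constructor
            · intro h5
              exact ⟨by rw [h5]; exact hpos i, h5⟩
            · exact fun h5 => h5.2
          · intro j hj
            simpa [A] using hj
        · intro j _ hj
          have : j = 0 := by
            by_contra h0
            exact hj (by simpa using hyp.l_pos j h0)
          rw [this, hyp.l_zero, zero_mul]
      rw [Finset.sum_congr rfl fun i _ => h3 i, h4, h]
      push_cast
      ring
    have := (key.mp h2).2
    omega
  · refine le_trans ?_ hk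
    have h1 : ∀ i, |∑ j ∈ Finset.univ.filter (fun j => l j = e i), k j| ≤
        ∑ j ∈ Finset.univ.filter (fun j => l j = e i), |k j| := fun i => Finset.abs_sum_le_sum_abs _ _
    refine (Finset.sum_le_sum fun i _ => h1 i).trans ?_
    rw [← Finset.sum_biUnion]
    · exact Finset.sum_le_sum_of_subset_of_nonneg (Finset.subset_univ _) fun _ _ _ => abs_nonneg _
    · intro i _ i' _ hii
      rw [Function.onFun, Finset.disjoint_left]
      intro j hj hj'
      apply hii
      apply e.injective
      apply Subtype.ext
      rw [← (Finset.mem_filter.mp hj).2, (Finset.mem_filter.mp hj').2]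

/-- The indices of the resonant monomials without `f`, of degree between `4` and `2r`. -/
def NormZ (l : Fin (n + 1) → ℝ) (r : ℕ) (m : ℤ) (μ ν : MI n) : Prop :=
  m = 0 ∧ ∑ j, l j * ((μ j : ℝ) - ν j) = 0 ∧ len μ = len ν ∧ 4 ≤ len μ + len ν ∧
    len μ + len ν ≤ 2 * r

/-- The indices of the resonant monomials that are linear in `f`, of degree between `4` and `2r`. -/
def NormF (c : ℝ) (l : Fin (n + 1) → ℝ) (r : ℕ) (m : ℤ) (μ ν : MI n) : Prop :=
  (∑ j, l j * ((μ j : ℝ) - ν j)) - m < -c ∧ len μ + 1 = len ν ∧ |m| ≤ len μ ∧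
    4 ≤ len μ + len ν + 1 ∧ len μ + len ν + 1 ≤ 2 * r

/-- The homological equation can be solved for `p`, up to resonant terms and terms that are at least
quadratic in `f, \bar f`. -/
def Solvable (V : 𝓢(E3, ℝ)) (c : ℝ) (l : Fin (n + 1) → ℝ) (φ : Fin (n + 1) → 𝓢(E3, ℂ)) (r : ℕ)
    (p : VPoly (Lab n)) : Prop :=
  ∃ χ z q : VPoly (Lab n), IsHom 2 0 (2 * r + 2) χ ∧ IsHom 2 0 (2 * r + 2) z ∧
    IsHom 2 0 (2 * r + 2) q ∧ (∀ κ ∈ χ.support, wdeg κ ≤ 1) ∧ (∀ κ ∈ q.support, 2 ≤ wdeg κ) ∧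
    LinRep φ (NormZ l (r + 1)) (NormF c l (r + 1))
      (fun t u => ((MvPolynomial.eval ((dat φ).xval t u) z).re : ℂ)) ∧
    ∀ t u, (MvPolynomial.eval ((dat φ).xval t u) p).re +
        (MvPolynomial.eval ((dat φ).xval t u) (energyD V c l χ)).re =
      (MvPolynomial.eval ((dat φ).xval t u) z).re + (MvPolynomial.eval ((dat φ).xval t u) q).re

theorem forall_support_add {J : Type} {P : (J →₀ ℕ) → Prop} {p q : MvPolynomial J ℂ}
    (hp : ∀ κ ∈ p.support, P κ) (hq : ∀ κ ∈ q.support, P κ) : ∀ κ ∈ (p + q).support, P κ := by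
  classical
  intro κ hκ
  rcases Finset.mem_union.mp (MvPolynomial.support_add hκ) with h | h
  · exact hp κ h
  · exact hq κ h

theorem isHom_zero {ι : Type} (j q : ℤ) (d : ℕ) : IsHom (ι := ι) j q d 0 :=
  MvPolynomial.isWeightedHomogeneous_zero _ _ _

theorem LinRep.re_eval_zero {P Q : ℤ → MI n → MI n → Prop} : LinRep φ P Q
    (fun t u => ((MvPolynomial.eval ((dat φ).xval t u) 0).re : ℂ)) :=
  LinRep.zero.congr fun t u => by simp

theorem Solvable.zero (r : ℕ) : Solvable V c l φ r 0 :=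
  ⟨0, 0, 0, isHom_zero _ _ _, isHom_zero _ _ _, isHom_zero _ _ _, by simp, by simp,
    LinRep.re_eval_zero, fun t u => by simp⟩

theorem Solvable.add {r : ℕ} {p p' : VPoly (Lab n)} (h : Solvable V c l φ r p)
    (h' : Solvable V c l φ r p') : Solvable V c l φ r (p + p') := by
  obtain ⟨χ, z, q, h1, h2, h3, h4, h5, h6, h7⟩ := h
  obtain ⟨χ', z', q', h1', h2', h3', h4', h5', h6', h7'⟩ := h'
  refine ⟨χ + χ', z + z', q + q', h1.add h1', h2.add h2', h3.add h3', forall_support_add h4 h4',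
    forall_support_add h5 h5', (h6.add h6').congr fun t u => ?_, fun t u => ?_⟩
  · simp
  · have e1 := h7 t u
    have e2 := h7' t u
    simp only [map_add, Complex.add_re]
    linarith

theorem isHom_monomial {j q : ℤ} {d : ℕ} {κ : Var (Lab n) →₀ ℕ}
    (hw : Finsupp.weight Var.wt κ = (j, q, d)) (a : ℂ) : IsHom j q d (MvPolynomial.monomial κ a) :=
  MvPolynomial.isWeightedHomogeneous_monomial _ _ _ hw

theorem forall_support_monomial {J : Type} {P : (J →₀ ℕ) → Prop} {κ : J →₀ ℕ} {a : ℂ} (h : P κ) :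
    ∀ κ' ∈ (MvPolynomial.monomial κ a).support, P κ' := by
  intro κ' h'
  rw [Finset.mem_singleton.mp (MvPolynomial.support_monomial_subset h')]
  exact h

/-- If the frequency vanishes then nonresonance forces `m = 0`, and the monomial is in normal form;
the bounds hold since `|μ| + |ν| = 2r + 2 ≤ 4N + 2` and `|m| ≤ r`. Otherwise one divides by the
frequency. -/
theorem Solvable.of_wdeg_zero (hyp : StandingHypotheses V c γ₀ γ₁ l (eigH φ)) {r : ℕ} (hr : 1 ≤ r)
    (hrN : r ≤ bigN c l) {κ : Var (Lab n) →₀ ℕ} (hw : Finsupp.weight Var.wt κ = (2, 0, 2 * r + 2))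
    (h : wdeg κ = 0) (a : ℂ) : Solvable V c l φ r (MvPolynomial.monomial κ a) := by
  by_cases h0 : freqGap l (mfreq κ) (mμ κ) (mν κ) = 0
  · refine ⟨0, MvPolynomial.monomial κ a, 0, isHom_zero _ _ _, isHom_monomial hw a,
      isHom_zero _ _ _, by simp, by simp, ?_, fun t u => by simp⟩
    obtain ⟨h2, h3, h4⟩ := zdata h
    rw [hw] at h2 h3 h4
    simp only at h2 h3 h4
    have hm : mfreq κ = 0 := by
      refine hyp.freq_eq_zero (k := fun j => (mμ κ j : ℤ) - mν κ j) ?_ (by omega) ?_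
      · calc ∑ j, |(mμ κ j : ℤ) - mν κ j| ≤ ∑ j, ((mμ κ j : ℤ) + mν κ j) :=
              Finset.sum_le_sum fun j _ => by rw [abs_le]; constructor <;> omega
          _ = (len (mμ κ) + len (mν κ) : ℕ) := by
            rw [Finset.sum_add_distrib, len, len]
            push_cast
            rfl
          _ ≤ _ := by omega
      · rw [freqGap, sub_eq_zero] at h0
        push_cast
        exact h0
    have hz : ∑ j, l j * ((mμ κ j : ℝ) - mν κ j) = 0 := by
      rw [freqGap, hm] at h0
      simpa using h0
    have hz' : ∑ j, l j * ((mν κ j : ℝ) - mμ κ j) = 0 := by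
      rw [← neg_eq_zero, ← Finset.sum_neg_distrib, ← hz]
      exact Finset.sum_congr rfl fun j _ => by ring
    refine (LinRep.of_z (m := mfreq κ) (μ := mμ κ) (ν := mν κ)
      ⟨hm, hz, by omega, by omega, by omega⟩
      ⟨by omega, hz', by omega, by omega, by omega⟩ a).congr fun t u => ?_
    rw [eval_zmonomial h]
  · refine ⟨MvPolynomial.monomial κ (Complex.I * a / freqGap l (mfreq κ) (mμ κ) (mν κ)), 0, 0,
      isHom_monomial hw _, isHom_zero _ _ _, isHom_zero _ _ _,
      forall_support_monomial (by omega), by simp, LinRep.re_eval_zero, fun t u => ?_⟩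
    have h0' : (freqGap l (mfreq κ) (mμ κ) (mν κ) : ℂ) ≠ 0 := by exact_mod_cast h0
    have e : Complex.I * freqGap l (mfreq κ) (mμ κ) (mν κ) *
        (Complex.I * a / freqGap l (mfreq κ) (mμ κ) (mν κ)) = -a := by
      field_simp
      rw [Complex.I_sq]
      ring
    rw [energyD_monomial h, e, map_neg]
    simp

theorem pair_eig_fCoord (hE : EigenSys V c l φ) (j : Fin (n + 1)) (u : H1) :
    pair (φ j) (fCoord (eigH φ) u) = 0 := by
  have : projS φ (φ j) = 0 := by
    simp only [projS, pair_ofSchwartz, hE.orth, ite_smul, one_smul, zero_smul]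
    simp
  rw [pair_fCoord, this, pair_zero_left]

/-- The alternative is whether minus the frequency lies above or below `c`; equality is excluded
because `|μ| + |ν| = 2r + 1 ≤ 2N + 1` and `|m| ≤ r ≤ N`. Below `c` the resolvent provides `Θ`, and
the eigenfunctions that it leaves over pair to zero with `f`. -/
theorem Solvable.of_h (hE : EigenSys V c l φ) (hyp : StandingHypotheses V c γ₀ γ₁ l (eigH φ))
    {r : ℕ} (hr : 1 ≤ r) (hrN : r ≤ bigN c l) {κ : Var (Lab n) →₀ ℕ} {θ : 𝓢(E3, ℂ)}
    (hw : Finsupp.weight Var.wt (κ + Finsupp.single (.h (.inr θ)) 1) = (2, 0, 2 * r + 2))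
    (h : wdeg κ = 0) (a : ℂ) :
    Solvable V c l φ r (MvPolynomial.monomial (κ + Finsupp.single (.h (.inr θ)) 1) a) := by
  obtain ⟨h2, h3, h4⟩ := zdata h
  have hw' := hw
  rw [map_add, Finsupp.weight_single, one_smul] at hw'
  have e1 := congrArg Prod.fst hw'
  have e2 := congrArg (fun x => x.2.1) hw'
  have e3 := congrArg (fun x => x.2.2) hw'
  simp only [Prod.fst_add, Prod.snd_add, Var.wt] at e1 e2 e3
  by_cases h0 : freqGap l (mfreq κ) (mμ κ) (mν κ) < -c
  · refine ⟨0, _, 0, isHom_zero _ _ _, isHom_monomial hw a,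
      isHom_zero _ _ _, by simp, by simp, ?_, fun t u => by simp⟩
    refine (LinRep.of_f (m := mfreq κ) (μ := mμ κ) (ν := mν κ)
      ⟨h0, by omega, by omega, by omega, by omega⟩ a θ).congr fun t u => ?_
    rw [eval_monomial_add_single, eval_zmonomial h, PData.xval, ← pair_fCoord_eq]
    ring_nf
  · have h5 : freqGap l (mfreq κ) (mμ κ) (mν κ) ≠ -c := by
      intro h6
      refine hyp.nonres_edge (fun j => (mν κ j : ℤ) - mμ κ j) (mfreq κ) ?_ (by omega) ?_
      · calc ∑ j, |(mν κ j : ℤ) - mμ κ j| ≤ ∑ j, ((mμ κ j : ℤ) + mν κ j) :=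
              Finset.sum_le_sum fun j _ => by rw [abs_le]; constructor <;> omega
          _ = (len (mμ κ) + len (mν κ) : ℕ) := by
            rw [Finset.sum_add_distrib, len, len]
            push_cast
            rfl
          _ ≤ _ := by omega
      · rw [← neg_eq_iff_eq_neg] at h6
        rw [← h6, freqGap, neg_sub, sub_eq_add_neg, ← Finset.sum_neg_distrib, add_comm]
        congr 1
        refine Finset.sum_congr rfl fun j _ => ?_
        push_cast
        ring
    have h6 : -freqGap l (mfreq κ) (mμ κ) (mν κ) < c := by
      have := lt_of_le_of_ne (not_lt.mp h0) (Ne.symm h5)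
      linarith
    obtain ⟨Θ, hΘ⟩ := hE.exists_resolvent h6 θ
    refine ⟨MvPolynomial.monomial (κ + Finsupp.single (.h (.inr Θ)) 1) (Complex.I * a), 0, 0,
      isHom_monomial ?_ _, isHom_zero _ _ _, isHom_zero _ _ _, forall_support_monomial ?_, by simp,
      LinRep.re_eval_zero, fun t u => ?_⟩
    · rw [← hw, map_add, map_add, Finsupp.weight_single, Finsupp.weight_single]
      rfl
    · rw [wdeg_add, wdeg_single_h, h]
    · have hp : pair (schS V c Θ) (fCoord (eigH φ) u) =
          -freqGap l (mfreq κ) (mμ κ) (mν κ) * pair Θ (fCoord (eigH φ) u) +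
          pair θ (fCoord (eigH φ) u) := by
        rw [hΘ, pair_sub_left, pair_add_left, pair_smul_left, eigProj, pair_sum_left,
          Finset.sum_eq_zero, sub_zero]
        · push_cast
          rfl
        · intro j _
          rw [pair_smul_left, pair_eig_fCoord hE, mul_zero]
      rw [MvPolynomial.monomial_add_single, MvPolynomial.monomial_add_single, pow_one, pow_one,
        Derivation.leibniz, energyD_monomial h]
      have hX : energyD V c l (MvPolynomial.X (.h (.inr Θ))) =
          MvPolynomial.C Complex.I * MvPolynomial.X (.h (.inr (schS V c Θ))) := by
        rw [energyD, MvPolynomial.mkDerivation_X]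
      rw [hX]
      simp only [smul_eq_mul, map_add, map_mul, MvPolynomial.eval_X, MvPolynomial.eval_C,
        eval_zmonomial h, PData.xval, ← pair_fCoord_eq, hp, map_zero, Complex.zero_re, add_zero]
      rw [← Complex.add_re, ← Complex.zero_re]
      congr 1
      linear_combination (a * (osc (mfreq κ) t * mon (mμ κ) (mν κ) (zCoord (eigH φ) u))) *
        pair θ (fCoord (eigH φ) u) * Complex.I_sq

theorem Solvable.congr_re {r : ℕ} {p p' : VPoly (Lab n)} (h : Solvable V c l φ r p)
    (e : ∀ t u, (MvPolynomial.eval ((dat φ).xval t u) p).re =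
      (MvPolynomial.eval ((dat φ).xval t u) p').re) : Solvable V c l φ r p' := by
  obtain ⟨χ, z, q, h1, h2, h3, h4, h5, h6, h7⟩ := h
  exact ⟨χ, z, q, h1, h2, h3, h4, h5, h6, fun t u => by rw [← e, h7]⟩

theorem re_eval_starP (p : VPoly (Lab n)) (t : ℝ) (u : H1) :
    (MvPolynomial.eval ((dat φ).xval t u) (starP p)).re =
      (MvPolynomial.eval ((dat φ).xval t u) p).re := by
  rw [eval_starP ((dat φ).xval_swap t u), Complex.conj_re]

theorem Solvable.of_monomial (hE : EigenSys V c l φ)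
    (hyp : StandingHypotheses V c γ₀ γ₁ l (eigH φ))
    {r : ℕ} (hr : 1 ≤ r) (hrN : r ≤ bigN c l) {κ : Var (Lab n) →₀ ℕ}
    (hw : Finsupp.weight Var.wt κ = (2, 0, 2 * r + 2)) (a : ℂ) :
    Solvable V c l φ r (MvPolynomial.monomial κ a) := by
  classical
  by_cases h2 : 2 ≤ wdeg κ
  · exact ⟨0, 0, _, isHom_zero _ _ _, isHom_zero _ _ _, isHom_monomial hw a, by simp,
      forall_support_monomial h2, LinRep.re_eval_zero, fun t u => by simp⟩
  · rcases Nat.le_one_iff_eq_zero_or_eq_one.mp (by omega : wdeg κ ≤ 1) with h0 | h1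
    · exact Solvable.of_wdeg_zero hyp hr hrN hw h0 a
    · obtain ⟨κ', θ, h0, rfl | rfl⟩ := wdeg_one_cases h1
      · exact Solvable.of_h hE hyp hr hrN hw h0 a
      -- Only real parts matter, so a monomial in `\bar f` is handled through its conjugate, which
      -- is a monomial in `f`.
      · have e : starP (MvPolynomial.monomial (κ' + Finsupp.single (.a (.inr θ)) 1) a) =
            MvPolynomial.monomial (κ'.mapDomain Var.swap + Finsupp.single (.h (.inr θ)) 1) (conj a) := by
          rw [starP_monomial, Finsupp.mapDomain_add, Finsupp.mapDomain_single]
          rfl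
        have hw' : Finsupp.weight Var.wt
            (κ'.mapDomain Var.swap + Finsupp.single (.h (.inr θ) : Var (Lab n)) 1) =
              (2, 0, 2 * r + 2) := by
          have h3 := isHom_starP (isHom_monomial hw 1)
          rw [starP_monomial, Finsupp.mapDomain_add, Finsupp.mapDomain_single] at h3
          have h4 := h3 (d := κ'.mapDomain Var.swap + Finsupp.single (.h (.inr θ) : Var (Lab n)) 1)
            (by
              rw [show (Var.a (.inr θ) : Var (Lab n)).swap = .h (.inr θ) from rfl,
                MvPolynomial.coeff_monomial, if_pos rfl]
              simp)
          simpa using h4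
        have hd : wdeg (κ'.mapDomain Var.swap) = 0 := (wdeg_mapDomain_swap κ').trans h0
        refine (Solvable.of_h hE hyp hr hrN hw' hd (conj a)).congr_re fun t u => ?_
        rw [← e, re_eval_starP]

theorem solvable (hE : EigenSys V c l φ) (hyp : StandingHypotheses V c γ₀ γ₁ l (eigH φ))
    {r : ℕ} (hr : 1 ≤ r) (hrN : r ≤ bigN c l) {p : VPoly (Lab n)} (hp : IsHom 2 0 (2 * r + 2) p) :
    Solvable V c l φ r p := by
  classical
  rw [p.as_sum]
  have h1 : ∀ κ ∈ p.support, Finsupp.weight Var.wt κ = (2, 0, 2 * r + 2) := fun κ hκ =>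
    hp (coeff_ne_zero_of_mem hκ)
  generalize p.support = s at h1
  induction s using Finset.induction_on with
  | empty => exact Solvable.zero r
  | insert κ s hκ ih =>
    rw [Finset.sum_insert hκ]
    exact (Solvable.of_monomial hE hyp hr hrN (h1 κ (Finset.mem_insert_self _ _)) _).add
      (ih fun κ' h' => h1 κ' (Finset.mem_insert_of_mem h'))

end homological

end NLSNormalForm

end


noncomputable section

namespace NLSNormalForm

/-! ### One step of the normal form reduction -/

section step

variable {n : ℕ} {V : 𝓢(E3, ℝ)} {c γ₀ γ₁ : ℝ} {l : Fin (n + 1) → ℝ} {φ : Fin (n + 1) → 𝓢(E3, ℂ)}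

theorem zSum_eq_sum {a : (ℤ × MI n × MI n) →₀ ℂ} {m₀ k k' : ℕ}
    (h : ∀ m μ ν, a (m, μ, ν) ≠ 0 → |m| ≤ m₀ ∧ len μ = k ∧ len ν = k') (t : ℝ)
    (z : Fin (n + 1) → ℂ) : zSum a t z = ∑ m ∈ Finset.Icc (-(m₀ : ℤ)) m₀, osc m t *
      ∑ μ ∈ ofLen n k, ∑ ν ∈ ofLen n k', a (m, μ, ν) * mon μ ν z := by
  classical
  rw [zSum, Finset.sum_subset (s₂ := Finset.Icc (-(m₀ : ℤ)) m₀ ×ˢ (ofLen n k ×ˢ ofLen n k'))]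
  · rw [Finset.sum_product]
    refine Finset.sum_congr rfl fun m _ => ?_
    rw [Finset.sum_product, Finset.mul_sum]
    refine Finset.sum_congr rfl fun μ _ => ?_
    rw [Finset.mul_sum]
    exact Finset.sum_congr rfl fun ν _ => by ring
  · rintro ⟨m, μ, ν⟩ hi
    obtain ⟨h1, h2, h3⟩ := h m μ ν (Finsupp.mem_support_iff.mp hi)
    simp only [Finset.mem_product, Finset.mem_Icc, ofLen, Finset.mem_piAntidiag]
    exact ⟨abs_le.mp h1, ⟨h2, fun _ _ => Finset.mem_univ _⟩, ⟨h3, fun _ _ => Finset.mem_univ _⟩⟩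
  · intro i _ hi
    rw [Finsupp.notMem_support_iff.mp hi, zero_mul, zero_mul]

theorem fSum_eq_sum {Φ : (ℤ × MI n × MI n) →₀ 𝓢(E3, ℂ)} {m₀ k k' : ℕ}
    (h : ∀ m μ ν, Φ (m, μ, ν) ≠ 0 → |m| ≤ m₀ ∧ len μ = k ∧ len ν = k') (t : ℝ)
    (z : Fin (n + 1) → ℂ) (L : 𝓢(E3, ℂ) → ℂ) (hL : L 0 = 0) :
    ∑ i ∈ Φ.support, osc i.1 t * mon i.2.1 i.2.2 z * L (Φ i) =
      ∑ m ∈ Finset.Icc (-(m₀ : ℤ)) m₀, osc m t *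
      ∑ μ ∈ ofLen n k, ∑ ν ∈ ofLen n k', mon μ ν z * L (Φ (m, μ, ν)) := by
  classical
  rw [Finset.sum_subset (s₂ := Finset.Icc (-(m₀ : ℤ)) m₀ ×ˢ (ofLen n k ×ˢ ofLen n k'))]
  · rw [Finset.sum_product]
    refine Finset.sum_congr rfl fun m _ => ?_
    rw [Finset.sum_product, Finset.mul_sum]
    refine Finset.sum_congr rfl fun μ _ => ?_
    rw [Finset.mul_sum]
    exact Finset.sum_congr rfl fun ν _ => by ring
  · rintro ⟨m, μ, ν⟩ hi
    obtain ⟨h1, h2, h3⟩ := h m μ ν (Finsupp.mem_support_iff.mp hi)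
    simp only [Finset.mem_product, Finset.mem_Icc, ofLen, Finset.mem_piAntidiag]
    exact ⟨abs_le.mp h1, ⟨h2, fun _ _ => Finset.mem_univ _⟩, ⟨h3, fun _ _ => Finset.mem_univ _⟩⟩
  · intro i _ hi
    rw [Finsupp.notMem_support_iff.mp hi, hL, mul_zero]

theorem LinRep.conj_flip {Q : ℤ → MI n → MI n → Prop} {Φ Ψ : (ℤ × MI n × MI n) →₀ 𝓢(E3, ℂ)}
    (hQ : ∀ m μ ν, Φ (m, μ, ν) ≠ 0 → Q m μ ν)
    (hΨ : ∀ m μ ν, Ψ (-m, ν, μ) = conjS (Φ (m, μ, ν))) :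
    ∀ m μ ν, Ψ (m, μ, ν) ≠ 0 → Q (-m) ν μ := by
  intro m μ ν h
  refine hQ _ _ _ fun h0 => h ?_
  have := hΨ (-m) ν μ
  rw [neg_neg] at this
  rw [this, h0, conjS_zero]

/-- Polynomials that are at most linear in `f, \bar f` are given by the coefficients of a Lie
generator. -/
theorem exists_lieGenerator {r : ℕ} (hr : 1 ≤ r) {G : ℝ → H1 → ℂ}
    (h : LinRep φ (fun m μ ν => len μ = len ν ∧ 2 * len μ = 2 * r + 2 ∧ |m| + 1 ≤ len μ)
      (fun m μ ν => len μ + 1 = len ν ∧ 2 * len ν = 2 * r + 2 ∧ |m| ≤ len μ) G) :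
    ∃ g : LieGenerator n, ∀ t u, g.eval t (zCoord (eigH φ) u) (fCoord (eigH φ) u) = G t u := by
  obtain ⟨a, Φ, Ψ, hG, hP, hQ, ha, hΨ⟩ := h
  have hQ' := LinRep.conj_flip hQ hΨ
  refine ⟨⟨r, r, hr, fun m μ ν => a (m, μ, ν), fun m μ ν => Φ (m, μ, ν), fun m μ ν => Ψ (m, μ, ν),
    ha, fun m μ ν x => by rw [hΨ]; rfl⟩, fun t u => ?_⟩
  rw [hG, zSum_eq_sum (m₀ := r) (k := r + 1) (k' := r + 1) fun m μ ν h0 => ?_, linSum,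
    fSum_eq_sum (m₀ := r) (k := r) (k' := r + 1) (fun m μ ν h0 => ?_) t _
      (fun θ => pair θ (fCoord (eigH φ) u)) (pair_zero_left _),
    fSum_eq_sum (m₀ := r) (k := r + 1) (k' := r) (fun m μ ν h0 => ?_) t _
      (fun θ => pairConj θ (fCoord (eigH φ) u)) (pairConj_zero_left _),
    ← Finset.sum_add_distrib, ← Finset.sum_add_distrib, LieGenerator.eval]
  · refine Finset.sum_congr rfl fun m _ => ?_
    ring
  · obtain ⟨h1, h2, h3⟩ := hQ' _ _ _ h0
    rw [abs_neg] at h3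
    exact ⟨by omega, by omega, by omega⟩
  · obtain ⟨h1, h2, h3⟩ := hQ _ _ _ h0
    exact ⟨by omega, by omega, by omega⟩
  · obtain ⟨h1, h2, h3⟩ := hP _ _ _ h0
    exact ⟨by omega, by omega, by omega⟩

/-- The generator of a Lie transform given by the real part of a polynomial. -/
theorem exists_gen {r : ℕ} (hr : 1 ≤ r) {χ : VPoly (Lab n)} (hχ : IsHom 2 0 (2 * r + 2) χ) :
    ∃ g : Gen (Lab n), g.M = 2 * r ∧ g.χ = (1 / 2 : ℂ) • (χ + starP χ) := by
  have hs : IsHom 2 0 (2 * r + 2) (starP χ) := by simpa using isHom_starP hχ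
  obtain ⟨S, hS⟩ := exists_mem_VSupp ((1 / 2 : ℂ) • (χ + starP χ))
  refine ⟨⟨_, S, 2 * r, by omega, IsHom.smul (p := χ + starP χ) (hχ.add hs) _, hS, ?_⟩, rfl, rfl⟩
  rw [starP_smul, map_add, starP_starP, add_comm]
  congr 1
  simp [Complex.conj_ofNat]

theorem eval_half_starP {χ : VPoly (Lab n)} (t : ℝ) (u : H1) :
    MvPolynomial.eval ((dat φ).xval t u) ((1 / 2 : ℂ) • (χ + starP χ)) =
      ((MvPolynomial.eval ((dat φ).xval t u) χ).re : ℂ) := by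
  rw [MvPolynomial.smul_eval, map_add, eval_starP ((dat φ).xval_swap t u), Complex.re_eq_add_conj]
  ring

theorem re_eval_energyD_half {χ : VPoly (Lab n)} (t : ℝ) (u : H1) :
    (MvPolynomial.eval ((dat φ).xval t u) (energyD V c l ((1 / 2 : ℂ) • (χ + starP χ)))).re =
      (MvPolynomial.eval ((dat φ).xval t u) (energyD V c l χ)).re := by
  rw [Derivation.map_smul, map_add, ← starP_energyD, eval_half_starP, Complex.ofReal_re]

/-- Sums of monomials of weight `(2, 0, d)` with `d ≥ 4`. -/
def Quartic (p : VPoly (Lab n)) : Prop :=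
  ∀ κ ∈ p.support, ∃ d, 4 ≤ d ∧ Finsupp.weight Var.wt κ = (2, 0, d)

theorem Quartic.cls {p : VPoly (Lab n)} (h : Quartic p) :
    (dat φ).Cls 2 0 4 fun t u => MvPolynomial.eval ((dat φ).xval t u) p := by
  have h1 : (dat φ).Cls 2 0 4 fun t u => ∑ κ ∈ p.support,
      MvPolynomial.eval ((dat φ).xval t u) (MvPolynomial.monomial κ (p.coeff κ)) := by
    refine PData.Cls.sum _ fun κ hκ => ?_
    obtain ⟨d, hd, hw⟩ := h κ hκ
    exact (PData.Cls.poly (isHom_monomial hw _)).mono hd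
  simpa only [← eval_eq_sum] using h1

theorem IsHom.quartic {d : ℕ} {p : VPoly (Lab n)} (h : IsHom 2 0 d p) (hd : 4 ≤ d) : Quartic p :=
  fun _ hκ => ⟨d, hd, h (coeff_ne_zero_of_mem hκ)⟩

variable (V c γ₀ γ₁ l φ) in
/-- The form of the energy after the canonical transformation `T`, at order `r`. -/
def Reduced (r : ℕ) (δ : ℝ) (T : Phase → Phase) : Prop :=
  0 < δ ∧ IsCanonicalOn T (cyl (Metric.ball 0 δ)) ∧
  ∃ (z q : VPoly (Lab n)) (F E : ℝ → H1 → ℂ), Quartic z ∧ Quartic q ∧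
    (∀ κ ∈ q.support, 2 ≤ wdeg κ) ∧
    LinRep φ (NormZ l r) (NormF c l r)
      (fun t u => ((MvPolynomial.eval ((dat φ).xval t u) z).re : ℂ)) ∧
    (dat φ).Cls 2 0 (2 * r + 2) F ∧ ECls φ E ∧
    ∀ p ∈ cyl (Metric.ball (0 : H1) δ), ham V c γ₀ γ₁ (T p) = hamF V c p
      + (MvPolynomial.eval ((dat φ).xval p.2.1 p.2.2) z).re
      + (MvPolynomial.eval ((dat φ).xval p.2.1 p.2.2) q).re
      + (F p.2.1 p.2.2).re + (E p.2.1 p.2.2).re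
      + potentialEnergy γ₀ γ₁ p.2.1 (fCoord (eigH φ) p.2.2)

theorem mem_cyl_ball {δ : ℝ} {p : Phase} : p ∈ cyl (Metric.ball (0 : H1) δ) ↔ ‖p.2.2‖ < δ := by
  simp [cyl]

theorem Reduced.mono {r : ℕ} {δ δ' : ℝ} {T : Phase → Phase} (h : Reduced V c γ₀ γ₁ l φ r δ T)
    (h0 : 0 < δ') (hδ : δ' ≤ δ) : Reduced V c γ₀ γ₁ l φ r δ' T := by
  obtain ⟨_, hT, z, q, F, E, h1, h2, h3, h4, h5, h6, h7⟩ := h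
  have hs : cyl (Metric.ball (0 : H1) δ') ⊆ cyl (Metric.ball 0 δ) := fun p hp =>
    Metric.ball_subset_ball hδ hp
  exact ⟨h0, hT.comp (isCanonicalOn_id (isOpen_cyl Metric.isOpen_ball)) hs, z, q, F, E, h1, h2, h3,
    h4, h5, h6, fun p hp => h7 p (hs hp)⟩

/-- At the start nothing is in normal form, and the series part of the expanded quartic energy has
degree at least `4 = 2 · 1 + 2`. -/
theorem reduced_one : Reduced V c γ₀ γ₁ l φ 1 1 id := by
  obtain ⟨E, C, hE, hC, h⟩ := quartic_expand (φ := φ) γ₀ γ₁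
  refine ⟨one_pos, isCanonicalOn_id (isOpen_cyl Metric.isOpen_ball), 0, 0, C, E, by simp [Quartic],
    by simp [Quartic], by simp, LinRep.re_eval_zero, hC, hE, fun p _ => ?_⟩
  have h1 := congrArg Complex.re (h p.2.1 p.2.2)
  simp only [Complex.add_re, Complex.ofReal_re] at h1
  rw [id, ham, h1]
  simp only [map_zero, Complex.zero_re]
  ring

/-- The generator is chosen so that `{H_F, χ}` cancels the polynomial of degree `2r + 2` in `F`, up
to resonant terms and terms at least quadratic in `f`. These join the normal form and `q`. -/
theorem Reduced.step (hE : EigenSys V c l φ) (hyp : StandingHypotheses V c γ₀ γ₁ l (eigH φ))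
    {r : ℕ} (hr : 1 ≤ r) (hrN : r ≤ bigN c l) {δ : ℝ} {T : Phase → Phase}
    (h : Reduced V c γ₀ γ₁ l φ r δ T) :
    ∃ (G : LieGenerator n) (𝔉 : Phase → Phase) (δ₁ : ℝ),
      IsLieTransformOn (G.onPhase (eigH φ)) 𝔉 (cyl (Metric.ball 0 δ₁)) ∧
      MapsTo 𝔉 (cyl (Metric.ball 0 δ₁)) (cyl (Metric.ball 0 δ)) ∧
      Reduced V c γ₀ γ₁ l φ (r + 1) δ₁ (T ∘ 𝔉) := by
  obtain ⟨hδ, hT, z, q, F, E, hz, hq, hqw, hNF, hF, hEc, hH⟩ := h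
  obtain ⟨p₁, hp₁, hF'⟩ := hF.split_two ⟨r, by push_cast; ring⟩
  obtain ⟨χ, z', q', hχ, hz', hq', hχw, hqw', hNF', hsol⟩ := solvable hE hyp hr hrN hp₁
  obtain ⟨g, hgM, hgχ⟩ := exists_gen hr hχ
  obtain ⟨G, hG⟩ := exists_lieGenerator hr (LinRep.of_poly (φ := φ) hχ hχw)
  have hGχ : G.onPhase (eigH φ) = (dat φ).fnχ g := by
    funext p
    rw [LieGenerator.onPhase, hG, PData.fnχ, hgχ, eval_half_starP]
  obtain ⟨ρ, hρ, hρl, hρ2⟩ := (dat φ).exists_norm_flowU_le g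
  have hl := (dat φ).lieRad_pos g
  -- The flow at most doubles the norm on the ball of radius `ρ`, so half of the target radius is
  -- enough. The target must also lie in the ball where the inverse flow is defined.
  set δ₁ := min ρ (min δ ((dat φ).lieRad g) / 2) with hδ₁
  have hδ₁0 : 0 < δ₁ := lt_min hρ (half_pos (lt_min hδ hl))
  have hm : ∀ p ∈ cyl (Metric.ball (0 : H1) δ₁),
      ‖((dat φ).flow g 1 p).2.2‖ < min δ ((dat φ).lieRad g) := by
    intro p hp
    rw [mem_cyl_ball] at hp
    have h1 := hρ2 1 p.2.1 (by norm_num) p.2.2 (hp.le.trans (min_le_left _ _))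
    have h2 := hp.trans_le (min_le_right ρ _)
    calc _ ≤ 2 * ‖p.2.2‖ := h1
      _ < _ := by linarith
  have hδl : δ₁ ≤ (dat φ).lieRad g := (min_le_left _ _).trans hρl
  have hmaps : MapsTo ((dat φ).flow g 1) (cyl (Metric.ball 0 δ₁)) (cyl (Metric.ball 0 δ)) :=
    fun p hp => mem_cyl_ball.mpr ((hm p hp).trans_le (min_le_left _ _))
  have hcan := isCanonicalOn_flow φ g hδl fun p hp =>
    mem_cyl_ball.mpr ((hm p hp).trans_le (min_le_right _ _))
  refine ⟨G, (dat φ).flow g 1, δ₁, isLieTransformOn_flow φ g hGχ hδl, hmaps, hδ₁0,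
    hT.comp hcan hmaps, ?_⟩
  obtain ⟨E₁, C₁, hE₁, hC₁, h1⟩ := hEc.comp_flow g
  obtain ⟨E₂, C₂, hE₂, hC₂, h2⟩ := quartic_comp_flow (φ := φ) γ₀ γ₁ g
  have hC₃ := hz.cls (φ := φ).comp_flow_sub g
  have hC₄ := hq.cls (φ := φ).comp_flow_sub g
  have hC₅ := hF.comp_flow_sub g
  have hC₆ := PData.Cls.prim_sub (D := dat φ) (isHom_energyD (V := V) (c := c) (l := l) g.hom) g
  rw [hgM] at hC₁ hC₂ hC₃ hC₄ hC₅ hC₆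
  have hd : 2 * r + 2 + 2 = 2 * (r + 1) + 2 := by ring
  rw [hd] at hF'
  -- The new series collects all the corrections. Here `M = 2r`, and the transform raises by `2r`
  -- the degree of pieces that had degree at least four, so each correction has degree at least `2r
  -- + 4`.
  refine ⟨z + z', q + q', _, fun t u => E₁ t u + E₂ t u,
    forall_support_add hz (hz'.quartic (by omega)), forall_support_add hq (hq'.quartic (by omega)),
    forall_support_add hqw hqw', (LinRep.add (hNF.mono ?_ ?_) hNF').congr fun t u => ?_,
    ((((((hC₁.mono (by omega)).add (hC₂.mono (by omega))).add (hC₃.mono (by omega))).add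
      (hC₄.mono (by omega))).add (hC₅.mono (by omega))).add (hC₆.mono (by omega))).add hF',
    hE₁.add hE₂, fun p hp => ?_⟩
  · rintro m μ ν ⟨h1, h2, h3, h4, h5⟩
    exact ⟨h1, h2, h3, h4, by omega⟩
  · rintro m μ ν ⟨h1, h2, h3, h4, h5⟩
    exact ⟨h1, h2, h3, h4, by omega⟩
  · simp
  · have hp' : ‖p.2.2‖ ≤ (dat φ).lieRad g := ((mem_cyl_ball.mp hp).trans_le hδl).le
    rw [Function.comp_apply, hH _ (hmaps hp), hamF_flow hE g hp']
    have e1 := congrArg Complex.re (h1 p.2.1 p.2.2)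
    have e2 := congrArg Complex.re (h2 p.2.1 p.2.2)
    have e3 := hsol p.2.1 p.2.2
    have e4 := re_eval_energyD_half (φ := φ) (V := V) (c := c) (l := l) (χ := χ) p.2.1 p.2.2
    rw [← hgχ] at e4
    have ef1 : ((dat φ).flow g 1 p).2.1 = p.2.1 := rfl
    have ef2 : ((dat φ).flow g 1 p).2.2 = (dat φ).flowU g 1 p.2.1 p.2.2 := rfl
    rw [ef1, ef2]
    simp only [Complex.add_re, Complex.sub_re, Complex.ofReal_re, map_add] at e1 e2 ⊢
    rw [e1, e2]
    linarith

end step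

end NLSNormalForm

end


noncomputable section

namespace NLSNormalForm

/-! ### The smooth part of the remainder -/

/-- The distribution is recovered from its `L²` representative by operators continuous into the
tempered distributions; evaluation at `θ` is then a continuous functional on `L²`, hence bounded,
for arbitrary `k` and `s`. -/
theorem exists_norm_toDist_le (k s : ℝ) (θ : 𝓢(E3, ℂ)) :
    ∃ C : ℝ, ∀ T : HSpace k s, ‖T.toDist θ‖ ≤ C * ‖T‖ := by
  let A : L2 →L[ℂ] 𝓢'(E3, ℂ) := (besselPotential E3 ℂ (-k)).comp
    ((weightOp (-s)).comp (Lp.toTemperedDistributionCLM ℂ (volume : Measure E3) 2))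
  let L : L2 →L[ℂ] ℂ := (PointwiseConvergenceCLM.evalCLM (RingHom.id ℂ) ℂ θ).comp A
  refine ⟨‖L‖, fun T => ?_⟩
  have h1 : A T.toL2 = T.toDist := by
    change besselPotential E3 ℂ (-k) (weightOp (-s) (l2Incl T.toL2)) = _
    rw [HSpace.l2Incl_toL2, sobolevOp]
    change besselPotential E3 ℂ (-k) (weightOp (-s) (weightOp s (besselPotential E3 ℂ k T.toDist))) = _
    rw [weightOp_neg_weightOp]
    simp
  have h2 : L T.toL2 = T.toDist θ := by
    change (A T.toL2) θ = _
    rw [h1]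
  rw [← h2, HSpace.norm_def]
  exact L.le_opNorm _

/-- The functional `T ↦ ⟨θ, T⟩` on `H^{k,s}`. -/
def evalHS (k s : ℝ) (θ : 𝓢(E3, ℂ)) : HSpace k s →L[ℂ] ℂ :=
  LinearMap.mkContinuousOfExistsBound
    { toFun := fun T => T.toDist θ
      map_add' := fun T T' => by rw [map_add]; rfl
      map_smul' := fun a T => by rw [map_smul]; rfl } (exists_norm_toDist_le k s θ)

section smooth

variable {n : ℕ} {V : 𝓢(E3, ℝ)} {c : ℝ} {φ : Fin (n + 1) → 𝓢(E3, ℂ)}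

/-- The values of the variables at time `t`, at `z` and at a distribution `T`. -/
def distVal (t : ℝ) (z : Fin (n + 1) → ℂ) (T : 𝓢'(E3, ℂ)) : Var (Lab n) → ℂ
  | .e => osc 1 t
  | .e' => osc (-1) t
  | .o => 1
  | .h (.inl j) => z j
  | .h (.inr θ) => T θ
  | .a (.inl j) => conj (z j)
  | .a (.inr θ) => conj (T θ)

theorem distVal_coord (t : ℝ) (u : H1) :
    distVal t (zCoord (eigH φ) u) (fCoord (eigH φ) u).toDist = (dat φ).xval t u := by
  funext j
  rcases j with _ | _ | _ | (j | θ) | (j | θ) <;>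
    simp only [distVal, PData.xval, ← zCoord_eq, ← pair_fCoord_eq, pair_eq]

theorem VSupp_le_labs {S : Finset (Lab n)} {T : Finset 𝓢(E3, ℂ)} (h : S.toRight ⊆ T) :
    VSupp S ≤ VSupp (labs n T) := by
  refine VSupp_mono fun v hv => ?_
  rcases v with j | θ
  · simp [labs]
  · simpa [labs] using h (by simpa using hv)

theorem norm_distVal_lt (D : PData (Lab n) H1) {T : Finset 𝓢(E3, ℂ)} {ρ : ℝ} (t : ℝ)
    {z : Fin (n + 1) → ℂ} {𝒯 : 𝓢'(E3, ℂ)} (hz : ‖z‖ < ρ) (h : ∀ θ ∈ T, ‖𝒯 θ‖ < ρ) :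
    ∀ j ∈ Var.fin (labs n T), ‖distVal t z 𝒯 j‖ < wB (fun v => D.B v * ρ) j := by
  intro j hj
  rw [← Finset.mem_coe, Var.coe_fin] at hj
  have hρ : 0 ≤ ρ := (norm_nonneg z).trans hz.le
  have hB (v : Lab n) : ρ ≤ D.B v * ρ := le_mul_of_one_le_left hρ (D.one_le v)
  rcases j with _ | _ | _ | (j | θ) | (j | θ)
  · simp [distVal, wB, norm_osc]
  · simp [distVal, wB, norm_osc]
  · simp [distVal, wB]
  · exact ((norm_le_pi_norm z j).trans_lt hz).trans_le (hB _)
  · exact (h θ (by simpa [labs] using hj)).trans_le (hB _)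
  · simp only [distVal, RCLike.norm_conj]
    exact ((norm_le_pi_norm z j).trans_lt hz).trans_le (hB _)
  · simp only [distVal, RCLike.norm_conj]
    exact (h θ (by simpa [labs] using hj)).trans_le (hB _)

/-- The series depends on `f` through finitely many pairings with Schwartz functions, which make
sense for distributions. The same function therefore serves for all `K` and `S`; only the
neighbourhood and the constant change. -/
theorem isRemainderSmooth_of_cls {k : ℕ} {F : ℝ → H1 → ℂ} (hF : (dat φ).Cls 2 0 k F) :
    ∃ (R : ℝ → (Fin (n + 1) → ℂ) → 𝓢'(E3, ℂ) → ℝ) (δ : ℝ), IsRemainderSmooth V c k R ∧ 0 < δ ∧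
      ∀ t u, ‖u‖ < δ → R t (zCoord (eigH φ) u) (fCoord (eigH φ) u).toDist = (F t u).re := by
  classical
  obtain ⟨P, S, ρ, hρ, hP, hPS, hP0, hs, hF⟩ := hF
  set T := S.toRight
  have hPT : ∀ d, P d ∈ MvPolynomial.supported ℂ (Var.fin (labs n T) : Set (Var (Lab n))) :=
    fun d => by
      rw [Var.coe_fin]
      exact VSupp_le_labs subset_rfl (hPS d)
  refine ⟨fun t z 𝒯 => (∑' d, MvPolynomial.eval (distVal t z 𝒯) (P d)).re, ρ, fun K S' => ?_, hρ,
    fun t u hu => ?_⟩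
  swap
  · beta_reduce
    rw [distVal_coord, (hF t u hu).tsum_eq]
  choose C hC using exists_norm_toDist_le (-K) (-S')
  -- The sum dominates all the constants of the finitely many functionals, and the factor two yields
  -- strict inequalities.
  set M : ℝ := 2 * (1 + ∑ θ ∈ T, |C θ|) with hM
  have hM0 : 0 ≤ ∑ θ ∈ T, |C θ| := Finset.sum_nonneg fun _ _ => abs_nonneg _
  have hM1 : 1 ≤ M := by linarith
  have hCM : ∀ θ ∈ T, ∀ 𝒯 : HSpace (-K) (-S'), ‖𝒯.toDist θ‖ ≤ M / 2 * ‖𝒯‖ := fun θ hθ 𝒯 => by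
    refine (hC θ 𝒯).trans (mul_le_mul_of_nonneg_right ?_ (norm_nonneg _))
    have := Finset.single_le_sum (f := fun θ => |C θ|) (fun _ _ => abs_nonneg _) hθ
    have h2 := le_abs_self (C θ)
    linarith
  have hb : ∀ (σ : ℝ) (t : ℝ) (z : Fin (n + 1) → ℂ) (𝒯 : HSpace (-K) (-S')),
      M * (‖z‖ + ‖𝒯‖) ≤ σ → 0 < σ → ∀ j ∈ Var.fin (labs n T),
        ‖distVal t z 𝒯.toDist j‖ < wB (fun v => (dat φ).B v * σ) j := by
    intro σ t z 𝒯 h hσ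
    have h1 := norm_nonneg z
    have h2 := norm_nonneg 𝒯
    refine norm_distVal_lt _ t ?_ fun θ hθ => (hCM θ hθ 𝒯).trans_lt ?_
    · nlinarith
    · nlinarith
  refine ⟨{p | ‖p.1‖ + ‖p.2‖ < ρ / M}, ?_, ?_, ?_, (M / ρ) ^ k * ∑' d, wnorm (wB (dat φ).B) (P d) * ρ ^ d,
    fun t p hp => ?_⟩
  · exact isOpen_lt (by fun_prop) continuous_const
  · simp only [mem_ofPred_eq, norm_zero, add_zero]
    positivity
  · refine Complex.reCLM.contDiff.comp_contDiffOn (contDiffOn_infty.mpr fun N => ?_)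
    refine contDiffOn_tsum_eval (S := Var.fin (labs n T)) N
      (isOpen_univ.prod (isOpen_lt (by fun_prop) continuous_const)) (fun j _ => ?_)
      (B := wB fun v => (dat φ).B v * ρ) (fun j => (dat φ).wB_nonneg' hρ.le j)
      (fun q hq => hb ρ q.1 q.2.1 q.2.2 ?_ hρ) hPT ?_
    · have hz : ContDiff ℝ ∞ fun q : ℝ × (Fin (n + 1) → ℂ) × HcSpace V c (-K) (-S') => q.2.1 :=
        contDiff_fst.comp contDiff_snd
      have hT (θ : 𝓢(E3, ℂ)) : ContDiff ℝ ∞ fun q : ℝ × (Fin (n + 1) → ℂ) × HcSpace V c (-K) (-S') =>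
          (q.2.2 : HSpace (-K) (-S')).toDist θ :=
        (((evalHS (-K) (-S') θ).comp (HcSpace V c (-K) (-S')).subtypeL).restrictScalars ℝ).contDiff.comp
          (contDiff_snd.comp contDiff_snd)
      rcases j with _ | _ | _ | (j | θ) | (j | θ)
      · exact ((contDiff_osc 1).comp contDiff_fst).contDiffOn
      · exact ((contDiff_osc (-1)).comp contDiff_fst).contDiffOn
      · exact contDiffOn_const
      · exact ((contDiff_apply ℝ ℂ j).comp hz).contDiffOn
      · exact (hT θ).contDiffOn
      · exact (Complex.conjCLE.contDiff.comp ((contDiff_apply ℝ ℂ j).comp hz)).contDiffOn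
      · exact (Complex.conjCLE.contDiff.comp (hT θ)).contDiffOn
    · have := (lt_div_iff₀ (zero_lt_one.trans_le hM1)).mp hq.2
      rw [mul_comm] at this
      exact this.le
    · simpa only [wnorm_wB_scale _ _ (hP _)] using hs
  · set s := ‖p.1‖ + ‖p.2‖ with hsdef
    have hs0 : 0 ≤ s := by positivity
    have hsρ : M * s < ρ := by
      have := (lt_div_iff₀ (zero_lt_one.trans_le hM1)).mp hp
      rwa [mul_comm] at this
    have hterm : ∀ d, ‖MvPolynomial.eval (distVal t p.1 (p.2 : HSpace (-K) (-S')).toDist) (P d)‖ ≤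
        (M / ρ) ^ k * s ^ k * (wnorm (wB (dat φ).B) (P d) * ρ ^ d) := by
      intro d
      rcases lt_or_ge d k with hd | hd
      · rw [hP0 d hd]
        simp
      have h1 : ‖MvPolynomial.eval (distVal t p.1 (p.2 : HSpace (-K) (-S')).toDist) (P d)‖ ≤
          wnorm (wB (dat φ).B) (P d) * (M * s) ^ d := by
        -- The bound is proved for every radius `σ > M s` and passed to the limit, since the strict
        -- inequalities behind it fail at the origin, where `s = 0`.
        have hc : Continuous fun σ : ℝ => wnorm (wB (dat φ).B) (P d) * σ ^ d := by fun_prop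
        refine ge_of_tendsto (hc.continuousAt.tendsto.mono_left nhdsWithin_le_nhds : Filter.Tendsto
          _ (𝓝[>] (M * s)) _) ?_
        filter_upwards [self_mem_nhdsWithin] with σ hσ
        rw [← wnorm_wB_scale _ _ (hP d)]
        have h0 : 0 ≤ M * s := by positivity
        exact norm_eval_le (hPT d)
          (fun j hj => (hb σ t p.1 p.2 (le_of_lt hσ) (h0.trans_lt hσ) j hj).le)
      refine h1.trans ?_
      -- All degrees are at least `k`: `k` factors are kept to give the order of vanishing, and the
      -- others are bounded by `ρ`.
      have h2 : (M * s) ^ d ≤ (M / ρ) ^ k * s ^ k * ρ ^ d := by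
        obtain ⟨e, rfl⟩ := Nat.exists_eq_add_of_le hd
        calc (M * s) ^ (k + e) = (M * s) ^ k * (M * s) ^ e := pow_add _ _ _
          _ ≤ (M * s) ^ k * ρ ^ e := by gcongr
          _ = _ := by
            rw [pow_add, div_pow, mul_pow]
            field_simp
      calc _ ≤ wnorm (wB (dat φ).B) (P d) * ((M / ρ) ^ k * s ^ k * ρ ^ d) :=
            mul_le_mul_of_nonneg_left h2 (PData.wnorm_nonneg' _)
        _ = _ := by ring
    refine (Complex.abs_re_le_norm _).trans ?_
    rw [show (M / ρ) ^ k * (∑' d, wnorm (wB (dat φ).B) (P d) * ρ ^ d) * s ^ k =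
      (M / ρ) ^ k * s ^ k * ∑' d, wnorm (wB (dat φ).B) (P d) * ρ ^ d by ring]
    exact tsum_of_norm_bounded (hs.hasSum.mul_left _) hterm

end smooth

end NLSNormalForm

end


noncomputable section

namespace NLSNormalForm

/-! ### The terms that are quadratic and cubic in `f` -/

section mid

variable {n : ℕ} {φ : Fin (n + 1) → 𝓢(E3, ℂ)}

/-- The degree of a monomial, without the factor `⟨f^a \bar f^b, Θ⟩`. -/
def MonIndex.deg {p q : ℕ} (i : MonIndex n p q) : ℕ := len i.μ + len i.ν + len i.α + len i.β

/-- The monomials that are allowed in the part of the remainder of index `d`. -/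
def MonIndex.Good (d : ℕ) {p q : ℕ} (i : MonIndex n p q) : Prop :=
  (i.a + i.b = d ∨ (d = 2 ∧ i.a + i.b ≤ 1 ∧ 2 ≤ len i.α + len i.β + i.a + i.b)) ∧
    len i.μ + len i.α + i.a = len i.ν + len i.β + i.b ∧ 2 ≤ len i.μ + len i.α + i.a ∧
    |i.m| + 1 ≤ (len i.μ + len i.α + i.a : ℕ)

variable (φ) in
/-- `G` is a sum of monomials in the functionals `Φ_j` and their complex conjugates, as in the
part of the remainder of index `d`. -/
def MidRep (d : ℕ) {p : ℕ} (Φ : Fin p → 𝓢(E3, ℂ)) (G : ℝ → H1 → ℂ) : Prop :=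
  ∃ Θ : MonIndex n p p → 𝓢(E3, ℂ), (∀ i, Θ i ≠ 0 → i.Good d) ∧
    {i | Θ i ≠ 0 ∧ i.a + i.b ≠ 2 ∧ i.a + i.b ≠ 3}.Finite ∧
    (∃ ρ : ℝ, 0 < ρ ∧ ∀ j k : ℕ, Summable fun i => ρ ^ i.deg * SchwartzMap.seminorm ℂ j k (Θ i)) ∧
    ∃ δ : ℝ, 0 < δ ∧ ∀ t u, ‖u‖ < δ →
      HasSum (fun i => genMon Φ (fun j => conjS (Φ j)) i (Θ i) t (zCoord (eigH φ) u)
        (fCoord (eigH φ) u)) (G t u)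

theorem genMon_eq {p : ℕ} (Φ Ψ : Fin p → 𝓢(E3, ℂ)) (i : MonIndex n p p) (θ : 𝓢(E3, ℂ)) (t : ℝ)
    (z : Fin (n + 1) → ℂ) (f : H1) : genMon Φ Ψ i θ t z f =
      osc i.m t * mon i.μ i.ν z * (∏ j, pair (Φ j) f ^ i.α j) * (∏ j, pairConj (Ψ j) f ^ i.β j)
        * nlInt i.a i.b θ f := rfl

theorem nlInt_add {a b : ℕ} (h : a + b ≤ 4) (ψ η : 𝓢(E3, ℂ)) (f : H1) :
    nlInt a b (ψ + η) f = nlInt a b ψ f + nlInt a b η f := by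
  rw [nlInt, nlInt, nlInt, ← integral_add (integrable_nl h ψ f) (integrable_nl h η f)]
  exact integral_congr_ae (Filter.Eventually.of_forall fun x => by
    simp only [add_apply]; ring)

theorem nlInt_smul (a b : ℕ) (c : ℂ) (ψ : 𝓢(E3, ℂ)) (f : H1) :
    nlInt a b (c • ψ) f = c * nlInt a b ψ f := by
  rw [nlInt, nlInt, ← integral_const_mul]
  exact integral_congr_ae (Filter.Eventually.of_forall fun x => by
    simp only [smul_apply, smul_eq_mul]; ring)

theorem genMon_smul {p : ℕ} (Φ Ψ : Fin p → 𝓢(E3, ℂ)) (i : MonIndex n p p) (c : ℂ) (θ : 𝓢(E3, ℂ))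
    (t : ℝ) (z : Fin (n + 1) → ℂ) (f : H1) :
    genMon Φ Ψ i (c • θ) t z f = c * genMon Φ Ψ i θ t z f := by
  rw [genMon_eq, genMon_eq, nlInt_smul]
  ring

theorem genMon_zero {p : ℕ} (Φ Ψ : Fin p → 𝓢(E3, ℂ)) (i : MonIndex n p p) (t : ℝ)
    (z : Fin (n + 1) → ℂ) (f : H1) : genMon Φ Ψ i 0 t z f = 0 := by
  have := genMon_smul Φ Ψ i 0 0 t z f
  rwa [zero_smul, zero_mul] at this

variable {d : ℕ} {p : ℕ} {Φ : Fin p → 𝓢(E3, ℂ)}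

theorem MidRep.zero : MidRep φ d Φ fun _ _ => 0 := by
  refine ⟨0, by simp, by simp, ⟨1, one_pos, by simp [summable_zero]⟩, 1, one_pos, fun t u _ => ?_⟩
  simp only [Pi.zero_apply, genMon_zero]
  exact hasSum_zero

theorem MidRep.add (hd : d ≤ 4) {G G' : ℝ → H1 → ℂ} (h : MidRep φ d Φ G) (h' : MidRep φ d Φ G') :
    MidRep φ d Φ fun t u => G t u + G' t u := by
  obtain ⟨Θ, h1, h2, ⟨ρ, hρ, h3⟩, δ, hδ, h4⟩ := h
  obtain ⟨Θ', h1', h2', ⟨ρ', hρ', h3'⟩, δ', hδ', h4'⟩ := h'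
  have hne : ∀ i, Θ i + Θ' i ≠ 0 → Θ i ≠ 0 ∨ Θ' i ≠ 0 := fun i h => by
    by_contra! h0
    exact h (by rw [h0.1, h0.2, add_zero])
  refine ⟨fun i => Θ i + Θ' i, fun i hi => (hne i hi).elim (h1 i) (h1' i),
    (h2.union h2').subset ?_, ⟨min ρ ρ', lt_min hρ hρ', fun j k => ?_⟩,
    min δ δ', lt_min hδ hδ', fun t u hu => ?_⟩
  · rintro i ⟨hi, hi'⟩
    exact (hne i hi).imp (fun h => ⟨h, hi'⟩) fun h => ⟨h, hi'⟩
  · refine Summable.of_nonneg_of_le (fun i => by positivity) (fun i => ?_) ((h3 j k).add (h3' j k))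
    have e1 : min ρ ρ' ^ i.deg ≤ ρ ^ i.deg := by gcongr; exact min_le_left _ _
    have e2 : min ρ ρ' ^ i.deg ≤ ρ' ^ i.deg := by gcongr; exact min_le_right _ _
    calc _ ≤ min ρ ρ' ^ i.deg *
          (SchwartzMap.seminorm ℂ j k (Θ i) + SchwartzMap.seminorm ℂ j k (Θ' i)) := by
          gcongr
          exact map_add_le_add _ _ _
      _ ≤ _ := by
          rw [mul_add]
          gcongr
  · refine ((h4 t u (hu.trans_le (min_le_left _ _))).add
      (h4' t u (hu.trans_le (min_le_right _ _)))).congr_fun fun i => ?_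
    by_cases hi : i.Good d
    · have h5 : i.a + i.b ≤ 4 := by
        rcases hi.1 with h | h <;> omega
      rw [genMon_eq, genMon_eq, genMon_eq, nlInt_add h5]
      ring
    · have e1 : Θ i = 0 := by_contra fun h => hi (h1 i h)
      have e2 : Θ' i = 0 := by_contra fun h => hi (h1' i h)
      simp only [e1, e2, add_zero, genMon_zero]

/-- The index of a monomial. -/
def monIndex (Φ : Fin p → 𝓢(E3, ℂ)) (a b : ℕ) (κ : Var (Lab n) →₀ ℕ) : MonIndex n p p :=
  ⟨a, b, mfreq κ, mμ κ, mν κ, fun j => κ (.h (.inr (Φ j))), fun j => κ (.a (.inr (Φ j)))⟩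

/-- Several monomials can share an index, since the variable `o` is forgotten and only the
difference of the exponents of the oscillations is recorded. Coefficients are summed over the
fibres; as `ψ` is fixed, the decay of every seminorm follows from that of the scalars. -/
theorem MidRep.of_family {J : Type} {κ : J → Var (Lab n) →₀ ℕ} {C : J → ℂ} {a b : ℕ}
    (ψ : 𝓢(E3, ℂ)) (hgood : ∀ j, C j ≠ 0 → (monIndex Φ a b (κ j)).Good d)
    (hfin : a + b = 2 ∨ a + b = 3 ∨ Finite J) {ρ : ℝ} (hρ : 0 < ρ)
    (hs : Summable fun j => ‖C j‖ * ρ ^ (monIndex Φ a b (κ j)).deg) {G : ℝ → H1 → ℂ}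
    {δ : ℝ} (hδ : 0 < δ)
    (hG : ∀ t u, ‖u‖ < δ → HasSum (fun j => C j * genMon Φ (fun j => conjS (Φ j))
      (monIndex Φ a b (κ j)) ψ t (zCoord (eigH φ) u) (fCoord (eigH φ) u)) (G t u)) :
    MidRep φ d Φ G := by
  classical
  set idx : J → MonIndex n p p := fun j => monIndex Φ a b (κ j) with hidx
  set c : MonIndex n p p → ℂ := fun i => ∑' x : {x // idx x = i}, C x with hc
  have hne : ∀ i, c i ≠ 0 → ∃ j, idx j = i ∧ C j ≠ 0 := by
    intro i hi
    by_contra! h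
    exact hi (by
      have : ∀ x : {x // idx x = i}, C x = 0 := fun x => h x x.2
      simp only [hc, this, tsum_zero])
  have hne' : ∀ i, c i • ψ ≠ 0 → ∃ j, idx j = i ∧ C j ≠ 0 := fun i hi =>
    hne i fun h => hi (by rw [h, zero_smul])
  have hs' := (Equiv.sigmaFiberEquiv idx).summable_iff.mpr hs
  have hsum := hs'.sigma
  refine ⟨fun i => c i • ψ, fun i hi => ?_, ?_, ⟨ρ, hρ, fun j k => ?_⟩, δ, hδ, fun t u hu => ?_⟩
  · obtain ⟨j, rfl, hj⟩ := hne' i hi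
    exact hgood j hj
  · rcases hfin with h | h | h
    · refine Set.finite_empty.subset ?_
      rintro i ⟨hi, h2, -⟩
      obtain ⟨j, rfl, -⟩ := hne' i hi
      exact h2 h
    · refine Set.finite_empty.subset ?_
      rintro i ⟨hi, -, h2⟩
      obtain ⟨j, rfl, -⟩ := hne' i hi
      exact h2 h
    · refine (Set.finite_range idx).subset ?_
      rintro i ⟨hi, -⟩
      obtain ⟨j, rfl, -⟩ := hne' i hi
      exact ⟨j, rfl⟩
  · refine Summable.of_nonneg_of_le (fun i => by positivity) (fun i => ?_)
      (hsum.mul_right (SchwartzMap.seminorm ℂ j k ψ))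
    rw [map_smul_eq_mul]
    have h1 : ∀ x : {x // idx x = i}, ‖C x‖ * ρ ^ (idx x).deg = ‖C x‖ * ρ ^ i.deg := fun x => by
      rw [x.2]
    have h2 : Summable fun x : {x // idx x = i} => ‖C x‖ := by
      have := hs'.sigma_factor i
      have h3 : Summable fun x : {x // idx x = i} => ‖C x‖ * ρ ^ i.deg :=
        this.congr fun x => h1 x
      exact (summable_mul_right_iff (by positivity)).mp h3
    have h4 : ∑' x : {x // idx x = i}, ‖C x‖ * ρ ^ (idx x).deg =
        (∑' x : {x // idx x = i}, ‖C x‖) * ρ ^ i.deg := by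
      rw [← tsum_mul_right]
      exact tsum_congr h1
    have h5 : ‖c i‖ ≤ ∑' x : {x // idx x = i}, ‖C x‖ := norm_tsum_le_tsum_norm h2
    calc ρ ^ i.deg * (‖c i‖ * SchwartzMap.seminorm ℂ j k ψ)
        ≤ ρ ^ i.deg * ((∑' x : {x // idx x = i}, ‖C x‖) * SchwartzMap.seminorm ℂ j k ψ) := by
          gcongr
      _ = (∑' x : {x // idx x = i}, ‖C x‖ * ρ ^ (idx x).deg) * SchwartzMap.seminorm ℂ j k ψ := by
          rw [h4]
          ring
  · have h1 := (Equiv.sigmaFiberEquiv idx).hasSum_iff.mpr (hG t u hu)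
    refine h1.sigma fun i => ?_
    have h2 := h1.summable.sigma_factor i
    have h3 : ∀ x : {x // idx x = i}, ((fun j => C j * genMon Φ (fun j => conjS (Φ j)) (idx j) ψ t
        (zCoord (eigH φ) u) (fCoord (eigH φ) u)) ∘ Equiv.sigmaFiberEquiv idx) ⟨i, x⟩ =
        C x * genMon Φ (fun j => conjS (Φ j)) i ψ t (zCoord (eigH φ) u) (fCoord (eigH φ) u) :=
      fun x => by
        change C x * genMon Φ (fun j => conjS (Φ j)) (idx x) ψ t _ _ = _
        rw [x.2]
    have h4 := h2.hasSum
    rw [tsum_congr h3, tsum_mul_right] at h4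
    rw [genMon_smul]
    exact h4

end mid

end NLSNormalForm

end


/-! ### Reading off the quadratic and cubic parts of the remainder -/

noncomputable section

namespace NLSNormalForm

section mid

variable {n : ℕ} {φ : Fin (n + 1) → 𝓢(E3, ℂ)}

/-- An enumeration of a finite set of Schwartz functions. -/
def enumS (T : Finset 𝓢(E3, ℂ)) (j : Fin T.card) : 𝓢(E3, ℂ) := T.equivFin.symm j

theorem sum_enumS {M : Type} [AddCommMonoid M] (T : Finset 𝓢(E3, ℂ)) (F : 𝓢(E3, ℂ) → M) :
    ∑ j, F (enumS T j) = ∑ θ ∈ T, F θ :=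
  (T.equivFin.symm.sum_comp fun θ : T => F θ).trans (Finset.sum_coe_sort T F)

theorem prod_enumS {M : Type} [CommMonoid M] (T : Finset 𝓢(E3, ℂ)) (F : 𝓢(E3, ℂ) → M) :
    ∏ j, F (enumS T j) = ∏ θ ∈ T, F θ :=
  (T.equivFin.symm.prod_comp fun θ : T => F θ).trans (Finset.prod_coe_sort T F)

variable {T : Finset 𝓢(E3, ℂ)} {κ : Var (Lab n) →₀ ℕ}

theorem genMon_monIndex (h : κ.support ⊆ Var.fin (labs n T)) (a b : ℕ) (c : ℂ) (ψ : 𝓢(E3, ℂ))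
    (t : ℝ) (u : H1) :
    c * genMon (enumS T) (fun j => conjS (enumS T j)) (monIndex (enumS T) a b κ) ψ t
      (zCoord (eigH φ) u) (fCoord (eigH φ) u) =
    MvPolynomial.eval ((dat φ).xval t u) (MvPolynomial.monomial κ c) *
      nlInt a b ψ (fCoord (eigH φ) u) := by
  rw [eval_monomial_xval φ h, genMon_eq]
  simp only [monIndex, pairConj_conjS]
  rw [prod_enumS T fun θ => pair θ (fCoord (eigH φ) u) ^ κ (.h (.inr θ)),
    prod_enumS T fun θ => conj (pair θ (fCoord (eigH φ) u)) ^ κ (.a (.inr θ))]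
  ring

theorem deg_monIndex (h : κ.support ⊆ Var.fin (labs n T)) (a b : ℕ) :
    (monIndex (enumS T) a b κ).deg = (Finsupp.weight Var.wt κ).2.2 := by
  rw [(weight_of_support h).2, MonIndex.deg]
  simp only [monIndex, len]
  rw [sum_enumS T fun θ => κ (.h (.inr θ)), sum_enumS T fun θ => κ (.a (.inr θ))]
  ring

/-- Together with the factors `f^a \bar f^b` the charge is zero and the first weight is two, which
gives equal numbers of both kinds and the frequency bound; total degree at least four gives two of
each. -/
theorem monIndex_good (h : κ.support ⊆ Var.fin (labs n T)) {a b d e : ℕ}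
    (hw : Finsupp.weight Var.wt κ = (2 - ((a : ℤ) + b), (b : ℤ) - a, e)) (he : 4 ≤ e + (a + b))
    (hd : a + b = d ∨ (d = 2 ∧ a + b = 0 ∧ 2 ≤ wdeg κ)) :
    (monIndex (enumS T) a b κ).Good d := by
  obtain ⟨h1, h2⟩ := weight_of_support h
  have h3 := weight_wt_fst κ
  have h4 := abs_mfreq_le κ
  have h5 := wdeg_of_support h
  rw [hw] at h1 h2 h3
  have e1 : len (fun j => κ (.h (.inr (enumS T j)))) = ∑ θ ∈ T, κ (.h (.inr θ)) :=
    sum_enumS T fun θ => κ (.h (.inr θ))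
  have e2 : len (fun j => κ (.a (.inr (enumS T j)))) = ∑ θ ∈ T, κ (.a (.inr θ)) :=
    sum_enumS T fun θ => κ (.a (.inr θ))
  simp only [MonIndex.Good, monIndex, e1, e2] at h1 h2 h3 ⊢
  generalize ∑ θ ∈ T, κ (.h (.inr θ)) = A at *
  generalize ∑ θ ∈ T, κ (.a (.inr θ)) = B at *
  refine ⟨?_, ?_, ?_, ?_⟩ <;> omega

theorem summable_monomials {D : PData (Lab n) H1} {P : ℕ → VPoly (Lab n)} {ρ : ℝ} (hρ : 0 < ρ)
    (hs : Summable fun d => wnorm (wB D.B) (P d) * ρ ^ d) :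
    Summable fun j : Σ d, (P d).support =>
      ‖(P j.1).coeff j.2‖ * (j.2.1.prod fun v k => wB D.B v ^ k) * ρ ^ j.1 := by
  refine (summable_sigma_of_nonneg fun j => ?_).mpr ⟨fun d => (hasSum_fintype _).summable, ?_⟩
  · exact mul_nonneg (mul_nonneg (norm_nonneg _) (prod_pow_nonneg D.wB_pos _)) (by positivity)
  · refine hs.congr fun d => ?_
    rw [tsum_fintype]
    exact (congrArg (· * ρ ^ d) (Finset.sum_coe_sort (P d).support fun κ =>
      ‖(P d).coeff κ‖ * κ.prod fun v k => wB D.B v ^ k).symm).trans (Finset.sum_mul _ _ _)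

/-- Each polynomial of the series is split into monomials. Any family containing the needed Schwartz
functions will do, so that the pieces of a sum can be written with a common one. -/
theorem MidRep.of_cls {a b e : ℕ} (hab : a + b = 2 ∨ a + b = 3) {Q : ℝ → H1 → ℂ}
    (hQ : (dat φ).Cls (2 - (a + b)) (b - a) e Q) (he : 4 ≤ e + (a + b)) (ψ : 𝓢(E3, ℂ)) :
    ∃ T₀ : Finset 𝓢(E3, ℂ), ∀ T, T₀ ⊆ T → MidRep φ (a + b) (enumS T)
      fun t u => Q t u * nlInt a b ψ (fCoord (eigH φ) u) := by
  classical
  obtain ⟨P, S, ρ, hρ, hP, hPS, hP0, hs, hF⟩ := hQ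
  refine ⟨S.toRight, fun T hT => ?_⟩
  have hsupp (j : Σ d, (P d).support) : j.2.1.support ⊆ Var.fin (labs n T) :=
    support_subset_of_mem_VSupp (VSupp_le_labs hT (hPS j.1)) j.2.2
  have hw (j : Σ d, (P d).support) :
      Finsupp.weight Var.wt j.2.1 = (2 - ((a : ℤ) + b), (b : ℤ) - a, j.1) :=
    hP j.1 (coeff_ne_zero_of_mem j.2.2)
  have hsum := summable_monomials hρ hs
  refine MidRep.of_family (J := Σ d, (P d).support) (κ := fun j => j.2.1)
    (C := fun j => (P j.1).coeff j.2.1) (a := a) (b := b) ψ (fun j _ => ?_)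
    (hab.imp_right Or.inl) hρ ?_ hρ fun t u hu => ?_
  · refine monIndex_good (hsupp j) (hw j) ?_ (Or.inl rfl)
    have : e ≤ j.1 := by
      by_contra! h
      exact coeff_ne_zero_of_mem j.2.2
        (by simpa using congrArg (MvPolynomial.coeff j.2.1) (hP0 _ h))
    omega
  · refine Summable.of_nonneg_of_le (fun j => by positivity) (fun j => ?_) hsum
    rw [deg_monIndex (hsupp j), hw j]
    -- The bounds `B` are at least one, so the weights can be dropped and `ρ` itself is the common
    -- rate of decay.
    have h1 : (1 : ℝ) ≤ j.2.1.prod fun v k => wB (dat φ).B v ^ k := by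
      refine Finset.prod_induction _ (fun x : ℝ => 1 ≤ x) (fun _ _ => one_le_mul_of_one_le_of_one_le)
        le_rfl fun v hv => one_le_pow₀ ?_
      clear hv
      cases v
      case h v => exact (dat φ).one_le v
      case a v => exact (dat φ).one_le v
      all_goals simp [wB]
    have h2 : ‖(P j.1).coeff j.2.1‖ ≤
        ‖(P j.1).coeff j.2.1‖ * j.2.1.prod fun v k => wB (dat φ).B v ^ k :=
      le_mul_of_one_le_right (norm_nonneg _) h1
    gcongr
  · simp only [genMon_monIndex (hsupp _)]
    refine HasSum.mul_right _ ?_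
    have h1 : Summable fun j : Σ d, (P d).support => MvPolynomial.eval ((dat φ).xval t u)
        (MvPolynomial.monomial j.2.1 ((P j.1).coeff j.2.1)) := by
      refine Summable.of_norm_bounded hsum fun j => ?_
      refine (PData.norm_eval_le_scale (isHom_monomial (hw j) _) t hu.le).trans
        (mul_le_mul_of_nonneg_right (le_of_eq_of_le (wnorm_eq_sum (s := {j.2.1})
          MvPolynomial.support_monomial_subset) ?_) (by positivity))
      simp
    have h2 := h1.hasSum.sigma fun d => hasSum_fintype _
    have h3 : ∀ d, ∑ j : (P d).support, MvPolynomial.eval ((dat φ).xval t u)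
        (MvPolynomial.monomial j.1 ((P d).coeff j.1)) =
        MvPolynomial.eval ((dat φ).xval t u) (P d) := fun d =>
      (Finset.sum_coe_sort (P d).support fun κ => MvPolynomial.eval ((dat φ).xval t u)
        (MvPolynomial.monomial κ ((P d).coeff κ))).trans (eval_eq_sum _ (P d)).symm
    simp only [h3] at h2
    rw [(hF t u hu).unique h2]
    exact h1.hasSum

variable (φ) in
/-- `G` is a sum of monomials as in the part of the remainder of index `d`, in the functionals given
by any large finite set of Schwartz functions. -/
def EventuallyMid (d : ℕ) (G : ℝ → H1 → ℂ) : Prop :=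
  ∃ T₀ : Finset 𝓢(E3, ℂ), ∀ T, T₀ ⊆ T → MidRep φ d (enumS T) G

theorem EventuallyMid.zero (d : ℕ) : EventuallyMid φ d fun _ _ => 0 := ⟨∅, fun _ _ => MidRep.zero⟩

theorem EventuallyMid.add {d : ℕ} (hd : d ≤ 4) {G G' : ℝ → H1 → ℂ} (h : EventuallyMid φ d G)
    (h' : EventuallyMid φ d G') : EventuallyMid φ d fun t u => G t u + G' t u := by
  classical
  obtain ⟨T, hT⟩ := h
  obtain ⟨T', hT'⟩ := h'
  exact ⟨T ∪ T', fun T₁ h => (hT _ (Finset.union_subset_left h)).add hd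
    (hT' _ (Finset.union_subset_right h))⟩

theorem ETerm.eventuallyMid (τ : ETerm φ) :
    EventuallyMid φ (τ.a + τ.b) fun t u => ((τ.val t u).re : ℂ) := by
  obtain ⟨T₁, h1⟩ := MidRep.of_cls τ.hab (τ.hQ.const_mul (1 / 2)) τ.he τ.ψ
  have hQ : (dat φ).Cls (2 - ((τ.b : ℤ) + τ.a)) (τ.a - τ.b) τ.e fun t u => conj (τ.Q t u) := by
    have := τ.hQ.conj
    rwa [neg_sub, add_comm (τ.a : ℤ)] at this
  obtain ⟨T₂, h2⟩ := MidRep.of_cls (by rw [add_comm]; exact τ.hab) (hQ.const_mul (1 / 2))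
    (by rw [add_comm τ.b]; exact τ.he) (conjS τ.ψ)
  rw [add_comm τ.b] at h2
  have h3 := EventuallyMid.add (by rcases τ.hab with h | h <;> omega) ⟨T₁, h1⟩ ⟨T₂, h2⟩
  convert h3 using 3 with t u
  rw [Complex.re_eq_add_conj, ETerm.val, map_mul, conj_nlInt]
  ring

theorem ECls.eventuallyMid {G : ℝ → H1 → ℂ} (h : ECls φ G) : ∃ G₂ G₃ : ℝ → H1 → ℝ,
    EventuallyMid φ 2 (fun t u => (G₂ t u : ℂ)) ∧ EventuallyMid φ 3 (fun t u => (G₃ t u : ℂ)) ∧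
      ∀ t u, (G t u).re = G₂ t u + G₃ t u := by
  obtain ⟨L, hL⟩ := h
  simp only [hL]
  clear hL
  induction L with
  | nil =>
    exact ⟨fun _ _ => 0, fun _ _ => 0, by simpa using EventuallyMid.zero 2,
      by simpa using EventuallyMid.zero 3, by simp⟩
  | cons τ L ih =>
    obtain ⟨G₂, G₃, h2, h3, h⟩ := ih
    have hτ := τ.eventuallyMid
    rcases τ.hab with hab | hab
    · rw [hab] at hτ
      refine ⟨fun t u => (τ.val t u).re + G₂ t u, G₃, ?_, h3, fun t u => ?_⟩
      · simpa only [Complex.ofReal_add] using hτ.add (by norm_num) h2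
      · rw [List.map_cons, List.sum_cons, Complex.add_re, h]
        ring
    · rw [hab] at hτ
      refine ⟨G₂, fun t u => (τ.val t u).re + G₃ t u, h2, ?_, fun t u => ?_⟩
      · simpa only [Complex.ofReal_add] using hτ.add (by norm_num) h3
      · rw [List.map_cons, List.sum_cons, Complex.add_re, h]
        ring

/-- A product of pairings alone is brought to the required shape, with `a = b = 0`, by inserting the
factor `∫ η = 1`. -/
theorem EventuallyMid.of_monomial (hE : ∃ η : 𝓢(E3, ℂ), ∫ x, η x = 1) {e : ℕ} (he : 4 ≤ e)
    (hw : Finsupp.weight Var.wt κ = (2, 0, e)) (h2 : 2 ≤ wdeg κ) (c : ℂ) :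
    EventuallyMid φ 2 fun t u => MvPolynomial.eval ((dat φ).xval t u) (MvPolynomial.monomial κ c) := by
  classical
  obtain ⟨η, hη⟩ := hE
  obtain ⟨S, hS⟩ := exists_mem_VSupp (MvPolynomial.monomial κ (1 : ℂ))
  refine ⟨S.toRight, fun T hT => ?_⟩
  have hsupp : κ.support ⊆ Var.fin (labs n T) :=
    support_subset_of_mem_VSupp (VSupp_le_labs hT hS) (by simp)
  refine MidRep.of_family (J := Unit) (κ := fun _ => κ) (C := fun _ => c) (a := 0) (b := 0) η
    (fun _ _ => monIndex_good hsupp (by simpa using hw) he (Or.inr ⟨rfl, rfl, h2⟩))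
    (Or.inr (Or.inr inferInstance)) one_pos (hasSum_fintype _).summable one_pos fun t u _ => ?_
  have h3 : nlInt 0 0 η (fCoord (eigH φ) u) = 1 := by simpa [nlInt] using hη
  simp only [genMon_monIndex hsupp, h3, mul_one]
  simp

theorem Quartic.eventuallyMid (hE : ∃ η : 𝓢(E3, ℂ), ∫ x, η x = 1) {q : VPoly (Lab n)}
    (hq : Quartic q) (h2 : ∀ κ ∈ q.support, 2 ≤ wdeg κ) :
    EventuallyMid φ 2 fun t u => ((MvPolynomial.eval ((dat φ).xval t u) q).re : ℂ) := by
  classical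
  have h : ∀ κ ∈ q.support, EventuallyMid φ 2 fun t u =>
      ((MvPolynomial.eval ((dat φ).xval t u) (MvPolynomial.monomial κ (q.coeff κ))).re : ℂ) := by
    intro κ hκ
    obtain ⟨e, he, hw⟩ := hq κ hκ
    have hw' : Finsupp.weight Var.wt (κ.mapDomain Var.swap) = (2, 0, e) := by
      have h1 := isHom_starP (isHom_monomial hw 1)
      rw [starP_monomial, map_one, neg_zero] at h1
      exact h1 (by simp)
    have h3 := (EventuallyMid.of_monomial (φ := φ) hE he hw (h2 κ hκ) (1 / 2 * q.coeff κ)).add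
      (by norm_num) (EventuallyMid.of_monomial (φ := φ) hE he hw'
        ((h2 κ hκ).trans_eq (wdeg_mapDomain_swap κ).symm) (1 / 2 * conj (q.coeff κ)))
    convert h3 using 3 with t u
    rw [Complex.re_eq_add_conj, ← eval_starP ((dat φ).xval_swap t u), starP_monomial,
      MvPolynomial.eval_monomial, MvPolynomial.eval_monomial, MvPolynomial.eval_monomial,
      MvPolynomial.eval_monomial]
    ring
  have h3 : EventuallyMid φ 2 fun t u => ∑ κ ∈ q.support,
      ((MvPolynomial.eval ((dat φ).xval t u) (MvPolynomial.monomial κ (q.coeff κ))).re : ℂ) := by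
    generalize q.support = s at h
    induction s using Finset.induction_on with
    | empty => simpa using EventuallyMid.zero 2
    | insert κ s hκ ih =>
      simp only [Finset.sum_insert hκ]
      exact (h κ (Finset.mem_insert_self _ _)).add (by norm_num)
        (ih fun κ' h' => h κ' (Finset.mem_insert_of_mem h'))
  convert h3 using 3 with t u
  rw [eval_eq_sum, Complex.re_sum, Complex.ofReal_sum]

end mid

end NLSNormalForm

end


noncomputable section

namespace NLSNormalForm

/-! ### The form of the energy in the new coordinates -/

section conclusion

variable {n : ℕ} {V : 𝓢(E3, ℝ)} {c γ₀ γ₁ : ℝ} {l : Fin (n + 1) → ℝ} {φ : Fin (n + 1) → 𝓢(E3, ℂ)}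

theorem EventuallyMid.isRemainderMid {d : ℕ} {G : ℝ → H1 → ℝ}
    (h : EventuallyMid φ d fun t u => (G t u : ℂ)) : ∃ δ : ℝ, 0 < δ ∧ ∀ δ' ≤ δ,
      IsRemainderMid (eigH φ) d (Metric.ball 0 δ') fun t z f => (G t (recon φ z f) : ℂ) := by
  obtain ⟨T, hT⟩ := h
  obtain ⟨Θ, h1, h2, h3, δ, hδ, h4⟩ := hT T subset_rfl
  refine ⟨δ, hδ, fun δ' hδ' => ⟨T.card, T.card, enumS T, fun j => conjS (enumS T j), Θ, h1, h2, h3,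
    fun t u hu => ⟨?_, Complex.ofReal_im _⟩⟩⟩
  beta_reduce
  rw [recon_coord]
  exact h4 t u ((mem_ball_zero_iff.mp hu).trans_le hδ')

/-- Resonant monomials without `f` have frequency zero, so their coefficients can be reindexed by
`(μ, ν)` alone. The conditions on the `\bar f` terms are those on the `f` terms, conjugated. -/
theorem LinRep.isNormalForm {r : ℕ} {G : ℝ → H1 → ℂ} (h : LinRep φ (NormZ l r) (NormF c l r) G) :
    ∃ Z : ℝ → (Fin (n + 1) → ℂ) → H1 → ℂ, IsNormalForm c l r Z ∧
      ∀ t u, Z t (zCoord (eigH φ) u) (fCoord (eigH φ) u) = G t u := by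
  obtain ⟨a, Φ, Ψ, hG, hP, hQ, ha, hΨ⟩ := h
  have hinj : Function.Injective fun i : MI n × MI n => ((0 : ℤ), i) := fun i j h =>
    (Prod.mk.inj h).2
  refine ⟨fun t z f => zSum a t z + linSum Φ Ψ t z f,
    ⟨a.comapDomain (fun i => ((0 : ℤ), i)) hinj.injOn, Φ, Ψ, fun t z f => ?_, fun μ ν h => ?_,
      fun m μ ν h => hQ m μ ν h, fun m μ ν h => ?_, fun μ ν => ?_, fun m μ ν x => ?_⟩,
    fun t u => (hG t u).symm⟩
  · refine congrArg (· + linSum Φ Ψ t z f) ?_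
    have hb : Set.BijOn (fun i : MI n × MI n => ((0 : ℤ), i))
        ((fun i : MI n × MI n => ((0 : ℤ), i)) ⁻¹' (a.support : Set _)) (a.support : Set _) := by
      refine ⟨fun i hi => hi, hinj.injOn, ?_⟩
      rintro ⟨m, μ, ν⟩ hi
      have h0 := (hP m μ ν (Finsupp.mem_support_iff.mp hi)).1
      subst h0
      exact ⟨(μ, ν), hi, rfl⟩
    have h1 := Finsupp.sum_comapDomain _ a
      (fun i c => c * osc i.1 t * mon i.2.1 i.2.2 z) hb
    rw [zSum_eq, ← h1, Finsupp.sum]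
    exact Finset.sum_congr rfl fun i _ => by simp [osc_zero]
  · exact (hP 0 μ ν h).2
  · obtain ⟨h1, h2, h3, h4, h5⟩ := LinRep.conj_flip hQ hΨ m μ ν h
    have h6 : ∑ j, l j * ((ν j : ℝ) - μ j) = -∑ j, l j * ((μ j : ℝ) - ν j) := by
      rw [← Finset.sum_neg_distrib]
      exact Finset.sum_congr rfl fun j _ => by ring
    rw [h6] at h1
    push_cast at h1
    rw [abs_neg] at h3
    exact ⟨by linarith, h2.symm, h3, by omega, by omega⟩
  · simpa using ha 0 μ ν
  · have := hΨ (-m) ν μ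
    rw [neg_neg] at this
    rw [this, conjS_apply]

/-- The indices of the terms of the remainder that do not depend on `f`. -/
def RemZ (r : ℕ) (m : ℤ) (μ ν : MI n) : Prop := len μ = len ν ∧ r + 1 ≤ len μ ∧ |m| ≤ len μ

/-- The indices of the terms of the remainder that are linear in `f`. -/
def RemF (r : ℕ) (m : ℤ) (μ ν : MI n) : Prop := len μ + 1 = len ν ∧ r ≤ len μ ∧ |m| ≤ len μ

theorem LinRep.isRemainder {r : ℕ} {G : ℝ → H1 → ℂ} (h : LinRep φ (RemZ r) (RemF r) G) :
    ∃ R₀ R₁ : ℝ → (Fin (n + 1) → ℂ) → H1 → ℂ, IsRemainderZ r R₀ ∧ IsRemainderLin r R₁ ∧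
      ∀ t u, G t u = R₀ t (zCoord (eigH φ) u) (fCoord (eigH φ) u) +
        R₁ t (zCoord (eigH φ) u) (fCoord (eigH φ) u) := by
  obtain ⟨a, Φ, Ψ, hG, hP, hQ, ha, hΨ⟩ := h
  refine ⟨fun t z _ => zSum a t z, linSum Φ Ψ, ⟨a, fun _ _ _ => rfl, hP, ha⟩,
    ⟨Φ, Ψ, fun _ _ _ => rfl, hQ, fun m μ ν h => ?_, fun m μ ν x => by rw [hΨ, conjS_apply]⟩, hG⟩
  obtain ⟨h1, h2, h3⟩ := LinRep.conj_flip hQ hΨ m μ ν h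
  rw [abs_neg] at h3
  exact ⟨h1, h2, h3⟩

theorem IsHom.exists_split {d : ℕ} {p : VPoly (Lab n)} (hp : IsHom 2 0 d p) :
    ∃ p₁ p₂ : VPoly (Lab n), p = p₁ + p₂ ∧ IsHom 2 0 d p₁ ∧ IsHom 2 0 d p₂ ∧
      (∀ κ ∈ p₁.support, wdeg κ ≤ 1) ∧ ∀ κ ∈ p₂.support, 2 ≤ wdeg κ := by
  classical
  have h1 : ∀ κ ∈ p.support, Finsupp.weight Var.wt κ = (2, 0, d) := fun κ hκ =>
    hp (coeff_ne_zero_of_mem hκ)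
  rw [p.as_sum]
  generalize p.support = s at h1
  induction s using Finset.induction_on with
  | empty => exact ⟨0, 0, by simp, isHom_zero _ _ _, isHom_zero _ _ _, by simp, by simp⟩
  | insert κ s hκ ih =>
    obtain ⟨p₁, p₂, h, h3, h4, h5, h6⟩ := ih fun κ' h' => h1 κ' (Finset.mem_insert_of_mem h')
    have h7 := isHom_monomial (h1 κ (Finset.mem_insert_self _ _)) (p.coeff κ)
    rw [Finset.sum_insert hκ, h]
    rcases le_or_gt (wdeg κ) 1 with hw | hw
    · exact ⟨MvPolynomial.monomial κ (p.coeff κ) + p₁, p₂, by ring, h7.add h3, h4,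
        forall_support_add (forall_support_monomial hw) h5, h6⟩
    · exact ⟨p₁, MvPolynomial.monomial κ (p.coeff κ) + p₂, by ring, h3, h7.add h4,
        h5, forall_support_add (forall_support_monomial hw) h6⟩

/-- The lowest polynomial of the series is removed `k` times, without any Lie transform. Its part at
most linear in `f` is admissible in the remainder as it stands, and the rest is added to `q`. -/
theorem exists_peel {r : ℕ} (hr : 1 ≤ r) {F : ℝ → H1 → ℂ} (hF : (dat φ).Cls 2 0 (2 * r + 2) F)
    (k : ℕ) : ∃ (G : ℝ → H1 → ℂ) (q : VPoly (Lab n)) (F' : ℝ → H1 → ℂ),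
      LinRep φ (RemZ r) (RemF r) G ∧ Quartic q ∧ (∀ κ ∈ q.support, 2 ≤ wdeg κ) ∧
      (dat φ).Cls 2 0 (2 * (r + k) + 2) F' ∧ ∀ t u, ((F t u).re : ℂ) =
        G t u + ((MvPolynomial.eval ((dat φ).xval t u) q).re : ℂ) + ((F' t u).re : ℂ) := by
  induction k with
  | zero => exact ⟨_, 0, F, LinRep.zero, by simp [Quartic], by simp, hF, fun t u => by simp⟩
  | succ k ih =>
    obtain ⟨G, q, F', hG, hq, hqw, hF', h⟩ := ih
    obtain ⟨p, hp, hF''⟩ := hF'.split_two ⟨r + k, by push_cast; ring⟩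
    obtain ⟨p₁, p₂, rfl, h1, h2, h3, h4⟩ := IsHom.exists_split hp
    refine ⟨_, q + p₂, _, hG.add ((LinRep.of_poly (φ := φ) h1 h3).mono ?_ ?_),
      forall_support_add hq (IsHom.quartic h2 (by omega)), forall_support_add hqw h4, hF'',
      fun t u => ?_⟩
    · rintro m μ ν ⟨e1, e2, e3⟩
      exact ⟨e1, by omega, by omega⟩
    · rintro m μ ν ⟨e1, e2, e3⟩
      exact ⟨e1, by omega, e3⟩
    · rw [h]
      simp only [map_add, Complex.add_re, Complex.sub_re, Complex.ofReal_add, Complex.ofReal_sub]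
      ring

/-- The pieces with index four and five are zero: apart from the quartic energy of `f`, no integral
has more than three factors `f, \bar f`. -/
theorem Reduced.exists_remainder (hE : EigenSys V c l φ) {r : ℕ} (hr : 1 ≤ r)
    (hrN : r ≤ bigN c l + 1) {δ : ℝ} {T : Phase → Phase} (h : Reduced V c γ₀ γ₁ l φ r δ T) :
    ∃ δ' : ℝ, Reduced V c γ₀ γ₁ l φ r δ' T ∧ δ' ≤ δ ∧
      ∃ (Z : ℝ → (Fin (n + 1) → ℂ) → H1 → ℂ) (R : ℕ → ℝ → (Fin (n + 1) → ℂ) → H1 → ℂ)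
        (R₇ : ℝ → (Fin (n + 1) → ℂ) → 𝓢'(E3, ℂ) → ℝ),
        IsNormalForm c l r Z ∧ IsRemainderZ r (R 0) ∧ IsRemainderLin r (R 1) ∧
        (∀ d : ℕ, 2 ≤ d → d ≤ 5 → IsRemainderMid (eigH φ) d (Metric.ball 0 δ') (R d)) ∧
        (∀ t z f, R 6 t z f = ((gam γ₀ γ₁ t * ∫ x : E3, ‖fn f x‖ ^ 4 / 4 : ℝ) : ℂ)) ∧
        IsRemainderSmooth V c (2 * bigN c l + 4) R₇ ∧
        (∀ t z f, R 7 t z f = (R₇ t z f.toDist : ℂ)) ∧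
        ∀ p ∈ cyl (Metric.ball (0 : H1) δ'),
          (ham V c γ₀ γ₁ (T p) : ℂ) = (hamF V c p : ℂ)
            + Z p.2.1 (zCoord (eigH φ) p.2.2) (fCoord (eigH φ) p.2.2)
            + ∑ d ∈ Finset.range 8, R d p.2.1 (zCoord (eigH φ) p.2.2) (fCoord (eigH φ) p.2.2) := by
  have h' := h
  obtain ⟨hδ, -, z, q, F, E, -, hq, hqw, hNF, hF, hEc, hH⟩ := h'
  obtain ⟨Z, hZ, hZe⟩ := hNF.isNormalForm
  -- The number of degrees to peel is `N + 1 - r`, which leaves order `2(N + 1) + 2 = 2N + 4`.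
  obtain ⟨k, hk⟩ := Nat.exists_eq_add_of_le hrN
  obtain ⟨G, q', F', hG, hq', hqw', hF', hFe⟩ := exists_peel hr hF k
  obtain ⟨R₀, R₁, hR₀, hR₁, hGe⟩ := hG.isRemainder
  obtain ⟨G₂, G₃, hG₂, hG₃, hEe⟩ := hEc.eventuallyMid
  -- The square of the normalised real eigenfunction has integral one.
  have hη : ∃ η : 𝓢(E3, ℂ), ∫ x, η x = 1 := ⟨mulS (φ 0) (φ 0), by simpa using hE.orth 0 0⟩
  have hqe := (Quartic.eventuallyMid (φ := φ) hη (forall_support_add hq hq')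
    (forall_support_add hqw hqw')).add (by norm_num) hG₂
  simp only [← Complex.ofReal_add] at hqe
  obtain ⟨δ₂, hδ₂, hM₂⟩ := hqe.isRemainderMid
  obtain ⟨δ₃, hδ₃, hM₃⟩ := hG₃.isRemainderMid
  have h0 (d : ℕ) : EventuallyMid φ d fun _ _ => ((0 : ℝ) : ℂ) := by
    simpa using EventuallyMid.zero d
  obtain ⟨δ₄, hδ₄, hM₄⟩ := (h0 4).isRemainderMid
  obtain ⟨δ₅, hδ₅, hM₅⟩ := (h0 5).isRemainderMid
  rw [show 2 * (r + k) + 2 = 2 * bigN c l + 4 by omega] at hF'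
  obtain ⟨R₇, δ₇, hR₇, hδ₇, hRe⟩ := isRemainderSmooth_of_cls (V := V) (c := c) hF'
  obtain ⟨δ', hδ', h1⟩ : ∃ δ' : ℝ, 0 < δ' ∧ ∀ s ∈ ({δ, δ₂, δ₃, δ₄, δ₅, δ₇} : Set ℝ), δ' ≤ s := by
    refine ⟨min δ (min δ₂ (min δ₃ (min δ₄ (min δ₅ δ₇)))), by simp [*], ?_⟩
    simp
  simp only [mem_insert_iff, mem_singleton_iff, forall_eq_or_imp, forall_eq] at h1
  obtain ⟨l0, l2, l3, l4, l5, l7⟩ := h1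
  refine ⟨δ', h.mono hδ' l0, l0, Z, fun d => match d with
    | 0 => R₀
    | 1 => R₁
    | 2 => fun t z f => (((MvPolynomial.eval ((dat φ).xval t (recon φ z f)) (q + q')).re +
        G₂ t (recon φ z f) : ℝ) : ℂ)
    | 3 => fun t z f => (G₃ t (recon φ z f) : ℂ)
    | 6 => fun t _ f => ((gam γ₀ γ₁ t * ∫ x : E3, ‖fn f x‖ ^ 4 / 4 : ℝ) : ℂ)
    | 7 => fun t z f => (R₇ t z f.toDist : ℂ)
    | _ => fun _ _ _ => ((0 : ℝ) : ℂ), R₇, hZ, hR₀, hR₁, fun d h2 h5 => ?_, fun _ _ _ => rfl, hR₇,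
    fun _ _ _ => rfl, fun p hp => ?_⟩
  · interval_cases d
    · exact hM₂ δ' l2
    · exact hM₃ δ' l3
    · exact hM₄ δ' l4
    · exact hM₅ δ' l5
  · have hp' := mem_cyl_ball.mp hp
    rw [hH p (mem_cyl_ball.mpr (hp'.trans_le l0))]
    simp only [Finset.sum_range_succ, Finset.sum_range_zero, recon_coord, hZe,
      hRe _ _ (hp'.trans_le l7), map_add, Complex.add_re]
    have e1 := hFe p.2.1 p.2.2
    rw [hGe] at e1
    rw [hEe, potentialEnergy]
    push_cast
    rw [e1]
    ring

end conclusion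

end NLSNormalForm

end

/-! ### Iteration of the reduction -/

namespace NLSNormalForm

/-- The generator with vanishing coefficients. -/
noncomputable instance (n : ℕ) : Inhabited (LieGenerator n) :=
  ⟨⟨0, 1, le_rfl, 0, 0, 0, by simp, by simp⟩⟩

/-- A finite number of steps of an inductive construction. -/
theorem exists_seq_of_step {α : Type} {N : ℕ} {P : ℕ → α → Prop} {S : ℕ → α → α → Prop} (x₁ : α)
    (h₁ : P 1 x₁) (hS : ∀ r x, 1 ≤ r → r ≤ N → P r x → ∃ y, P (r + 1) y ∧ S (r + 1) x y) :
    ∃ x : ℕ → α, x 1 = x₁ ∧ (∀ r, 1 ≤ r → r ≤ N + 1 → P r (x r)) ∧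
      ∀ r, 2 ≤ r → r ≤ N + 1 → S r (x (r - 1)) (x r) := by
  classical
  have h : ∀ r x, ∃ y, 1 ≤ r → r ≤ N → P r x → P (r + 1) y ∧ S (r + 1) x y := by
    intro r x
    by_cases hr : 1 ≤ r ∧ r ≤ N ∧ P r x
    · obtain ⟨y, hy⟩ := hS r x hr.1 hr.2.1 hr.2.2
      exact ⟨y, fun _ _ _ => hy⟩
    · exact ⟨x, fun a b c => absurd ⟨a, b, c⟩ hr⟩
  choose f hf using h
  -- Counting starts at one, so `x r` results from `r - 1` steps; the value at zero is a dummy.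
  let x : ℕ → α := fun r => Nat.rec x₁ (fun k y => f (k + 1) y) (r - 1)
  have hx : ∀ r, 1 ≤ r → x (r + 1) = f r (x r) := by
    rintro (_ | r) hr
    · omega
    · rfl
  have hP : ∀ r, 1 ≤ r → r ≤ N + 1 → P r (x r) := by
    intro r hr
    induction r, hr using Nat.le_induction with
    | base => exact fun _ => h₁
    | succ r hr ih =>
      intro hN
      rw [hx r hr]
      exact (hf r (x r) hr (by omega) (ih (by omega))).1
  refine ⟨x, rfl, hP, fun r hr hN => ?_⟩
  obtain ⟨k, rfl⟩ := Nat.exists_eq_add_of_le' hr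
  have h1 := (hf (k + 1) (x (k + 1)) (by omega) (by omega) (hP _ (by omega) (by omega))).2
  rwa [← hx _ (by omega)] at h1

end NLSNormalForm

open NLSNormalForm in
theorem theorem3p5 {n : ℕ} (V : 𝓢(E3, ℝ)) (c γ₀ γ₁ : ℝ) (l : Fin (n + 1) → ℝ)
    (φ : Fin (n + 1) → H1) (hyp : StandingHypotheses V c γ₀ γ₁ l φ) :
    ∃ (U : ℕ → Set H1) (T 𝔉 : ℕ → Phase → Phase) (χ : ℕ → LieGenerator n),
      T 1 = id ∧
      (∀ r : ℕ, 2 ≤ r → r ≤ bigN c l + 1 →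
        IsLieTransformOn ((χ r).onPhase φ) (𝔉 r) (cyl (U r)) ∧
        MapsTo (𝔉 r) (cyl (U r)) (cyl (U (r - 1))) ∧
        EqOn (T r) (T (r - 1) ∘ 𝔉 r) (cyl (U r))) ∧
      ∀ r : ℕ, 1 ≤ r → r ≤ bigN c l + 1 →
        IsOpen (U r) ∧ 0 ∈ U r ∧ IsCanonicalOn (T r) (cyl (U r)) ∧
        ∃ (Z : ℝ → (Fin (n + 1) → ℂ) → H1 → ℂ)
          (R : ℕ → ℝ → (Fin (n + 1) → ℂ) → H1 → ℂ)
          (R₇ : ℝ → (Fin (n + 1) → ℂ) → 𝓢'(E3, ℂ) → ℝ),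
          IsNormalForm c l r Z ∧
          IsRemainderZ r (R 0) ∧
          IsRemainderLin r (R 1) ∧
          (∀ d : ℕ, 2 ≤ d → d ≤ 5 → IsRemainderMid φ d (U r) (R d)) ∧
          (∀ t z f, R 6 t z f = ((gam γ₀ γ₁ t * ∫ x : E3, ‖fn f x‖ ^ 4 / 4 : ℝ) : ℂ)) ∧
          IsRemainderSmooth V c (2 * bigN c l + 4) R₇ ∧
          (∀ t z f, R 7 t z f = (R₇ t z f.toDist : ℂ)) ∧
          ∀ p ∈ cyl (U r),
            (ham V c γ₀ γ₁ (T r p) : ℂ) =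
              (hamF V c p : ℂ)
              + Z p.2.1 (zCoord φ p.2.2) (fCoord φ p.2.2)
              + ∑ d ∈ Finset.range 8, R d p.2.1 (zCoord φ p.2.2) (fCoord φ p.2.2) := by
  obtain ⟨φS, hφ, hE⟩ := hyp.exists_eigenSys
  obtain rfl : φ = eigH φS := funext hφ
  obtain ⟨δ₁, h₁, -, hR₁⟩ := Reduced.exists_remainder hE le_rfl (by omega)
    (reduced_one (V := V) (c := c) (γ₀ := γ₀) (γ₁ := γ₁) (l := l) (φ := φS))
  obtain ⟨x, hx1, hxP, hxS⟩ := exists_seq_of_step (N := bigN c l)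
    (α := ℝ × (Phase → Phase) × (Phase → Phase) × LieGenerator n)
    (P := fun r x => Reduced V c γ₀ γ₁ l φS r x.1 x.2.1 ∧
      ∃ (Z : ℝ → (Fin (n + 1) → ℂ) → H1 → ℂ) (R : ℕ → ℝ → (Fin (n + 1) → ℂ) → H1 → ℂ)
        (R₇ : ℝ → (Fin (n + 1) → ℂ) → 𝓢'(E3, ℂ) → ℝ),
        IsNormalForm c l r Z ∧ IsRemainderZ r (R 0) ∧ IsRemainderLin r (R 1) ∧
        (∀ d : ℕ, 2 ≤ d → d ≤ 5 → IsRemainderMid (eigH φS) d (Metric.ball 0 x.1) (R d)) ∧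
        (∀ t z f, R 6 t z f = ((gam γ₀ γ₁ t * ∫ x : E3, ‖fn f x‖ ^ 4 / 4 : ℝ) : ℂ)) ∧
        IsRemainderSmooth V c (2 * bigN c l + 4) R₇ ∧
        (∀ t z f, R 7 t z f = (R₇ t z f.toDist : ℂ)) ∧
        ∀ p ∈ cyl (Metric.ball (0 : H1) x.1),
          (ham V c γ₀ γ₁ (x.2.1 p) : ℂ) = (hamF V c p : ℂ)
            + Z p.2.1 (zCoord (eigH φS) p.2.2) (fCoord (eigH φS) p.2.2)
            + ∑ d ∈ Finset.range 8, R d p.2.1 (zCoord (eigH φS) p.2.2) (fCoord (eigH φS) p.2.2))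
    (S := fun _ x y =>
      IsLieTransformOn (y.2.2.2.onPhase (eigH φS)) y.2.2.1 (cyl (Metric.ball 0 y.1)) ∧
      MapsTo y.2.2.1 (cyl (Metric.ball 0 y.1)) (cyl (Metric.ball 0 x.1)) ∧
      EqOn y.2.1 (x.2.1 ∘ y.2.2.1) (cyl (Metric.ball 0 y.1)))
    -- The Lie transform and the generator at index one are placeholders, as the relation between
    -- consecutive terms begins at `r = 2`.
    (δ₁, id, id, default) ⟨h₁, hR₁⟩ (by
      rintro r ⟨δ, T, F, χ⟩ hr hrN ⟨h, -⟩
      obtain ⟨G, 𝔉, δ₂, hL, hm, h2⟩ := h.step hE hyp hr hrN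
      -- Reading off the remainder may shrink the ball, so that its series converge; the properties
      -- of the Lie transform restrict to the smaller one.
      obtain ⟨δ', h3, hδ', h4⟩ := h2.exists_remainder hE (by omega) (by omega)
      have hs : cyl (Metric.ball (0 : H1) δ') ⊆ cyl (Metric.ball 0 δ₂) := fun p hp =>
        Metric.ball_subset_ball hδ' hp
      exact ⟨(δ', T ∘ 𝔉, 𝔉, G), ⟨h3, h4⟩, fun p hp => hL p (hs hp), hm.mono_left hs,
        fun _ _ => rfl⟩)
  refine ⟨fun r => Metric.ball 0 (x r).1, fun r => (x r).2.1, fun r => (x r).2.2.1,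
    fun r => (x r).2.2.2, congrArg (fun y => y.2.1) hx1, hxS, fun r hr hrN => ?_⟩
  obtain ⟨h, h'⟩ := hxP r hr hrN
  exact ⟨Metric.isOpen_ball, Metric.mem_ball_self h.1, h.2.1, h'⟩
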